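/- **Setting.** Let $m_0,m_1,m_2,m_3>0$ with $m_0\ne m_1$, $m_0+m_1\ne m_2$; $M_j=m_0+\dots+m_j$, $\sigma_{ij}=m_i/M_j$, $\mu_j^{-1}=M_{j-1}^{-1}+m_j^{-1}$. Consider triples of oriented Keplerian ellipses in $\mathbb R^3$ (focus at the origin, semimajor axes $a_j$, eccentricities $e_j\in(0,1)$, pericenters $\Pi_j$, mean anomalies $\ell_j$, positions $q_j$, $j=1,2,3$), with angular momenta $C_j$ of norm $\mu_j\sqrt{M_ja_j(1-e_j^2)}$, nonzero nodes $\nu_1=\nu_2=C_1\times C_2$, $\nu_3=(C_1+C_2)\times C_3$, and Deprit coordinates $L_j=\mu_j\sqrt{M_ja_j}$, $\Gamma_j=\|C_j\|$, $\gamma_j=\alpha_{C_j}(\nu_j,\Pi_j)$, $\Psi_1=\|C_1+C_2\|$, $\Psi_2=\|C_1+C_2+C_3\|$, $\psi_1=\alpha_{C_1+C_2}(\nu_3,\nu_2)$, where $\alpha_z(u,v)$ is the oriented angle from $u$ to $v$ around $z$. Let $$F^{12}_{\rm per}=\frac{\mu_2M_2}{\|q_2\|}-\frac{m_0m_2}{\|q_2+\sigma_{11}q_1\|}-\frac{m_1m_2}{\|q_2-\sigma_{01}q_1\|},\qquad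 F^{23}_{\rm per}=\frac{\mu_3M_3}{\|q_3\|}-\frac{(m_0+m_1)m_3}{\|q_3+\sigma_{22}q_2\|}-\frac{m_2m_3}{\|q_3+(\sigma_{22}-1)q_2\|},$$ let $\langle\cdot\rangle$ be the average over the two mean anomalies involved, let $\zeta_j$ be the angle between $q_j$ and $q_{j+1}$, and let $$F^{j,j+1}_{\rm quad}=\Big\langle P_2(\cos\zeta_j)\tfrac{\|q_j\|^2}{\|q_{j+1}\|^3}\Big\rangle,\qquad F^{j,j+1}_{\rm oct}=\Big\langle P_3(\cos\zeta_j)\tfrac{\|q_j\|^3}{\|q_{j+1}\|^4}\Big\rangle\quad(j=1,2)$$ with the Legendre polynomials $P_2,P_3$. Fix $L_1>0$, $\delta_1,\delta_2\in(0,1)$ and $\delta_3$ with $|\delta_3|<\delta_1$, fix $\Psi_2=\delta_2L_3$, put $\epsilon=1/L_2$, $\mu=L_2/L_3$, and use the coordinates $\gamma_1,\Gamma_1$ and $$\tilde\Psi_1=\Psi_1-\delta_1L_2,\ \ \tilde\psi_1=\psi_1+\gamma_2,\ \ \tilde\Gamma_2=\Psi_1-\Gamma_2,\ \ \tilde\gamma_2=-\gamma_2,\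 \ \tilde\Gamma_3=\Psi_2-\Gamma_3-\delta_3L_2,\ \ \tilde\gamma_3=-\gamma_3$$ on $D=\{0<\tilde\Gamma_2<\Gamma_1<L_1\}$. The secular Hamiltonian is $$F_{\rm sec}=\langle F^{12}_{\rm per}\rangle+\langle F^{23}_{\rm per}\rangle+R_{12}+R_{23}+R_3,$$ where the $R$'s are arbitrary remainders with expansions in powers of $\epsilon,\mu$ (in the sense defined next): $R_{12}=O(a_2^{-9/2})$, i.e. only powers $\epsilon^i$, $i\ge9$, independent of $\tilde\psi_1,\tilde\gamma_3,\tilde\Gamma_3$; $R_{23}=O(a_2^4a_3^{-9/2})$, i.e. only $\epsilon^i\mu^j$ with $i\ge1$, $j\ge9$; $R_3=O(a_3^{-3})$, i.e. only $i,j\ge6$. An *expansion* $\sum\epsilon^i\mu^jF_{ij}$ has coefficients $F_{ij}$ analytic on $D$, and for every compact $K\subset D$ there is $\rho>0$ such that it converges on $K$ for all $\epsilon,\mu\in(0,\rho)$, with $\sup_{i,j,\,K}\rho^{i+j}\|D^kF_{ij}\|<\infty$ for every $k$. Write $\epsilon^i\mu^j\ll\epsilon^{i'}\mu^{j'}$ if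 the quotient of the left by the right side tends to $0$ whenever $L_2\to\infty$, $L_2^{11/6}\ll L_3\ll L_2^2$. A term $F_{i_0j_0}$ is the *first* one with some property if it has it and $\epsilon^i\mu^j\ll\epsilon^{i_0}\mu^{j_0}$ for all other $F_{ij}$ that have it; a variable *first appears* in $F_{i_0j_0}$ if this is the first coefficient depending on it. A function *couples* an angle $\theta$ with $(\gamma_1,\Gamma_1,\tilde\gamma_2)$ if it is not the sum of a function independent of $\theta$ and a function independent of $\gamma_1,\Gamma_1,\tilde\gamma_2$ (i.e. it contains products of functions of $\theta$ with functions of $\gamma_1,\Gamma_1,\tilde\gamma_2$). **Proposition.** Every point of a compact $K\subset D$ is realized by a triple of ellipses when $\epsilon,\mu$ are small enough (depending on $K$), and $$F_{\rm sec}=c+\sum_{i,j\ge0}\epsilon^i\mu^jF_{ij}$$ with $c$ depending only on $\epsilon,\mu$ (for fixed masses, $L_1$ and $\delta_j$). Likewise, up to such constants, $F^{12}_{\rm quad},F^{12}_{\rm oct},F^{23}_{\rm quad},F^{23}_{\rm oct}$ have expansions, with coefficients $Q^{12}_{ij},O^{12}_{ij},Q^{23}_{ij},O^{23}_{ij}$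 vanishing unless, respectively, ($j=0$, $i\ge6$), ($j=0$, $i\ge8$), ($i\ge2$, $j\ge6$), ($i\ge2$, $j\ge8$). With $\tilde\sigma_{1,3}=\sigma_{01}^2-\sigma_{11}^2$, $\tilde\sigma_{2,3}=(\sigma_{02}+\sigma_{12})^2-\sigma_{22}^2$ one has $$F_{ij}=-\mu_1m_2\big(Q^{12}_{ij}+\tilde\sigma_{1,3}O^{12}_{ij}\big)-\mu_2m_3\big(Q^{23}_{ij}+\tilde\sigma_{2,3}O^{23}_{ij}\big)+(\text{coefficients of }R_{12},R_{23},R_3)$$ unless ($j=0$, $i\ge10$) or ($i\ge2$, $j\ge10$). Moreover: 1. $Q^{12}_{6,0}=\alpha_0^{12}H_0^{12}$, $Q^{12}_{7,0}=\alpha_1^{12}H_1^{12}$, $F_{6,0}=-\mu_1m_2\alpha_0^{12}H_0^{12}$, $F_{7,0}=-\mu_1m_2\alpha_1^{12}H_1^{12}$, where $$H_0^{12}=\Big(1-\tfrac{\Gamma_1^2}{L_1^2}\Big)\Big[2-5\Big(1-\tfrac{\tilde\Gamma_2^2}{\Gamma_1^2}\Big)\sin^2\gamma_1\Big]+\tfrac{\tilde\Gamma_2^2}{L_1^2},\qquad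 H_1^{12}=(3H_0^{12}-1)\tilde\Psi_1-4\tilde\Gamma_2H_0^{12}+3\tilde\Gamma_2-\tfrac{\Gamma_1^2\tilde\Gamma_2}{L_1^2},$$ $$\alpha_0^{12}=\frac{3L_1^4M_2^3\mu_2^6}{8M_1^2\delta_1^3\mu_1^4},\qquad \alpha_1^{12}=-\frac{3L_1^4M_2^3\mu_2^6}{8M_1^2\delta_1^4\mu_1^4}.$$ These are the first two nontrivial terms: $\epsilon^7\ll\epsilon^6$, and $\epsilon^i\mu^j\ll\epsilon^7$ for every other $F_{ij}\not\equiv0$. $H_0^{12}$ and $H_1^{12}$ are Liouville integrable on $D$ (for $d\Gamma_1\wedge d\gamma_1+d\tilde\Gamma_2\wedge d\tilde\gamma_2+d\tilde\Psi_1\wedge d\tilde\psi_1+d\tilde\Gamma_3\wedge d\tilde\gamma_3$: four analytic integrals in involution, the given function being one of them, with differentials independent on a dense set) and do not depend on the masses. $\gamma_1,\Gamma_1,\tilde\Gamma_2$ first appear in $F_{6,0}$, and $\tilde\Psi_1$ first appears in $F_{7,0}$. 2. $O^{12}_{8,0}=\alpha_2^{12}H_2^{12}$ with $\alpha_2^{12}=-\frac{15}{64}\frac{L_1^6\mu_2^8M_2^4}{\mu_1^6M_1^3}\frac{\sqrt{1-\delta_1^2}}{\delta_1^5}$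 and, with $s=1-\tilde\Gamma_2^2/\Gamma_1^2$, $k=\Gamma_1^2/L_1^2$, $$H_2^{12}=\sqrt{1-k}\,\Big\{\cos\gamma_1\cos\tilde\gamma_2\big[k(5s(6-7\cos^2\gamma_1)-3)-35s\sin^2\gamma_1+7\big]-\tfrac{\tilde\Gamma_2}{\Gamma_1}\sin\gamma_1\sin\tilde\gamma_2\big[k(5s(4-7\cos^2\gamma_1)-3)-35s\sin^2\gamma_1+7\big]\Big\}.$$ $F_{8,0}+\mu_1m_2\tilde\sigma_{1,3}\alpha_2^{12}H_2^{12}$ is independent of $\tilde\gamma_2$, and $\tilde\gamma_2$ first appears in $F_{8,0}$. 3. $Q^{23}_{2,6}=\alpha_0^{23}\cos^2\tilde\psi_1$ and $F_{2,6}=-\mu_2m_3\alpha_0^{23}\cos^2\tilde\psi_1$, with $\alpha_0^{23}=\frac{15}{8}\kappa\frac{(1-\delta_1^2)(\delta_1^2-\delta_3^2)}{\delta_1^2\delta_2^3}$, $\kappa=\frac{\mu_3^6M_3^3}{\mu_2^4M_2^2}$; $\tilde\psi_1$ first appears in $F_{2,6}$. 4. $Q^{23}_{3,6}=\alpha_2^{23}H_2^{23}+\tilde\alpha_3\tilde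 H_3$ and $F_{3,6}=-\mu_2m_3(\alpha_2^{23}H_2^{23}+\tilde\alpha_3\tilde H_3)$, where $\alpha_2^{23}=\frac34\kappa\frac{\delta_3\sqrt{\delta_1^2-\delta_3^2}}{\delta_1^3\delta_2^3}$, $\tilde\alpha_3=\frac{3\kappa}{4\delta_1^3\delta_2^3}$, $$H_2^{23}=\sqrt{\Gamma_1^2-\tilde\Gamma_2^2}\,\big(\delta_1^2\cos\tilde\psi_1\cos\tilde\gamma_2-(5-4\delta_1^2)\sin\tilde\psi_1\sin\tilde\gamma_2\big),$$ $$\tilde H_3=\tilde\Psi_1\big[5(\delta_3^2-\delta_1^4)\cos^2\tilde\psi_1-5\delta_3^2+3\delta_1^4\big]+\tilde\Gamma_2\big[5(\delta_1^4-\delta_1^2\delta_3^2)\cos^2\tilde\psi_1+4\delta_1^2\delta_3^2-3\delta_1^4\big]+\tilde\Gamma_3\big[5(\delta_1^3\delta_3-\delta_1\delta_3)\cos^2\tilde\psi_1+5\delta_1\delta_3-4\delta_1^3\delta_3\big].$$ If $\delta_3\neq0$, $F_{3,6}$ is the first term coupling $\tilde\psi_1$ with $(\gamma_1,\Gamma_1,\tilde\gamma_2)$.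 5. If $\delta_3\ne0$, $\tilde\Gamma_3$ first appears in $F_{3,6}$ (through $\tilde H_3$). 6. $O^{23}_{2,8}=\alpha_3^{23}H_3^{23}$, where $\alpha_3^{23}=-\frac{15}{64}\kappa'\frac{\sqrt{1-\delta_1^2}\sqrt{1-\delta_2^2}}{\delta_2^5}$, $\kappa'=\frac{\mu_3^8M_3^4}{\mu_2^6M_2^3}$, $$H_3^{23}=\nu_0\cos(\tilde\gamma_3+3\tilde\psi_1)+\nu_1\cos(\tilde\gamma_3+\tilde\psi_1)+\nu_2\cos(\tilde\gamma_3-\tilde\psi_1)+\nu_3\cos(\tilde\gamma_3-3\tilde\psi_1),$$ with the constants $\nu_0=\frac{35}{8\delta_1^3}(\delta_1^2-1)(\delta_3-\delta_1)(\delta_3+\delta_1)^2$, $\nu_1=-\frac{1}{8\delta_1^3}(3\delta_1^2-7)(\delta_3+\delta_1)(15\delta_3^2-10\delta_1\delta_3-\delta_1^2)$, $\nu_2=\frac{1}{8\delta_1^3}(3\delta_1^2-7)(\delta_3-\delta_1)(15\delta_3^2+10\delta_1\delta_3-\delta_1^2)$, $\nu_3=-\frac{35}{8\delta_1^3}(\delta_1^2-1)(\delta_3+\delta_1)(\delta_3-\delta_1)^2$.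 $F_{2,8}+\mu_2m_3\tilde\sigma_{2,3}\alpha_3^{23}H_3^{23}$ is independent of $\tilde\gamma_3$, and $\tilde\gamma_3$ first appears in $F_{2,8}$, provided that all terms of $R_{23}$ depending on $\tilde\gamma_3$ are of order $\ll\epsilon^2\mu^8$ (for example if $R_{23}=0$). 7. $O^{23}_{3,8}-\alpha_5^{23}H_5^{23}$ is independent of $\gamma_1,\Gamma_1,\tilde\gamma_2$, where $\alpha_5^{23}=\frac{15}{64}\kappa'\frac{\sqrt{1-\delta_1^2}\sqrt{1-\delta_2^2}\sqrt{\delta_1^2-\delta_3^2}}{\delta_1^2\delta_2^5}$, $H_5^{23}=\sqrt{\Gamma_1^2-\tilde\Gamma_2^2}\,(J_1\cos\tilde\gamma_2+J_2\sin\tilde\gamma_2)$ and $$J_1=(30\delta_3^2-10\delta_1^2)\sin\tilde\gamma_3\cos\tilde\psi_1\sin\tilde\psi_1-20\delta_1\delta_3\cos\tilde\gamma_3\cos^2\tilde\psi_1+10\delta_1\delta_3\cos\tilde\gamma_3,$$ $$J_2=\Big(\tfrac{70\delta_3}{\delta_1}-50\delta_1\delta_3\Big)\cos\tilde\gamma_3\cos\tilde\psi_1\sin\tilde\psi_1+\Big(\tfrac{105\delta_3^2}{\delta_1^2}-75\delta_3^2+25\delta_1^2-35\Big)\sin\tilde\gamma_3\cos^2\tilde\psi_1+\Big(60\delta_3^2-\tfrac{105\delta_3^2}{\delta_1^2}-17\delta_1^2+28\Big)\sin\tilde\gamma_3.$$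 $F_{3,8}+\mu_2m_3\tilde\sigma_{2,3}\alpha_5^{23}H_5^{23}$ does not couple $\tilde\gamma_3$ with $(\gamma_1,\Gamma_1,\tilde\gamma_2)$, and $F_{3,8}$ is the first term that does, provided that all terms of $R_{23}$ coupling them are of order $\ll\epsilon^3\mu^8$ (for example if $R_{23}=0$). All constants $\alpha$ above are nonzero ($\alpha_2^{23}$ if $\delta_3\ne0$). -/

import Mathlib

open Filter Topology

noncomputable section

namespace FourBody

/-! ### Masses -/

/-- `M_j = m_0 + ... + m_j`. -/
def totalMass (m : Fin 4 → ℝ) (j : Fin 4) : ℝ := ∑ i ∈ Finset.Iic j, m i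

/-- The mass ratio `σ_{ij} = m_i / M_j`. -/
def massRatio (m : Fin 4 → ℝ) (i j : Fin 4) : ℝ := m i / totalMass m j

/-- The reduced mass `μ_j`, with `μ_j⁻¹ = M_{j-1}⁻¹ + m_j⁻¹` (used for `j = 1, 2, 3`). -/
def redMass (m : Fin 4 → ℝ) (j : Fin 4) : ℝ := ((totalMass m (j - 1))⁻¹ + (m j)⁻¹)⁻¹

/-- `σ̃_{1,3} = σ_{01}² - σ_{11}²`. -/
def sigmaOct12 (m : Fin 4 → ℝ) : ℝ := massRatio m 0 1 ^ 2 - massRatio m 1 1 ^ 2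

/-- `σ̃_{2,3} = (σ_{02} + σ_{12})² - σ_{22}²`. -/
def sigmaOct23 (m : Fin 4 → ℝ) : ℝ :=
  (massRatio m 0 2 + massRatio m 1 2) ^ 2 - massRatio m 2 2 ^ 2

/-! ### Keplerian ellipses -/

/-- Euclidean three-space. -/
abbrev Space : Type := EuclideanSpace ℝ (Fin 3)

/-- The cross product of `Space`. -/
def cross (u v : Space) : Space :=
  WithLp.toLp 2 (crossProduct (WithLp.ofLp u) (WithLp.ofLp v))

/-- An oriented Keplerian ellipse with a focus at the origin: semimajor axis, eccentricity in
`(0, 1)`, unit vector towards the pericenter, and unit normal giving the sense of the motion. -/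
structure KeplerEllipse where
  semiaxis : ℝ
  ecc : ℝ
  peri : Space
  normal : Space
  semiaxis_pos : 0 < semiaxis
  ecc_pos : 0 < ecc
  ecc_lt_one : ecc < 1
  norm_peri : ‖peri‖ = 1
  norm_normal : ‖normal‖ = 1
  orth : inner ℝ peri normal = 0

/-- The eccentric anomaly as a function of the mean anomaly `ℓ`: the solution `u` of Kepler's
equation `u - e sin u = ℓ` (unique for `0 ≤ e < 1`). -/
def eccAnomaly (e ℓ : ℝ) : ℝ := Function.invFun (fun u : ℝ => u - e * Real.sin u) ℓ

/-- The point with mean anomaly `ℓ` on an ellipse. -/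
def KeplerEllipse.pos (E : KeplerEllipse) (ℓ : ℝ) : Space :=
  (E.semiaxis * (Real.cos (eccAnomaly E.ecc ℓ) - E.ecc)) • E.peri
    + (E.semiaxis * √(1 - E.ecc ^ 2) * Real.sin (eccAnomaly E.ecc ℓ)) • cross E.normal E.peri

/-- Average over two mean anomalies,
`(2π)⁻² ∫_{𝕋²} f (q(ℓ), q'(ℓ')) dℓ dℓ'`. -/
def mean2 (E E' : KeplerEllipse) (f : Space → Space → ℝ) : ℝ :=
  ((2 * Real.pi) ^ 2)⁻¹ *
    ∫ ℓ in (0 : ℝ)..(2 * Real.pi), ∫ ℓ' in (0 : ℝ)..(2 * Real.pi), f (E.pos ℓ) (E'.pos ℓ')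

/-- A point of the secular space: the ellipses of the planets 1, 2, 3. -/
structure EllipseTriple where
  E₁ : KeplerEllipse
  E₂ : KeplerEllipse
  E₃ : KeplerEllipse

/-! ### The perturbing functions, in Jacobi coordinates -/

/-- Perturbing function of the planets 1 and 2. -/
def Fper12 (m : Fin 4 → ℝ) (q₁ q₂ : Space) : ℝ :=
  redMass m 2 * totalMass m 2 / ‖q₂‖
    - m 0 * m 2 / ‖q₂ + massRatio m 1 1 • q₁‖
    - m 1 * m 2 / ‖q₂ - massRatio m 0 1 • q₁‖

/-- Perturbing function of the planets 2 and 3, where the bodies 0 and 1 act on planet 3 as if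
merged at their barycenter: the terms with `m_3` of the full perturbing function
at `q₁ = 0`. By the generating function of the Legendre polynomials it equals, for `‖q₂‖ < ‖q₃‖`,
`-(μ_2 m_3 / ‖q₃‖) ∑_{n ≥ 2} σ̃_{2,n} P_n(cos ζ_2) (‖q₂‖ / ‖q₃‖)^n` with
`σ̃_{2,n} = (σ_{02} + σ_{12})^{n-1} + (-1)^n σ_{22}^{n-1}` and `ζ_2` the angle of `q₂`, `q₃`. -/
def Fper23 (m : Fin 4 → ℝ) (q₂ q₃ : Space) : ℝ :=
  redMass m 3 * totalMass m 3 / ‖q₃‖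
    - (m 0 + m 1) * m 3 / ‖q₃ + massRatio m 2 2 • q₂‖
    - m 2 * m 3 / ‖q₃ + (massRatio m 2 2 - 1) • q₂‖

/-- The cosine of the angle between two vectors. -/
def cosAngle (q q' : Space) : ℝ := inner ℝ q q' / (‖q‖ * ‖q'‖)

/-- The quadrupole `P_2(cos ζ) ‖q‖² / ‖q'‖³`, with `P_2(x) = (3x² - 1)/2`. -/
def quadKernel (q q' : Space) : ℝ :=
  (3 * cosAngle q q' ^ 2 - 1) / 2 * (‖q‖ ^ 2 / ‖q'‖ ^ 3)

/-- The octupole `P_3(cos ζ) ‖q‖³ / ‖q'‖⁴`, with `P_3(x) = (5x³ - 3x)/2`. -/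
def octKernel (q q' : Space) : ℝ :=
  (5 * cosAngle q q' ^ 3 - 3 * cosAngle q q') / 2 * (‖q‖ ^ 3 / ‖q'‖ ^ 4)

def Fquad12 (T : EllipseTriple) : ℝ := mean2 T.E₁ T.E₂ quadKernel
def Foct12 (T : EllipseTriple) : ℝ := mean2 T.E₁ T.E₂ octKernel
def Fquad23 (T : EllipseTriple) : ℝ := mean2 T.E₂ T.E₃ quadKernel
def Foct23 (T : EllipseTriple) : ℝ := mean2 T.E₂ T.E₃ octKernel

/-- The averages of the two perturbing functions. -/
def averagedPer (m : Fin 4 → ℝ) (T : EllipseTriple) : ℝ :=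
  mean2 T.E₁ T.E₂ (Fper12 m) + mean2 T.E₂ T.E₃ (Fper23 m)

/-! ### Deprit coordinates -/

/-- `L_j = μ_j √(M_j a_j)`. -/
def actionL (m : Fin 4 → ℝ) (j : Fin 4) (E : KeplerEllipse) : ℝ :=
  redMass m j * √(totalMass m j * E.semiaxis)

/-- The angular momentum `C_j = q_j × p_j` of planet `j` on its ellipse. -/
def angMom (m : Fin 4 → ℝ) (j : Fin 4) (E : KeplerEllipse) : Space :=
  (redMass m j * √(totalMass m j * E.semiaxis * (1 - E.ecc ^ 2))) • E.normal

/-- `θ` is (a lift to `ℝ` of) the oriented angle `α_z(u, v)` from `u` to `v` in the plane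
orthogonal to `z`, with the right hand rule with respect to `z`. -/
def IsOrientedAngle (z u v : Space) (θ : ℝ) : Prop :=
  inner ℝ u v = ‖u‖ * ‖v‖ * Real.cos θ ∧
    inner ℝ z (cross u v) = ‖z‖ * ‖u‖ * ‖v‖ * Real.sin θ

/-- The triple `T` of ellipses has nonzero nodes `ν_1 = ν_2 = C_1 × C_2`,
`ν_3 = (C_1 + C_2) × C_3` and the given Deprit coordinates. (The remaining Deprit variables are
the mean anomalies, which are averaged out, and `ψ_2`, `ψ_3`, `Ψ_3`, which only encode the
position of `T` up to a rotation.) -/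
def HasDepritCoords (m : Fin 4 → ℝ) (T : EllipseTriple)
    (L₁ L₂ L₃ γ₁ Γ₁ γ₂ Γ₂ γ₃ Γ₃ ψ₁ Ψ₁ Ψ₂ : ℝ) : Prop :=
  let C₁ := angMom m 1 T.E₁
  let C₂ := angMom m 2 T.E₂
  let C₃ := angMom m 3 T.E₃
  let ν₂ := cross C₁ C₂
  let ν₃ := cross (C₁ + C₂) C₃
  ν₂ ≠ 0 ∧ ν₃ ≠ 0 ∧
  (actionL m 1 T.E₁ = L₁ ∧ actionL m 2 T.E₂ = L₂ ∧ actionL m 3 T.E₃ = L₃) ∧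
  (‖C₁‖ = Γ₁ ∧ ‖C₂‖ = Γ₂ ∧ ‖C₃‖ = Γ₃) ∧
  (‖C₁ + C₂‖ = Ψ₁ ∧ ‖C₁ + C₂ + C₃‖ = Ψ₂) ∧
  IsOrientedAngle C₁ ν₂ T.E₁.peri γ₁ ∧
  IsOrientedAngle C₂ ν₂ T.E₂.peri γ₂ ∧
  IsOrientedAngle C₃ ν₃ T.E₃.peri γ₃ ∧
  IsOrientedAngle (C₁ + C₂) ν₃ ν₂ ψ₁

/-! ### The localized ("tilde") coordinates -/

/-- The secular phase space, in the coordinates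
`(γ₁, Γ₁, γ̃₂, Γ̃₂, ψ̃₁, Ψ̃₁, γ̃₃, Γ̃₃)`, the angles being lifted to `ℝ`. -/
abbrev Phase : Type := Fin 8 → ℝ

abbrev vγ₁ : Fin 8 := 0
abbrev vΓ₁ : Fin 8 := 1
abbrev vγ₂ : Fin 8 := 2
abbrev vΓ₂ : Fin 8 := 3
abbrev vψ₁ : Fin 8 := 4
abbrev vΨ₁ : Fin 8 := 5
abbrev vγ₃ : Fin 8 := 6
abbrev vΓ₃ : Fin 8 := 7

/-- The domain `0 < Γ̃₂ < Γ₁ < L₁`. -/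
def domain (L₁ : ℝ) : Set Phase := {x | 0 < x vΓ₂ ∧ x vΓ₂ < x vΓ₁ ∧ x vΓ₁ < L₁}

/-- The triple `T` of ellipses has the coordinates `x`, where `L₂ = 1/ε`, `L₃ = 1/(εμ)`,
`Ψ₂ = δ₂ L₃` and
`Ψ̃₁ = Ψ₁ - δ₁ L₂`, `ψ̃₁ = ψ₁ + γ₂`, `Γ̃₂ = Ψ₁ - Γ₂`, `γ̃₂ = -γ₂`,
`Γ̃₃ = Ψ₂ - Γ₃ - δ₃ L₂`, `γ̃₃ = -γ₃`. -/
def Realizes (m : Fin 4 → ℝ) (L₁ δ₁ δ₂ δ₃ ε μ : ℝ) (x : Phase) (T : EllipseTriple) : Prop :=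
  ∃ γ₂ Γ₂ γ₃ Γ₃ ψ₁ Ψ₁ Ψ₂ : ℝ,
    HasDepritCoords m T L₁ (1 / ε) (1 / (ε * μ)) (x vγ₁) (x vΓ₁) γ₂ Γ₂ γ₃ Γ₃ ψ₁ Ψ₁ Ψ₂ ∧
    Ψ₂ = δ₂ * (1 / (ε * μ)) ∧
    x vΨ₁ = Ψ₁ - δ₁ * (1 / ε) ∧ x vψ₁ = ψ₁ + γ₂ ∧
    x vΓ₂ = Ψ₁ - Γ₂ ∧ x vγ₂ = -γ₂ ∧
    x vΓ₃ = Ψ₂ - Γ₃ - δ₃ * (1 / ε) ∧ x vγ₃ = -γ₃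

/-! ### Power series in `ε`, `μ` -/

/-- The quantities `y` with `V ε μ x y` are given by the series `∑_{i,j} ε^i μ^j F_{ij}(x)`: the
coefficients are analytic on `D`, and on every compact subset `K` of `D` the series converges
for `0 < ε, μ < ρ`, with bounds on the coefficients that make it converge in every `C^k` norm
on `K`. -/
def IsExpansion (D : Set Phase) (V : ℝ → ℝ → Phase → ℝ → Prop) (F : ℕ → ℕ → Phase → ℝ) :
    Prop :=
  (∀ i j, AnalyticOnNhd ℝ (F i j) D) ∧
  ∀ K : Set Phase, K ⊆ D → IsCompact K → ∃ ρ : ℝ, 0 < ρ ∧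
    (∀ k : ℕ, ∃ C : ℝ, ∀ i j, ∀ x ∈ K, ‖iteratedFDeriv ℝ k (F i j) x‖ * ρ ^ (i + j) ≤ C) ∧
    ∀ ε μ : ℝ, 0 < ε → ε < ρ → 0 < μ → μ < ρ → ∀ x ∈ K, ∀ y : ℝ, V ε μ x y →
      HasSum (fun p : ℕ × ℕ => ε ^ p.1 * μ ^ p.2 * F p.1 p.2 x) y

/-- `ε^i μ^j ≪ ε^{i'} μ^{j'}` in the regime `L₂ → ∞`, `L₂^{11/6} ≪ L₃ ≪ L₂²`, where `ε = 1/L₂`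
and `μ = L₂/L₃`. -/
def MuchSmaller (i j i' j' : ℕ) : Prop :=
  ∀ L₂ L₃ : ℕ → ℝ, Tendsto L₂ atTop atTop →
    Tendsto (fun n => L₃ n / L₂ n ^ (11 / 6 : ℝ)) atTop atTop →
    Tendsto (fun n => L₂ n ^ 2 / L₃ n) atTop atTop →
    (fun n => (1 / L₂ n) ^ i * (L₂ n / L₃ n) ^ j) =o[atTop]
      (fun n => (1 / L₂ n) ^ i' * (L₂ n / L₃ n) ^ j')

/-- `f` does not depend on the variable `v`, on `D`. -/
def Indep (D : Set Phase) (v : Fin 8) (f : Phase → ℝ) : Prop :=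
  ∀ x ∈ D, ∀ y ∈ D, (∀ w, w ≠ v → x w = y w) → f x = f y

/-- The variable `v` appears in `f`. -/
def Appears (D : Set Phase) (v : Fin 8) (f : Phase → ℝ) : Prop := ¬ Indep D v f

/-- `f` contains products of functions of `v` with functions of the variables
`γ₁, Γ₁, γ̃₂`: it is not the sum of a function without `v` and one without `γ₁, Γ₁, γ̃₂`. -/
def Couples (D : Set Phase) (v : Fin 8) (f : Phase → ℝ) : Prop :=
  ¬ ∃ a b : Phase → ℝ, Indep D v a ∧ (Indep D vγ₁ b ∧ Indep D vΓ₁ b ∧ Indep D vγ₂ b) ∧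
    ∀ x ∈ D, f x = a x + b x

/-- Among the terms of the series with coefficients `F`, the first one with the property `P` is
`ε^{i₀} μ^{j₀} F_{i₀ j₀}`: all others with the property are of smaller order. -/
def FirstAt (P : (Phase → ℝ) → Prop) (F : ℕ → ℕ → Phase → ℝ) (i₀ j₀ : ℕ) : Prop :=
  P (F i₀ j₀) ∧ ∀ i j, P (F i j) → (i, j) ≠ (i₀, j₀) → MuchSmaller i j i₀ j₀

/-- A remainder `O(a₂^{-9/2})` of the Hamiltonian of the planets 1 and 2: a series in
the powers `ε^i`, `i ≥ 9`, without `ψ̃₁`, `γ̃₃`, `Γ̃₃`. (Recall `a_j = L_j² / (μ_j² M_j)`.) -/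
def IsRemainder12 (D : Set Phase) (R : ℝ → ℝ → Phase → ℝ) (r : ℕ → ℕ → Phase → ℝ) : Prop :=
  IsExpansion D (fun ε μ x y => y = R ε μ x) r ∧
  (∀ i j, ¬ (9 ≤ i ∧ j = 0) → ∀ x ∈ D, r i j x = 0) ∧
  ∀ i j, Indep D vψ₁ (r i j) ∧ Indep D vγ₃ (r i j) ∧ Indep D vΓ₃ (r i j)

/-- A remainder `O(a₂⁴ a₃^{-9/2}) = O(ε μ⁹)`. -/
def IsRemainder23 (D : Set Phase) (R : ℝ → ℝ → Phase → ℝ) (r : ℕ → ℕ → Phase → ℝ) : Prop :=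
  IsExpansion D (fun ε μ x y => y = R ε μ x) r ∧
  ∀ i j, ¬ (1 ≤ i ∧ 9 ≤ j) → ∀ x ∈ D, r i j x = 0

/-- A remainder `O(a₃^{-3}) = O(ε⁶ μ⁶)`. -/
def IsRemainder3 (D : Set Phase) (R : ℝ → ℝ → Phase → ℝ) (r : ℕ → ℕ → Phase → ℝ) : Prop :=
  IsExpansion D (fun ε μ x y => y = R ε μ x) r ∧
  ∀ i j, ¬ (6 ≤ i ∧ 6 ≤ j) → ∀ x ∈ D, r i j x = 0

/-! ### Integrability -/

/-- Poisson bracket of the symplectic form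
`dΓ₁ ∧ dγ₁ + dΓ̃₂ ∧ dγ̃₂ + dΨ̃₁ ∧ dψ̃₁ + dΓ̃₃ ∧ dγ̃₃`. -/
def poisson (f g : Phase → ℝ) (x : Phase) : ℝ :=
  let d (h : Phase → ℝ) (v : Fin 8) : ℝ := fderiv ℝ h x (Pi.single v 1)
  (d f vγ₁ * d g vΓ₁ - d f vΓ₁ * d g vγ₁) + (d f vγ₂ * d g vΓ₂ - d f vΓ₂ * d g vγ₂)
    + (d f vψ₁ * d g vΨ₁ - d f vΨ₁ * d g vψ₁) + (d f vγ₃ * d g vΓ₃ - d f vΓ₃ * d g vγ₃)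

/-- Liouville integrability on `D`: there are four analytic functions in involution, the first
one being `H`, with linearly independent differentials on a dense subset of `D`. -/
def IsIntegrable (D : Set Phase) (H : Phase → ℝ) : Prop :=
  ∃ f : Fin 4 → Phase → ℝ, f 0 = H ∧ (∀ a, AnalyticOnNhd ℝ (f a) D) ∧
    (∀ a b, ∀ x ∈ D, poisson (f a) (f b) x = 0) ∧
    D ⊆ closure {x | x ∈ D ∧ LinearIndependent ℝ (fun a => fderiv ℝ (f a) x)}

/-! ### The explicit terms -/

def H012 (L₁ : ℝ) (x : Phase) : ℝ :=
  (1 - x vΓ₁ ^ 2 / L₁ ^ 2) *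
      (2 - 5 * (1 - x vΓ₂ ^ 2 / x vΓ₁ ^ 2) * Real.sin (x vγ₁) ^ 2)
    + x vΓ₂ ^ 2 / L₁ ^ 2

def H112 (L₁ : ℝ) (x : Phase) : ℝ :=
  (3 * H012 L₁ x - 1) * x vΨ₁ - 4 * x vΓ₂ * H012 L₁ x + 3 * x vΓ₂
    - x vΓ₁ ^ 2 * x vΓ₂ / L₁ ^ 2

def H212 (L₁ : ℝ) (x : Phase) : ℝ :=
  √(1 - x vΓ₁ ^ 2 / L₁ ^ 2) *
    (Real.cos (x vγ₁) * Real.cos (x vγ₂) *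
        (x vΓ₁ ^ 2 / L₁ ^ 2 *
            (5 * (1 - x vΓ₂ ^ 2 / x vΓ₁ ^ 2) * (6 - 7 * Real.cos (x vγ₁) ^ 2) - 3)
          - 35 * Real.sin (x vγ₁) ^ 2 * (1 - x vΓ₂ ^ 2 / x vΓ₁ ^ 2) + 7)
      - x vΓ₂ / x vΓ₁ * Real.sin (x vγ₁) * Real.sin (x vγ₂) *
        (x vΓ₁ ^ 2 / L₁ ^ 2 *
            (5 * (1 - x vΓ₂ ^ 2 / x vΓ₁ ^ 2) * (4 - 7 * Real.cos (x vγ₁) ^ 2) - 3)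
          - 35 * Real.sin (x vγ₁) ^ 2 * (1 - x vΓ₂ ^ 2 / x vΓ₁ ^ 2) + 7))

/-- The leading term of `H_0^{23}`. -/
def H023 (x : Phase) : ℝ := Real.cos (x vψ₁) ^ 2

/-- The leading term of `H_2^{23}`. -/
def H223 (δ₁ : ℝ) (x : Phase) : ℝ :=
  √(x vΓ₁ ^ 2 - x vΓ₂ ^ 2) *
    (δ₁ ^ 2 * Real.cos (x vψ₁) * Real.cos (x vγ₂)
      - (5 - 4 * δ₁ ^ 2) * Real.sin (x vψ₁) * Real.sin (x vγ₂))

/-- `H̃_3`. -/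
def Htilde3 (δ₁ δ₃ : ℝ) (x : Phase) : ℝ :=
  x vΨ₁ * (5 * (δ₃ ^ 2 - δ₁ ^ 4) * Real.cos (x vψ₁) ^ 2 - 5 * δ₃ ^ 2 + 3 * δ₁ ^ 4)
    + x vΓ₂ * (5 * (δ₁ ^ 4 - δ₁ ^ 2 * δ₃ ^ 2) * Real.cos (x vψ₁) ^ 2
        + 4 * δ₁ ^ 2 * δ₃ ^ 2 - 3 * δ₁ ^ 4)
    + x vΓ₃ * (5 * (δ₁ ^ 3 * δ₃ - δ₁ * δ₃) * Real.cos (x vψ₁) ^ 2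
        + 5 * δ₁ * δ₃ - 4 * δ₁ ^ 3 * δ₃)

def nu0 (δ₁ δ₃ : ℝ) : ℝ := 35 / (8 * δ₁ ^ 3) * (δ₁ ^ 2 - 1) * (δ₃ - δ₁) * (δ₃ + δ₁) ^ 2
def nu1 (δ₁ δ₃ : ℝ) : ℝ :=
  -(1 / (8 * δ₁ ^ 3)) * (3 * δ₁ ^ 2 - 7) * (δ₃ + δ₁) *
    (15 * δ₃ ^ 2 - 10 * δ₁ * δ₃ - δ₁ ^ 2)
def nu2 (δ₁ δ₃ : ℝ) : ℝ :=
  1 / (8 * δ₁ ^ 3) * (3 * δ₁ ^ 2 - 7) * (δ₃ - δ₁) * (15 * δ₃ ^ 2 + 10 * δ₁ * δ₃ - δ₁ ^ 2)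
def nu3 (δ₁ δ₃ : ℝ) : ℝ :=
  -(35 / (8 * δ₁ ^ 3)) * (δ₁ ^ 2 - 1) * (δ₃ + δ₁) * (δ₃ - δ₁) ^ 2

def H323 (δ₁ δ₃ : ℝ) (x : Phase) : ℝ :=
  nu0 δ₁ δ₃ * Real.cos (x vγ₃ + 3 * x vψ₁) + nu1 δ₁ δ₃ * Real.cos (x vγ₃ + x vψ₁)
    + nu2 δ₁ δ₃ * Real.cos (x vγ₃ - x vψ₁) + nu3 δ₁ δ₃ * Real.cos (x vγ₃ - 3 * x vψ₁)

def J₁ (δ₁ δ₃ ψ γ : ℝ) : ℝ :=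
  30 * δ₃ ^ 2 * Real.sin γ * Real.cos ψ * Real.sin ψ
    - 10 * δ₁ ^ 2 * Real.sin γ * Real.cos ψ * Real.sin ψ
    - 20 * δ₁ * δ₃ * Real.cos γ * Real.cos ψ ^ 2 + 10 * δ₁ * δ₃ * Real.cos γ

def J₂ (δ₁ δ₃ ψ γ : ℝ) : ℝ :=
  -50 * δ₁ * δ₃ * Real.cos γ * Real.cos ψ * Real.sin ψ
    + 70 * δ₃ / δ₁ * Real.cos γ * Real.cos ψ * Real.sin ψ
    + 105 * δ₃ ^ 2 / δ₁ ^ 2 * Real.sin γ * Real.cos ψ ^ 2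
    - 75 * δ₃ ^ 2 * Real.sin γ * Real.cos ψ ^ 2
    + 25 * δ₁ ^ 2 * Real.sin γ * Real.cos ψ ^ 2
    - 35 * Real.sin γ * Real.cos ψ ^ 2
    - 105 * δ₃ ^ 2 / δ₁ ^ 2 * Real.sin γ
    + 60 * δ₃ ^ 2 * Real.sin γ - 17 * δ₁ ^ 2 * Real.sin γ + 28 * Real.sin γ

def H523 (δ₁ δ₃ : ℝ) (x : Phase) : ℝ :=
  √(x vΓ₁ ^ 2 - x vΓ₂ ^ 2) *
    (J₁ δ₁ δ₃ (x vψ₁) (x vγ₃) * Real.cos (x vγ₂)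
      + J₂ δ₁ δ₃ (x vψ₁) (x vγ₃) * Real.sin (x vγ₂))

/-! ### The constants in front of the explicit terms -/

def alpha012 (m : Fin 4 → ℝ) (L₁ δ₁ : ℝ) : ℝ :=
  3 * L₁ ^ 4 * totalMass m 2 ^ 3 * redMass m 2 ^ 6
    / (8 * totalMass m 1 ^ 2 * δ₁ ^ 3 * redMass m 1 ^ 4)

def alpha112 (m : Fin 4 → ℝ) (L₁ δ₁ : ℝ) : ℝ :=
  -(3 * L₁ ^ 4 * totalMass m 2 ^ 3 * redMass m 2 ^ 6
    / (8 * totalMass m 1 ^ 2 * δ₁ ^ 4 * redMass m 1 ^ 4))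

def alpha212 (m : Fin 4 → ℝ) (L₁ δ₁ : ℝ) : ℝ :=
  -(15 / 64) * (L₁ ^ 6 * redMass m 2 ^ 8 * totalMass m 2 ^ 4
    / (redMass m 1 ^ 6 * totalMass m 1 ^ 3)) * (√(1 - δ₁ ^ 2) / δ₁ ^ 5)

/-- `(a₂² / a₃³) (L₃⁶ / L₂⁴)`. -/
def kquad23 (m : Fin 4 → ℝ) : ℝ :=
  redMass m 3 ^ 6 * totalMass m 3 ^ 3 / (redMass m 2 ^ 4 * totalMass m 2 ^ 2)

/-- `(a₂³ / a₃⁴) (L₃⁸ / L₂⁶)`. -/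
def koct23 (m : Fin 4 → ℝ) : ℝ :=
  redMass m 3 ^ 8 * totalMass m 3 ^ 4 / (redMass m 2 ^ 6 * totalMass m 2 ^ 3)

def alpha023 (m : Fin 4 → ℝ) (δ₁ δ₂ δ₃ : ℝ) : ℝ :=
  15 / 8 * kquad23 m * (1 - δ₁ ^ 2) * (δ₁ ^ 2 - δ₃ ^ 2) / (δ₁ ^ 2 * δ₂ ^ 3)

def alpha223 (m : Fin 4 → ℝ) (δ₁ δ₂ δ₃ : ℝ) : ℝ :=
  3 / 4 * kquad23 m * δ₃ * √(δ₁ ^ 2 - δ₃ ^ 2) / (δ₁ ^ 3 * δ₂ ^ 3)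

def alphaTilde3 (m : Fin 4 → ℝ) (δ₁ δ₂ : ℝ) : ℝ :=
  3 / 4 * kquad23 m / (δ₁ ^ 3 * δ₂ ^ 3)

def alpha323 (m : Fin 4 → ℝ) (δ₁ δ₂ : ℝ) : ℝ :=
  -(15 / 64) * koct23 m * √(1 - δ₁ ^ 2) * √(1 - δ₂ ^ 2) / δ₂ ^ 5

def alpha523 (m : Fin 4 → ℝ) (δ₁ δ₂ δ₃ : ℝ) : ℝ :=
  15 / 64 * koct23 m * √(1 - δ₁ ^ 2) * √(1 - δ₂ ^ 2) * √(δ₁ ^ 2 - δ₃ ^ 2) / (δ₁ ^ 2 * δ₂ ^ 5)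

end FourBody

end

/-!
The theorem rests on three facts: the averages have closed forms in the elements and the relative
position of two ellipses; in Deprit coordinates these data are explicit and analytic at
`ε = μ = 0`; and the Taylor coefficients of an analytic function at `ε = μ = 0` form an expansion.

*Closed forms.* The average of a function of two positions becomes an integral over the eccentric
anomalies. For the quadrupole and the octupole, the true anomaly turns the integral over the outer
ellipse into that of a trigonometric polynomial, and the one over the inner ellipse is already of
this form. The results `quadAvg`, `octAvg` are polynomials in the inner products of the axes of
the ellipses (`AxisDots`), up to powers of the eccentricities and of `√(1 - e²)`. The averaged
perturbing function is the sum of a quadrupole, an octupole and higher multipoles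
(`mean2_pairKernel`), since the monopole is compensated by the Keplerian term and the dipole by
the choice of the barycenter. The higher multipoles (`multipoleTail`) are an integral whose
integrand is analytic in the ratio of the semimajor axes, also at 0.

*Deprit coordinates.* They determine the elements and the inner products of the axes
(`Realizes.ellipseData`) by the law of cosines in the triangles `C₁, C₂, C₁ + C₂` and
`C₁ + C₂, C₃, C₁ + C₂ + C₃`. At `ε = 0` the first triangle degenerates, and the angle between
`C₁ + C₂` and `C₂` vanishes: its sine is not an analytic function of its cosine. The law of sines
gives it as `ε` times an analytic function (`sinIncl₂`). So the quadrupole, the octupole and the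
higher multipoles are `ε⁶`, `ε⁸`, `ε¹⁰` for the planets 1 and 2, and `ε²μ⁶`, `ε²μ⁸`, `ε²μ¹⁰` for
the planets 2 and 3, times functions `quadFun₁₂`, …, `tailFun₂₃` analytic at `(0, 0, x)`, up to
constants. Conversely the coordinates are realized whenever the triangle inequalities hold
(`exists_realizes`), which is the case for small `ε`, `μ`.

*Expansions.* The Cauchy estimates, uniform on compact sets, show that the Taylor coefficients in
`ε`, `μ` are the coefficients of an expansion (`isExpansion_taylorCoeff`). The explicit terms are
the values and the first `ε`-derivatives of the functions above at `ε = μ = 0`. The functions of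
the planets 1 and 2 do not contain `μ`, and at `ε = 0` those of the planets 2 and 3 depend only on
`ψ̃₁` and, for the octupole, on `γ̃₃`.

*First appearances.* The regime `L₂^{11/6} ≪ L₃ ≪ L₂²` lies between `μ = ε^{5/6}` and `μ = ε`, so
that monomials are compared at these two ends (`muchSmaller_of_le`). The support of the
coefficients and their independence of variables exclude the terms which are not smaller than the
one in question; that this one contains the variable, or couples it, is seen by evaluating the
explicit function at a few points.

*Integrability.* `H_0^{12}` and `H_1^{12}` depend only on `γ₁`, `Γ₁`, `Γ̃₂` and `Ψ̃₁`, so that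
`Γ̃₂`, `Ψ̃₁`, `Γ̃₃` are further integrals. The differentials are independent where the derivative
in `γ₁` does not vanish, which is a dense set (`mem_closure_generic`).
-/

noncomputable section

namespace FourBody

/-! ### Locally uniform Cauchy estimates for analytic functions -/

section Cauchy

variable {E F : Type*} [NormedAddCommGroup E] [NormedSpace ℝ E] [NormedAddCommGroup F]
  [NormedSpace ℝ F] [CompleteSpace F]

/-- Near a point of analyticity, the function has power series of a common radius with a common
geometric bound on the coefficients. -/
theorem exists_uniform_powerSeries {f : E → F} {z₀ : E} (hf : AnalyticAt ℝ f z₀) :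
    ∃ R : NNReal, 0 < R ∧ ∃ C : ℝ, ∀ᶠ z in 𝓝 z₀, ∃ q : FormalMultilinearSeries ℝ E F,
      HasFPowerSeriesOnBall f q z R ∧ ∀ n, ‖q n‖ * (R : ℝ) ^ n ≤ C := by
  obtain ⟨p, r, hp⟩ := hf
  obtain ⟨R, hR0, hR⟩ : ∃ R : NNReal, 0 < R ∧ ((R : ENNReal) + R) < r := by
    obtain ⟨s, hs0, hs⟩ := ENNReal.lt_iff_exists_nnreal_btwn.1 hp.r_pos
    refine ⟨s / 2, by simpa using hs0, ?_⟩
    rw [← ENNReal.coe_add, add_halves]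
    exact hs
  have hrad : ((R : ENNReal) + R) < p.radius := hR.trans_le hp.r_le
  have hsum := p.changeOriginSeries_summable_aux₁ hrad
  refine ⟨R, hR0, ((∑' s : Σ k l : ℕ, { s : Finset (Fin (k + l)) // s.card = l },
    ‖p (s.1 + s.2.1)‖₊ * R ^ s.2.1 * R ^ s.1 : NNReal) : ℝ), ?_⟩
  filter_upwards [Metric.ball_mem_nhds z₀ (NNReal.coe_pos.2 hR0)] with z hz
  have hzR : ‖z - z₀‖₊ < R := by
    rw [Metric.mem_ball, dist_eq_norm] at hz
    exact_mod_cast hz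
  have hzr : (‖z - z₀‖₊ : ENNReal) < R := by exact_mod_cast hzR
  have hRr : (R : ENNReal) ≤ r := le_self_add.trans hR.le
  refine ⟨p.changeOrigin (z - z₀), ?_, fun n => ?_⟩
  · have h1 := hp.changeOrigin (y := z - z₀) (hzr.trans_le hRr)
    rw [add_sub_cancel] at h1
    refine h1.mono (by exact_mod_cast hR0) ?_
    refine ENNReal.le_sub_of_add_le_right (by simp) ?_
    exact (add_le_add_right hzr.le _).trans hR.le
  · have hlt : (‖z - z₀‖₊ : ENNReal) < p.radius := (hzr.trans_le hRr).trans_le hp.r_le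
    have h1 : ‖p.changeOrigin (z - z₀) n‖₊ * R ^ n ≤
        ∑' s : Σ k l : ℕ, { s : Finset (Fin (k + l)) // s.card = l },
          ‖p (s.1 + s.2.1)‖₊ * R ^ s.2.1 * R ^ s.1 := by
      calc ‖p.changeOrigin (z - z₀) n‖₊ * R ^ n
          ≤ (∑' s : Σ l : ℕ, { s : Finset (Fin (n + l)) // s.card = l },
              ‖p (n + s.1)‖₊ * ‖z - z₀‖₊ ^ s.1) * R ^ n := by
            gcongr; exact p.nnnorm_changeOrigin_le n hlt
        _ ≤ (∑' s : Σ l : ℕ, { s : Finset (Fin (n + l)) // s.card = l },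
              ‖p (n + s.1)‖₊ * R ^ s.1) * R ^ n := by
            gcongr ?_ * _
            refine Summable.tsum_le_tsum (fun s => by gcongr)
              (p.changeOriginSeries_summable_aux₂ hlt n)
              (p.changeOriginSeries_summable_aux₂ (lt_of_le_of_lt le_self_add hrad) n)
        _ = ∑' s : Σ l : ℕ, { s : Finset (Fin (n + l)) // s.card = l },
              ‖p (n + s.1)‖₊ * R ^ s.1 * R ^ n := (NNReal.tsum_mul_right _ _).symm
        _ ≤ _ := by
            have h2 := NNReal.summable_sigma.1 hsum
            have h3 := h2.2.le_tsum' n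
            rwa [← hsum.tsum_sigma' h2.1] at h3
    exact_mod_cast h1

/-- Cauchy estimates and convergence of the Taylor series, uniformly near a point of
analyticity. -/
theorem exists_cauchy_estimate {f : E → F} {z₀ : E} (hf : AnalyticAt ℝ f z₀) :
    ∃ R : ℝ, 0 < R ∧ ∃ C : ℝ, ∀ᶠ z in 𝓝 z₀,
      (∀ n, ‖iteratedFDeriv ℝ n f z‖ * R ^ n ≤ C * n.factorial) ∧
      ∀ h : E, ‖h‖ < R →
        HasSum (fun n : ℕ => (n.factorial : ℝ)⁻¹ • iteratedFDeriv ℝ n f z fun _ => h)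
          (f (z + h)) := by
  obtain ⟨R, hR, C, hq⟩ := exists_uniform_powerSeries hf
  refine ⟨R, by exact_mod_cast hR, C, ?_⟩
  filter_upwards [hq] with z hz
  obtain ⟨q, hfq, hC⟩ := hz
  refine ⟨fun n => ?_, fun h hh => ?_⟩
  · have h1 : ‖iteratedFDeriv ℝ n f z‖ ≤ n.factorial * ‖q n‖ := by
      refine ContinuousMultilinearMap.opNorm_le_bound (by positivity) fun v => ?_
      rw [hfq.iteratedFDeriv_eq_sum_of_completeSpace]
      calc ‖∑ σ : Equiv.Perm (Fin n), q n fun i => v (σ i)‖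
          ≤ ∑ _σ : Equiv.Perm (Fin n), ‖q n‖ * ∏ i, ‖v i‖ := by
            refine norm_sum_le_of_le _ fun σ _ => ((q n).le_opNorm _).trans_eq ?_
            rw [Equiv.prod_comp σ fun i => ‖v i‖]
        _ = n.factorial * ‖q n‖ * ∏ i, ‖v i‖ := by
            simp [Finset.sum_const, Fintype.card_perm, mul_assoc]
    calc ‖iteratedFDeriv ℝ n f z‖ * (R : ℝ) ^ n ≤ n.factorial * ‖q n‖ * (R : ℝ) ^ n := by gcongr
      _ = n.factorial * (‖q n‖ * (R : ℝ) ^ n) := by ring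
      _ ≤ n.factorial * C := by gcongr; exact hC n
      _ = _ := by ring
  · refine hfq.hasSum_iteratedFDeriv ?_
    rw [mem_eball_zero_iff, ← ofReal_norm, ← ENNReal.ofReal_coe_nnreal]
    exact (ENNReal.ofReal_lt_ofReal_iff (by exact_mod_cast hR)).2 hh

/-- `exists_cauchy_estimate` on a compact set. -/
theorem exists_cauchy_estimate_of_isCompact {f : E → F} {S : Set E} (hS : IsCompact S)
    (hf : AnalyticOnNhd ℝ f S) :
    ∃ R : ℝ, 0 < R ∧ ∃ C : ℝ, 0 ≤ C ∧ ∀ z ∈ S,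
      (∀ n, ‖iteratedFDeriv ℝ n f z‖ * R ^ n ≤ C * n.factorial) ∧
      ∀ h : E, ‖h‖ < R →
        HasSum (fun n : ℕ => (n.factorial : ℝ)⁻¹ • iteratedFDeriv ℝ n f z fun _ => h)
          (f (z + h)) := by
  refine hS.induction_on (p := fun S => ∃ R : ℝ, 0 < R ∧ ∃ C : ℝ, 0 ≤ C ∧ ∀ z ∈ S,
      (∀ n, ‖iteratedFDeriv ℝ n f z‖ * R ^ n ≤ C * n.factorial) ∧
      ∀ h : E, ‖h‖ < R →
        HasSum (fun n : ℕ => (n.factorial : ℝ)⁻¹ • iteratedFDeriv ℝ n f z fun _ => h)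
          (f (z + h))) ⟨1, one_pos, 0, le_rfl, by simp⟩ ?_ ?_ ?_
  · rintro s t hst ⟨R, hR, C, hC, h⟩
    exact ⟨R, hR, C, hC, fun z hz => h z (hst hz)⟩
  · rintro s t ⟨R, hR, C, hC, h⟩ ⟨R', hR', C', hC', h'⟩
    refine ⟨min R R', lt_min hR hR', max C C', le_max_of_le_left hC, ?_⟩
    have mono : ∀ (ρ D : ℝ) (z : E), min R R' ≤ ρ → D ≤ max C C' →
        (∀ n, ‖iteratedFDeriv ℝ n f z‖ * ρ ^ n ≤ D * n.factorial) →
        ∀ n, ‖iteratedFDeriv ℝ n f z‖ * min R R' ^ n ≤ max C C' * n.factorial := by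
      intro ρ D z hρ hD h n
      calc ‖iteratedFDeriv ℝ n f z‖ * min R R' ^ n ≤ ‖iteratedFDeriv ℝ n f z‖ * ρ ^ n := by
            have := (lt_min hR hR').le
            gcongr
        _ ≤ D * n.factorial := h n
        _ ≤ _ := by gcongr
    rintro z (hz | hz)
    · exact ⟨mono R C z (min_le_left _ _) (le_max_left _ _) (h z hz).1,
        fun v hv => (h z hz).2 v (hv.trans_le (min_le_left _ _))⟩
    · exact ⟨mono R' C' z (min_le_right _ _) (le_max_right _ _) (h' z hz).1,
        fun v hv => (h' z hz).2 v (hv.trans_le (min_le_right _ _))⟩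
  · intro z hz
    obtain ⟨R, hR, C, h⟩ := exists_cauchy_estimate (hf z hz)
    refine ⟨_, mem_nhdsWithin_of_mem_nhds h, R, hR, max C 0, le_max_right _ _, fun w hw => ?_⟩
    refine ⟨fun n => (hw.1 n).trans ?_, hw.2⟩
    gcongr
    exact le_max_left _ _

/-- The integral of an analytic family over a compact interval is analytic. -/
theorem analyticAt_intervalIntegral {f : E × ℝ → F} {z₀ : E} {a b : ℝ} (hab : a ≤ b)
    (hf : ∀ u ∈ Set.Icc a b, AnalyticAt ℝ f (z₀, u)) :
    AnalyticAt ℝ (fun z => ∫ u in a..b, f (z, u)) z₀ := by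
  have hK : IsCompact ((fun u : ℝ => (z₀, u)) '' Set.Icc a b) :=
    isCompact_Icc.image (by fun_prop)
  have hKf : AnalyticOnNhd ℝ f ((fun u : ℝ => (z₀, u)) '' Set.Icc a b) := by
    rintro _ ⟨u, hu, rfl⟩
    exact hf u hu
  obtain ⟨R, hR, C, hC, hest⟩ := exists_cauchy_estimate_of_isCompact hK hKf
  have hest' : ∀ u ∈ Set.Icc a b, _ := fun u hu => hest _ ⟨u, hu, rfl⟩
  let q : ℝ → FormalMultilinearSeries ℝ E F := fun u n =>
    (n.factorial : ℝ)⁻¹ • (iteratedFDeriv ℝ n f (z₀, u)).compContinuousLinearMap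
      fun _ => ContinuousLinearMap.inl ℝ E ℝ
  have hqn : ∀ u ∈ Set.Icc a b, ∀ n, ‖q u n‖ * R ^ n ≤ C := by
    intro u hu n
    have h1 : ‖(iteratedFDeriv ℝ n f (z₀, u)).compContinuousLinearMap
        fun _ => ContinuousLinearMap.inl ℝ E ℝ‖ ≤ ‖iteratedFDeriv ℝ n f (z₀, u)‖ := by
      refine ContinuousMultilinearMap.opNorm_le_bound (norm_nonneg _) fun v => ?_
      refine ((iteratedFDeriv ℝ n f (z₀, u)).le_opNorm _).trans_eq ?_
      simp
    have h2 := (hest' u hu).1 n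
    have hn : (0 : ℝ) < n.factorial := by positivity
    calc ‖q u n‖ * R ^ n ≤ (n.factorial : ℝ)⁻¹ * ‖iteratedFDeriv ℝ n f (z₀, u)‖ * R ^ n := by
          simp only [q, norm_smul]
          gcongr
          rw [Real.norm_of_nonneg (by positivity)]
      _ = (‖iteratedFDeriv ℝ n f (z₀, u)‖ * R ^ n) / n.factorial := by field_simp
      _ ≤ C := by rw [div_le_iff₀ hn]; exact h2
  have hqc : ∀ n, ContinuousOn (fun u => q u n) (Set.Icc a b) := by
    intro n
    have h1 : ContinuousOn (iteratedFDeriv ℝ n f) ((fun u : ℝ => (z₀, u)) '' Set.Icc a b) :=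
      (hKf.iteratedFDeriv n).continuousOn
    have h2 : ContinuousOn (fun u : ℝ => iteratedFDeriv ℝ n f (z₀, u)) (Set.Icc a b) :=
      h1.comp (by fun_prop) fun u hu => ⟨u, hu, rfl⟩
    have h3 : Continuous fun g : ContinuousMultilinearMap ℝ (fun _ : Fin n => E × ℝ) F =>
        g.compContinuousLinearMap fun _ => ContinuousLinearMap.inl ℝ E ℝ :=
      (ContinuousMultilinearMap.compContinuousLinearMapL
        fun _ : Fin n => ContinuousLinearMap.inl ℝ E ℝ).continuous
    exact (h3.comp_continuousOn h2).const_smul (n.factorial : ℝ)⁻¹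
  have hqi : ∀ n, IntervalIntegrable (fun u => q u n) MeasureTheory.volume a b := fun n =>
    ContinuousOn.intervalIntegrable (by rw [Set.uIcc_of_le hab]; exact hqc n)
  let p : FormalMultilinearSeries ℝ E F := fun n => ∫ u in a..b, q u n
  have hp : ∀ n, ‖p n‖ * R ^ n ≤ C * |b - a| := by
    intro n
    have h1 : ‖p n‖ ≤ C / R ^ n * |b - a| := by
      refine intervalIntegral.norm_integral_le_of_norm_le_const fun u hu => ?_
      rw [Set.uIoc_of_le hab] at hu
      rw [le_div_iff₀ (by positivity)]
      exact hqn u ⟨hu.1.le, hu.2⟩ n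
    calc ‖p n‖ * R ^ n ≤ C / R ^ n * |b - a| * R ^ n := by gcongr
      _ = _ := by field_simp
  lift R to NNReal using hR.le
  refine ⟨p, R, ?_, by exact_mod_cast hR, ?_⟩
  · exact FormalMultilinearSeries.le_radius_of_bound _ _ hp
  · intro y hy
    have hyR : ‖y‖ < R := by
      rw [mem_eball_zero_iff, ← ofReal_norm, ← ENNReal.ofReal_coe_nnreal] at hy
      exact (ENNReal.ofReal_lt_ofReal_iff (by exact_mod_cast hR)).1 hy
    have h1 : ∀ n, p n (fun _ => y) = ∫ u in a..b, q u n fun _ => y := by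
      intro n
      exact ((ContinuousMultilinearMap.apply ℝ (fun _ : Fin n => E) F
        fun _ => y).intervalIntegral_comp_comm (hqi n)).symm
    simp only [h1]
    have hgeo : Summable fun n : ℕ => C * (‖y‖ / R) ^ n :=
      (summable_geometric_of_lt_one (by positivity) ((div_lt_one hR).2 hyR)).mul_left C
    refine intervalIntegral.hasSum_integral_of_dominated_convergence
      (fun n _ => C * (‖y‖ / R) ^ n) (fun n => ?_) (fun n => ?_) ?_ ?_ ?_
    · have h2 : ContinuousOn (fun u => q u n fun _ => y) (Set.uIcc a b) := by
        rw [Set.uIcc_of_le hab]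
        exact (ContinuousMultilinearMap.apply ℝ (fun _ : Fin n => E) F
          fun _ => y).continuous.comp_continuousOn (hqc n)
      exact (h2.mono Set.uIoc_subset_uIcc).aestronglyMeasurable measurableSet_uIoc
    · refine Filter.Eventually.of_forall fun u hu => ?_
      rw [Set.uIoc_of_le hab] at hu
      have h2 := hqn u ⟨hu.1.le, hu.2⟩ n
      calc ‖q u n fun _ => y‖ ≤ ‖q u n‖ * ∏ _i : Fin n, ‖y‖ := (q u n).le_opNorm _
        _ = (‖q u n‖ * (R : ℝ) ^ n) * (‖y‖ / R) ^ n := by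
            rw [div_pow, Finset.prod_const, Finset.card_univ, Fintype.card_fin]
            field_simp
        _ ≤ _ := by gcongr
    · exact Filter.Eventually.of_forall fun u _ => hgeo
    · exact intervalIntegrable_const
    · refine Filter.Eventually.of_forall fun u hu => ?_
      rw [Set.uIoc_of_le hab] at hu
      have h2 := (hest' u ⟨hu.1.le, hu.2⟩).2 (y, 0) (by simpa using hyR)
      simpa [q] using h2

end Cauchy

/-! ### Taylor coefficients in the two small parameters -/

/-- The parameters `ε`, `μ` together with the phase point. -/
abbrev Param : Type := ℝ × ℝ × Phase

/-- The unit vector of the parameter `ε`. -/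
def unitε : Param := (1, 0, 0)

/-- The unit vector of the parameter `μ`. -/
def unitμ : Param := (0, 1, 0)

/-- The coefficient of `ε^i μ^j` in the Taylor expansion of `G` at `(0, 0, x)`. The sum over all
positions of the `i` arguments in the direction of `ε` makes it unnecessary to use the symmetry of
the derivative. -/
def taylorCoeff (G : Param → ℝ) (i j : ℕ) (x : Phase) : ℝ :=
  ((i + j).factorial : ℝ)⁻¹ * ∑ s : Finset (Fin (i + j)) with s.card = i,
    iteratedFDeriv ℝ (i + j) G (0, 0, x) (s.piecewise (fun _ => unitε) fun _ => unitμ)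

section Coeff

variable {E F F' : Type*} [NormedAddCommGroup E] [NormedSpace ℝ E] [NormedAddCommGroup F]
  [NormedSpace ℝ F] [NormedAddCommGroup F'] [NormedSpace ℝ F']

theorem norm_iteratedFDeriv_iteratedFDeriv (f : E → F) (z : E) (k n : ℕ) :
    ‖iteratedFDeriv ℝ k (iteratedFDeriv ℝ n f) z‖ = ‖iteratedFDeriv ℝ (k + n) f z‖ := by
  induction n generalizing k with
  | zero =>
    rw [iteratedFDeriv_zero_eq_comp, LinearIsometryEquiv.norm_iteratedFDeriv_comp_left]
    rfl
  | succ n ih =>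
    obtain ⟨g, hg⟩ : ∃ g : (E →L[ℝ] (E [×n]→L[ℝ] F)) ≃ₗᵢ[ℝ] (E [×(n + 1)]→L[ℝ] F),
        iteratedFDeriv ℝ (n + 1) f = g ∘ fderiv ℝ (iteratedFDeriv ℝ n f) :=
      ⟨(continuousMultilinearCurryLeftEquiv ℝ (fun _ : Fin (n + 1) => E) F).symm,
        iteratedFDeriv_succ_eq_comp_left⟩
    rw [hg, LinearIsometryEquiv.norm_iteratedFDeriv_comp_left (𝕜 := ℝ) (E := E)
      (F := E →L[ℝ] (E [×n]→L[ℝ] F)) (G := E [×(n + 1)]→L[ℝ] F) g]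
    rw [norm_iteratedFDeriv_fderiv, ih, show k + 1 + n = k + (n + 1) by omega]

/-- Chain rule for iterated derivatives and a linear map on the right, at a point of
analyticity. -/
theorem iteratedFDeriv_comp_clm [CompleteSpace F] {f : F' → F} (g : E →L[ℝ] F') {z : E}
    (hf : AnalyticAt ℝ f (g z)) (n : ℕ) :
    iteratedFDeriv ℝ n (f ∘ g) z =
      (iteratedFDeriv ℝ n f (g z)).compContinuousLinearMap fun _ => g := by
  let s := {w | AnalyticAt ℝ f w}
  have hs : IsOpen s := isOpen_analyticAt ℝ f
  have hs' : IsOpen (g ⁻¹' s) := hs.preimage g.continuous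
  have h : ContDiffOn ℝ n f s := fun w hw =>
    (AnalyticAt.contDiffAt (show AnalyticAt ℝ f w from hw)).contDiffWithinAt
  have key := g.iteratedFDerivWithin_comp_right h hs.uniqueDiffOn hs'.uniqueDiffOn
    (x := z) hf le_rfl
  rwa [iteratedFDerivWithin_of_isOpen n hs' hf, iteratedFDerivWithin_of_isOpen n hs hf] at key

end Coeff

/-- The embedding of the phase space at `ε = μ = 0`. -/
def phaseIncl : Phase →L[ℝ] Param :=
  (ContinuousLinearMap.inr ℝ ℝ (ℝ × Phase)).comp (ContinuousLinearMap.inr ℝ ℝ Phase)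

@[simp] theorem phaseIncl_apply (x : Phase) : phaseIncl x = (0, 0, x) := rfl

theorem norm_phaseIncl_le (x : Phase) : ‖phaseIncl x‖ ≤ ‖x‖ := by
  simp [Prod.norm_def]

/-- `taylorCoeff` as a continuous linear functional of the iterated derivative. -/
def coeffFunctional (i j : ℕ) :
    ContinuousMultilinearMap ℝ (fun _ : Fin (i + j) => Param) ℝ →L[ℝ] ℝ :=
  ((i + j).factorial : ℝ)⁻¹ • ∑ s : Finset (Fin (i + j)) with s.card = i,
    ContinuousMultilinearMap.apply ℝ (fun _ : Fin (i + j) => Param) ℝ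
      (s.piecewise (fun _ => unitε) fun _ => unitμ)

theorem taylorCoeff_eq (G : Param → ℝ) (i j : ℕ) :
    taylorCoeff G i j =
      fun x => coeffFunctional i j (iteratedFDeriv ℝ (i + j) G (phaseIncl x)) := by
  funext x
  simp [taylorCoeff, coeffFunctional]

theorem norm_coeffFunctional_le (i j : ℕ) :
    ‖coeffFunctional i j‖ ≤ ((i + j).factorial : ℝ)⁻¹ * 2 ^ (i + j) := by
  refine ContinuousLinearMap.opNorm_le_bound _ (by positivity) fun f => ?_
  have h1 : ∀ s : Finset (Fin (i + j)),
      ‖f (s.piecewise (fun _ => unitε) fun _ => unitμ)‖ ≤ ‖f‖ := by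
    intro s
    refine (f.le_opNorm _).trans ?_
    refine mul_le_of_le_one_right (norm_nonneg _) (Finset.prod_le_one (by simp) fun k _ => ?_)
    by_cases hk : k ∈ s <;> simp [hk, unitε, unitμ, Prod.norm_def]
  have h2 : coeffFunctional i j f = ((i + j).factorial : ℝ)⁻¹ *
      ∑ s : Finset (Fin (i + j)) with s.card = i,
        f (s.piecewise (fun _ => unitε) fun _ => unitμ) := by
    simp [coeffFunctional]
  rw [h2, norm_mul, Real.norm_of_nonneg (by positivity), mul_assoc]
  gcongr
  refine (norm_sum_le_of_le _ fun s _ => h1 s).trans ?_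
  rw [Finset.sum_const, nsmul_eq_mul]
  gcongr
  calc ((Finset.univ.filter fun s : Finset (Fin (i + j)) => s.card = i).card : ℝ)
      ≤ (Finset.univ : Finset (Finset (Fin (i + j)))).card := by
        exact_mod_cast Finset.card_filter_le _ _
    _ = 2 ^ (i + j) := by simp

theorem analyticAt_taylorCoeff {G : Param → ℝ} {x : Phase} (hG : AnalyticAt ℝ G (0, 0, x))
    (i j : ℕ) : AnalyticAt ℝ (taylorCoeff G i j) x := by
  rw [taylorCoeff_eq]
  have h1 : AnalyticAt ℝ (iteratedFDeriv ℝ (i + j) G) (phaseIncl x) := by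
    have h2 : AnalyticOnNhd ℝ G {(0, 0, x)} := by
      rintro _ rfl
      exact hG
    exact h2.iteratedFDeriv (i + j) _ rfl
  exact ((coeffFunctional i j).analyticAt _).comp (h1.comp (phaseIncl.analyticAt x))

theorem norm_iteratedFDeriv_taylorCoeff_le {G : Param → ℝ} {x : Phase}
    (hG : AnalyticAt ℝ G (0, 0, x)) (i j k : ℕ) :
    ‖iteratedFDeriv ℝ k (taylorCoeff G i j) x‖ ≤
      ((i + j).factorial : ℝ)⁻¹ * 2 ^ (i + j) *
        ‖iteratedFDeriv ℝ (k + (i + j)) G (0, 0, x)‖ := by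
  rw [taylorCoeff_eq]
  have h2 : AnalyticAt ℝ (iteratedFDeriv ℝ (i + j) G) (phaseIncl x) := by
    have h2 : AnalyticOnNhd ℝ G {(0, 0, x)} := by
      rintro _ rfl
      exact hG
    exact h2.iteratedFDeriv (i + j) _ rfl
  have h3 : AnalyticAt ℝ (iteratedFDeriv ℝ (i + j) G ∘ phaseIncl) x :=
    h2.comp (phaseIncl.analyticAt x)
  have h4 := (coeffFunctional i j).norm_iteratedFDeriv_comp_left (n := k)
    (AnalyticAt.contDiffAt h3) le_rfl
  refine h4.trans ?_
  refine mul_le_mul (norm_coeffFunctional_le i j) ?_ (norm_nonneg _) (by positivity)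
  rw [iteratedFDeriv_comp_clm phaseIncl h2, ← norm_iteratedFDeriv_iteratedFDeriv]
  refine ContinuousMultilinearMap.opNorm_le_bound (norm_nonneg _) fun v => ?_
  rw [ContinuousMultilinearMap.compContinuousLinearMap_apply]
  refine (ContinuousMultilinearMap.le_opNorm _ _).trans ?_
  simp only [phaseIncl_apply]
  gcongr
  exact norm_phaseIncl_le _

theorem factorial_add_le (k n : ℕ) :
    ((k + n).factorial : ℝ) ≤ 2 ^ (k + n) * k.factorial * n.factorial := by
  have h1 := Nat.add_choose_mul_factorial_mul_factorial k n
  have h2 : (k + n).choose n ≤ 2 ^ (k + n) := Nat.choose_le_two_pow _ _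
  rw [← h1]
  push_cast
  gcongr
  exact_mod_cast h2

/-- The homogeneous part of degree `n` of the Taylor series, sorted by powers of `ε` and `μ`. -/
theorem iteratedFDeriv_apply_eq_sum_taylorCoeff (G : Param → ℝ) (x : Phase) (ε μ : ℝ) (n : ℕ) :
    (n.factorial : ℝ)⁻¹ • (iteratedFDeriv ℝ n G (0, 0, x) fun _ => ((ε, μ, 0) : Param)) =
      ∑ p ∈ Finset.HasAntidiagonal.antidiagonal n, ε ^ p.1 * μ ^ p.2 * taylorCoeff G p.1 p.2 x := by
  have h1 : (fun _ : Fin n => ((ε, μ, 0) : Param)) =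
      (fun _ => ε • unitε) + fun _ => μ • unitμ := by
    funext k
    simp [unitε, unitμ]
  rw [h1, ContinuousMultilinearMap.map_add_univ]
  have h2 : ∀ s : Finset (Fin n),
      iteratedFDeriv ℝ n G (0, 0, x)
        (s.piecewise (fun _ => ε • unitε) fun _ => μ • unitμ) =
      ε ^ s.card * μ ^ (n - s.card) * iteratedFDeriv ℝ n G (0, 0, x)
        (s.piecewise (fun _ => unitε) fun _ => unitμ) := by
    intro s
    have h3 : (s.piecewise (fun _ => ε • unitε) fun _ => μ • unitμ) =
        fun k => (s.piecewise (fun _ => ε) fun _ => μ : Fin n → ℝ) k •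
          (s.piecewise (fun _ => unitε) fun _ => unitμ : Fin n → Param) k := by
      funext k
      by_cases hk : k ∈ s <;> simp [hk]
    rw [h3, ContinuousMultilinearMap.map_smul_univ, Finset.prod_piecewise]
    simp [Finset.card_univ_sdiff]
  simp only [h2]
  rw [← Finset.sum_fiberwise_of_maps_to (s := Finset.univ)
    (t := Finset.HasAntidiagonal.antidiagonal n) (g := fun s : Finset (Fin n) => (s.card, n - s.card))
    (fun s _ => by
      rw [Finset.HasAntidiagonal.mem_antidiagonal]
      exact Nat.add_sub_of_le (card_finset_fin_le s))]
  rw [smul_eq_mul, Finset.mul_sum]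
  refine Finset.sum_congr rfl ?_
  rintro ⟨i, j⟩ hij
  rw [Finset.HasAntidiagonal.mem_antidiagonal] at hij
  simp only at hij
  subst hij
  rw [taylorCoeff, mul_left_comm (ε ^ i * μ ^ j)]
  congr 1
  have h5 : (Finset.univ.filter fun s : Finset (Fin (i + j)) =>
      (s.card, i + j - s.card) = (i, j)) = Finset.univ.filter fun s => s.card = i := by
    ext s
    simp only [Finset.mem_filter, Finset.mem_univ, true_and, Prod.mk.injEq]
    omega
  rw [h5, Finset.mul_sum]
  refine Finset.sum_congr rfl fun s hs => ?_
  rw [(Finset.mem_filter.1 hs).2, Nat.add_sub_cancel_left]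

/-- A function that is analytic at `ε = μ = 0` is given by an expansion, with its Taylor
coefficients. -/
theorem isExpansion_taylorCoeff {D : Set Phase} {G : Param → ℝ}
    (hG : ∀ x ∈ D, AnalyticAt ℝ G (0, 0, x)) :
    IsExpansion D (fun ε μ x y => y = G (ε, μ, x)) (taylorCoeff G) := by
  refine ⟨fun i j x hx => analyticAt_taylorCoeff (hG x hx) i j, fun K hKD hK => ?_⟩
  have hK' : IsCompact (phaseIncl '' K) := hK.image phaseIncl.continuous
  have hGK : AnalyticOnNhd ℝ G (phaseIncl '' K) := by
    rintro _ ⟨x, hx, rfl⟩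
    exact hG x (hKD hx)
  obtain ⟨R, hR, C, hC, hest⟩ := exists_cauchy_estimate_of_isCompact hK' hGK
  have hbound : ∀ k : ℕ, ∀ i j, ∀ x ∈ K,
      ‖iteratedFDeriv ℝ k (taylorCoeff G i j) x‖ * (R / 4) ^ (i + j) ≤
        C * k.factorial * 2 ^ k / R ^ k := by
    intro k i j x hx
    have h1 := norm_iteratedFDeriv_taylorCoeff_le (hG x (hKD hx)) i j k
    have h2 := (hest _ ⟨x, hx, rfl⟩).1 (k + (i + j))
    rw [phaseIncl_apply] at h2
    rw [le_div_iff₀ (by positivity)]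
    have hn : ((i + j).factorial : ℝ) ≠ 0 := by positivity
    calc ‖iteratedFDeriv ℝ k (taylorCoeff G i j) x‖ * (R / 4) ^ (i + j) * R ^ k
        ≤ ((i + j).factorial : ℝ)⁻¹ * 2 ^ (i + j) *
          ‖iteratedFDeriv ℝ (k + (i + j)) G (0, 0, x)‖ * (R / 4) ^ (i + j) * R ^ k := by gcongr
      _ = ((i + j).factorial : ℝ)⁻¹ * (2 ^ (i + j) / 4 ^ (i + j)) *
          (‖iteratedFDeriv ℝ (k + (i + j)) G (0, 0, x)‖ * R ^ (k + (i + j))) := by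
          rw [div_pow, pow_add R k]; ring
      _ ≤ ((i + j).factorial : ℝ)⁻¹ * (2 ^ (i + j) / 4 ^ (i + j)) *
          (C * (2 ^ (k + (i + j)) * k.factorial * (i + j).factorial)) := by
          refine mul_le_mul_of_nonneg_left (h2.trans ?_) (by positivity)
          gcongr
          exact factorial_add_le _ _
      _ = C * k.factorial * 2 ^ k := by
          rw [pow_add 2 k, show (4 : ℝ) = 2 * 2 by norm_num, mul_pow]
          field_simp
  refine ⟨R / 4, by positivity, fun k => ⟨_, hbound k⟩, ?_⟩
  rintro ε μ hε hερ hμ hμρ x hx y rfl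
  have hnorm : ‖((ε, μ, 0) : Param)‖ < R := by
    simp only [Prod.norm_def, norm_zero, Real.norm_eq_abs, abs_of_pos hε, abs_of_pos hμ,
      max_eq_left hμ.le]
    exact max_lt (by linarith) (by linarith)
  have hsum := (hest _ ⟨x, hx, rfl⟩).2 _ hnorm
  simp only [phaseIncl_apply, Prod.mk_add_mk, zero_add, add_zero,
    iteratedFDeriv_apply_eq_sum_taylorCoeff] at hsum
  have hsummable : Summable fun p : ℕ × ℕ => ε ^ p.1 * μ ^ p.2 * taylorCoeff G p.1 p.2 x := by
    have hg : ∀ t : ℝ, 0 < t → t < R / 4 → Summable fun n : ℕ => (t / (R / 4)) ^ n :=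
      fun t ht htR => summable_geometric_of_lt_one (by positivity)
        ((div_lt_one (by positivity)).2 htR)
    refine Summable.of_norm_bounded (((hg ε hε hερ).mul_of_nonneg (hg μ hμ hμρ)
      (fun _ => by positivity) fun _ => by positivity).mul_left
      (C * Nat.factorial 0 * 2 ^ 0 / R ^ 0)) fun p => ?_
    have h1 := hbound 0 p.1 p.2 x hx
    rw [norm_iteratedFDeriv_zero] at h1
    calc ‖ε ^ p.1 * μ ^ p.2 * taylorCoeff G p.1 p.2 x‖
        = (‖taylorCoeff G p.1 p.2 x‖ * (R / 4) ^ (p.1 + p.2)) *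
            ((ε / (R / 4)) ^ p.1 * (μ / (R / 4)) ^ p.2) := by
          rw [norm_mul, norm_mul, norm_pow, norm_pow, Real.norm_of_nonneg hε.le,
            Real.norm_of_nonneg hμ.le, pow_add, div_pow ε, div_pow μ]
          have hR4 : R / 4 ≠ 0 := by positivity
          generalize R / 4 = ρ at hR4
          field_simp
      _ ≤ _ := by gcongr
  rw [← (Finset.HasAntidiagonal.sigmaAntidiagonalEquivProd (A := ℕ)).hasSum_iff]
  refine HasSum.sigma_of_hasSum hsum (fun n => ?_)
    ((Finset.HasAntidiagonal.sigmaAntidiagonalEquivProd (A := ℕ)).summable_iff.2 hsummable)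
  rw [← Finset.sum_coe_sort]
  exact hasSum_fintype _

/-! ### Operations on expansions -/

/-- `IsExpansion` for a function of the parameters and the phase point. -/
abbrev IsExpansionOf (D : Set Phase) (G : ℝ → ℝ → Phase → ℝ) (F : ℕ → ℕ → Phase → ℝ) : Prop :=
  IsExpansion D (fun ε μ x y => y = G ε μ x) F

/-- The coefficients of `ε^a μ^b` times a series. -/
def shiftCoeff (a b : ℕ) (F : ℕ → ℕ → Phase → ℝ) (i j : ℕ) : Phase → ℝ :=
  if a ≤ i ∧ b ≤ j then F (i - a) (j - b) else fun _ => 0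

theorem shiftCoeff_of_not {a b i j : ℕ} (h : ¬ (a ≤ i ∧ b ≤ j)) (F : ℕ → ℕ → Phase → ℝ)
    (x : Phase) : shiftCoeff a b F i j x = 0 := by
  simp [shiftCoeff, h]

theorem shiftCoeff_add (a b i j : ℕ) (F : ℕ → ℕ → Phase → ℝ) :
    shiftCoeff a b F (a + i) (b + j) = F i j := by
  simp [shiftCoeff]

section Ops

variable {D : Set Phase} {G G' : ℝ → ℝ → Phase → ℝ} {F F' : ℕ → ℕ → Phase → ℝ}

/-- Passage from an expansion of a function to the relation `V` between parameters, phase points and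
values, when `V` determines the value as that of the function. -/
theorem IsExpansionOf.isExpansion {V : ℝ → ℝ → Phase → ℝ → Prop} (h : IsExpansionOf D G F)
    (hV : ∀ K : Set Phase, K ⊆ D → IsCompact K → ∃ ρ : ℝ, 0 < ρ ∧
      ∀ ε μ : ℝ, 0 < ε → ε < ρ → 0 < μ → μ < ρ → ∀ x ∈ K, ∀ y, V ε μ x y → y = G ε μ x) :
    IsExpansion D V F := by
  refine ⟨h.1, fun K hKD hK => ?_⟩
  obtain ⟨ρ, hρ, hb, hs⟩ := h.2 K hKD hK
  obtain ⟨ρ', hρ', hV⟩ := hV K hKD hK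
  refine ⟨min ρ ρ', lt_min hρ hρ', fun k => ?_, fun ε μ hε hε' hμ hμ' x hx y hy => ?_⟩
  · obtain ⟨C, hC⟩ := hb k
    refine ⟨C, fun i j x hx => le_trans ?_ (hC i j x hx)⟩
    have := (lt_min hρ hρ').le
    gcongr
    exact min_le_left _ _
  · exact hs ε μ hε (hε'.trans_le (min_le_left _ _)) hμ (hμ'.trans_le (min_le_left _ _)) x hx y
      (hV ε μ hε (hε'.trans_le (min_le_right _ _)) hμ (hμ'.trans_le (min_le_right _ _)) x hx y hy)

theorem IsExpansionOf.add (h : IsExpansionOf D G F) (h' : IsExpansionOf D G' F') :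
    IsExpansionOf D (fun ε μ x => G ε μ x + G' ε μ x) (fun i j x => F i j x + F' i j x) := by
  refine ⟨fun i j => (h.1 i j).add (h'.1 i j), fun K hKD hK => ?_⟩
  obtain ⟨ρ, hρ, hb, hs⟩ := h.2 K hKD hK
  obtain ⟨ρ', hρ', hb', hs'⟩ := h'.2 K hKD hK
  have h0 := lt_min hρ hρ'
  refine ⟨min ρ ρ', h0, fun k => ?_, fun ε μ hε hε' hμ hμ' x hx y hy => ?_⟩
  · obtain ⟨C, hC⟩ := hb k
    obtain ⟨C', hC'⟩ := hb' k
    refine ⟨C + C', fun i j x hx => ?_⟩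
    have e1 : iteratedFDeriv ℝ k (fun x => F i j x + F' i j x) x =
        iteratedFDeriv ℝ k (F i j) x + iteratedFDeriv ℝ k (F' i j) x :=
      iteratedFDeriv_add_apply (AnalyticAt.contDiffAt (h.1 i j x (hKD hx)))
        (AnalyticAt.contDiffAt (h'.1 i j x (hKD hx)))
    rw [e1]
    calc _ ≤ (‖iteratedFDeriv ℝ k (F i j) x‖ + ‖iteratedFDeriv ℝ k (F' i j) x‖) *
          min ρ ρ' ^ (i + j) := by gcongr; exact norm_add_le _ _
      _ = ‖iteratedFDeriv ℝ k (F i j) x‖ * min ρ ρ' ^ (i + j) +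
          ‖iteratedFDeriv ℝ k (F' i j) x‖ * min ρ ρ' ^ (i + j) := by ring
      _ ≤ ‖iteratedFDeriv ℝ k (F i j) x‖ * ρ ^ (i + j) +
          ‖iteratedFDeriv ℝ k (F' i j) x‖ * ρ' ^ (i + j) := by
          gcongr
          · exact min_le_left _ _
          · exact min_le_right _ _
      _ ≤ _ := add_le_add (hC i j x hx) (hC' i j x hx)
  · rw [hy]
    have s1 := hs ε μ hε (hε'.trans_le (min_le_left _ _)) hμ (hμ'.trans_le (min_le_left _ _)) x hx
      _ rfl
    have s2 := hs' ε μ hε (hε'.trans_le (min_le_right _ _)) hμ (hμ'.trans_le (min_le_right _ _))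
      x hx _ rfl
    simpa only [mul_add] using s1.add s2

theorem IsExpansionOf.const_mul (h : IsExpansionOf D G F) (c : ℝ) :
    IsExpansionOf D (fun ε μ x => c * G ε μ x) (fun i j x => c * F i j x) := by
  refine ⟨fun i j => analyticOnNhd_const.mul (h.1 i j), fun K hKD hK => ?_⟩
  obtain ⟨ρ, hρ, hb, hs⟩ := h.2 K hKD hK
  refine ⟨ρ, hρ, fun k => ?_, fun ε μ hε hε' hμ hμ' x hx y hy => ?_⟩
  · obtain ⟨C, hC⟩ := hb k
    refine ⟨|c| * C, fun i j x hx => ?_⟩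
    have e1 : iteratedFDeriv ℝ k (fun x => c * F i j x) x = c • iteratedFDeriv ℝ k (F i j) x :=
      iteratedFDeriv_const_smul_apply (a := c) (AnalyticAt.contDiffAt (h.1 i j x (hKD hx)))
    rw [e1, norm_smul, Real.norm_eq_abs, mul_assoc]
    exact mul_le_mul_of_nonneg_left (hC i j x hx) (abs_nonneg c)
  · rw [hy]
    simpa only [mul_left_comm] using (hs ε μ hε hε' hμ hμ' x hx _ rfl).mul_left c

theorem IsExpansionOf.shift (h : IsExpansionOf D G F) (a b : ℕ) :
    IsExpansionOf D (fun ε μ x => ε ^ a * μ ^ b * G ε μ x) (shiftCoeff a b F) := by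
  refine ⟨fun i j => ?_, fun K hKD hK => ?_⟩
  · rw [shiftCoeff]
    split_ifs
    · exact h.1 _ _
    · exact analyticOnNhd_const
  obtain ⟨ρ, hρ, hb, hs⟩ := h.2 K hKD hK
  refine ⟨ρ, hρ, fun k => ?_, fun ε μ hε hε' hμ hμ' x hx y hy => ?_⟩
  · obtain ⟨C, hC⟩ := hb k
    refine ⟨max (C * ρ ^ (a + b)) 0, fun i j x hx => ?_⟩
    by_cases hij : a ≤ i ∧ b ≤ j
    · refine le_max_of_le_left ?_
      rw [shiftCoeff, if_pos hij, show i + j = (i - a + (j - b)) + (a + b) by omega, pow_add,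
        ← mul_assoc]
      gcongr
      exact hC _ _ x hx
    · rw [shiftCoeff, if_neg hij]
      have e0 : iteratedFDeriv ℝ k (fun _ : Phase => (0 : ℝ)) x = 0 := by
        simp
      simp [e0]
  · rw [hy]
    have s1 := (hs ε μ hε hε' hμ hμ' x hx _ rfl).mul_left (ε ^ a * μ ^ b)
    have hinj : Function.Injective fun p : ℕ × ℕ => (a + p.1, b + p.2) := by
      rintro ⟨i, j⟩ ⟨i', j'⟩ h
      simp only [Prod.mk.injEq] at h
      ext <;> simp <;> omega
    rw [← hinj.hasSum_iff]
    · refine s1.congr_fun fun p => ?_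
      simp only [Function.comp, shiftCoeff_add, pow_add]
      ring
    · rintro ⟨i, j⟩ hij
      rw [shiftCoeff_of_not, mul_zero]
      rintro ⟨hi, hj⟩
      exact hij ⟨(i - a, j - b), by simp [hi, hj]⟩

end Ops

/-! ### The order of the monomials -/

/-- A monomial is smaller as soon as it is at most as large at the two ends `μ = ε` and
`μ = ε^{5/6}` of the regime. -/
theorem muchSmaller_of_le {i j i' j' : ℕ} (h1 : 6 * i' + 5 * j' ≤ 6 * i + 5 * j)
    (h2 : i' + j' ≤ i + j) (h3 : (i, j) ≠ (i', j')) : MuchSmaller i j i' j' := by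
  intro L₂ L₃ hL₂ h23 h32
  obtain ⟨p, hp⟩ := Nat.exists_eq_add_of_le h1
  obtain ⟨q, hq⟩ := Nat.exists_eq_add_of_le h2
  rw [Asymptotics.isLittleO_iff_exists_eq_mul]
  have hpos : ∀ᶠ n in atTop, 0 < L₂ n ∧ 0 < L₃ n := by
    filter_upwards [hL₂.eventually_gt_atTop 0, h23.eventually_gt_atTop 0] with n h2 h3
    refine ⟨h2, ?_⟩
    have := Real.rpow_pos_of_pos h2 (11 / 6)
    rcases lt_or_ge 0 (L₃ n) with h | h
    · exact h
    · exact absurd h3 (not_lt.2 (div_nonpos_of_nonpos_of_nonneg h this.le))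
  have hA : Tendsto (fun n => L₃ n / L₂ n ^ 2) atTop (𝓝 0) := by
    refine h32.inv_tendsto_atTop.congr fun n => ?_
    simp
  have hB : Tendsto (fun n => L₂ n ^ 11 / L₃ n ^ 6) atTop (𝓝 0) := by
    have hB' := h23.inv_tendsto_atTop.pow 6
    rw [zero_pow (by norm_num)] at hB'
    refine hB'.congr' ?_
    filter_upwards [hpos] with n hn
    have e : (L₂ n ^ (11 / 6 : ℝ)) ^ 6 = L₂ n ^ 11 := by
      rw [← Real.rpow_natCast, ← Real.rpow_mul hn.1.le]
      norm_num
    simp only [Pi.inv_apply, inv_div, div_pow, e]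
  refine ⟨fun n => (L₃ n / L₂ n ^ 2) ^ p * (L₂ n ^ 11 / L₃ n ^ 6) ^ q, ?_, ?_⟩
  · rcases Nat.eq_zero_or_pos p with hp0 | hp0
    · have hq0 : 0 < q := by
        rcases Nat.eq_zero_or_pos q with hq0 | hq0
        · exact absurd (by ext <;> simp <;> omega) h3
        · exact hq0
      simpa [hp0, hq0.ne'] using hB.pow q
    · rcases Nat.eq_zero_or_pos q with hq0 | hq0
      · simpa [hq0, hp0.ne'] using hA.pow p
      · simpa [hp0.ne', hq0.ne'] using (hA.pow p).mul (hB.pow q)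
  · filter_upwards [hpos] with n hn
    obtain ⟨ha, hb⟩ := hn
    simp only [Pi.mul_apply]
    generalize L₂ n = a at ha
    generalize L₃ n = b at hb
    have hP : b / a ^ 2 = (1 / a) / (a / b) := by field_simp
    have hQ : a ^ 11 / b ^ 6 = (a / b) ^ 6 / (1 / a) ^ 5 := by field_simp
    rw [hP, hQ]
    have hx : 1 / a ≠ 0 := by positivity
    have hy : a / b ≠ 0 := by positivity
    generalize 1 / a = x at hx
    generalize a / b = y at hy
    rw [div_pow, div_pow, ← pow_mul, ← pow_mul, div_mul_div_comm, div_mul_eq_mul_div,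
      eq_div_iff (by positivity)]
    have e1 : i + 5 * q = p + i' := by omega
    have e2 : p + j = 6 * q + j' := by omega
    calc x ^ i * y ^ j * (y ^ p * x ^ (5 * q)) = x ^ (i + 5 * q) * y ^ (p + j) := by
          rw [pow_add, pow_add]; ring
      _ = _ := by rw [e1, e2, pow_add, pow_add]; ring

/-! ### Dependence of the coefficients on the variables -/

section Indep

variable {D : Set Phase} {v : Fin 8} {f g : Phase → ℝ}

theorem indep_const (c : ℝ) : Indep D v fun _ => c := fun _ _ _ _ _ => rfl

theorem Indep.add (hf : Indep D v f) (hg : Indep D v g) : Indep D v fun x => f x + g x :=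
  fun x hx y hy h => congrArg₂ (· + ·) (hf x hx y hy h) (hg x hx y hy h)

theorem Indep.const_mul (hf : Indep D v f) (c : ℝ) : Indep D v fun x => c * f x :=
  fun x hx y hy h => congrArg (c * ·) (hf x hx y hy h)

theorem Indep.congr (hf : Indep D v f) (h : ∀ x ∈ D, g x = f x) : Indep D v g :=
  fun x hx y hy hxy => by rw [h x hx, h y hy, hf x hx y hy hxy]

theorem Indep.of_forall_eq_zero (h : ∀ x ∈ D, f x = 0) : Indep D v f :=
  (indep_const 0).congr h

theorem indep_shiftCoeff {F : ℕ → ℕ → Phase → ℝ} (h : ∀ i j, Indep D v (F i j)) (a b i j : ℕ) :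
    Indep D v (shiftCoeff a b F i j) := by
  rw [shiftCoeff]
  split_ifs
  · exact h _ _
  · exact indep_const 0

/-- A parametrized function does not depend on the variable `v`. -/
def ParamIndep (v : Fin 8) (G : Param → ℝ) : Prop :=
  ∀ ε μ : ℝ, ∀ x y : Phase, (∀ w, w ≠ v → x w = y w) → G (ε, μ, x) = G (ε, μ, y)

theorem ParamIndep.indep_taylorCoeff {G : Param → ℝ} (hG : ParamIndep v G) (i j : ℕ) :
    Indep D v (taylorCoeff G i j) := by
  intro x _ y _ h
  have h1 : G = fun z => G (z + (0, 0, Pi.single v (y v - x v))) := by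
    funext ⟨ε, μ, z⟩
    simp only [Prod.mk_add_mk, add_zero]
    refine hG ε μ _ _ fun w hw => ?_
    simp [hw]
  have h2 : ((0, 0, x) : Param) + (0, 0, Pi.single v (y v - x v)) = (0, 0, y) := by
    simp only [Prod.mk_add_mk, add_zero, Prod.mk.injEq, true_and]
    funext w
    by_cases hw : w = v
    · subst hw; simp
    · simp [hw, h w hw]
  have h3 : iteratedFDeriv ℝ (i + j) G (0, 0, x) = iteratedFDeriv ℝ (i + j) G (0, 0, y) := by
    conv_lhs => rw [h1]
    rw [iteratedFDeriv_comp_add_right, h2]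
  simp only [taylorCoeff, h3]

/-- Setting `ε = 0`. -/
def dropε : Param →L[ℝ] Param :=
  (ContinuousLinearMap.inr ℝ ℝ (ℝ × Phase)).comp (ContinuousLinearMap.snd ℝ ℝ (ℝ × Phase))

/-- Setting `μ = 0`. -/
def dropμ : Param →L[ℝ] Param :=
  (ContinuousLinearMap.fst ℝ ℝ (ℝ × Phase)).prod
    ((ContinuousLinearMap.inr ℝ ℝ Phase).comp
      ((ContinuousLinearMap.snd ℝ ℝ Phase).comp (ContinuousLinearMap.snd ℝ ℝ (ℝ × Phase))))

@[simp] theorem dropε_apply (ε μ : ℝ) (x : Phase) : dropε (ε, μ, x) = (0, μ, x) := rfl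

@[simp] theorem dropμ_apply (ε μ : ℝ) (x : Phase) : dropμ (ε, μ, x) = (ε, 0, x) := rfl

theorem taylorCoeff_zero_dropε {G : Param → ℝ} {x : Phase} (hG : AnalyticAt ℝ G (0, 0, x))
    (j : ℕ) : taylorCoeff (G ∘ dropε) 0 j x = taylorCoeff G 0 j x := by
  rw [taylorCoeff, taylorCoeff]
  congr 1
  refine Finset.sum_congr rfl fun s hs => ?_
  have hs' : s = ∅ := Finset.card_eq_zero.1 (Finset.mem_filter.1 hs).2
  have h0 : (∅ : Finset (Fin (0 + j))).piecewise (fun _ => unitε) (fun _ => unitμ) =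
      fun _ => unitμ := by
    funext k; simp
  rw [iteratedFDeriv_comp_clm dropε (by simpa using hG), hs']
  simp only [ContinuousMultilinearMap.compContinuousLinearMap_apply, dropε_apply, h0]
  rfl

/-- The terms without `ε` depend only on the variables on which the function depends at
`ε = 0`. -/
theorem indep_taylorCoeff_zero {G : Param → ℝ} (hG : ∀ x ∈ D, AnalyticAt ℝ G (0, 0, x))
    (h : ∀ μ : ℝ, ∀ x y : Phase, (∀ w, w ≠ v → x w = y w) → G (0, μ, x) = G (0, μ, y)) (j : ℕ) :
    Indep D v (taylorCoeff G 0 j) := by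
  have h1 : ParamIndep v (G ∘ dropε) := fun ε μ x y hxy => h μ x y hxy
  exact (h1.indep_taylorCoeff 0 j).congr fun x hx => (taylorCoeff_zero_dropε (hG x hx) j).symm

/-- If a function does not depend on `μ`, its expansion has no terms with `μ`. -/
theorem taylorCoeff_eq_zero_of_dropμ {G : Param → ℝ} {x : Phase}
    (hG : AnalyticAt ℝ G (0, 0, x)) (h : ∀ ε μ : ℝ, ∀ x : Phase, G (ε, μ, x) = G (ε, 0, x))
    {i j : ℕ} (hj : j ≠ 0) : taylorCoeff G i j x = 0 := by
  have h1 : G ∘ dropμ = G := by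
    funext ⟨ε, μ, z⟩
    exact (h ε μ z).symm
  rw [taylorCoeff, ← h1, iteratedFDeriv_comp_clm dropμ (by simpa using hG)]
  rw [Finset.sum_eq_zero, mul_zero]
  intro s hs
  have hs' := (Finset.mem_filter.1 hs).2
  obtain ⟨k, hk⟩ : ∃ k, k ∉ s := by
    by_contra! hcon
    have : s = Finset.univ := Finset.eq_univ_iff_forall.2 hcon
    rw [this, Finset.card_univ, Fintype.card_fin] at hs'
    omega
  rw [ContinuousMultilinearMap.compContinuousLinearMap_apply]
  refine ContinuousMultilinearMap.map_coord_zero _ k ?_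
  simp [hk, unitμ]

theorem taylorCoeff_zero_zero (G : Param → ℝ) (x : Phase) :
    taylorCoeff G 0 0 x = G (0, 0, x) := by
  have h3 : (Finset.univ.filter fun s : Finset (Fin (0 + 0)) => s.card = 0) =
      {∅} := by decide
  rw [taylorCoeff, h3, Finset.sum_singleton]
  simp

theorem taylorCoeff_one_zero {G : Param → ℝ} {x : Phase} (hG : AnalyticAt ℝ G (0, 0, x))
    {d : ℝ} (hd : HasDerivAt (fun ε => G (ε, 0, x)) d 0) : taylorCoeff G 1 0 x = d := by
  have h1 : HasDerivAt (fun ε : ℝ => ((ε, 0, x) : Param)) unitε 0 :=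
    (hasDerivAt_id (0 : ℝ)).prodMk (hasDerivAt_const (0 : ℝ) ((0, x) : ℝ × Phase))
  have h2 : HasDerivAt (fun ε => G (ε, 0, x)) (fderiv ℝ G (0, 0, x) unitε) 0 :=
    hG.differentiableAt.hasFDerivAt.comp_hasDerivAt 0 h1
  rw [← hd.unique h2 |>.symm]
  have h3 : (Finset.univ.filter fun s : Finset (Fin (1 + 0)) => s.card = 1) =
      {Finset.univ} := by decide
  rw [taylorCoeff, h3, Finset.sum_singleton]
  simp [iteratedFDeriv_one_apply]

end Indep

/-! ### Eccentric and true anomaly -/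

theorem strictMono_kepler {e : ℝ} (he : |e| < 1) : StrictMono fun u : ℝ => u - e * Real.sin u := by
  refine strictMono_of_hasDerivAt_pos (f' := fun u => 1 - e * Real.cos u)
    (fun u => (hasDerivAt_id u).sub ((Real.hasDerivAt_sin u).const_mul e)) fun u => ?_
  have h1 : |e * Real.cos u| < 1 := by
    rw [abs_mul]
    exact (mul_le_of_le_one_right (abs_nonneg e) (Real.abs_cos_le_one u)).trans_lt he
  linarith [(abs_lt.1 h1).2]

theorem one_sub_mul_cos_pos {e : ℝ} (he : |e| < 1) (u : ℝ) : 0 < 1 - e * Real.cos u := by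
  have h1 : |e * Real.cos u| < 1 := by
    rw [abs_mul]
    exact (mul_le_of_le_one_right (abs_nonneg e) (Real.abs_cos_le_one u)).trans_lt he
  linarith [(abs_lt.1 h1).2]

/-- Averages over the mean anomaly as averages over the eccentric anomaly. -/
theorem integral_eccAnomaly {e : ℝ} (he : |e| < 1) (f : ℝ → ℝ) :
    ∫ ℓ in (0 : ℝ)..(2 * Real.pi), f (eccAnomaly e ℓ) =
      ∫ u in (0 : ℝ)..(2 * Real.pi), (1 - e * Real.cos u) * f u := by
  have hπ : (0 : ℝ) ≤ 2 * Real.pi := by positivity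
  set g : ℝ → ℝ := fun u => u - e * Real.sin u with hg
  have hmono : StrictMono g := strictMono_kepler he
  have hcont : Continuous g := by fun_prop
  have h0 : g 0 = 0 := by simp [hg]
  have h1 : g (2 * Real.pi) = 2 * Real.pi := by simp [hg]
  have himage : g '' Set.Icc 0 (2 * Real.pi) = Set.Icc 0 (2 * Real.pi) := by
    apply Set.Subset.antisymm
    · rintro _ ⟨u, hu, rfl⟩
      exact ⟨by simpa [h0] using hmono.monotone hu.1, by simpa [h1] using hmono.monotone hu.2⟩
    · have := intermediate_value_Icc hπ hcont.continuousOn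
      rwa [h0, h1] at this
  have hleft : ∀ u, eccAnomaly e (g u) = u := Function.leftInverse_invFun hmono.injective
  have key := MeasureTheory.integral_image_eq_integral_abs_deriv_smul (s := Set.Icc 0 (2 * Real.pi))
    (f := g) (f' := fun u => 1 - e * Real.cos u) measurableSet_Icc
    (fun u _ => ((hasDerivAt_id u).sub ((Real.hasDerivAt_sin u).const_mul e)).hasDerivWithinAt)
    hmono.injective.injOn (fun ℓ => f (eccAnomaly e ℓ))
  rw [himage] at key
  rw [intervalIntegral.integral_of_le hπ, intervalIntegral.integral_of_le hπ,
    ← MeasureTheory.integral_Icc_eq_integral_Ioc, ← MeasureTheory.integral_Icc_eq_integral_Ioc, key]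
  refine MeasureTheory.setIntegral_congr_fun measurableSet_Icc fun u _ => ?_
  simp only [hleft, smul_eq_mul, abs_of_pos (one_sub_mul_cos_pos he u)]

/-- The true anomaly as a function of the eccentric anomaly `u`, where
`β = e / (1 + √(1 - e²))`. -/
def trueAnomaly (e u : ℝ) : ℝ :=
  u + 2 * Real.arctan (e * Real.sin u / (1 + √(1 - e ^ 2) - e * Real.cos u))

theorem hasDerivAt_trueAnomaly {e : ℝ} (he : |e| < 1) (u : ℝ) :
    HasDerivAt (trueAnomaly e) (√(1 - e ^ 2) / (1 - e * Real.cos u)) u := by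
  have he2 : e ^ 2 < 1 := (sq_lt_one_iff_abs_lt_one e).2 he
  have hw : 0 < √(1 - e ^ 2) := Real.sqrt_pos.2 (by linarith)
  have hw2 : √(1 - e ^ 2) ^ 2 = 1 - e ^ 2 := Real.sq_sqrt (by linarith)
  set w := √(1 - e ^ 2) with hwdef
  have hρ := one_sub_mul_cos_pos he u
  have hD : 0 < 1 + w - e * Real.cos u := by linarith
  have h1 : HasDerivAt (fun u => e * Real.sin u / (1 + w - e * Real.cos u))
      ((e * Real.cos u * (1 + w - e * Real.cos u) - e * Real.sin u * (-(e * -Real.sin u))) /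
        (1 + w - e * Real.cos u) ^ 2) u :=
    ((Real.hasDerivAt_sin u).const_mul e).div
      (((Real.hasDerivAt_cos u).const_mul e).const_sub (1 + w)) hD.ne'
  have h2 := (hasDerivAt_id u).add (h1.arctan.const_mul 2)
  refine h2.congr_deriv ?_
  have hcs := Real.sin_sq_add_cos_sq u
  have hden : 0 < (1 + w - e * Real.cos u) ^ 2 + (e * Real.sin u) ^ 2 := by positivity
  generalize Real.sin u = s at *
  generalize Real.cos u = c at *
  have e1 : 1 + (e * s / (1 + w - e * c)) ^ 2 =
      ((1 + w - e * c) ^ 2 + (e * s) ^ 2) / (1 + w - e * c) ^ 2 := by field_simp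
  rw [e1]
  have e2 : (1 + w - e * c) ^ 2 + (e * s) ^ 2 = 2 * (1 + w) * (1 - e * c) := by
    linear_combination e ^ 2 * hcs + hw2
  have e3 : e * c * (1 + w - e * c) - e * s * -(e * -s) = e * c * (1 + w) - e ^ 2 := by
    linear_combination (-e ^ 2) * hcs
  rw [e2, e3]
  field_simp
  linear_combination -hw2

theorem cos_sin_trueAnomaly {e : ℝ} (he : |e| < 1) (u : ℝ) :
    Real.cos (trueAnomaly e u) = (Real.cos u - e) / (1 - e * Real.cos u) ∧
      Real.sin (trueAnomaly e u) = √(1 - e ^ 2) * Real.sin u / (1 - e * Real.cos u) := by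
  have he2 : e ^ 2 < 1 := (sq_lt_one_iff_abs_lt_one e).2 he
  have hw2 : √(1 - e ^ 2) ^ 2 = 1 - e ^ 2 := Real.sq_sqrt (by linarith)
  have hw : 0 < √(1 - e ^ 2) := Real.sqrt_pos.2 (by linarith)
  have hv := hasDerivAt_trueAnomaly he
  set w := √(1 - e ^ 2) with hwdef
  set v := trueAnomaly e with hvdef
  -- Both pairs of functions rotate with the same angular velocity.
  have hc : ∀ u, HasDerivAt (fun u => (Real.cos u - e) / (1 - e * Real.cos u))
      (-(w * Real.sin u / (1 - e * Real.cos u)) * (w / (1 - e * Real.cos u))) u := by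
    intro u
    have h := one_sub_mul_cos_pos he u
    have h1 := ((Real.hasDerivAt_cos u).sub_const e).div
      (((Real.hasDerivAt_cos u).const_mul e).const_sub 1) h.ne'
    refine h1.congr_deriv ?_
    field_simp
    linear_combination Real.sin u * hw2
  have hs : ∀ u, HasDerivAt (fun u => w * Real.sin u / (1 - e * Real.cos u))
      ((Real.cos u - e) / (1 - e * Real.cos u) * (w / (1 - e * Real.cos u))) u := by
    intro u
    have h := one_sub_mul_cos_pos he u
    have h1 := ((Real.hasDerivAt_sin u).const_mul w).div
      (((Real.hasDerivAt_cos u).const_mul e).const_sub 1) h.ne'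
    refine h1.congr_deriv ?_
    rw [div_mul_div_comm, ← sq]
    congr 1
    linear_combination (-w * e) * Real.sin_sq_add_cos_sq u
  have hA : ∀ u, HasDerivAt (fun u => (Real.cos u - e) / (1 - e * Real.cos u) * Real.cos (v u) +
      w * Real.sin u / (1 - e * Real.cos u) * Real.sin (v u)) 0 u := by
    intro u
    refine (((hc u).mul (hv u).cos).add ((hs u).mul (hv u).sin)).congr_deriv ?_
    ring
  have hB : ∀ u, HasDerivAt (fun u => w * Real.sin u / (1 - e * Real.cos u) * Real.cos (v u) -
      (Real.cos u - e) / (1 - e * Real.cos u) * Real.sin (v u)) 0 u := by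
    intro u
    refine (((hs u).mul (hv u).cos).sub ((hc u).mul (hv u).sin)).congr_deriv ?_
    ring
  have hv0 : v 0 = 0 := by simp [hvdef, trueAnomaly]
  have he1 : 1 - e ≠ 0 := by linarith [(abs_lt.1 he).2]
  have hA1 := is_const_of_deriv_eq_zero (fun u => (hA u).differentiableAt)
    (fun u => (hA u).deriv) u 0
  have hB1 := is_const_of_deriv_eq_zero (fun u => (hB u).differentiableAt)
    (fun u => (hB u).deriv) u 0
  simp only [hv0, Real.cos_zero, Real.sin_zero, mul_one, mul_zero, add_zero, zero_div, sub_zero,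
    div_self he1] at hA1 hB1
  have hcs := Real.sin_sq_add_cos_sq (v u)
  constructor
  · linear_combination (Real.cos u - e) / (1 - e * Real.cos u) * hcs -
      Real.cos (v u) * hA1 + Real.sin (v u) * hB1
  · linear_combination w * Real.sin u / (1 - e * Real.cos u) * hcs -
      Real.sin (v u) * hA1 - Real.cos (v u) * hB1

theorem integral_trueAnomaly {e : ℝ} (he : |e| < 1) {f : ℝ → ℝ → ℝ}
    (hf : Continuous fun v => f (Real.cos v) (Real.sin v)) :
    ∫ u in (0 : ℝ)..(2 * Real.pi),
      f ((Real.cos u - e) / (1 - e * Real.cos u)) (√(1 - e ^ 2) * Real.sin u / (1 - e * Real.cos u))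
        * (√(1 - e ^ 2) / (1 - e * Real.cos u)) =
      ∫ v in (0 : ℝ)..(2 * Real.pi), f (Real.cos v) (Real.sin v) := by
  have h := intervalIntegral.integral_comp_mul_deriv (a := 0) (b := 2 * Real.pi)
    (f := trueAnomaly e) (f' := fun u => √(1 - e ^ 2) / (1 - e * Real.cos u))
    (g := fun v => f (Real.cos v) (Real.sin v)) (fun u _ => hasDerivAt_trueAnomaly he u)
    (Continuous.continuousOn (continuous_const.div (by fun_prop)
      fun u => (one_sub_mul_cos_pos he u).ne')) hf
  have h0 : trueAnomaly e 0 = 0 := by simp [trueAnomaly]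
  have h1 : trueAnomaly e (2 * Real.pi) = 2 * Real.pi := by simp [trueAnomaly]
  rw [h0, h1] at h
  rw [← h]
  refine intervalIntegral.integral_congr fun u _ => ?_
  simp only [Function.comp, (cos_sin_trueAnomaly he u).1, (cos_sin_trueAnomaly he u).2]

/-! ### Integrals of trigonometric polynomials -/

/-- `∫ cos^m sin^n` over a period. -/
def trigMoment (m n : ℕ) : ℝ :=
  ∫ v in (0 : ℝ)..(2 * Real.pi), Real.cos v ^ m * Real.sin v ^ n

theorem trigMoment_odd_right {m n : ℕ} (hn : Odd n) : trigMoment m n = 0 := by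
  have h := intervalIntegral.integral_comp_sub_left (a := 0) (b := 2 * Real.pi)
    (fun v => Real.cos v ^ m * Real.sin v ^ n) (2 * Real.pi)
  simp only [Real.cos_two_pi_sub, Real.sin_two_pi_sub, hn.neg_pow, mul_neg,
    intervalIntegral.integral_neg, sub_self, sub_zero] at h
  rw [trigMoment]
  linarith

theorem trigMoment_odd_add {m n : ℕ} (hn : Odd (m + n)) : trigMoment m n = 0 := by
  have hper : Function.Periodic (fun v => Real.cos v ^ m * Real.sin v ^ n) (2 * Real.pi) := by
    intro v
    simp
  have h1 := hper.intervalIntegral_add_eq 0 Real.pi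
  have h2 := intervalIntegral.integral_comp_add_right (a := 0) (b := 2 * Real.pi)
    (fun v => Real.cos v ^ m * Real.sin v ^ n) Real.pi
  have h3 : ∀ v : ℝ, (-Real.cos v) ^ m * (-Real.sin v) ^ n = -(Real.cos v ^ m * Real.sin v ^ n) := by
    intro v
    rw [neg_pow, neg_pow (Real.sin v), mul_mul_mul_comm, ← pow_add, hn.neg_one_pow]
    ring
  simp only [Real.cos_add_pi, Real.sin_add_pi, h3, intervalIntegral.integral_neg] at h2
  rw [zero_add, add_comm Real.pi] at h1
  rw [zero_add] at h2
  rw [trigMoment]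
  linarith

theorem trigMoment_zero_zero : trigMoment 0 0 = 2 * Real.pi := by simp [trigMoment]

theorem trigMoment_two_zero : trigMoment 2 0 = Real.pi := by
  simp [trigMoment, integral_cos_sq]

theorem trigMoment_zero_two : trigMoment 0 2 = Real.pi := by
  simp [trigMoment, integral_sin_sq]

theorem trigMoment_four_zero : trigMoment 4 0 = 3 / 4 * Real.pi := by
  have h := integral_cos_pow (a := 0) (b := 2 * Real.pi) 2
  simp [integral_cos_sq] at h
  simp [trigMoment, h]
  ring

theorem trigMoment_two_two : trigMoment 2 2 = Real.pi / 4 := by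
  have h : trigMoment 2 2 = trigMoment 2 0 - trigMoment 4 0 := by
    rw [trigMoment, trigMoment, trigMoment, ← intervalIntegral.integral_sub
      (Continuous.intervalIntegrable (by fun_prop) _ _)
      (Continuous.intervalIntegrable (by fun_prop) _ _)]
    refine intervalIntegral.integral_congr fun v _ => ?_
    simp only [Real.sin_sq]
    ring
  rw [h, trigMoment_two_zero, trigMoment_four_zero]
  ring

/-- A trigonometric polynomial, given by the list of its coefficients and exponents. -/
def trigPoly (l : List (ℝ × ℕ × ℕ)) (v : ℝ) : ℝ :=
  (l.map fun t => t.1 * (Real.cos v ^ t.2.1 * Real.sin v ^ t.2.2)).sum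

theorem continuous_trigPoly (l : List (ℝ × ℕ × ℕ)) : Continuous (trigPoly l) := by
  induction l with
  | nil =>
    have : trigPoly [] = fun _ => 0 := by
      funext v
      simp [trigPoly]
    rw [this]
    exact continuous_const
  | cons t l ih =>
    have : trigPoly (t :: l) = fun v =>
        t.1 * (Real.cos v ^ t.2.1 * Real.sin v ^ t.2.2) + trigPoly l v := by
      funext v
      simp [trigPoly]
    rw [this]
    fun_prop

theorem integral_trigPoly (l : List (ℝ × ℕ × ℕ)) :
    ∫ v in (0 : ℝ)..(2 * Real.pi), trigPoly l v =
      (l.map fun t => t.1 * trigMoment t.2.1 t.2.2).sum := by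
  induction l with
  | nil => simp [trigPoly]
  | cons t l ih =>
    have : trigPoly (t :: l) = fun v =>
        t.1 * (Real.cos v ^ t.2.1 * Real.sin v ^ t.2.2) + trigPoly l v := by
      funext v
      simp [trigPoly]
    rw [this, intervalIntegral.integral_add (Continuous.intervalIntegrable (by fun_prop) _ _)
      ((continuous_trigPoly l).intervalIntegrable _ _), ih, intervalIntegral.integral_const_mul]
    simp [trigMoment]

/-! ### Means over two ellipses in terms of the eccentric anomalies -/

/-- First coordinate on the ellipse of semimajor axis 1, along the axis of the pericenter. -/
def ellX (e u : ℝ) : ℝ := Real.cos u - e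

/-- Second coordinate on the ellipse of semimajor axis 1. -/
def ellY (e u : ℝ) : ℝ := √(1 - e ^ 2) * Real.sin u

/-- Distance to the focus on the ellipse of semimajor axis 1. -/
def ellR (e u : ℝ) : ℝ := 1 - e * Real.cos u

theorem ellX_sq_add_ellY_sq {e : ℝ} (he : |e| < 1) (u : ℝ) :
    ellX e u ^ 2 + ellY e u ^ 2 = ellR e u ^ 2 := by
  have he2 : e ^ 2 < 1 := (sq_lt_one_iff_abs_lt_one e).2 he
  have hw2 : √(1 - e ^ 2) ^ 2 = 1 - e ^ 2 := Real.sq_sqrt (by linarith)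
  simp only [ellX, ellY, ellR, mul_pow, hw2]
  linear_combination (1 - e ^ 2) * Real.sin_sq_add_cos_sq u

theorem ellR_pos {e : ℝ} (he : |e| < 1) (u : ℝ) : 0 < ellR e u := one_sub_mul_cos_pos he u

/-- The matrix of the inner products of the axes of two ellipses; the entry `pq`, for example, is
the product of the pericenter direction of the first ellipse with the direction orthogonal to the
pericenter of the second. -/
structure AxisDots where
  pp : ℝ
  pq : ℝ
  qp : ℝ
  qq : ℝ

/-- The inner product of the points of two ellipses of semimajor axis 1. -/
def ellInner (e e' : ℝ) (d : AxisDots) (u u' : ℝ) : ℝ :=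
  (ellX e u * d.pp + ellY e u * d.qp) * ellX e' u' +
    (ellX e u * d.pq + ellY e u * d.qq) * ellY e' u'

namespace KeplerEllipse

variable (E E' : KeplerEllipse)

theorem abs_ecc_lt_one : |E.ecc| < 1 := by
  rw [abs_of_pos E.ecc_pos]
  exact E.ecc_lt_one

/-- The unit vector orthogonal to the pericenter, in the sense of the motion. -/
def quad : Space := cross E.normal E.peri

/-- The point with eccentric anomaly `u`. -/
def eccPos (u : ℝ) : Space :=
  (E.semiaxis * ellX E.ecc u) • E.peri + (E.semiaxis * ellY E.ecc u) • E.quad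

theorem pos_eq (ℓ : ℝ) : E.pos ℓ = E.eccPos (eccAnomaly E.ecc ℓ) := by
  simp only [pos, eccPos, ellX, ellY, quad, mul_assoc]

end KeplerEllipse

theorem inner_space (u v : Space) : inner ℝ u v = u 0 * v 0 + u 1 * v 1 + u 2 * v 2 := by
  simp [PiLp.inner_apply, Fin.sum_univ_three]
  ring

theorem cross_apply_zero (u v : Space) : cross u v 0 = u 1 * v 2 - u 2 * v 1 := by
  simp [cross, crossProduct]

theorem cross_apply_one (u v : Space) : cross u v 1 = u 2 * v 0 - u 0 * v 2 := by
  simp [cross, crossProduct]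

theorem cross_apply_two (u v : Space) : cross u v 2 = u 0 * v 1 - u 1 * v 0 := by
  simp [cross, crossProduct]

/-- The Binet-Cauchy identity. -/
theorem inner_cross_cross (a b c d : Space) :
    inner ℝ (cross a b) (cross c d) =
      inner ℝ a c * inner ℝ b d - inner ℝ a d * inner ℝ b c := by
  simp only [inner_space, cross_apply_zero, cross_apply_one, cross_apply_two]
  ring

theorem inner_cross_self_right (a b : Space) : inner ℝ (cross a b) b = 0 := by
  simp only [inner_space, cross_apply_zero, cross_apply_one, cross_apply_two]
  ring

theorem inner_cross_self_left (a b : Space) : inner ℝ (cross a b) a = 0 := by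
  simp only [inner_space, cross_apply_zero, cross_apply_one, cross_apply_two]
  ring

namespace KeplerEllipse

variable (E E' : KeplerEllipse)

theorem inner_quad_quad : inner ℝ E.quad E.quad = 1 := by
  rw [quad, inner_cross_cross, real_inner_self_eq_norm_sq, real_inner_self_eq_norm_sq, E.norm_peri,
    E.norm_normal, real_inner_comm, E.orth]
  norm_num

theorem inner_quad_peri : inner ℝ E.quad E.peri = 0 := inner_cross_self_right _ _

/-- The inner products of the axes of two ellipses. -/
def axisDots : AxisDots where
  pp := inner ℝ E.peri E'.peri
  pq := inner ℝ E.peri E'.quad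
  qp := inner ℝ E.quad E'.peri
  qq := inner ℝ E.quad E'.quad

theorem inner_eccPos (u u' : ℝ) : inner ℝ (E.eccPos u) (E'.eccPos u') =
    E.semiaxis * E'.semiaxis * ellInner E.ecc E'.ecc (E.axisDots E') u u' := by
  simp only [eccPos, inner_add_left, inner_add_right, real_inner_smul_left, real_inner_smul_right,
    ellInner, axisDots]
  ring

theorem norm_eccPos (u : ℝ) : ‖E.eccPos u‖ = E.semiaxis * ellR E.ecc u := by
  have h : ‖E.eccPos u‖ ^ 2 = (E.semiaxis * ellR E.ecc u) ^ 2 := by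
    rw [← real_inner_self_eq_norm_sq, inner_eccPos]
    have h1 : inner ℝ E.peri E.quad = 0 := by rw [real_inner_comm]; exact E.inner_quad_peri
    simp only [ellInner, axisDots, E.inner_quad_quad, E.inner_quad_peri, h1,
      real_inner_self_eq_norm_sq, E.norm_peri]
    rw [mul_pow, ← ellX_sq_add_ellY_sq E.abs_ecc_lt_one]
    ring
  exact (sq_eq_sq₀ (norm_nonneg _)
    (mul_pos E.semiaxis_pos (ellR_pos E.abs_ecc_lt_one u)).le).1 h

end KeplerEllipse

/-- The integral over the torus of two eccentric anomalies. -/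
def torusIntegral (f : ℝ → ℝ → ℝ) : ℝ :=
  ∫ u in (0 : ℝ)..(2 * Real.pi), ∫ u' in (0 : ℝ)..(2 * Real.pi), f u u'

theorem torusIntegral_congr {f g : ℝ → ℝ → ℝ} (h : ∀ u u', f u u' = g u u') :
    torusIntegral f = torusIntegral g := by
  have : f = g := by
    funext u u'
    exact h u u'
  rw [this]

theorem torusIntegral_add {f g : ℝ → ℝ → ℝ} (hf : Continuous (Function.uncurry f))
    (hg : Continuous (Function.uncurry g)) :
    torusIntegral (fun u u' => f u u' + g u u') = torusIntegral f + torusIntegral g := by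
  have hfi := intervalIntegral.continuous_parametric_intervalIntegral_of_continuous'
    (μ := MeasureTheory.volume) hf 0 (2 * Real.pi)
  have hgi := intervalIntegral.continuous_parametric_intervalIntegral_of_continuous'
    (μ := MeasureTheory.volume) hg 0 (2 * Real.pi)
  rw [torusIntegral, torusIntegral, torusIntegral,
    ← intervalIntegral.integral_add (hfi.intervalIntegrable _ _) (hgi.intervalIntegrable _ _)]
  refine intervalIntegral.integral_congr fun u _ => ?_
  have h1 : Continuous fun u' => f u u' := hf.comp (by fun_prop : Continuous fun u' => (u, u'))
  have h2 : Continuous fun u' => g u u' := hg.comp (by fun_prop : Continuous fun u' => (u, u'))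
  exact intervalIntegral.integral_add (h1.intervalIntegrable _ _) (h2.intervalIntegrable _ _)

theorem torusIntegral_const_mul (c : ℝ) (f : ℝ → ℝ → ℝ) :
    torusIntegral (fun u u' => c * f u u') = c * torusIntegral f := by
  simp only [torusIntegral, intervalIntegral.integral_const_mul]

/-- The mean over the mean anomalies, with the eccentric anomalies as variables of integration. -/
theorem mean2_eq (E E' : KeplerEllipse) (f : Space → Space → ℝ) :
    mean2 E E' f = ((2 * Real.pi) ^ 2)⁻¹ * torusIntegral fun u u' =>
      ellR E.ecc u * (ellR E'.ecc u' * f (E.eccPos u) (E'.eccPos u')) := by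
  simp only [mean2, torusIntegral, E.pos_eq, E'.pos_eq]
  congr 1
  rw [integral_eccAnomaly E.abs_ecc_lt_one fun u => ∫ ℓ' in (0 : ℝ)..(2 * Real.pi),
    f (E.eccPos u) (E'.eccPos (eccAnomaly E'.ecc ℓ'))]
  refine intervalIntegral.integral_congr fun u _ => ?_
  rw [integral_eccAnomaly E'.abs_ecc_lt_one fun u' => f (E.eccPos u) (E'.eccPos u'),
    intervalIntegral.integral_const_mul]
  rfl

/-! ### The secular quadrupole and octupole -/

/-- The secular quadrupole for semimajor axes 1, in closed form. -/
def quadAvg (e e' : ℝ) (d : AxisDots) : ℝ :=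
  1 / (4 * √(1 - e' ^ 2) ^ 3) *
    ((1 / 2 + 2 * e ^ 2) * (3 * (d.pp ^ 2 + d.pq ^ 2) - 2) +
      (1 - e ^ 2) / 2 * (3 * (d.qp ^ 2 + d.qq ^ 2) - 2))

/-- The secular octupole for semimajor axes 1, in closed form. -/
def octAvg (e e' : ℝ) (d : AxisDots) : ℝ :=
  -(15 * e * e') / (64 * √(1 - e' ^ 2) ^ 5) *
    (d.pp * ((5 * (d.pp ^ 2 + d.pq ^ 2) - 4) * (3 + 4 * e ^ 2) +
        (5 * (d.qp ^ 2 + d.qq ^ 2) - 4) * (1 - e ^ 2)) +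
      10 * d.qp * (d.pp * d.qp + d.pq * d.qq) * (1 - e ^ 2))

/-- The mean over the outer ellipse: substituting the true anomaly `v` for the eccentric anomaly
turns the negative powers of the distance into the polynomial `1 + e cos v`, so that the integrand
is a trigonometric polynomial. -/
theorem integral_outer_quad {e : ℝ} (he : |e| < 1) (A B r : ℝ) :
    ∫ u in (0 : ℝ)..(2 * Real.pi),
      (3 * (A * ellX e u + B * ellY e u) ^ 2 - r * ellR e u ^ 2) / (2 * ellR e u ^ 4) =
      2 * Real.pi / (4 * √(1 - e ^ 2) ^ 3) * (3 * (A ^ 2 + B ^ 2) - 2 * r) := by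
  have he2 : e ^ 2 < 1 := (sq_lt_one_iff_abs_lt_one e).2 he
  have hw : 0 < √(1 - e ^ 2) := Real.sqrt_pos.2 (by linarith)
  have hw2 : √(1 - e ^ 2) ^ 2 = 1 - e ^ 2 := Real.sq_sqrt (by linarith)
  have h := integral_trueAnomaly he (f := fun c s =>
    (3 * (A * c + B * s) ^ 2 - r) * (1 + e * c) / (2 * √(1 - e ^ 2) ^ 3)) (by fun_prop)
  have hL : ∀ u : ℝ,
      (3 * (A * ellX e u + B * ellY e u) ^ 2 - r * ellR e u ^ 2) / (2 * ellR e u ^ 4) =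
      (3 * (A * ((Real.cos u - e) / (1 - e * Real.cos u)) +
        B * (√(1 - e ^ 2) * Real.sin u / (1 - e * Real.cos u))) ^ 2 - r) *
        (1 + e * ((Real.cos u - e) / (1 - e * Real.cos u))) / (2 * √(1 - e ^ 2) ^ 3) *
        (√(1 - e ^ 2) / (1 - e * Real.cos u)) := by
    intro u
    have hρ := one_sub_mul_cos_pos he u
    have h1 : 1 + e * ((Real.cos u - e) / (1 - e * Real.cos u)) =
        √(1 - e ^ 2) ^ 2 / (1 - e * Real.cos u) := by
      rw [hw2]; field_simp; ring
    rw [h1]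
    simp only [ellX, ellY, ellR]
    generalize 1 - e * Real.cos u = ρ at hρ
    field_simp
  simp only [hL]
  rw [h]
  have hR : ∀ v : ℝ, (3 * (A * Real.cos v + B * Real.sin v) ^ 2 - r) * (1 + e * Real.cos v) /
      (2 * √(1 - e ^ 2) ^ 3) = (2 * √(1 - e ^ 2) ^ 3)⁻¹ * trigPoly
        [(3 * A ^ 2, 2, 0), (6 * A * B, 1, 1), (3 * B ^ 2, 0, 2), (-r, 0, 0),
          (3 * A ^ 2 * e, 3, 0), (6 * A * B * e, 2, 1), (3 * B ^ 2 * e, 1, 2), (-r * e, 1, 0)] v := by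
    intro v
    simp only [trigPoly, List.map_cons, List.map_nil, List.sum_cons, List.sum_nil]
    ring
  simp only [hR]
  rw [intervalIntegral.integral_const_mul, integral_trigPoly]
  simp only [List.map_cons, List.map_nil, List.sum_cons, List.sum_nil, trigMoment_two_zero,
    trigMoment_zero_two, trigMoment_zero_zero,
    trigMoment_odd_right (m := 1) (n := 1) (by decide),
    trigMoment_odd_right (m := 2) (n := 1) (by decide),
    trigMoment_odd_add (m := 3) (n := 0) (by decide),
    trigMoment_odd_add (m := 1) (n := 2) (by decide),
    trigMoment_odd_add (m := 1) (n := 0) (by decide)]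
  field_simp
  ring

/-- The analogue of `integral_outer_quad` for the octupole. -/
theorem integral_outer_oct {e : ℝ} (he : |e| < 1) (A B r : ℝ) :
    ∫ u in (0 : ℝ)..(2 * Real.pi),
      (5 * (A * ellX e u + B * ellY e u) ^ 3 -
        3 * (A * ellX e u + B * ellY e u) * r * ellR e u ^ 2) / (2 * ellR e u ^ 6) =
      2 * Real.pi * (3 * e / (8 * √(1 - e ^ 2) ^ 5)) * (A * (5 * (A ^ 2 + B ^ 2) - 4 * r)) := by
  have he2 : e ^ 2 < 1 := (sq_lt_one_iff_abs_lt_one e).2 he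
  have hw : 0 < √(1 - e ^ 2) := Real.sqrt_pos.2 (by linarith)
  have hw2 : √(1 - e ^ 2) ^ 2 = 1 - e ^ 2 := Real.sq_sqrt (by linarith)
  have h := integral_trueAnomaly he (f := fun c s =>
    (5 * (A * c + B * s) ^ 3 - 3 * (A * c + B * s) * r) * (1 + e * c) ^ 2 /
      (2 * √(1 - e ^ 2) ^ 5)) (by fun_prop)
  have hL : ∀ u : ℝ,
      (5 * (A * ellX e u + B * ellY e u) ^ 3 -
        3 * (A * ellX e u + B * ellY e u) * r * ellR e u ^ 2) / (2 * ellR e u ^ 6) =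
      (5 * (A * ((Real.cos u - e) / (1 - e * Real.cos u)) +
        B * (√(1 - e ^ 2) * Real.sin u / (1 - e * Real.cos u))) ^ 3 -
        3 * (A * ((Real.cos u - e) / (1 - e * Real.cos u)) +
        B * (√(1 - e ^ 2) * Real.sin u / (1 - e * Real.cos u))) * r) *
        (1 + e * ((Real.cos u - e) / (1 - e * Real.cos u))) ^ 2 / (2 * √(1 - e ^ 2) ^ 5) *
        (√(1 - e ^ 2) / (1 - e * Real.cos u)) := by
    intro u
    have hρ := one_sub_mul_cos_pos he u
    have h1 : 1 + e * ((Real.cos u - e) / (1 - e * Real.cos u)) =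
        √(1 - e ^ 2) ^ 2 / (1 - e * Real.cos u) := by
      rw [hw2]; field_simp; ring
    rw [h1]
    simp only [ellX, ellY, ellR]
    field_simp
  simp only [hL]
  rw [h]
  have hR : ∀ v : ℝ, (5 * (A * Real.cos v + B * Real.sin v) ^ 3 -
      3 * (A * Real.cos v + B * Real.sin v) * r) * (1 + e * Real.cos v) ^ 2 /
      (2 * √(1 - e ^ 2) ^ 5) = (2 * √(1 - e ^ 2) ^ 5)⁻¹ * trigPoly
        [(5 * A ^ 3, 3, 0), (15 * A ^ 2 * B, 2, 1), (15 * A * B ^ 2, 1, 2), (5 * B ^ 3, 0, 3),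
          (-3 * r * A, 1, 0), (-3 * r * B, 0, 1),
          (10 * e * A ^ 3, 4, 0), (30 * e * A ^ 2 * B, 3, 1), (30 * e * A * B ^ 2, 2, 2),
          (10 * e * B ^ 3, 1, 3), (-6 * e * r * A, 2, 0), (-6 * e * r * B, 1, 1),
          (5 * e ^ 2 * A ^ 3, 5, 0), (15 * e ^ 2 * A ^ 2 * B, 4, 1),
          (15 * e ^ 2 * A * B ^ 2, 3, 2), (5 * e ^ 2 * B ^ 3, 2, 3), (-3 * e ^ 2 * r * A, 3, 0),
          (-3 * e ^ 2 * r * B, 2, 1)] v := by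
    intro v
    simp only [trigPoly, List.map_cons, List.map_nil, List.sum_cons, List.sum_nil]
    ring
  simp only [hR]
  rw [intervalIntegral.integral_const_mul, integral_trigPoly]
  simp only [List.map_cons, List.map_nil, List.sum_cons, List.sum_nil, trigMoment_two_zero,
    trigMoment_two_two, trigMoment_four_zero,
    trigMoment_odd_right (m := 0) (n := 1) (by decide),
    trigMoment_odd_right (m := 1) (n := 1) (by decide),
    trigMoment_odd_right (m := 2) (n := 1) (by decide),
    trigMoment_odd_right (m := 3) (n := 1) (by decide),
    trigMoment_odd_right (m := 4) (n := 1) (by decide),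
    trigMoment_odd_right (m := 0) (n := 3) (by decide),
    trigMoment_odd_right (m := 1) (n := 3) (by decide),
    trigMoment_odd_right (m := 2) (n := 3) (by decide),
    trigMoment_odd_add (m := 3) (n := 0) (by decide),
    trigMoment_odd_add (m := 5) (n := 0) (by decide),
    trigMoment_odd_add (m := 3) (n := 2) (by decide),
    trigMoment_odd_add (m := 1) (n := 2) (by decide),
    trigMoment_odd_add (m := 1) (n := 0) (by decide)]
  field_simp
  ring

theorem mean2_quadKernel (E E' : KeplerEllipse) :
    mean2 E E' quadKernel =
      E.semiaxis ^ 2 / E'.semiaxis ^ 3 * quadAvg E.ecc E'.ecc (E.axisDots E') := by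
  have ha := E.semiaxis_pos
  have ha' := E'.semiaxis_pos
  have he := E.abs_ecc_lt_one
  have he' := E'.abs_ecc_lt_one
  have hw2 : √(1 - E.ecc ^ 2) ^ 2 = 1 - E.ecc ^ 2 :=
    Real.sq_sqrt (by linarith [(sq_lt_one_iff_abs_lt_one E.ecc).2 he])
  have hw' : 0 < √(1 - E'.ecc ^ 2) :=
    Real.sqrt_pos.2 (by linarith [(sq_lt_one_iff_abs_lt_one E'.ecc).2 he'])
  rw [mean2_eq]
  set d := E.axisDots E' with hd
  have h1 : ∀ u u' : ℝ, ellR E.ecc u * (ellR E'.ecc u' * quadKernel (E.eccPos u) (E'.eccPos u')) =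
      E.semiaxis ^ 2 / E'.semiaxis ^ 3 * (ellR E.ecc u *
        ((3 * ((ellX E.ecc u * d.pp + ellY E.ecc u * d.qp) * ellX E'.ecc u' +
          (ellX E.ecc u * d.pq + ellY E.ecc u * d.qq) * ellY E'.ecc u') ^ 2 -
            ellR E.ecc u ^ 2 * ellR E'.ecc u' ^ 2) / (2 * ellR E'.ecc u' ^ 4))) := by
    intro u u'
    have hρ := ellR_pos he u
    have hρ' := ellR_pos he' u'
    rw [quadKernel, cosAngle, E.inner_eccPos, E.norm_eccPos, E'.norm_eccPos, ellInner, ← hd]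
    field_simp
  rw [torusIntegral_congr h1, torusIntegral_const_mul, torusIntegral]
  simp only [intervalIntegral.integral_const_mul, integral_outer_quad he']
  have h2 : ∀ u : ℝ, ellR E.ecc u * (2 * Real.pi / (4 * √(1 - E'.ecc ^ 2) ^ 3) *
      (3 * ((ellX E.ecc u * d.pp + ellY E.ecc u * d.qp) ^ 2 +
        (ellX E.ecc u * d.pq + ellY E.ecc u * d.qq) ^ 2) - 2 * ellR E.ecc u ^ 2)) =
      2 * Real.pi / (4 * √(1 - E'.ecc ^ 2) ^ 3) * trigPoly
        [((3 * (d.pp ^ 2 + d.pq ^ 2) - 2) * (1 + 2 * E.ecc ^ 2), 2, 0),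
          ((3 * (d.pp ^ 2 + d.pq ^ 2) - 2) * (-2 * E.ecc - E.ecc ^ 3), 1, 0),
          ((3 * (d.pp ^ 2 + d.pq ^ 2) - 2) * E.ecc ^ 2, 0, 0),
          (-(3 * (d.pp ^ 2 + d.pq ^ 2) - 2) * E.ecc, 3, 0),
          (6 * (d.pp * d.qp + d.pq * d.qq) * √(1 - E.ecc ^ 2) * (1 + E.ecc ^ 2), 1, 1),
          (-6 * (d.pp * d.qp + d.pq * d.qq) * √(1 - E.ecc ^ 2) * E.ecc, 0, 1),
          (-6 * (d.pp * d.qp + d.pq * d.qq) * √(1 - E.ecc ^ 2) * E.ecc, 2, 1),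
          ((3 * (d.qp ^ 2 + d.qq ^ 2) - 2) * √(1 - E.ecc ^ 2) ^ 2, 0, 2),
          (-(3 * (d.qp ^ 2 + d.qq ^ 2) - 2) * √(1 - E.ecc ^ 2) ^ 2 * E.ecc, 1, 2)] u := by
    intro u
    rw [← ellX_sq_add_ellY_sq he]
    simp only [trigPoly, List.map_cons, List.map_nil, List.sum_cons, List.sum_nil, ellX, ellY,
      ellR]
    ring
  simp only [h2]
  rw [intervalIntegral.integral_const_mul, integral_trigPoly]
  simp only [List.map_cons, List.map_nil, List.sum_cons, List.sum_nil, trigMoment_two_zero,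
    trigMoment_zero_zero, trigMoment_zero_two,
    trigMoment_odd_right (m := 0) (n := 1) (by decide),
    trigMoment_odd_right (m := 1) (n := 1) (by decide),
    trigMoment_odd_right (m := 2) (n := 1) (by decide),
    trigMoment_odd_add (m := 3) (n := 0) (by decide),
    trigMoment_odd_add (m := 1) (n := 2) (by decide),
    trigMoment_odd_add (m := 1) (n := 0) (by decide), hw2]
  rw [quadAvg]
  field_simp
  ring

theorem mean2_octKernel (E E' : KeplerEllipse) :
    mean2 E E' octKernel =
      E.semiaxis ^ 3 / E'.semiaxis ^ 4 * octAvg E.ecc E'.ecc (E.axisDots E') := by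
  have ha := E.semiaxis_pos
  have ha' := E'.semiaxis_pos
  have he := E.abs_ecc_lt_one
  have he' := E'.abs_ecc_lt_one
  have hw2 : √(1 - E.ecc ^ 2) ^ 2 = 1 - E.ecc ^ 2 :=
    Real.sq_sqrt (by linarith [(sq_lt_one_iff_abs_lt_one E.ecc).2 he])
  have hw' : 0 < √(1 - E'.ecc ^ 2) :=
    Real.sqrt_pos.2 (by linarith [(sq_lt_one_iff_abs_lt_one E'.ecc).2 he'])
  rw [mean2_eq]
  set d := E.axisDots E' with hd
  have h1 : ∀ u u' : ℝ, ellR E.ecc u * (ellR E'.ecc u' * octKernel (E.eccPos u) (E'.eccPos u')) =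
      E.semiaxis ^ 3 / E'.semiaxis ^ 4 * (ellR E.ecc u *
        ((5 * ((ellX E.ecc u * d.pp + ellY E.ecc u * d.qp) * ellX E'.ecc u' +
          (ellX E.ecc u * d.pq + ellY E.ecc u * d.qq) * ellY E'.ecc u') ^ 3 -
            3 * ((ellX E.ecc u * d.pp + ellY E.ecc u * d.qp) * ellX E'.ecc u' +
          (ellX E.ecc u * d.pq + ellY E.ecc u * d.qq) * ellY E'.ecc u') *
            ellR E.ecc u ^ 2 * ellR E'.ecc u' ^ 2) / (2 * ellR E'.ecc u' ^ 6))) := by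
    intro u u'
    have hρ := ellR_pos he u
    have hρ' := ellR_pos he' u'
    rw [octKernel, cosAngle, E.inner_eccPos, E.norm_eccPos, E'.norm_eccPos, ellInner, ← hd]
    field_simp
  rw [torusIntegral_congr h1, torusIntegral_const_mul, torusIntegral]
  simp only [intervalIntegral.integral_const_mul, integral_outer_oct he']
  set P := d.pp ^ 2 + d.pq ^ 2 with hP
  set Q := d.qp ^ 2 + d.qq ^ 2 with hQ
  set R := d.pp * d.qp + d.pq * d.qq with hR
  have h2 : ∀ u : ℝ, ellR E.ecc u *
      (2 * Real.pi * (3 * E'.ecc / (8 * √(1 - E'.ecc ^ 2) ^ 5)) *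
        ((ellX E.ecc u * d.pp + ellY E.ecc u * d.qp) *
          (5 * ((ellX E.ecc u * d.pp + ellY E.ecc u * d.qp) ^ 2 +
            (ellX E.ecc u * d.pq + ellY E.ecc u * d.qq) ^ 2) - 4 * ellR E.ecc u ^ 2))) =
      2 * Real.pi * (3 * E'.ecc / (8 * √(1 - E'.ecc ^ 2) ^ 5)) * trigPoly
        [(-(d.pp * (5 * P - 4)) * E.ecc, 4, 0),
          (d.pp * (5 * P - 4) * (1 + 3 * E.ecc ^ 2), 3, 0),
          (-(d.pp * (5 * P - 4)) * (3 * E.ecc + 3 * E.ecc ^ 3), 2, 0),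
          (d.pp * (5 * P - 4) * (3 * E.ecc ^ 2 + E.ecc ^ 4), 1, 0),
          (-(d.pp * (5 * P - 4)) * E.ecc ^ 3, 0, 0),
          ((d.pp * (5 * Q - 4) + 10 * d.qp * R) * √(1 - E.ecc ^ 2) ^ 2 * (1 + E.ecc ^ 2), 1, 2),
          (-(d.pp * (5 * Q - 4) + 10 * d.qp * R) * √(1 - E.ecc ^ 2) ^ 2 * E.ecc, 0, 2),
          (-(d.pp * (5 * Q - 4) + 10 * d.qp * R) * √(1 - E.ecc ^ 2) ^ 2 * E.ecc, 2, 2),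
          (-(d.qp * (5 * P - 4) + 10 * d.pp * R) * √(1 - E.ecc ^ 2) * E.ecc, 3, 1),
          ((d.qp * (5 * P - 4) + 10 * d.pp * R) * √(1 - E.ecc ^ 2) * (1 + 2 * E.ecc ^ 2), 2, 1),
          (-(d.qp * (5 * P - 4) + 10 * d.pp * R) * √(1 - E.ecc ^ 2) *
            (2 * E.ecc + E.ecc ^ 3), 1, 1),
          ((d.qp * (5 * P - 4) + 10 * d.pp * R) * √(1 - E.ecc ^ 2) * E.ecc ^ 2, 0, 1),
          (d.qp * (5 * Q - 4) * √(1 - E.ecc ^ 2) ^ 3, 0, 3),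
          (-(d.qp * (5 * Q - 4)) * √(1 - E.ecc ^ 2) ^ 3 * E.ecc, 1, 3)] u := by
    intro u
    rw [← ellX_sq_add_ellY_sq he]
    simp only [trigPoly, List.map_cons, List.map_nil, List.sum_cons, List.sum_nil, ellX, ellY,
      ellR, hP, hQ, hR]
    ring
  simp only [h2]
  rw [intervalIntegral.integral_const_mul, integral_trigPoly]
  simp only [List.map_cons, List.map_nil, List.sum_cons, List.sum_nil, trigMoment_two_zero,
    trigMoment_zero_zero, trigMoment_zero_two, trigMoment_four_zero, trigMoment_two_two,
    trigMoment_odd_right (m := 0) (n := 1) (by decide),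
    trigMoment_odd_right (m := 1) (n := 1) (by decide),
    trigMoment_odd_right (m := 2) (n := 1) (by decide),
    trigMoment_odd_right (m := 3) (n := 1) (by decide),
    trigMoment_odd_right (m := 0) (n := 3) (by decide),
    trigMoment_odd_right (m := 1) (n := 3) (by decide),
    trigMoment_odd_add (m := 3) (n := 0) (by decide),
    trigMoment_odd_add (m := 1) (n := 2) (by decide),
    trigMoment_odd_add (m := 1) (n := 0) (by decide), hw2]
  rw [octAvg, ← hP, ← hQ, ← hR]
  field_simp
  ring

/-! ### The multipole remainder -/

/-- `((1 + t)^{-1/2} - 1 + t/2 - 3t²/8 + 5t³/16) / t⁴`, in a form that is analytic at `t = 0`. -/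
def invSqrtRem (t : ℝ) : ℝ :=
  (35 / 64 - 7 / 32 * t + 35 / 256 * t ^ 2 - 25 / 256 * t ^ 3) /
    ((1 + t) * ((√(1 + t))⁻¹ + (1 - t / 2 + 3 / 8 * t ^ 2 - 5 / 16 * t ^ 3)))

theorem invSqrtRem_denom_pos {t : ℝ} (ht : |t| < 1) :
    0 < (√(1 + t))⁻¹ + (1 - t / 2 + 3 / 8 * t ^ 2 - 5 / 16 * t ^ 3) := by
  have h1 := abs_lt.1 ht
  have h2 : 0 < (√(1 + t))⁻¹ := inv_pos.2 (Real.sqrt_pos.2 (by linarith))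
  have h3 : t ^ 3 < 1 := by
    have : |t ^ 3| < 1 := by rw [abs_pow]; exact pow_lt_one₀ (abs_nonneg t) ht (by norm_num)
    exact (abs_lt.1 this).2
  nlinarith [sq_nonneg t]

theorem inv_sqrt_one_add_eq {t : ℝ} (ht : |t| < 1) :
    (√(1 + t))⁻¹ = 1 - t / 2 + 3 / 8 * t ^ 2 - 5 / 16 * t ^ 3 + t ^ 4 * invSqrtRem t := by
  have h1 := abs_lt.1 ht
  have h2 : 0 < √(1 + t) := Real.sqrt_pos.2 (by linarith)
  have hsq : (√(1 + t)) ^ 2 = 1 + t := Real.sq_sqrt (by linarith)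
  have hd := invSqrtRem_denom_pos ht
  rw [invSqrtRem]
  set g := (√(1 + t))⁻¹ with hg
  have hg2 : g ^ 2 * (1 + t) = 1 := by
    rw [hg, inv_pow, hsq]
    exact inv_mul_cancel₀ (by linarith)
  have h1t : 0 < 1 + t := by linarith
  have h3 : t ^ 4 * ((35 / 64 - 7 / 32 * t + 35 / 256 * t ^ 2 - 25 / 256 * t ^ 3) /
      ((1 + t) * (g + (1 - t / 2 + 3 / 8 * t ^ 2 - 5 / 16 * t ^ 3)))) =
      g - (1 - t / 2 + 3 / 8 * t ^ 2 - 5 / 16 * t ^ 3) := by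
    rw [mul_div_assoc', div_eq_iff (mul_pos h1t hd).ne']
    linear_combination -hg2
  linarith

/-- The part of `(1 + 2sb + s²c)^{-1/2}` beyond the third order in `s`, divided by `s⁴`. -/
def multipoleRem (s b c : ℝ) : ℝ :=
  3 / 8 * c ^ 2 - 15 / 4 * b ^ 2 * c - 15 / 8 * s * b * c ^ 2 - 5 / 16 * s ^ 2 * c ^ 3 +
    (2 * b + s * c) ^ 4 * invSqrtRem (s * (2 * b + s * c))

theorem inv_sqrt_multipole {s b c : ℝ} (h : |s * (2 * b + s * c)| < 1) :
    (√(1 + s * (2 * b + s * c)))⁻¹ =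
      1 - s * b + s ^ 2 * ((3 * b ^ 2 - c) / 2) - s ^ 3 * ((5 * b ^ 3 - 3 * b * c) / 2) +
        s ^ 4 * multipoleRem s b c := by
  rw [inv_sqrt_one_add_eq h, multipoleRem]
  ring

/-- Legendre expansion of the inverse distance up to the third order, with remainder. -/
theorem inv_norm_add_smul {q q' : Space} (hq' : q' ≠ 0) {s : ℝ}
    (h : |s * (2 * (inner ℝ q q' / ‖q'‖ ^ 2) + s * (‖q‖ ^ 2 / ‖q'‖ ^ 2))| < 1) :
    (‖q' + s • q‖)⁻¹ = ‖q'‖⁻¹ *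
      (1 - s * (inner ℝ q q' / ‖q'‖ ^ 2) +
        s ^ 2 * ((3 * (inner ℝ q q' / ‖q'‖ ^ 2) ^ 2 - ‖q‖ ^ 2 / ‖q'‖ ^ 2) / 2) -
        s ^ 3 * ((5 * (inner ℝ q q' / ‖q'‖ ^ 2) ^ 3 -
          3 * (inner ℝ q q' / ‖q'‖ ^ 2) * (‖q‖ ^ 2 / ‖q'‖ ^ 2)) / 2) +
        s ^ 4 * multipoleRem s (inner ℝ q q' / ‖q'‖ ^ 2) (‖q‖ ^ 2 / ‖q'‖ ^ 2)) := by
  have hn : 0 < ‖q'‖ := norm_pos_iff.2 hq'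
  rw [← inv_sqrt_multipole h, ← mul_inv]
  congr 1
  have h1 : ‖q' + s • q‖ ^ 2 =
      ‖q'‖ ^ 2 * (1 + s * (2 * (inner ℝ q q' / ‖q'‖ ^ 2) + s * (‖q‖ ^ 2 / ‖q'‖ ^ 2))) := by
    rw [norm_add_sq_real, inner_smul_right, norm_smul, real_inner_comm, mul_pow,
      Real.norm_eq_abs, sq_abs]
    field_simp
    ring
  rw [← Real.sqrt_sq (norm_nonneg (q' + s • q)), h1, Real.sqrt_mul (by positivity),
    Real.sqrt_sq hn.le]

/-- The interaction of a body at `q'` with two bodies at `-sA q` and `sB q`, relative to the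
merged body at the origin. -/
def pairKernel (A B sA sB : ℝ) (q q' : Space) : ℝ :=
  (A + B) / ‖q'‖ - A / ‖q' + sA • q‖ - B / ‖q' - sB • q‖

/-- The average of the multipole remainder for semimajor axes 1; `η` is the scaled ratio of the
semimajor axes. -/
def multipoleTail (e e' : ℝ) (d : AxisDots) (η : ℝ) : ℝ :=
  ((2 * Real.pi) ^ 2)⁻¹ * torusIntegral fun u u' =>
    ellR e u * multipoleRem η (ellInner e e' d u u' / ellR e' u' ^ 2)
      (ellR e u ^ 2 / ellR e' u' ^ 2)

theorem abs_multipole_arg_lt {e e' η b c : ℝ} {u u' : ℝ} (he : |e| < 1) (he' : |e'| < 1)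
    (hη : 5 * |η| < 1 - |e'|) (hb : |b| ≤ ellR e u * ellR e' u')
    (hc : c = ellR e u ^ 2 / ellR e' u' ^ 2) :
    |η * (2 * (b / ellR e' u' ^ 2) + η * c)| < 1 := by
  have hR := ellR_pos he u
  have hR' := ellR_pos he' u'
  have hR2 : ellR e u < 2 := by
    have h1 : |e * Real.cos u| < 1 := by
      rw [abs_mul]
      exact (mul_le_of_le_one_right (abs_nonneg e) (Real.abs_cos_le_one u)).trans_lt he
    have := (abs_lt.1 h1).1
    rw [ellR]; linarith
  have hR1' : 1 - |e'| ≤ ellR e' u' := by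
    have h1 : |e' * Real.cos u'| ≤ |e'| := by
      rw [abs_mul]
      exact mul_le_of_le_one_right (abs_nonneg e') (Real.abs_cos_le_one u')
    have := (abs_le.1 h1).2
    rw [ellR]; linarith
  set r := ellR e u / ellR e' u' with hr
  have hr0 : 0 < r := by positivity
  have hηr : |η| * r < 2 / 5 := by
    rw [hr, ← mul_div_assoc, div_lt_iff₀ hR']
    nlinarith [abs_nonneg η]
  have hb' : |b / ellR e' u' ^ 2| ≤ r := by
    rw [abs_div, abs_of_pos (by positivity : (0 : ℝ) < ellR e' u' ^ 2), hr,
      div_le_div_iff₀ (by positivity) hR']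
    nlinarith
  have hc' : c = r ^ 2 := by rw [hc, hr, div_pow]
  calc |η * (2 * (b / ellR e' u' ^ 2) + η * c)|
      ≤ |η| * (2 * |b / ellR e' u' ^ 2| + |η| * |c|) := by
        rw [abs_mul]
        gcongr
        refine (abs_add_le _ _).trans_eq ?_
        rw [abs_mul, abs_mul, abs_two]
    _ ≤ |η| * (2 * r + |η| * r ^ 2) := by
        rw [hc', abs_of_pos (by positivity : (0 : ℝ) < r ^ 2)]
        gcongr
    _ = 2 * (|η| * r) + (|η| * r) ^ 2 := by ring
    _ < 1 := by nlinarith [mul_nonneg (abs_nonneg η) hr0.le]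

theorem abs_ellInner_le (E E' : KeplerEllipse) (u u' : ℝ) :
    |ellInner E.ecc E'.ecc (E.axisDots E') u u'| ≤ ellR E.ecc u * ellR E'.ecc u' := by
  have h := abs_real_inner_le_norm (E.eccPos u) (E'.eccPos u')
  have ha := E.semiaxis_pos
  have ha' := E'.semiaxis_pos
  rw [E.inner_eccPos, E.norm_eccPos, E'.norm_eccPos, abs_mul,
    abs_of_pos (mul_pos ha ha')] at h
  have h2 : E.semiaxis * E'.semiaxis * |ellInner E.ecc E'.ecc (E.axisDots E') u u'| ≤
      E.semiaxis * E'.semiaxis * (ellR E.ecc u * ellR E'.ecc u') := by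
    calc _ ≤ _ := h
      _ = _ := by ring
  exact le_of_mul_le_mul_left h2 (mul_pos ha ha')

theorem continuous_multipole (E E' : KeplerEllipse) {η : ℝ} (hη : 5 * |η| < 1 - E'.ecc) :
    Continuous (Function.uncurry fun u u' => ellR E.ecc u *
      multipoleRem η (ellInner E.ecc E'.ecc (E.axisDots E') u u' / ellR E'.ecc u' ^ 2)
      (ellR E.ecc u ^ 2 / ellR E'.ecc u' ^ 2)) := by
  have he' : 5 * |η| < 1 - |E'.ecc| := by rwa [abs_of_pos E'.ecc_pos]
  have hlt : ∀ p : ℝ × ℝ, |η * (2 * (ellInner E.ecc E'.ecc (E.axisDots E') p.1 p.2 /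
      ellR E'.ecc p.2 ^ 2) + η * (ellR E.ecc p.1 ^ 2 / ellR E'.ecc p.2 ^ 2))| < 1 := fun p =>
    abs_multipole_arg_lt E.abs_ecc_lt_one E'.abs_ecc_lt_one he' (abs_ellInner_le E E' p.1 p.2) rfl
  have hR : Continuous fun p : ℝ × ℝ => ellR E.ecc p.1 := by unfold ellR; fun_prop
  have hR' : Continuous fun p : ℝ × ℝ => ellR E'.ecc p.2 := by unfold ellR; fun_prop
  have hN : Continuous fun p : ℝ × ℝ => ellInner E.ecc E'.ecc (E.axisDots E') p.1 p.2 := by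
    unfold ellInner ellX ellY; fun_prop
  have hR0 : ∀ p : ℝ × ℝ, ellR E'.ecc p.2 ^ 2 ≠ 0 := fun p =>
    (pow_pos (ellR_pos E'.abs_ecc_lt_one p.2) 2).ne'
  have hb : Continuous fun p : ℝ × ℝ =>
      ellInner E.ecc E'.ecc (E.axisDots E') p.1 p.2 / ellR E'.ecc p.2 ^ 2 := hN.div (hR'.pow 2) hR0
  have hc : Continuous fun p : ℝ × ℝ => ellR E.ecc p.1 ^ 2 / ellR E'.ecc p.2 ^ 2 :=
    (hR.pow 2).div (hR'.pow 2) hR0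
  have hrem : ∀ t : ℝ × ℝ → ℝ, Continuous t → (∀ p, |t p| < 1) →
      Continuous fun p => invSqrtRem (t p) := by
    intro t ht ht1
    unfold invSqrtRem
    have h1 : ∀ p, 1 + t p ≠ 0 := fun p => by linarith [(abs_lt.1 (ht1 p)).1]
    have h2 : ∀ p, √(1 + t p) ≠ 0 := fun p =>
      (Real.sqrt_pos.2 (by linarith [(abs_lt.1 (ht1 p)).1])).ne'
    have h3 : Continuous fun p => (√(1 + t p))⁻¹ := (by fun_prop : Continuous fun p =>
      √(1 + t p)).inv₀ h2
    refine Continuous.div (by fun_prop) (by fun_prop) fun p => ?_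
    exact mul_ne_zero (h1 p) (invSqrtRem_denom_pos (ht1 p)).ne'
  refine hR.mul ?_
  unfold multipoleRem
  have h4 := hrem _ (continuous_const.mul ((continuous_const.mul hb).add
    (continuous_const.mul hc))) hlt
  exact Continuous.add (by fun_prop) (Continuous.mul (by fun_prop) h4)

theorem continuous_quad_integrand (E E' : KeplerEllipse) (f : Space → Space → ℝ)
    (hf : ContinuousOn (Function.uncurry f) {p | p.1 ≠ 0 ∧ p.2 ≠ 0}) :
    Continuous (Function.uncurry fun u u' =>
      ellR E.ecc u * (ellR E'.ecc u' * f (E.eccPos u) (E'.eccPos u'))) := by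
  have hR : Continuous fun p : ℝ × ℝ => ellR E.ecc p.1 := by unfold ellR; fun_prop
  have hR' : Continuous fun p : ℝ × ℝ => ellR E'.ecc p.2 := by unfold ellR; fun_prop
  have hq : Continuous fun p : ℝ × ℝ => (E.eccPos p.1, E'.eccPos p.2) := by
    unfold KeplerEllipse.eccPos ellX ellY; fun_prop
  have hne : ∀ (E : KeplerEllipse) (u : ℝ), E.eccPos u ≠ 0 := by
    intro E u
    rw [← norm_pos_iff, E.norm_eccPos]
    exact mul_pos E.semiaxis_pos (ellR_pos E.abs_ecc_lt_one u)
  have h1 : Continuous fun p : ℝ × ℝ => f (E.eccPos p.1) (E'.eccPos p.2) :=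
    hf.comp_continuous hq fun p => ⟨hne E p.1, hne E' p.2⟩
  exact hR.mul (hR'.mul h1)

theorem continuousOn_cosAngle :
    ContinuousOn (Function.uncurry cosAngle) {p : Space × Space | p.1 ≠ 0 ∧ p.2 ≠ 0} := by
  unfold cosAngle Function.uncurry
  refine ContinuousOn.div (by fun_prop) (by fun_prop) fun p hp => ?_
  exact mul_ne_zero (norm_ne_zero_iff.2 hp.1) (norm_ne_zero_iff.2 hp.2)

theorem continuousOn_quadKernel :
    ContinuousOn (Function.uncurry quadKernel) {p : Space × Space | p.1 ≠ 0 ∧ p.2 ≠ 0} := by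
  have h := continuousOn_cosAngle
  unfold quadKernel
  unfold Function.uncurry at *
  refine ContinuousOn.mul (by fun_prop)
    (ContinuousOn.div (by fun_prop) (by fun_prop) fun p hp => ?_)
  exact pow_ne_zero _ (norm_ne_zero_iff.2 hp.2)

theorem continuousOn_octKernel :
    ContinuousOn (Function.uncurry octKernel) {p : Space × Space | p.1 ≠ 0 ∧ p.2 ≠ 0} := by
  have h := continuousOn_cosAngle
  unfold octKernel
  unfold Function.uncurry at *
  refine ContinuousOn.mul (by fun_prop)
    (ContinuousOn.div (by fun_prop) (by fun_prop) fun p hp => ?_)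
  exact pow_ne_zero _ (norm_ne_zero_iff.2 hp.2)

theorem continuous_uncurry_const_mul (c : ℝ) (f : ℝ → ℝ → ℝ)
    (hf : Continuous (Function.uncurry f)) :
    Continuous (Function.uncurry fun u u' => c * f u u') :=
  continuous_const.mul hf

theorem continuous_uncurry_add (f g : ℝ → ℝ → ℝ) (hf : Continuous (Function.uncurry f))
    (hg : Continuous (Function.uncurry g)) :
    Continuous (Function.uncurry fun u u' => f u u' + g u u') :=
  hf.add hg

/-- The averaged interaction is the sum of its quadrupole, its octupole and the multipole tails;
the monopole and the dipole cancel. -/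
theorem mean2_pairKernel (E E' : KeplerEllipse) {A B sA sB : ℝ} (hAB : A * sA = B * sB)
    (hA : |sA| ≤ 1) (hB : |sB| ≤ 1) (hη : 5 * (E.semiaxis / E'.semiaxis) < 1 - E'.ecc) :
    mean2 E E' (pairKernel A B sA sB) =
      -(A * sA ^ 2 + B * sB ^ 2) * mean2 E E' quadKernel
        - (B * sB ^ 3 - A * sA ^ 3) * mean2 E E' octKernel
        - (E'.semiaxis)⁻¹ * (E.semiaxis / E'.semiaxis) ^ 4 *
          (A * sA ^ 4 * multipoleTail E.ecc E'.ecc (E.axisDots E')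
              (sA * (E.semiaxis / E'.semiaxis))
            + B * sB ^ 4 * multipoleTail E.ecc E'.ecc (E.axisDots E')
              (-sB * (E.semiaxis / E'.semiaxis))) := by
  have ha := E.semiaxis_pos
  have ha' := E'.semiaxis_pos
  set d := E.axisDots E' with hd
  set η := E.semiaxis / E'.semiaxis with hηdef
  have hη0 : 0 < η := div_pos ha ha'
  have hsη : ∀ s : ℝ, |s| ≤ 1 → 5 * |s * η| < 1 - E'.ecc := by
    intro s hs
    rw [abs_mul, abs_of_pos hη0]
    nlinarith
  -- expansion of one term of the kernel
  have key : ∀ s : ℝ, |s| ≤ 1 → ∀ u u' : ℝ,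
      ‖E'.eccPos u' + s • E.eccPos u‖⁻¹ = ‖E'.eccPos u'‖⁻¹ -
        s * (inner ℝ (E.eccPos u) (E'.eccPos u') / ‖E'.eccPos u'‖ ^ 3) +
        s ^ 2 * quadKernel (E.eccPos u) (E'.eccPos u') -
        s ^ 3 * octKernel (E.eccPos u) (E'.eccPos u') +
        (E'.semiaxis)⁻¹ * η ^ 4 * s ^ 4 * ((ellR E'.ecc u')⁻¹ *
          multipoleRem (s * η) (ellInner E.ecc E'.ecc d u u' / ellR E'.ecc u' ^ 2)
            (ellR E.ecc u ^ 2 / ellR E'.ecc u' ^ 2)) := by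
    intro s hs u u'
    have hR := ellR_pos E.abs_ecc_lt_one u
    have hR' := ellR_pos E'.abs_ecc_lt_one u'
    have hn : 0 < ‖E'.eccPos u'‖ := by rw [E'.norm_eccPos]; positivity
    have hbc1 : inner ℝ (E.eccPos u) (E'.eccPos u') / ‖E'.eccPos u'‖ ^ 2 =
        η * (ellInner E.ecc E'.ecc d u u' / ellR E'.ecc u' ^ 2) := by
      rw [E.inner_eccPos, E'.norm_eccPos, ← hd, hηdef]
      field_simp
    have hbc2 : ‖E.eccPos u‖ ^ 2 / ‖E'.eccPos u'‖ ^ 2 =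
        η ^ 2 * (ellR E.ecc u ^ 2 / ellR E'.ecc u' ^ 2) := by
      rw [E.norm_eccPos, E'.norm_eccPos, hηdef]
      field_simp
    have hq : quadKernel (E.eccPos u) (E'.eccPos u') = ‖E'.eccPos u'‖⁻¹ *
        ((3 * (inner ℝ (E.eccPos u) (E'.eccPos u') / ‖E'.eccPos u'‖ ^ 2) ^ 2 -
          ‖E.eccPos u‖ ^ 2 / ‖E'.eccPos u'‖ ^ 2) / 2) := by
      have h0 : 0 < ‖E.eccPos u‖ := by rw [E.norm_eccPos]; positivity
      rw [quadKernel, cosAngle]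
      field_simp
    have ho : octKernel (E.eccPos u) (E'.eccPos u') = ‖E'.eccPos u'‖⁻¹ *
        ((5 * (inner ℝ (E.eccPos u) (E'.eccPos u') / ‖E'.eccPos u'‖ ^ 2) ^ 3 -
          3 * (inner ℝ (E.eccPos u) (E'.eccPos u') / ‖E'.eccPos u'‖ ^ 2) *
          (‖E.eccPos u‖ ^ 2 / ‖E'.eccPos u'‖ ^ 2)) / 2) := by
      have h0 : 0 < ‖E.eccPos u‖ := by rw [E.norm_eccPos]; positivity
      rw [octKernel, cosAngle]
      field_simp
    have hscale : ∀ b c : ℝ, multipoleRem s (η * b) (η ^ 2 * c) =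
        η ^ 4 * multipoleRem (s * η) b c := by
      intro b c
      rw [multipoleRem, multipoleRem,
        show s * (2 * (η * b) + s * (η ^ 2 * c)) = s * η * (2 * b + s * η * c) by ring]
      ring
    have harg : |s * (2 * (inner ℝ (E.eccPos u) (E'.eccPos u') / ‖E'.eccPos u'‖ ^ 2) +
        s * (‖E.eccPos u‖ ^ 2 / ‖E'.eccPos u'‖ ^ 2))| < 1 := by
      have h1 := abs_multipole_arg_lt (η := s * η) E.abs_ecc_lt_one E'.abs_ecc_lt_one
        (by rw [abs_of_pos E'.ecc_pos]; exact hsη s hs) (abs_ellInner_le E E' u u') rfl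
      rw [hbc1, hbc2]
      convert h1 using 2
      ring
    rw [inv_norm_add_smul (norm_pos_iff.1 hn) harg, hq, ho, hbc1, hbc2, hscale]
    have h3 : inner ℝ (E.eccPos u) (E'.eccPos u') / ‖E'.eccPos u'‖ ^ 3 = ‖E'.eccPos u'‖⁻¹ *
        (η * (ellInner E.ecc E'.ecc d u u' / ellR E'.ecc u' ^ 2)) := by
      rw [← hbc1]
      field_simp
    have h4 : ‖E'.eccPos u'‖⁻¹ = (E'.semiaxis)⁻¹ * (ellR E'.ecc u')⁻¹ := by
      rw [E'.norm_eccPos, mul_inv]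
    rw [h3, h4]
    ring
  have hpair : ∀ u u' : ℝ, ellR E.ecc u * (ellR E'.ecc u' *
      pairKernel A B sA sB (E.eccPos u) (E'.eccPos u')) =
      -(A * sA ^ 2 + B * sB ^ 2) * (ellR E.ecc u * (ellR E'.ecc u' *
        quadKernel (E.eccPos u) (E'.eccPos u'))) +
      (-(B * sB ^ 3 - A * sA ^ 3) * (ellR E.ecc u * (ellR E'.ecc u' *
        octKernel (E.eccPos u) (E'.eccPos u'))) +
      (-((E'.semiaxis)⁻¹ * η ^ 4 * (A * sA ^ 4)) * (ellR E.ecc u * multipoleRem (sA * η)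
        (ellInner E.ecc E'.ecc d u u' / ellR E'.ecc u' ^ 2) (ellR E.ecc u ^ 2 / ellR E'.ecc u' ^ 2))
      + -((E'.semiaxis)⁻¹ * η ^ 4 * (B * sB ^ 4)) * (ellR E.ecc u * multipoleRem (-sB * η)
        (ellInner E.ecc E'.ecc d u u' / ellR E'.ecc u' ^ 2)
        (ellR E.ecc u ^ 2 / ellR E'.ecc u' ^ 2)))) := by
    intro u u'
    have hR' := ellR_pos E'.abs_ecc_lt_one u'
    have k1 := key sA hA u u'
    have k2 := key (-sB) (by rwa [abs_neg]) u u'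
    rw [neg_smul, ← sub_eq_add_neg] at k2
    rw [pairKernel, div_eq_mul_inv, div_eq_mul_inv, div_eq_mul_inv, k1, k2]
    have hc := mul_inv_cancel₀ hR'.ne'
    linear_combination (ellR E.ecc u * ellR E'.ecc u' *
      (inner ℝ (E.eccPos u) (E'.eccPos u') / ‖E'.eccPos u'‖ ^ 3)) * hAB -
      (ellR E.ecc u * (E'.semiaxis)⁻¹ * η ^ 4 *
        (A * sA ^ 4 * multipoleRem (sA * η) (ellInner E.ecc E'.ecc d u u' / ellR E'.ecc u' ^ 2)
            (ellR E.ecc u ^ 2 / ellR E'.ecc u' ^ 2) +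
          B * sB ^ 4 * multipoleRem (-sB * η) (ellInner E.ecc E'.ecc d u u' / ellR E'.ecc u' ^ 2)
            (ellR E.ecc u ^ 2 / ellR E'.ecc u' ^ 2))) * hc
  rw [mean2_eq, mean2_eq, mean2_eq, torusIntegral_congr hpair]
  have c1 := continuous_quad_integrand E E' quadKernel continuousOn_quadKernel
  have c2 := continuous_quad_integrand E E' octKernel continuousOn_octKernel
  have c3 := continuous_multipole E E' (hsη sA hA)
  have c4 := continuous_multipole E E' (hsη (-sB) (by rwa [abs_neg]))
  rw [← hd] at c3 c4
  have cmul := @continuous_uncurry_const_mul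
  have cadd := @continuous_uncurry_add
  rw [torusIntegral_add (cmul _ _ c1) (cadd _ _ (cmul _ _ c2) (cadd _ _ (cmul _ _ c3)
    (cmul _ _ c4))), torusIntegral_add (cmul _ _ c2) (cadd _ _ (cmul _ _ c3) (cmul _ _ c4)),
    torusIntegral_add (cmul _ _ c3) (cmul _ _ c4)]
  simp only [torusIntegral_const_mul, multipoleTail]
  ring

theorem contDiffAt_multipoleRem {E : Type*} [NormedAddCommGroup E] [NormedSpace ℝ E] {z₀ : E}
    {s b c : E → ℝ} (hs : ContDiffAt ℝ ⊤ s z₀) (hb : ContDiffAt ℝ ⊤ b z₀)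
    (hc : ContDiffAt ℝ ⊤ c z₀) (hs0 : s z₀ = 0) :
    ContDiffAt ℝ ⊤ (fun z => multipoleRem (s z) (b z) (c z)) z₀ := by
  have hrem : ContDiffAt ℝ ⊤ invSqrtRem 0 := by
    unfold invSqrtRem
    have h1 : ContDiffAt ℝ ⊤ (fun t : ℝ => √(1 + t)) 0 :=
      (contDiffAt_const.add contDiffAt_id).sqrt (by norm_num)
    have h2 : ContDiffAt ℝ ⊤ (fun t : ℝ => (√(1 + t))⁻¹) 0 := h1.inv (by norm_num)
    refine ContDiffAt.div (by fun_prop) (by fun_prop) (by norm_num)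
  have ht : ContDiffAt ℝ ⊤ (fun z => s z * (2 * b z + s z * c z)) z₀ := by fun_prop
  have hremt : ContDiffAt ℝ ⊤ (fun z => invSqrtRem (s z * (2 * b z + s z * c z))) z₀ := by
    refine ContDiffAt.comp z₀ (g := invSqrtRem) ?_ ht
    simpa [hs0] using hrem
  unfold multipoleRem
  fun_prop

/-- The multipole tail is an analytic function of its arguments at `η = 0`. -/
theorem analyticAt_multipoleTail {E : Type*} [NormedAddCommGroup E] [NormedSpace ℝ E] {z₀ : E}
    {e e' η : E → ℝ} {d : E → AxisDots} (he : ContDiffAt ℝ ⊤ e z₀) (he' : ContDiffAt ℝ ⊤ e' z₀)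
    (hη : ContDiffAt ℝ ⊤ η z₀) (hpp : ContDiffAt ℝ ⊤ (fun z => (d z).pp) z₀)
    (hpq : ContDiffAt ℝ ⊤ (fun z => (d z).pq) z₀) (hqp : ContDiffAt ℝ ⊤ (fun z => (d z).qp) z₀)
    (hqq : ContDiffAt ℝ ⊤ (fun z => (d z).qq) z₀) (he1 : |e z₀| < 1) (he1' : |e' z₀| < 1)
    (hη0 : η z₀ = 0) :
    AnalyticAt ℝ (fun z => multipoleTail (e z) (e' z) (d z) (η z)) z₀ := by
  unfold multipoleTail torusIntegral
  refine analyticAt_const.mul ?_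
  have hπ : (0 : ℝ) ≤ 2 * Real.pi := by positivity
  refine analyticAt_intervalIntegral (f := fun p : E × ℝ => ∫ u' in (0 : ℝ)..(2 * Real.pi),
    ellR (e p.1) p.2 * multipoleRem (η p.1)
      (ellInner (e p.1) (e' p.1) (d p.1) p.2 u' / ellR (e' p.1) u' ^ 2)
      (ellR (e p.1) p.2 ^ 2 / ellR (e' p.1) u' ^ 2)) hπ fun u _ => ?_
  refine analyticAt_intervalIntegral (f := fun p : (E × ℝ) × ℝ =>
    ellR (e p.1.1) p.1.2 * multipoleRem (η p.1.1)
      (ellInner (e p.1.1) (e' p.1.1) (d p.1.1) p.1.2 p.2 / ellR (e' p.1.1) p.2 ^ 2)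
      (ellR (e p.1.1) p.1.2 ^ 2 / ellR (e' p.1.1) p.2 ^ 2)) hπ fun u' _ => ?_
  have hfst : ContDiffAt ℝ ⊤ (fun p : (E × ℝ) × ℝ => p.1.1) ((z₀, u), u') := by fun_prop
  have lift : ∀ f : E → ℝ, ContDiffAt ℝ ⊤ f z₀ →
      ContDiffAt ℝ ⊤ (fun p : (E × ℝ) × ℝ => f p.1.1) ((z₀, u), u') := fun f hf =>
    ContDiffAt.comp ((z₀, u), u') (g := f) hf hfst
  replace hη := lift _ hη
  replace hpp := lift _ hpp
  replace hpq := lift _ hpq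
  replace hqp := lift _ hqp
  replace hqq := lift _ hqq
  have hw : ∀ f : E → ℝ, ContDiffAt ℝ ⊤ f z₀ → |f z₀| < 1 →
      ContDiffAt ℝ ⊤ (fun p : (E × ℝ) × ℝ => √(1 - f p.1.1 ^ 2)) ((z₀, u), u') := by
    intro f hf hf1
    refine (contDiffAt_const.sub ((lift f hf).pow 2)).sqrt ?_
    have := (sq_lt_one_iff_abs_lt_one (f z₀)).2 hf1
    simp only
    linarith
  have hwe := hw e he he1
  have hwe' := hw e' he' he1'
  replace he := lift _ he
  replace he' := lift _ he'
  have hR' : ellR (e' z₀) u' ≠ 0 := (ellR_pos he1' u').ne'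
  have hcos : ContDiffAt ℝ ⊤ (fun p : (E × ℝ) × ℝ => Real.cos p.1.2) ((z₀, u), u') :=
    (Real.contDiff_cos.comp (by fun_prop)).contDiffAt
  have hcos' : ContDiffAt ℝ ⊤ (fun p : (E × ℝ) × ℝ => Real.cos p.2) ((z₀, u), u') :=
    (Real.contDiff_cos.comp (by fun_prop)).contDiffAt
  have hsin : ContDiffAt ℝ ⊤ (fun p : (E × ℝ) × ℝ => Real.sin p.1.2) ((z₀, u), u') :=
    (Real.contDiff_sin.comp (by fun_prop)).contDiffAt
  have hsin' : ContDiffAt ℝ ⊤ (fun p : (E × ℝ) × ℝ => Real.sin p.2) ((z₀, u), u') :=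
    (Real.contDiff_sin.comp (by fun_prop)).contDiffAt
  have hRc : ContDiffAt ℝ ⊤ (fun p : (E × ℝ) × ℝ => ellR (e p.1.1) p.1.2) ((z₀, u), u') :=
    contDiffAt_const.sub (he.mul hcos)
  have hRc' : ContDiffAt ℝ ⊤ (fun p : (E × ℝ) × ℝ => ellR (e' p.1.1) p.2) ((z₀, u), u') :=
    contDiffAt_const.sub (he'.mul hcos')
  have hN : ContDiffAt ℝ ⊤ (fun p : (E × ℝ) × ℝ =>
      ellInner (e p.1.1) (e' p.1.1) (d p.1.1) p.1.2 p.2) ((z₀, u), u') :=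
    ((((hcos.sub he).mul hpp).add ((hwe.mul hsin).mul hqp)).mul (hcos'.sub he')).add
      ((((hcos.sub he).mul hpq).add ((hwe.mul hsin).mul hqq)).mul (hwe'.mul hsin'))
  exact (hRc.mul (contDiffAt_multipoleRem hη (hN.div (hRc'.pow 2) (pow_ne_zero 2 hR'))
    ((hRc.pow 2).div (hRc'.pow 2) (pow_ne_zero 2 hR')) hη0)).analyticAt

/-! ### Vector algebra -/

theorem cross_add_left (a b c : Space) : cross (a + b) c = cross a c + cross b c := by
  ext i; fin_cases i <;> simp [cross_apply_zero, cross_apply_one, cross_apply_two] <;> ring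

theorem cross_add_right (a b c : Space) : cross a (b + c) = cross a b + cross a c := by
  ext i; fin_cases i <;> simp [cross_apply_zero, cross_apply_one, cross_apply_two] <;> ring

theorem cross_smul_left (r : ℝ) (a b : Space) : cross (r • a) b = r • cross a b := by
  ext i; fin_cases i <;> simp [cross_apply_zero, cross_apply_one, cross_apply_two] <;> ring

theorem cross_smul_right (r : ℝ) (a b : Space) : cross a (r • b) = r • cross a b := by
  ext i; fin_cases i <;> simp [cross_apply_zero, cross_apply_one, cross_apply_two] <;> ring

theorem cross_self (a : Space) : cross a a = 0 := by
  ext i; fin_cases i <;> simp [cross_apply_zero, cross_apply_one, cross_apply_two] <;> ring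

theorem cross_cross_right (a b c : Space) :
    cross a (cross b c) = (inner ℝ a c : ℝ) • b - (inner ℝ a b : ℝ) • c := by
  ext i; fin_cases i <;>
    simp [cross_apply_zero, cross_apply_one, cross_apply_two, inner_space] <;> ring

theorem cross_cross_left (a b c : Space) :
    cross (cross a b) c = (inner ℝ a c : ℝ) • b - (inner ℝ b c : ℝ) • a := by
  ext i; fin_cases i <;>
    simp [cross_apply_zero, cross_apply_one, cross_apply_two, inner_space] <;> ring

theorem inner_cross_rotate (a b c : Space) :
    (inner ℝ a (cross b c) : ℝ) = inner ℝ c (cross a b) := by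
  simp only [inner_space, cross_apply_zero, cross_apply_one, cross_apply_two]; ring

/-- `u`, `cross n u` is an oriented orthonormal basis of the plane orthogonal to the unit
vector `n`. -/
structure IsFrame (n u : Space) : Prop where
  nn : (inner ℝ n n : ℝ) = 1
  uu : (inner ℝ u u : ℝ) = 1
  nu : (inner ℝ n u : ℝ) = 0

namespace IsFrame

variable {n u : Space}

theorem un (h : IsFrame n u) : (inner ℝ u n : ℝ) = 0 := by rw [real_inner_comm, h.nu]

theorem vv (h : IsFrame n u) : (inner ℝ (cross n u) (cross n u) : ℝ) = 1 := by
  rw [inner_cross_cross, h.nn, h.uu, h.nu]; ring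

theorem vu (_ : IsFrame n u) : (inner ℝ (cross n u) u : ℝ) = 0 := inner_cross_self_right _ _

theorem uv (h : IsFrame n u) : (inner ℝ u (cross n u) : ℝ) = 0 := by rw [real_inner_comm, h.vu]

theorem vn (_ : IsFrame n u) : (inner ℝ (cross n u) n : ℝ) = 0 := inner_cross_self_left _ _

theorem nv (h : IsFrame n u) : (inner ℝ n (cross n u) : ℝ) = 0 := by rw [real_inner_comm, h.vn]

theorem cross_v (h : IsFrame n u) : cross n (cross n u) = -u := by
  rw [cross_cross_right, h.nn, h.nu]; simp

/-- The frame turned by the angle `θ`. -/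
theorem rotate (h : IsFrame n u) (θ : ℝ) : IsFrame n (Real.cos θ • u + Real.sin θ • cross n u) where
  nn := h.nn
  uu := by
    simp only [inner_add_left, inner_add_right, real_inner_smul_left, real_inner_smul_right,
      h.uu, h.vv, h.uv, h.vu]
    linear_combination Real.sin_sq_add_cos_sq θ
  nu := by
    simp only [inner_add_right, real_inner_smul_right, h.nu, h.nv]
    ring

theorem cross_rotate (h : IsFrame n u) (θ : ℝ) : cross n (Real.cos θ • u + Real.sin θ • cross n u) =
    -Real.sin θ • u + Real.cos θ • cross n u := by
  rw [cross_add_right, cross_smul_right, cross_smul_right, h.cross_v]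
  module

/-- A unit vector in the plane of the frame is determined by its angle. -/
theorem eq_rotate (h : IsFrame n u) {w : Space} {θ : ℝ} (hw : (inner ℝ w w : ℝ) = 1)
    (hc : (inner ℝ u w : ℝ) = Real.cos θ) (hs : (inner ℝ n (cross u w) : ℝ) = Real.sin θ) :
    w = Real.cos θ • u + Real.sin θ • cross n u := by
  have hs' : (inner ℝ w (cross n u) : ℝ) = Real.sin θ := by rw [← inner_cross_rotate, hs]
  have hc' : (inner ℝ w u : ℝ) = Real.cos θ := by rw [real_inner_comm, hc]
  have hs'' : (inner ℝ (cross n u) w : ℝ) = Real.sin θ := by rw [real_inner_comm, hs']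
  rw [← sub_eq_zero, ← inner_self_eq_zero (𝕜 := ℝ)]
  simp only [inner_sub_left, inner_sub_right, inner_add_left, inner_add_right,
    real_inner_smul_left, real_inner_smul_right, h.uu, h.vv, h.uv, h.vu, hw, hc, hs', hc', hs'']
  linear_combination -Real.sin_sq_add_cos_sq θ

/-- A second plane whose normal `n'` is obtained by turning `n` around `u`. -/
theorem cross_tilt (h : IsFrame n u) {n' : Space} {s : ℝ} (hs : cross n n' = s • u) :
    cross n' u = (inner ℝ n n' : ℝ) • cross n u + s • n := by
  have h1 : n' = (inner ℝ n n' : ℝ) • n - s • cross n u := by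
    have h2 : cross n (cross n n') = s • cross n u := by rw [hs, cross_smul_right]
    rw [← h2, cross_cross_right, h.nn]
    module
  conv_lhs => rw [h1]
  rw [sub_eq_add_neg, ← neg_smul, cross_add_left, cross_smul_left, cross_smul_left,
    cross_cross_left, h.uu, h.nu]
  module

end IsFrame

/-- The unit vector in the direction of `v`. -/
def dir (v : Space) : Space := ‖v‖⁻¹ • v

theorem norm_smul_dir (v : Space) : ‖v‖ • dir v = v := by
  by_cases hv : v = 0
  · simp [dir, hv]
  · rw [dir, smul_smul, mul_inv_cancel₀ (norm_ne_zero_iff.2 hv), one_smul]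

theorem inner_dir_self {v : Space} (hv : v ≠ 0) : (inner ℝ (dir v) (dir v) : ℝ) = 1 := by
  have h := norm_ne_zero_iff.2 hv
  rw [dir, real_inner_smul_left, real_inner_smul_right, real_inner_self_eq_norm_sq]
  field_simp

theorem dir_smul_of_unit {n : Space} (hn : ‖n‖ = 1) {c : ℝ} (hc : 0 < c) : dir (c • n) = n := by
  rw [dir, norm_smul, hn, mul_one, Real.norm_eq_abs, abs_of_pos hc, smul_smul,
    inv_mul_cancel₀ hc.ne', one_smul]

theorem isFrame_dir {z u : Space} (hz : z ≠ 0) (hu : u ≠ 0) (h : (inner ℝ z u : ℝ) = 0) :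
    IsFrame (dir z) (dir u) where
  nn := inner_dir_self hz
  uu := inner_dir_self hu
  nu := by rw [dir, dir, real_inner_smul_left, real_inner_smul_right, h]; ring

theorem IsOrientedAngle.dir_eq {z u v : Space} {θ : ℝ} (h : IsOrientedAngle z u v θ)
    (hz : z ≠ 0) (hu : u ≠ 0) (hv : v ≠ 0) (hzu : (inner ℝ z u : ℝ) = 0) :
    dir v = Real.cos θ • dir u + Real.sin θ • cross (dir z) (dir u) := by
  have hz' := norm_ne_zero_iff.2 hz
  have hu' := norm_ne_zero_iff.2 hu
  have hv' := norm_ne_zero_iff.2 hv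
  refine (isFrame_dir hz hu hzu).eq_rotate (inner_dir_self hv) ?_ ?_
  · rw [dir, dir, real_inner_smul_left, real_inner_smul_right, h.1]
    field_simp
  · rw [dir, dir, dir, cross_smul_left, cross_smul_right, real_inner_smul_left,
      real_inner_smul_right, real_inner_smul_right, h.2]
    field_simp

theorem IsFrame.isOrientedAngle {n u : Space} (h : IsFrame n u) {a b c : ℝ} (ha : 0 ≤ a)
    (hb : 0 ≤ b) (hc : 0 ≤ c) (θ : ℝ) : IsOrientedAngle (a • n) (b • u)
      (c • (Real.cos θ • u + Real.sin θ • cross n u)) θ := by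
  have e1 : ‖n‖ = 1 := by rw [norm_eq_sqrt_real_inner, h.nn, Real.sqrt_one]
  have e2 : ‖u‖ = 1 := by rw [norm_eq_sqrt_real_inner, h.uu, Real.sqrt_one]
  have e3 : ‖Real.cos θ • u + Real.sin θ • cross n u‖ = 1 := by
    rw [norm_eq_sqrt_real_inner, (h.rotate θ).uu, Real.sqrt_one]
  rw [IsOrientedAngle, norm_smul, norm_smul, norm_smul, e1, e2, e3, Real.norm_eq_abs,
    Real.norm_eq_abs, Real.norm_eq_abs, abs_of_nonneg ha, abs_of_nonneg hb, abs_of_nonneg hc]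
  constructor
  · simp only [real_inner_smul_left, real_inner_smul_right, inner_add_right, h.uu, h.uv]
    ring
  · simp only [cross_smul_left, cross_smul_right, cross_add_right, cross_self,
      cross_cross_right, h.uu, h.un, real_inner_smul_left, real_inner_smul_right,
      inner_sub_right, smul_zero, zero_add, h.nn, h.nu]
    ring

/-! ### Ellipses placed by the angle of the pericenter -/

/-- The inner products of the axes of two ellipses whose pericenters are at the angles `θ`, `θ'`
in two frames, in terms of the inner products of the vectors of these frames. -/
def AxisDots.rot (g : AxisDots) (θ θ' : ℝ) : AxisDots where
  pp := (Real.cos θ * g.pp + Real.sin θ * g.qp) * Real.cos θ'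
    + (Real.cos θ * g.pq + Real.sin θ * g.qq) * Real.sin θ'
  pq := -((Real.cos θ * g.pp + Real.sin θ * g.qp) * Real.sin θ')
    + (Real.cos θ * g.pq + Real.sin θ * g.qq) * Real.cos θ'
  qp := (-Real.sin θ * g.pp + Real.cos θ * g.qp) * Real.cos θ'
    + (-Real.sin θ * g.pq + Real.cos θ * g.qq) * Real.sin θ'
  qq := -((-Real.sin θ * g.pp + Real.cos θ * g.qp) * Real.sin θ')
    + (-Real.sin θ * g.pq + Real.cos θ * g.qq) * Real.cos θ'

/-- The inner products of the vectors of two frames. -/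
def frameDots (n u n' u' : Space) : AxisDots where
  pp := inner ℝ u u'
  pq := inner ℝ u (cross n' u')
  qp := inner ℝ (cross n u) u'
  qq := inner ℝ (cross n u) (cross n' u')

theorem KeplerEllipse.axisDots_eq_rot {E E' : KeplerEllipse} {u u' : Space} {θ θ' : ℝ}
    (hf : IsFrame E.normal u) (hf' : IsFrame E'.normal u')
    (h : E.peri = Real.cos θ • u + Real.sin θ • cross E.normal u)
    (h' : E'.peri = Real.cos θ' • u' + Real.sin θ' • cross E'.normal u') :
    E.axisDots E' = (frameDots E.normal u E'.normal u').rot θ θ' := by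
  have q : E.quad = -Real.sin θ • u + Real.cos θ • cross E.normal u := by
    rw [KeplerEllipse.quad, h, hf.cross_rotate]
  have q' : E'.quad = -Real.sin θ' • u' + Real.cos θ' • cross E'.normal u' := by
    rw [KeplerEllipse.quad, h', hf'.cross_rotate]
  rw [KeplerEllipse.axisDots, AxisDots.rot, frameDots, q, q', h, h']
  simp only [inner_add_left, inner_add_right, real_inner_smul_left, real_inner_smul_right,
    AxisDots.mk.injEq]
  refine ⟨?_, ?_, ?_, ?_⟩ <;> ring

/-- The frames of two ellipses with a common node. -/
theorem frameDots_common {n n' u : Space} (h : IsFrame n u) (h' : IsFrame n' u) :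
    frameDots n u n' u = ⟨1, 0, 0, inner ℝ n n'⟩ := by
  rw [frameDots, h.uu, h.vu, h'.uv, inner_cross_cross, h.uu, h.nu]
  simp

/-- The frames of two planes which are both inclined to the plane orthogonal to `k`, with the
angle `ψ` between the nodes. -/
theorem frameDots_of_nodes {k n n' u u' : Space} {s s' ψ : ℝ} (h : IsFrame k u')
    (hu : u = Real.cos ψ • u' + Real.sin ψ • cross k u') (hs : cross k n = s • u)
    (hs' : cross k n' = s' • u') :
    frameDots n u n' u' = ⟨Real.cos ψ, (inner ℝ k n' : ℝ) * Real.sin ψ,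
      -(inner ℝ k n : ℝ) * Real.sin ψ,
      (inner ℝ k n : ℝ) * (inner ℝ k n' : ℝ) * Real.cos ψ + s * s'⟩ := by
  have hr : IsFrame k u := hu ▸ h.rotate ψ
  have hku : cross k u = -Real.sin ψ • u' + Real.cos ψ • cross k u' := by
    rw [hu, h.cross_rotate]
  rw [frameDots, hr.cross_tilt hs, h.cross_tilt hs', hku, hu]
  simp only [inner_add_left, inner_add_right, real_inner_smul_left, real_inner_smul_right,
    h.uu, h.vv, h.uv, h.vu, h.nn, h.nu, h.un, h.nv, h.vn, AxisDots.mk.injEq]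
  refine ⟨?_, ?_, ?_, ?_⟩ <;> ring

/-! ### Elements and axes of the ellipses in Deprit coordinates -/

section Masses

variable {m : Fin 4 → ℝ}

theorem totalMass_pos (hm : ∀ i, 0 < m i) (j : Fin 4) : 0 < totalMass m j :=
  Finset.sum_pos (fun i _ => hm i) ⟨j, by simp⟩

theorem redMass_pos (hm : ∀ i, 0 < m i) (j : Fin 4) : 0 < redMass m j := by
  have h1 := totalMass_pos hm (j - 1)
  have h2 := hm j
  rw [redMass]
  positivity

end Masses

/-- The cosine of the angle between two sides `a`, `b` of a triangle, when the third side is the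
sum `c` of the two vectors. -/
def cosSum (a b c : ℝ) : ℝ := (c ^ 2 - a ^ 2 - b ^ 2) / (2 * a * b)

theorem inner_dir_eq_cosSum (u v : Space) :
    (inner ℝ (dir u) (dir v) : ℝ) = cosSum ‖u‖ ‖v‖ ‖u + v‖ := by
  rw [cosSum, norm_add_sq_real, dir, dir, real_inner_smul_left, real_inner_smul_right]
  by_cases hu : ‖u‖ = 0
  · simp [hu]
  by_cases hv : ‖v‖ = 0
  · simp [hv]
  field_simp
  ring

theorem inner_dir_add_eq_cosSum (u v : Space) :
    (inner ℝ (dir (u + v)) (dir v) : ℝ) = -cosSum ‖u + v‖ ‖v‖ ‖u‖ := by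
  have h := inner_dir_eq_cosSum (u + v) (-v)
  have e : dir (-v) = -dir v := by simp [dir]
  rw [e, inner_neg_right, norm_neg, add_neg_cancel_right] at h
  linarith

theorem norm_cross (u v : Space) (hu : u ≠ 0) (hv : v ≠ 0) :
    ‖cross u v‖ = ‖u‖ * ‖v‖ * √(1 - cosSum ‖u‖ ‖v‖ ‖u + v‖ ^ 2) := by
  have hu' := norm_ne_zero_iff.2 hu
  have hv' := norm_ne_zero_iff.2 hv
  have h : ‖cross u v‖ ^ 2 = (‖u‖ * ‖v‖) ^ 2 * (1 - cosSum ‖u‖ ‖v‖ ‖u + v‖ ^ 2) := by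
    rw [← real_inner_self_eq_norm_sq, inner_cross_cross, ← inner_dir_eq_cosSum,
      real_inner_self_eq_norm_sq, real_inner_self_eq_norm_sq, dir, dir, real_inner_smul_left,
      real_inner_smul_right, real_inner_comm u v]
    field_simp
  rw [← Real.sqrt_sq (norm_nonneg (cross u v)), h, Real.sqrt_mul (sq_nonneg _),
    Real.sqrt_sq (by positivity)]

theorem cross_dir (u v : Space) :
    cross (dir u) (dir v) = (‖cross u v‖ / (‖u‖ * ‖v‖)) • dir (cross u v) := by
  conv_lhs => rw [dir, dir, cross_smul_left, cross_smul_right, ← norm_smul_dir (cross u v)]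
  rw [smul_smul, smul_smul]
  congr 1
  ring

/-- The inner products of the vectors of two frames with a common node and the cosine `c` of the
mutual inclination. -/
def commonNodeDots (c : ℝ) : AxisDots := ⟨1, 0, 0, c⟩

/-- The inner products of the vectors of the frames of two planes which are inclined to a third
one with cosines `c`, `c'` and sines `s`, `s'`, with the angle `ψ` between the nodes. -/
def twoNodesDots (ψ c c' s s' : ℝ) : AxisDots :=
  ⟨Real.cos ψ, c' * Real.sin ψ, -c * Real.sin ψ, c * c' * Real.cos ψ + s * s'⟩

section Elements

variable {m : Fin 4 → ℝ} {j : Fin 4} {E : KeplerEllipse} {L Γ : ℝ}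

theorem angMom_eq (hm : ∀ i, 0 < m i) :
    ∃ c : ℝ, 0 < c ∧ angMom m j E = c • E.normal := by
  refine ⟨_, mul_pos (redMass_pos hm j) (Real.sqrt_pos.2 (mul_pos (mul_pos (totalMass_pos hm j)
    E.semiaxis_pos) ?_)), rfl⟩
  have := (sq_lt_one_iff_abs_lt_one _).2 E.abs_ecc_lt_one
  linarith

theorem angMom_ne_zero (hm : ∀ i, 0 < m i) : angMom m j E ≠ 0 := by
  obtain ⟨c, hc, h⟩ := angMom_eq (j := j) (E := E) hm
  rw [h, smul_ne_zero_iff]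
  refine ⟨hc.ne', fun h0 => ?_⟩
  have := E.norm_normal
  rw [h0, norm_zero] at this
  exact zero_ne_one this

theorem dir_angMom (hm : ∀ i, 0 < m i) : dir (angMom m j E) = E.normal := by
  obtain ⟨c, hc, h⟩ := angMom_eq (j := j) (E := E) hm
  rw [h, dir_smul_of_unit E.norm_normal hc]

theorem semiaxis_of_actionL (hm : ∀ i, 0 < m i) (hL : actionL m j E = L) :
    E.semiaxis = L ^ 2 / (redMass m j ^ 2 * totalMass m j) := by
  have h1 := totalMass_pos hm j
  have h2 := redMass_pos hm j
  rw [← hL, actionL, mul_pow, Real.sq_sqrt (mul_pos h1 E.semiaxis_pos).le]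
  field_simp

theorem ecc_of_action (hm : ∀ i, 0 < m i) (hL : actionL m j E = L)
    (hΓ : ‖angMom m j E‖ = Γ) : E.ecc = √(1 - (Γ / L) ^ 2) := by
  have h1 := totalMass_pos hm j
  have h2 := redMass_pos hm j
  have h3 := E.semiaxis_pos
  have h4 := (sq_lt_one_iff_abs_lt_one _).2 E.abs_ecc_lt_one
  rw [← hL, ← hΓ, actionL, angMom, norm_smul, E.norm_normal, mul_one, Real.norm_eq_abs,
    div_pow, sq_abs, mul_pow, mul_pow, Real.sq_sqrt (by positivity),
    Real.sq_sqrt (mul_nonneg (by positivity) (by linarith))]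
  have : 1 - redMass m j ^ 2 * (totalMass m j * E.semiaxis * (1 - E.ecc ^ 2)) /
      (redMass m j ^ 2 * (totalMass m j * E.semiaxis)) = E.ecc ^ 2 := by
    field_simp
    ring
  rw [this, Real.sqrt_sq E.ecc_pos.le]

end Elements

section Deprit

variable {m : Fin 4 → ℝ} {T : EllipseTriple}
  {L₁ L₂ L₃ γ₁ Γ₁ γ₂ Γ₂ γ₃ Γ₃ ψ₁ Ψ₁ Ψ₂ : ℝ}

theorem dir_peri (E : KeplerEllipse) : dir E.peri = E.peri := by
  simp [dir, E.norm_peri]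

theorem peri_ne_zero (E : KeplerEllipse) : E.peri ≠ 0 := by
  intro h0
  have := E.norm_peri
  rw [h0, norm_zero] at this
  exact zero_ne_one this

theorem HasDepritCoords.axisDots₁₂ (hm : ∀ i, 0 < m i)
    (h : HasDepritCoords m T L₁ L₂ L₃ γ₁ Γ₁ γ₂ Γ₂ γ₃ Γ₃ ψ₁ Ψ₁ Ψ₂) :
    T.E₁.axisDots T.E₂ = (commonNodeDots (cosSum Γ₁ Γ₂ Ψ₁)).rot γ₁ γ₂ := by
  obtain ⟨hν₂, -, -, ⟨rfl, rfl, -⟩, ⟨rfl, -⟩, h₁, h₂, -, -⟩ := h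
  have hC₁ : angMom m 1 T.E₁ ≠ 0 := angMom_ne_zero hm
  have hC₂ : angMom m 2 T.E₂ ≠ 0 := angMom_ne_zero hm
  have o₁ : (inner ℝ (angMom m 1 T.E₁) (cross (angMom m 1 T.E₁) (angMom m 2 T.E₂)) : ℝ) = 0 := by
    rw [real_inner_comm, inner_cross_self_left]
  have o₂ : (inner ℝ (angMom m 2 T.E₂) (cross (angMom m 1 T.E₁) (angMom m 2 T.E₂)) : ℝ) = 0 := by
    rw [real_inner_comm, inner_cross_self_right]
  have f₁ := isFrame_dir hC₁ hν₂ o₁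
  have f₂ := isFrame_dir hC₂ hν₂ o₂
  have p₁ := h₁.dir_eq hC₁ hν₂ (peri_ne_zero _) o₁
  have p₂ := h₂.dir_eq hC₂ hν₂ (peri_ne_zero _) o₂
  have hc := inner_dir_eq_cosSum (angMom m 1 T.E₁) (angMom m 2 T.E₂)
  rw [dir_angMom hm, dir_peri] at p₁ p₂
  rw [dir_angMom hm] at f₁ f₂
  rw [dir_angMom hm, dir_angMom hm] at hc
  rw [KeplerEllipse.axisDots_eq_rot f₁ f₂ p₁ p₂, frameDots_common f₁ f₂, hc, commonNodeDots]

theorem HasDepritCoords.axisDots₂₃ (hm : ∀ i, 0 < m i)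
    (h : HasDepritCoords m T L₁ L₂ L₃ γ₁ Γ₁ γ₂ Γ₂ γ₃ Γ₃ ψ₁ Ψ₁ Ψ₂) :
    T.E₂.axisDots T.E₃ = (twoNodesDots ψ₁ (-cosSum Ψ₁ Γ₂ Γ₁) (cosSum Ψ₁ Γ₃ Ψ₂)
      (Γ₁ * √(1 - cosSum Γ₁ Γ₂ Ψ₁ ^ 2) / Ψ₁) √(1 - cosSum Ψ₁ Γ₃ Ψ₂ ^ 2)).rot γ₂ γ₃ := by
  obtain ⟨hν₂, hν₃, -, ⟨rfl, rfl, rfl⟩, ⟨rfl, rfl⟩, -, h₂, h₃, h₄⟩ := h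
  have hC₁ : angMom m 1 T.E₁ ≠ 0 := angMom_ne_zero hm
  have hC₂ : angMom m 2 T.E₂ ≠ 0 := angMom_ne_zero hm
  have hC₃ : angMom m 3 T.E₃ ≠ 0 := angMom_ne_zero hm
  have d₂ : dir (angMom m 2 T.E₂) = T.E₂.normal := dir_angMom hm
  have d₃ : dir (angMom m 3 T.E₃) = T.E₃.normal := dir_angMom hm
  generalize angMom m 1 T.E₁ = C₁ at *
  generalize angMom m 2 T.E₂ = C₂ at *
  generalize angMom m 3 T.E₃ = C₃ at *
  have hν : cross (C₁ + C₂) C₂ = cross C₁ C₂ := by rw [cross_add_left, cross_self, add_zero]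
  have hC : C₁ + C₂ ≠ 0 := by
    intro h0
    rw [h0] at hν₃
    exact hν₃ (by rw [← zero_smul ℝ (0 : Space), cross_smul_left, zero_smul, zero_smul])
  have o₂ : (inner ℝ C₂ (cross C₁ C₂) : ℝ) = 0 := by
    rw [real_inner_comm, inner_cross_self_right]
  have o₃ : (inner ℝ C₃ (cross (C₁ + C₂) C₃) : ℝ) = 0 := by
    rw [real_inner_comm, inner_cross_self_right]
  have o : (inner ℝ (C₁ + C₂) (cross (C₁ + C₂) C₃) : ℝ) = 0 := by
    rw [real_inner_comm, inner_cross_self_left]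
  have f₂ := isFrame_dir hC₂ hν₂ o₂
  have f₃ := isFrame_dir hC₃ hν₃ o₃
  have f := isFrame_dir hC hν₃ o
  have p₂ := h₂.dir_eq hC₂ hν₂ (peri_ne_zero _) o₂
  have p₃ := h₃.dir_eq hC₃ hν₃ (peri_ne_zero _) o₃
  have p := h₄.dir_eq hC hν₃ hν₂ o
  have t₂ := cross_dir (C₁ + C₂) C₂
  have t₃ := cross_dir (C₁ + C₂) C₃
  rw [hν] at t₂
  rw [d₂, dir_peri] at p₂
  rw [d₃, dir_peri] at p₃
  rw [KeplerEllipse.axisDots_eq_rot (d₂ ▸ f₂) (d₃ ▸ f₃) p₂ p₃, ← d₂, ← d₃,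
    frameDots_of_nodes f p t₂ t₃, twoNodesDots, inner_dir_add_eq_cosSum, inner_dir_eq_cosSum,
    norm_cross C₁ C₂ hC₁ hC₂, norm_cross (C₁ + C₂) C₃ hC hC₃]
  have n₂ := norm_ne_zero_iff.2 hC₂
  have n₃ := norm_ne_zero_iff.2 hC₃
  have n := norm_ne_zero_iff.2 hC
  have e₂ : ‖C₁‖ * ‖C₂‖ * √(1 - cosSum ‖C₁‖ ‖C₂‖ ‖C₁ + C₂‖ ^ 2) / (‖C₁ + C₂‖ * ‖C₂‖) =
      ‖C₁‖ * √(1 - cosSum ‖C₁‖ ‖C₂‖ ‖C₁ + C₂‖ ^ 2) / ‖C₁ + C₂‖ := by field_simp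
  have e₃ : ‖C₁ + C₂‖ * ‖C₃‖ * √(1 - cosSum ‖C₁ + C₂‖ ‖C₃‖ ‖C₁ + C₂ + C₃‖ ^ 2) /
      (‖C₁ + C₂‖ * ‖C₃‖) = √(1 - cosSum ‖C₁ + C₂‖ ‖C₃‖ ‖C₁ + C₂ + C₃‖ ^ 2) := by field_simp
  rw [e₂, e₃]

/-- The ellipse with semimajor axis `a`, normal `n` and `√(1 - e²) = w`, the pericenter being at
the angle `θ` from `u`. -/
def ellipseOfFrame {n u : Space} (hf : IsFrame n u) {a w : ℝ} (ha : 0 < a) (hw : 0 < w)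
    (hw1 : w < 1) (θ : ℝ) : KeplerEllipse where
  semiaxis := a
  ecc := √(1 - w ^ 2)
  peri := Real.cos θ • u + Real.sin θ • cross n u
  normal := n
  semiaxis_pos := ha
  ecc_pos := Real.sqrt_pos.2 (by nlinarith)
  ecc_lt_one := (Real.sqrt_lt' one_pos).2 (by nlinarith)
  norm_peri := by rw [norm_eq_sqrt_real_inner, (hf.rotate θ).uu, Real.sqrt_one]
  norm_normal := by rw [norm_eq_sqrt_real_inner, hf.nn, Real.sqrt_one]
  orth := (hf.rotate θ).un

/-- An ellipse with given actions, in a given frame. -/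
theorem exists_ellipse (hm : ∀ i, 0 < m i) (j : Fin 4) {n u : Space} (hf : IsFrame n u) {L Γ : ℝ}
    (hΓ : 0 < Γ) (hL : Γ < L) (θ : ℝ) : ∃ E : KeplerEllipse, actionL m j E = L ∧
      angMom m j E = Γ • n ∧ E.peri = Real.cos θ • u + Real.sin θ • cross n u := by
  have h1 := totalMass_pos hm j
  have h2 := redMass_pos hm j
  have hL0 := hΓ.trans hL
  have hw : 0 < Γ / L := by positivity
  have hw1 : Γ / L < 1 := (div_lt_one hL0).2 hL
  have ha : 0 < L ^ 2 / (redMass m j ^ 2 * totalMass m j) := by positivity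
  refine ⟨ellipseOfFrame hf ha hw hw1 θ, ?_, ?_, rfl⟩
  · have e : totalMass m j * (L ^ 2 / (redMass m j ^ 2 * totalMass m j)) =
        (L / redMass m j) ^ 2 := by field_simp
    rw [actionL]
    change redMass m j * √(totalMass m j * (L ^ 2 / (redMass m j ^ 2 * totalMass m j))) = L
    rw [e, Real.sqrt_sq (by positivity)]
    field_simp
  · rw [angMom]
    change (redMass m j * √(totalMass m j * (L ^ 2 / (redMass m j ^ 2 * totalMass m j)) *
      (1 - √(1 - (Γ / L) ^ 2) ^ 2))) • n = Γ • n
    rw [Real.sq_sqrt (by nlinarith)]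
    have e : totalMass m j * (L ^ 2 / (redMass m j ^ 2 * totalMass m j)) *
        (1 - (1 - (Γ / L) ^ 2)) = (Γ / redMass m j) ^ 2 := by
      field_simp
      ring
    rw [e, Real.sqrt_sq (by positivity)]
    congr 1
    field_simp

theorem abs_cosSum_lt_one {a b c : ℝ} (ha : 0 < a) (hb : 0 < b) (hc : 0 < c) (h1 : a < b + c)
    (h2 : b < c + a) (h3 : c < a + b) : |cosSum a b c| < 1 := by
  rw [cosSum, abs_div, abs_of_pos (by positivity : 0 < 2 * a * b),
    div_lt_one (by positivity), abs_lt]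
  constructor
  · nlinarith [mul_pos (sub_pos.2 h1) (sub_pos.2 h2)]
  · nlinarith [mul_pos (sub_pos.2 h3) (add_pos (add_pos ha hb) hc)]

theorem exists_isFrame : ∃ n u : Space, IsFrame n u := by
  refine ⟨EuclideanSpace.single 2 1, EuclideanSpace.single 0 1, ?_, ?_, ?_⟩ <;>
    simp [inner_space]

/-- Deprit coordinates are free except for the triangle inequalities between the angular momenta
and the bounds by the circular angular momenta. -/
theorem exists_hasDepritCoords (hm : ∀ i, 0 < m i) (γ₁ γ₂ γ₃ ψ₁ : ℝ) (hΓ₁ : 0 < Γ₁)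
    (hΓ₂ : 0 < Γ₂) (hΓ₃ : 0 < Γ₃) (hL₁ : Γ₁ < L₁) (hL₂ : Γ₂ < L₂) (hL₃ : Γ₃ < L₃)
    (hΨ₁ : 0 < Ψ₁) (hΨ₂ : 0 < Ψ₂)
    (t₁ : Γ₁ < Γ₂ + Ψ₁) (t₂ : Γ₂ < Ψ₁ + Γ₁) (t₃ : Ψ₁ < Γ₁ + Γ₂)
    (t₄ : Ψ₁ < Γ₃ + Ψ₂) (t₅ : Γ₃ < Ψ₂ + Ψ₁) (t₆ : Ψ₂ < Ψ₁ + Γ₃) :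
    ∃ T, HasDepritCoords m T L₁ L₂ L₃ γ₁ Γ₁ γ₂ Γ₂ γ₃ Γ₃ ψ₁ Ψ₁ Ψ₂ := by
  -- `k` will be the direction of `C₁ + C₂`, and `u₃`, `u₂` those of the nodes `ν₃`, `ν₂`. The planes
  -- of the ellipses 2 and 3 are obtained by tilting the plane orthogonal to `k` around the nodes,
  -- and `C₁` as the difference of `C₁ + C₂` and `C₂`.
  obtain ⟨k, u₃, f⟩ := exists_isFrame
  have hcs := fun c : ℝ => fun h : |c| < 1 => (sq_lt_one_iff_abs_lt_one c).2 h
  set c₂ := -cosSum Ψ₁ Γ₂ Γ₁ with hc₂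
  have hc₂1 : c₂ ^ 2 < 1 := hcs _ (by
    rw [hc₂, abs_neg]; exact abs_cosSum_lt_one hΨ₁ hΓ₂ hΓ₁ (by linarith) (by linarith) (by linarith))
  set c₃ := cosSum Ψ₁ Γ₃ Ψ₂ with hc₃
  have hc₃1 : c₃ ^ 2 < 1 := hcs _ (abs_cosSum_lt_one hΨ₁ hΓ₃ hΨ₂ t₄ (by linarith) t₆)
  set s₂ := √(1 - c₂ ^ 2) with hs₂
  set s₃ := √(1 - c₃ ^ 2) with hs₃
  have hs₂0 : 0 < s₂ := Real.sqrt_pos.2 (by linarith)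
  have hs₃0 : 0 < s₃ := Real.sqrt_pos.2 (by linarith)
  have hs₂2 : s₂ ^ 2 = 1 - c₂ ^ 2 := Real.sq_sqrt (by linarith)
  have hs₃2 : s₃ ^ 2 = 1 - c₃ ^ 2 := Real.sq_sqrt (by linarith)
  have g₂ : 2 * Ψ₁ * Γ₂ * c₂ = Ψ₁ ^ 2 + Γ₂ ^ 2 - Γ₁ ^ 2 := by
    rw [hc₂, cosSum]; field_simp; ring
  have g₃ : 2 * Ψ₁ * Γ₃ * c₃ = Ψ₂ ^ 2 - Ψ₁ ^ 2 - Γ₃ ^ 2 := by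
    rw [hc₃, cosSum]; field_simp
  clear_value c₂ c₃ s₂ s₃
  obtain ⟨u₂, hu₂⟩ : ∃ u, u = Real.cos ψ₁ • u₃ + Real.sin ψ₁ • cross k u₃ := ⟨_, rfl⟩
  have f' : IsFrame k u₂ := hu₂ ▸ f.rotate ψ₁
  have tilt : ∀ {u : Space}, IsFrame k u → ∀ {c s : ℝ}, s ^ 2 = 1 - c ^ 2 →
      IsFrame (c • k - s • cross k u) u ∧ cross k (c • k - s • cross k u) = s • u ∧
      (inner ℝ k (c • k - s • cross k u) : ℝ) = c := by
    intro u fu c s hs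
    refine ⟨⟨?_, fu.uu, ?_⟩, ?_, ?_⟩
    · simp only [inner_sub_left, inner_sub_right, real_inner_smul_left, real_inner_smul_right,
        fu.nn, fu.nv, fu.vn, fu.vv]
      linear_combination hs
    · simp only [inner_sub_left, real_inner_smul_left, fu.nu, fu.vu]
      ring
    · rw [sub_eq_add_neg, ← neg_smul, cross_add_right, cross_smul_right, cross_smul_right,
        cross_self, fu.cross_v]
      module
    · simp only [inner_sub_right, real_inner_smul_right, fu.nn, fu.nv]
      ring
  obtain ⟨f₂, k₂, i₂⟩ := tilt f' hs₂2
  obtain ⟨f₃, k₃, i₃⟩ := tilt f hs₃2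
  generalize c₂ • k - s₂ • cross k u₂ = n₂ at f₂ k₂ i₂
  generalize c₃ • k - s₃ • cross k u₃ = n₃ at f₃ k₃ i₃
  have i₂' : (inner ℝ n₂ k : ℝ) = c₂ := by rw [real_inner_comm, i₂]
  have f₁ : IsFrame (Γ₁⁻¹ • (Ψ₁ • k - Γ₂ • n₂)) u₂ := by
    refine ⟨?_, f'.uu, ?_⟩
    · simp only [inner_sub_left, inner_sub_right, real_inner_smul_left, real_inner_smul_right,
        f'.nn, f₂.nn, i₂, i₂']
      field_simp
      linear_combination -g₂
    · simp only [inner_sub_left, real_inner_smul_left, f'.nu, f₂.nu]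
      ring
  obtain ⟨E₁, a₁, b₁, p₁⟩ := exists_ellipse hm 1 f₁ hΓ₁ hL₁ γ₁
  obtain ⟨E₂, a₂, b₂, p₂⟩ := exists_ellipse hm 2 f₂ hΓ₂ hL₂ γ₂
  obtain ⟨E₃, a₃, b₃, p₃⟩ := exists_ellipse hm 3 f₃ hΓ₃ hL₃ γ₃
  have hsum : angMom m 1 E₁ + angMom m 2 E₂ = Ψ₁ • k := by
    rw [b₁, b₂, smul_smul, mul_inv_cancel₀ hΓ₁.ne', one_smul]
    abel
  have hν₂ : cross (angMom m 1 E₁) (angMom m 2 E₂) = (Ψ₁ * Γ₂ * s₂) • u₂ := by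
    have : cross (angMom m 1 E₁) (angMom m 2 E₂) =
        cross (angMom m 1 E₁ + angMom m 2 E₂) (angMom m 2 E₂) := by
      rw [cross_add_left, cross_self, add_zero]
    rw [this, hsum, b₂, cross_smul_left, cross_smul_right, k₂, smul_smul, smul_smul]
  have hν₃ : cross (angMom m 1 E₁ + angMom m 2 E₂) (angMom m 3 E₃) = (Ψ₁ * Γ₃ * s₃) • u₃ := by
    rw [hsum, b₃, cross_smul_left, cross_smul_right, k₃, smul_smul, smul_smul]
  have nz : ∀ {n u : Space}, IsFrame n u → u ≠ 0 := fun hf h0 => by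
    have := hf.uu
    rw [h0, inner_zero_left] at this
    exact zero_ne_one this
  have nn : ∀ {n u : Space}, IsFrame n u → ‖n‖ = 1 := fun hf => by
    rw [norm_eq_sqrt_real_inner, hf.nn, Real.sqrt_one]
  have nrm : ∀ {n u : Space}, IsFrame n u → ∀ {r : ℝ}, 0 < r → ‖r • n‖ = r := fun hf r hr => by
    rw [norm_smul, nn hf, mul_one, Real.norm_eq_abs, abs_of_pos hr]
  have q₂ : 0 < Ψ₁ * Γ₂ * s₂ := by positivity
  have q₃ : 0 < Ψ₁ * Γ₃ * s₃ := by positivity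
  refine ⟨⟨E₁, E₂, E₃⟩, ?_⟩
  simp only [HasDepritCoords]
  rw [hν₂, hν₃, hsum]
  refine ⟨smul_ne_zero q₂.ne' (nz f'), smul_ne_zero q₃.ne' (nz f), ⟨a₁, a₂, a₃⟩, ⟨?_, ?_, ?_⟩,
    ⟨nrm f hΨ₁, ?_⟩, ?_, ?_, ?_, ?_⟩
  · rw [b₁, nrm f₁ hΓ₁]
  · rw [b₂, nrm f₂ hΓ₂]
  · rw [b₃, nrm f₃ hΓ₃]
  · have : ‖Ψ₁ • k + angMom m 3 E₃‖ ^ 2 = Ψ₂ ^ 2 := by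
      rw [norm_add_sq_real, nrm f hΨ₁, b₃, nrm f₃ hΓ₃, real_inner_smul_left,
        real_inner_smul_right, i₃]
      linear_combination g₃
    exact (sq_eq_sq₀ (norm_nonneg _) hΨ₂.le).1 this
  · have := f₁.isOrientedAngle hΓ₁.le q₂.le zero_le_one γ₁
    rwa [one_smul, ← p₁, ← b₁] at this
  · have := f₂.isOrientedAngle hΓ₂.le q₂.le zero_le_one γ₂
    rwa [one_smul, ← p₂, ← b₂] at this
  · have := f₃.isOrientedAngle hΓ₃.le q₃.le zero_le_one γ₃
    rwa [one_smul, ← p₃, ← b₃] at this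
  · have := f.isOrientedAngle hΨ₁.le q₃.le q₂.le ψ₁
    rwa [← hu₂] at this

end Deprit

/-! ### The averages in the localized coordinates -/

section Turn

variable (g : AxisDots)

theorem AxisDots.rot_rot (θ θ' : ℝ) : (g.rot θ 0).rot 0 θ' = g.rot θ θ' := by
  simp [AxisDots.rot]

/-- The quadrupole for semimajor axes 1 with `w = √(1 - e²)` as variables. It does not depend on
the pericenter of the outer ellipse. -/
def quadNorm (w w' : ℝ) : ℝ :=
  1 / (4 * w' ^ 3) * ((5 / 2 - 2 * w ^ 2) * (3 * (g.pp ^ 2 + g.pq ^ 2) - 2) +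
    w ^ 2 / 2 * (3 * (g.qp ^ 2 + g.qq ^ 2) - 2))

/-- The octupole for semimajor axes 1 with `w = √(1 - e²)` as variables. -/
def octNorm (w w' : ℝ) : ℝ :=
  -(15 * √(1 - w ^ 2) * √(1 - w' ^ 2)) / (64 * w' ^ 5) *
    (g.pp * ((5 * (g.pp ^ 2 + g.pq ^ 2) - 4) * (7 - 4 * w ^ 2) +
        (5 * (g.qp ^ 2 + g.qq ^ 2) - 4) * w ^ 2) +
      10 * g.qp * (g.pp * g.qp + g.pq * g.qq) * w ^ 2)

variable {g}

theorem sqrt_one_sub_sq_sqrt {w : ℝ} (hw : 0 < w) (hw1 : w < 1) :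
    √(1 - √(1 - w ^ 2) ^ 2) = w := by
  rw [Real.sq_sqrt (by nlinarith), sub_sub_cancel, Real.sqrt_sq hw.le]

theorem quadAvg_eq_quadNorm {w w' : ℝ} (hw : 0 < w) (hw1 : w < 1) (hw' : 0 < w')
    (hw1' : w' < 1) (θ : ℝ) :
    quadAvg √(1 - w ^ 2) √(1 - w' ^ 2) (g.rot 0 θ) = quadNorm g w w' := by
  have h1 : (g.rot 0 θ).pp ^ 2 + (g.rot 0 θ).pq ^ 2 = g.pp ^ 2 + g.pq ^ 2 := by
    simp only [AxisDots.rot, Real.cos_zero, Real.sin_zero]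
    linear_combination (g.pp ^ 2 + g.pq ^ 2) * Real.sin_sq_add_cos_sq θ
  have h2 : (g.rot 0 θ).qp ^ 2 + (g.rot 0 θ).qq ^ 2 = g.qp ^ 2 + g.qq ^ 2 := by
    simp only [AxisDots.rot, Real.cos_zero, Real.sin_zero]
    linear_combination (g.qp ^ 2 + g.qq ^ 2) * Real.sin_sq_add_cos_sq θ
  rw [quadAvg, quadNorm, h1, h2, sqrt_one_sub_sq_sqrt hw' hw1', Real.sq_sqrt (by nlinarith)]
  ring

theorem octAvg_eq_octNorm {w w' : ℝ} (hw : 0 < w) (hw1 : w < 1) (hw' : 0 < w')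
    (hw1' : w' < 1) : octAvg √(1 - w ^ 2) √(1 - w' ^ 2) g = octNorm g w w' := by
  rw [octAvg, octNorm, sqrt_one_sub_sq_sqrt hw' hw1', Real.sq_sqrt (by nlinarith)]
  ring

end Turn

section Scaled

variable (δ₁ δ₂ δ₃ : ℝ) (z : Param)

/-- `Ψ₁ / L₂` -/
def relΨ₁ : ℝ := δ₁ + z.1 * z.2.2 vΨ₁

/-- `Γ₂ / L₂` -/
def relΓ₂ : ℝ := relΨ₁ δ₁ z - z.1 * z.2.2 vΓ₂

/-- `(Ψ₂ - Γ₃) / L₂` -/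
def relΔ : ℝ := δ₃ + z.1 * z.2.2 vΓ₃

/-- `Γ₃ / L₃` -/
def relΓ₃ : ℝ := δ₂ - z.2.1 * relΔ δ₃ z

/-- The cosine of the angle between `C₁` and `C₂`, by the law of cosines. The factor `ε` of
numerator and denominator is cancelled, which makes the expression analytic at `ε = 0`. -/
def cosIncl₁₂ : ℝ :=
  (2 * relΨ₁ δ₁ z * z.2.2 vΓ₂ - z.1 * (z.2.2 vΓ₂ ^ 2 + z.2.2 vΓ₁ ^ 2)) /
    (2 * z.2.2 vΓ₁ * relΓ₂ δ₁ z)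

/-- The cosine of the angle between `C₁ + C₂` and `C₂`. -/
def cosIncl₂ : ℝ :=
  (relΨ₁ δ₁ z ^ 2 + relΓ₂ δ₁ z ^ 2 - z.1 ^ 2 * z.2.2 vΓ₁ ^ 2) / (2 * relΨ₁ δ₁ z * relΓ₂ δ₁ z)

/-- The sine of the angle between `C₁ + C₂` and `C₂`, by the law of sines. Unlike the square root
of `1 - cosIncl₂²`, this expression is analytic at `ε = 0`. -/
def sinIncl₂ : ℝ := z.1 * (z.2.2 vΓ₁ * √(1 - cosIncl₁₂ δ₁ z ^ 2) / relΨ₁ δ₁ z)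

/-- The cosine of the angle between `C₁ + C₂` and `C₃`, with a factor `μ` cancelled. -/
def cosIncl₃ : ℝ :=
  (2 * δ₂ * relΔ δ₃ z - z.2.1 * (relΔ δ₃ z ^ 2 + relΨ₁ δ₁ z ^ 2)) /
    (2 * relΨ₁ δ₁ z * relΓ₃ δ₂ δ₃ z)

/-- The sine of the angle between `C₁ + C₂` and `C₃`. -/
def sinIncl₃ : ℝ := √(1 - cosIncl₃ δ₁ δ₂ δ₃ z ^ 2)

/-- The inner products of the axes of the first ellipse with the frame of the second one. -/
def dots₁₂ : AxisDots := (commonNodeDots (cosIncl₁₂ δ₁ z)).rot (z.2.2 vγ₁) 0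

/-- The inner products of the axes of the second ellipse with the frame of the third one. -/
def dots₂₃ : AxisDots :=
  (twoNodesDots (z.2.2 vψ₁ + z.2.2 vγ₂) (cosIncl₂ δ₁ z) (cosIncl₃ δ₁ δ₂ δ₃ z) (sinIncl₂ δ₁ z)
    (sinIncl₃ δ₁ δ₂ δ₃ z)).rot (-z.2.2 vγ₂) 0

end Scaled

/-- `μ_j² M_j`, so that `a_j = L_j² / (μ_j² M_j)`. -/
def kepler (m : Fin 4 → ℝ) (j : Fin 4) : ℝ := redMass m j ^ 2 * totalMass m j

theorem kepler_pos {m : Fin 4 → ℝ} (hm : ∀ i, 0 < m i) (j : Fin 4) : 0 < kepler m j :=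
  mul_pos (pow_pos (redMass_pos hm j) 2) (totalMass_pos hm j)

theorem HasDepritCoords.pos {m : Fin 4 → ℝ} (hm : ∀ i, 0 < m i) {T : EllipseTriple}
    {L₁ L₂ L₃ γ₁ Γ₁ γ₂ Γ₂ γ₃ Γ₃ ψ₁ Ψ₁ Ψ₂ : ℝ}
    (h : HasDepritCoords m T L₁ L₂ L₃ γ₁ Γ₁ γ₂ Γ₂ γ₃ Γ₃ ψ₁ Ψ₁ Ψ₂) :
    0 < Γ₁ ∧ 0 < Γ₂ ∧ 0 < Γ₃ ∧ 0 < Ψ₁ := by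
  obtain ⟨-, hν₃, -, ⟨rfl, rfl, rfl⟩, ⟨rfl, -⟩, -⟩ := h
  refine ⟨norm_pos_iff.2 (angMom_ne_zero hm), norm_pos_iff.2 (angMom_ne_zero hm),
    norm_pos_iff.2 (angMom_ne_zero hm), norm_pos_iff.2 fun h0 => hν₃ ?_⟩
  rw [h0, ← zero_smul ℝ (0 : Space), cross_smul_left, zero_smul, zero_smul]

/-- The elements and relative positions of the ellipses with given localized coordinates. -/
structure EllipseData (m : Fin 4 → ℝ) (L₁ δ₁ δ₂ δ₃ : ℝ) (z : Param) (T : EllipseTriple) :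
    Prop where
  semi₁ : T.E₁.semiaxis = L₁ ^ 2 / kepler m 1
  semi₂ : T.E₂.semiaxis = 1 / (kepler m 2 * z.1 ^ 2)
  semi₃ : T.E₃.semiaxis = 1 / (kepler m 3 * z.1 ^ 2 * z.2.1 ^ 2)
  ecc₁ : T.E₁.ecc = √(1 - (z.2.2 vΓ₁ / L₁) ^ 2)
  ecc₂ : T.E₂.ecc = √(1 - relΓ₂ δ₁ z ^ 2)
  ecc₃ : T.E₃.ecc = √(1 - relΓ₃ δ₂ δ₃ z ^ 2)
  dots₁₂ : T.E₁.axisDots T.E₂ = (dots₁₂ δ₁ z).rot 0 (-z.2.2 vγ₂)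
  dots₂₃ : T.E₂.axisDots T.E₃ = (dots₂₃ δ₁ δ₂ δ₃ z).rot 0 (-z.2.2 vγ₃)

theorem Realizes.ellipseData {m : Fin 4 → ℝ} (hm : ∀ i, 0 < m i) {L₁ δ₁ δ₂ δ₃ ε μ : ℝ}
    {x : Phase} {T : EllipseTriple} (hε : 0 < ε) (hμ : 0 < μ)
    (h : Realizes m L₁ δ₁ δ₂ δ₃ ε μ x T) : EllipseData m L₁ δ₁ δ₂ δ₃ (ε, μ, x) T := by
  obtain ⟨γ₂, Γ₂, γ₃, Γ₃, ψ₁, Ψ₁, Ψ₂, h, h1, h2, h3, h4, h5, h6, h7⟩ := h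
  obtain ⟨p1, p2, p3, p4⟩ := h.pos hm
  have d12 := h.axisDots₁₂ hm
  have d23 := h.axisDots₂₃ hm
  have a : x vΨ₁ * ε + δ₁ = Ψ₁ * ε := by rw [h2]; field_simp; ring
  have b : x vΓ₂ = Ψ₁ - Γ₂ := h4
  have eΨ : relΨ₁ δ₁ (ε, μ, x) = ε * Ψ₁ := by simp only [relΨ₁]; linarith
  have eΓ₂ : relΓ₂ δ₁ (ε, μ, x) = ε * Γ₂ := by
    rw [relΓ₂, eΨ]; simp only [b]; ring
  have eΔ : relΔ δ₃ (ε, μ, x) = ε * (Ψ₂ - Γ₃) := by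
    simp only [relΔ, h6]; field_simp; ring
  have eΓ₃ : relΓ₃ δ₂ δ₃ (ε, μ, x) = ε * μ * Γ₃ := by
    rw [relΓ₃, eΔ]
    simp only [h1]
    field_simp
    ring
  have eδ : δ₂ = ε * μ * Ψ₂ := by rw [h1]; field_simp
  have ec12 : cosSum (x vΓ₁) Γ₂ Ψ₁ = cosIncl₁₂ δ₁ (ε, μ, x) := by
    rw [cosIncl₁₂, eΨ, eΓ₂, cosSum]
    simp only [b]
    field_simp
    ring
  have ec2 : -cosSum Ψ₁ Γ₂ (x vΓ₁) = cosIncl₂ δ₁ (ε, μ, x) := by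
    rw [cosIncl₂, eΨ, eΓ₂, cosSum]
    field_simp
    ring
  have es2 : x vΓ₁ * √(1 - cosSum (x vΓ₁) Γ₂ Ψ₁ ^ 2) / Ψ₁ = sinIncl₂ δ₁ (ε, μ, x) := by
    rw [sinIncl₂, eΨ, ← ec12]
    field_simp
  have ec3 : cosSum Ψ₁ Γ₃ Ψ₂ = cosIncl₃ δ₁ δ₂ δ₃ (ε, μ, x) := by
    rw [cosIncl₃, eΨ, eΓ₃, eΔ, cosSum]
    simp only [eδ]
    field_simp
    ring
  have eψ : ψ₁ = x vψ₁ + x vγ₂ := by rw [h3, h5]; ring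
  have eγ₂ : γ₂ = -x vγ₂ := by rw [h5, neg_neg]
  have eγ₃ : γ₃ = -x vγ₃ := by rw [h7, neg_neg]
  obtain ⟨-, -, ⟨l1, l2, l3⟩, ⟨g1, g2, g3⟩, -⟩ := h
  refine ⟨?_, ?_, ?_, ?_, ?_, ?_, ?_, ?_⟩
  · rw [semiaxis_of_actionL hm l1, kepler]
  · rw [semiaxis_of_actionL hm l2, ← kepler]
    have := kepler_pos hm 2
    simp only
    field_simp
  · rw [semiaxis_of_actionL hm l3, ← kepler]
    have := kepler_pos hm 3
    simp only
    field_simp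
  · exact ecc_of_action hm l1 g1
  · rw [ecc_of_action hm l2 g2, eΓ₂]
    congr 3
    field_simp
  · rw [ecc_of_action hm l3 g3, eΓ₃]
    congr 3
    field_simp
  · rw [d12, dots₁₂, AxisDots.rot_rot, ec12, eγ₂]
  · rw [d23, dots₂₃, AxisDots.rot_rot, es2, ec2, ec3, eγ₂, eγ₃, eψ, sinIncl₃]

/-- The localized coordinates are realized as soon as the triangle inequalities between the
angular momenta and the bounds on the eccentricities hold. -/
theorem exists_realizes {m : Fin 4 → ℝ} (hm : ∀ i, 0 < m i) {L₁ δ₁ δ₂ δ₃ ε μ : ℝ} {x : Phase}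
    (hx : x ∈ domain L₁) (hδ₂ : 0 < δ₂) (hε : 0 < ε) (hμ : 0 < μ)
    (h2 : 0 < relΓ₂ δ₁ (ε, μ, x)) (h2' : relΓ₂ δ₁ (ε, μ, x) < 1)
    (h3 : 0 < relΓ₃ δ₂ δ₃ (ε, μ, x)) (h3' : relΓ₃ δ₂ δ₃ (ε, μ, x) < 1)
    (hΔ : |relΔ δ₃ (ε, μ, x)| < relΨ₁ δ₁ (ε, μ, x))
    (hΓ : ε * x vΓ₁ < relΨ₁ δ₁ (ε, μ, x) + relΓ₂ δ₁ (ε, μ, x))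
    (hΨ : μ * relΨ₁ δ₁ (ε, μ, x) < relΓ₃ δ₂ δ₃ (ε, μ, x) + δ₂) :
    ∃ T, Realizes m L₁ δ₁ δ₂ δ₃ ε μ x T := by
  obtain ⟨hx1, hx2, hx3⟩ := hx
  have hεμ := mul_pos hε hμ
  have hP : 0 < relΨ₁ δ₁ (ε, μ, x) := (abs_nonneg _).trans_lt hΔ
  obtain ⟨hΔ1, hΔ2⟩ := abs_lt.1 hΔ
  have e1 : relΓ₂ δ₁ (ε, μ, x) = relΨ₁ δ₁ (ε, μ, x) - ε * x vΓ₂ := rfl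
  have e2 : relΓ₃ δ₂ δ₃ (ε, μ, x) = δ₂ - μ * relΔ δ₃ (ε, μ, x) := rfl
  have e3 : relΨ₁ δ₁ (ε, μ, x) = δ₁ + ε * x vΨ₁ := rfl
  have e4 : relΔ δ₃ (ε, μ, x) = δ₃ + ε * x vΓ₃ := rfl
  generalize relΨ₁ δ₁ (ε, μ, x) = Φ at *
  generalize relΓ₂ δ₁ (ε, μ, x) = w₂ at *
  generalize relΓ₃ δ₂ δ₃ (ε, μ, x) = w₃ at *
  generalize relΔ δ₃ (ε, μ, x) = Δ at *
  obtain ⟨T, hT⟩ := exists_hasDepritCoords (L₁ := L₁) (L₂ := 1 / ε) (L₃ := 1 / (ε * μ))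
    (Γ₁ := x vΓ₁) (Γ₂ := w₂ / ε) (Γ₃ := w₃ / (ε * μ)) (Ψ₁ := Φ / ε) (Ψ₂ := δ₂ / (ε * μ)) hm
    (x vγ₁) (-x vγ₂) (-x vγ₃) (x vψ₁ + x vγ₂) (by linarith) (by positivity) (by positivity) hx3
    (by gcongr) (by gcongr) (by positivity) (by positivity)
    (by rw [← add_div, lt_div_iff₀ hε]; linarith)
    (by
      have := mul_pos hε (hx1.trans hx2)
      have := mul_pos hε hx1
      rw [div_lt_iff₀ hε, add_mul, div_mul_cancel₀ _ hε.ne']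
      linarith)
    (by
      have := mul_lt_mul_of_pos_left hx2 hε
      rw [div_lt_iff₀ hε, add_mul, div_mul_cancel₀ _ hε.ne']
      linarith)
    (by
      rw [← add_div, div_lt_div_iff₀ hε hεμ]
      nlinarith)
    (by
      have := mul_lt_mul_of_pos_left hΔ1 hμ
      have e : Φ / ε = Φ * μ / (ε * μ) := by field_simp
      rw [e, ← add_div]
      gcongr
      linarith)
    (by
      have := mul_lt_mul_of_pos_left hΔ2 hμ
      have e : Φ / ε = Φ * μ / (ε * μ) := by field_simp
      rw [e, ← add_div]
      gcongr
      linarith)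
  refine ⟨T, _, _, _, _, _, _, _, hT, by ring, ?_, by ring, ?_, by ring, ?_, by ring⟩
  · rw [e3]; field_simp; ring
  · rw [e1]; field_simp; ring
  · rw [e2, e4]; field_simp; ring

/-! ### Masses of the perturbing functions -/

section MassIdentities

variable {m : Fin 4 → ℝ}

theorem totalMass_zero : totalMass m 0 = m 0 := by
  rw [totalMass, show Finset.Iic (0 : Fin 4) = {0} by decide, Finset.sum_singleton]

theorem totalMass_one : totalMass m 1 = m 0 + m 1 := by
  rw [totalMass, show Finset.Iic (1 : Fin 4) = {0, 1} by decide, Finset.sum_pair (by decide)]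

theorem totalMass_two : totalMass m 2 = m 0 + m 1 + m 2 := by
  rw [totalMass, show Finset.Iic (2 : Fin 4) = {0, 1, 2} by decide,
    Finset.sum_insert (by decide), Finset.sum_pair (by decide), add_assoc]

theorem totalMass_three : totalMass m 3 = m 0 + m 1 + m 2 + m 3 := by
  rw [totalMass, show Finset.Iic (3 : Fin 4) = {0, 1, 2, 3} by decide,
    Finset.sum_insert (by decide), Finset.sum_insert (by decide), Finset.sum_pair (by decide)]
  ring

theorem redMass_one (hm : ∀ i, 0 < m i) : redMass m 1 = m 0 * m 1 / (m 0 + m 1) := by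
  have h0 := hm 0
  have h1 := hm 1
  rw [redMass, show (1 : Fin 4) - 1 = 0 by decide, totalMass_zero]
  field_simp
  ring

theorem redMass_two (hm : ∀ i, 0 < m i) :
    redMass m 2 = (m 0 + m 1) * m 2 / (m 0 + m 1 + m 2) := by
  have h0 := hm 0
  have h1 := hm 1
  have h2 := hm 2
  rw [redMass, show (2 : Fin 4) - 1 = 1 by decide, totalMass_one]
  field_simp
  ring

theorem redMass_three (hm : ∀ i, 0 < m i) :
    redMass m 3 = (m 0 + m 1 + m 2) * m 3 / (m 0 + m 1 + m 2 + m 3) := by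
  have h0 := hm 0
  have h1 := hm 1
  have h2 := hm 2
  have h3 := hm 3
  rw [redMass, show (3 : Fin 4) - 1 = 2 by decide, totalMass_two]
  field_simp
  ring

theorem massRatio_pos (hm : ∀ i, 0 < m i) (i j : Fin 4) : 0 < massRatio m i j :=
  div_pos (hm i) (totalMass_pos hm j)

theorem massRatio_one (hm : ∀ i, 0 < m i) : massRatio m 0 1 + massRatio m 1 1 = 1 := by
  have := totalMass_pos hm 1
  rw [massRatio, massRatio, ← add_div, ← totalMass_one, div_self this.ne']

theorem massRatio_two (hm : ∀ i, 0 < m i) :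
    massRatio m 0 2 + massRatio m 1 2 + massRatio m 2 2 = 1 := by
  have := totalMass_pos hm 2
  rw [massRatio, massRatio, massRatio, ← add_div, ← add_div, ← totalMass_two, div_self this.ne']

theorem Fper12_eq (hm : ∀ i, 0 < m i) : Fper12 m =
    pairKernel (m 0 * m 2) (m 1 * m 2) (massRatio m 1 1) (massRatio m 0 1) := by
  funext q q'
  have h0 := hm 0
  have h1 := hm 1
  have h2 := hm 2
  have : redMass m 2 * totalMass m 2 = m 0 * m 2 + m 1 * m 2 := by
    rw [redMass_two hm, totalMass_two]; field_simp
  rw [Fper12, pairKernel, this]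

theorem Fper23_eq (hm : ∀ i, 0 < m i) : Fper23 m =
    pairKernel ((m 0 + m 1) * m 3) (m 2 * m 3) (massRatio m 2 2)
      (massRatio m 0 2 + massRatio m 1 2) := by
  funext q q'
  have h0 := hm 0
  have h1 := hm 1
  have h2 := hm 2
  have h3 := hm 3
  have : redMass m 3 * totalMass m 3 = (m 0 + m 1) * m 3 + m 2 * m 3 := by
    rw [redMass_three hm, totalMass_three]; field_simp
  have e : massRatio m 2 2 - 1 = -(massRatio m 0 2 + massRatio m 1 2) := by
    linarith [massRatio_two hm]
  rw [Fper23, pairKernel, this, e, neg_smul, ← sub_eq_add_neg]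

/-- The mass coefficients of the quadrupole and the octupole. -/
theorem mass_coeff₁₂ (hm : ∀ i, 0 < m i) :
    m 0 * m 2 * massRatio m 1 1 = m 1 * m 2 * massRatio m 0 1 ∧
    m 0 * m 2 * massRatio m 1 1 ^ 2 + m 1 * m 2 * massRatio m 0 1 ^ 2 = redMass m 1 * m 2 ∧
    m 1 * m 2 * massRatio m 0 1 ^ 3 - m 0 * m 2 * massRatio m 1 1 ^ 3 =
      redMass m 1 * m 2 * sigmaOct12 m := by
  have h0 := hm 0
  have h1 := hm 1
  simp only [sigmaOct12, massRatio, totalMass_one, redMass_one hm]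
  refine ⟨?_, ?_, ?_⟩ <;> (field_simp; try ring)

theorem mass_coeff₂₃ (hm : ∀ i, 0 < m i) :
    (m 0 + m 1) * m 3 * massRatio m 2 2 = m 2 * m 3 * (massRatio m 0 2 + massRatio m 1 2) ∧
    (m 0 + m 1) * m 3 * massRatio m 2 2 ^ 2 +
      m 2 * m 3 * (massRatio m 0 2 + massRatio m 1 2) ^ 2 = redMass m 2 * m 3 ∧
    m 2 * m 3 * (massRatio m 0 2 + massRatio m 1 2) ^ 3 -
      (m 0 + m 1) * m 3 * massRatio m 2 2 ^ 3 = redMass m 2 * m 3 * sigmaOct23 m := by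
  have h0 := hm 0
  have h1 := hm 1
  have h2 := hm 2
  simp only [sigmaOct23, massRatio, totalMass_two, redMass_two hm]
  refine ⟨?_, ?_, ?_⟩ <;> (field_simp; try ring)

theorem abs_massRatio_le (hm : ∀ i, 0 < m i) : |massRatio m 1 1| ≤ 1 ∧ |massRatio m 0 1| ≤ 1 ∧
    |massRatio m 2 2| ≤ 1 ∧ |massRatio m 0 2 + massRatio m 1 2| ≤ 1 := by
  have a := massRatio_pos hm 0 1
  have b := massRatio_pos hm 1 1
  have c := massRatio_pos hm 0 2
  have d := massRatio_pos hm 1 2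
  have e := massRatio_pos hm 2 2
  have f := massRatio_one hm
  have g := massRatio_two hm
  refine ⟨?_, ?_, ?_, ?_⟩ <;> rw [abs_of_pos (by linarith)] <;> linarith

end MassIdentities

/-! ### The averages as functions of the small parameters -/

section Functions

variable (m : Fin 4 → ℝ) (L₁ δ₁ δ₂ δ₃ : ℝ) (z : Param)

/-- The quadrupole of the planets 1 and 2, divided by `ε⁶`, up to a constant. -/
def quadFun₁₂ : ℝ :=
  (L₁ ^ 2 / kepler m 1) ^ 2 * kepler m 2 ^ 3 *
    (quadNorm (dots₁₂ δ₁ z) (z.2.2 vΓ₁ / L₁) (relΓ₂ δ₁ z) + 1 / (8 * δ₁ ^ 3))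

/-- The octupole of the planets 1 and 2, divided by `ε⁸`. -/
def octFun₁₂ : ℝ :=
  (L₁ ^ 2 / kepler m 1) ^ 3 * kepler m 2 ^ 4 *
    octNorm ((dots₁₂ δ₁ z).rot 0 (-z.2.2 vγ₂)) (z.2.2 vΓ₁ / L₁) (relΓ₂ δ₁ z)

/-- The multipoles of higher order of the planets 1 and 2, divided by `ε¹⁰`. -/
def tailFun₁₂ : ℝ :=
  kepler m 2 * (L₁ ^ 2 / kepler m 1 * kepler m 2) ^ 4 *
    (m 0 * m 2 * massRatio m 1 1 ^ 4 *
        multipoleTail √(1 - (z.2.2 vΓ₁ / L₁) ^ 2) √(1 - relΓ₂ δ₁ z ^ 2)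
          ((dots₁₂ δ₁ z).rot 0 (-z.2.2 vγ₂))
          (massRatio m 1 1 * (L₁ ^ 2 / kepler m 1 * kepler m 2 * z.1 ^ 2))
      + m 1 * m 2 * massRatio m 0 1 ^ 4 *
        multipoleTail √(1 - (z.2.2 vΓ₁ / L₁) ^ 2) √(1 - relΓ₂ δ₁ z ^ 2)
          ((dots₁₂ δ₁ z).rot 0 (-z.2.2 vγ₂))
          (-massRatio m 0 1 * (L₁ ^ 2 / kepler m 1 * kepler m 2 * z.1 ^ 2)))

/-- The part of the leading quadrupole of the planets 2 and 3 without `ψ̃₁`. -/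
def quadConst₂₃ : ℝ :=
  1 / (4 * δ₂ ^ 3) *
    ((5 / 2 - 2 * δ₁ ^ 2) * (3 * (δ₃ / δ₁) ^ 2 - 2) + δ₁ ^ 2 / 2)

/-- The quadrupole of the planets 2 and 3, divided by `ε² μ⁶`, up to a constant. -/
def quadFun₂₃ : ℝ :=
  kquad23 m * (quadNorm (dots₂₃ δ₁ δ₂ δ₃ z) (relΓ₂ δ₁ z) (relΓ₃ δ₂ δ₃ z) - quadConst₂₃ δ₁ δ₂ δ₃)

/-- The octupole of the planets 2 and 3, divided by `ε² μ⁸`. -/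
def octFun₂₃ : ℝ :=
  koct23 m * octNorm ((dots₂₃ δ₁ δ₂ δ₃ z).rot 0 (-z.2.2 vγ₃)) (relΓ₂ δ₁ z) (relΓ₃ δ₂ δ₃ z)

/-- The multipoles of higher order of the planets 2 and 3, divided by `ε² μ¹⁰`. -/
def tailFun₂₃ : ℝ :=
  kepler m 3 * (kepler m 3 / kepler m 2) ^ 4 *
    ((m 0 + m 1) * m 3 * massRatio m 2 2 ^ 4 *
        multipoleTail √(1 - relΓ₂ δ₁ z ^ 2) √(1 - relΓ₃ δ₂ δ₃ z ^ 2)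
          ((dots₂₃ δ₁ δ₂ δ₃ z).rot 0 (-z.2.2 vγ₃))
          (massRatio m 2 2 * (kepler m 3 / kepler m 2 * z.2.1 ^ 2))
      + m 2 * m 3 * (massRatio m 0 2 + massRatio m 1 2) ^ 4 *
        multipoleTail √(1 - relΓ₂ δ₁ z ^ 2) √(1 - relΓ₃ δ₂ δ₃ z ^ 2)
          ((dots₂₃ δ₁ δ₂ δ₃ z).rot 0 (-z.2.2 vγ₃))
          (-(massRatio m 0 2 + massRatio m 1 2) * (kepler m 3 / kepler m 2 * z.2.1 ^ 2)))

/-- The parameters are so small that the coordinates are realized and the multipole expansions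
converge. -/
structure IsSmall : Prop where
  Γ₂_pos : 0 < relΓ₂ δ₁ z
  Γ₂_lt : relΓ₂ δ₁ z < 1
  Γ₃_pos : 0 < relΓ₃ δ₂ δ₃ z
  Γ₃_lt : relΓ₃ δ₂ δ₃ z < 1
  abs_Δ_lt : |relΔ δ₃ z| < relΨ₁ δ₁ z
  Γ₁_lt : z.1 * z.2.2 vΓ₁ < relΨ₁ δ₁ z + relΓ₂ δ₁ z
  Ψ₁_lt : z.2.1 * relΨ₁ δ₁ z < relΓ₃ δ₂ δ₃ z + δ₂
  ratio₁₂ : 5 * (L₁ ^ 2 / kepler m 1 * kepler m 2 * z.1 ^ 2) < 1 - √(1 - relΓ₂ δ₁ z ^ 2)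
  ratio₂₃ : 5 * (kepler m 3 / kepler m 2 * z.2.1 ^ 2) < 1 - √(1 - relΓ₃ δ₂ δ₃ z ^ 2)

end Functions

/-- A property that holds near `ε = μ = 0` at every point of a compact set holds on it for all
sufficiently small parameters. -/
theorem exists_forall_small {P : Param → Prop} {K : Set Phase} (hK : IsCompact K)
    (h : ∀ x ∈ K, ∀ᶠ z in 𝓝 ((0, 0, x) : Param), P z) :
    ∃ ρ : ℝ, 0 < ρ ∧ ∀ ε μ : ℝ, 0 < ε → ε < ρ → 0 < μ → μ < ρ → ∀ x ∈ K, P (ε, μ, x) := by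
  have h1 : ∀ᶠ p in 𝓝 ((0, 0) : ℝ × ℝ), ∀ x ∈ K, P (p.1, p.2, x) := by
    refine hK.eventually_forall_of_forall_eventually fun x hx => ?_
    have hc : Continuous fun q : (ℝ × ℝ) × Phase => ((q.1.1, q.1.2, q.2) : Param) := by fun_prop
    exact (hc.tendsto ((0, 0), x)).eventually (h x hx)
  obtain ⟨ρ, hρ, hb⟩ := Metric.eventually_nhds_iff.1 h1
  refine ⟨ρ, hρ, fun ε μ hε hε' hμ hμ' x hx => hb (y := (ε, μ)) ?_ x hx⟩
  rw [Prod.dist_eq, Real.dist_eq, Real.dist_eq]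
  simp only [sub_zero, abs_of_pos hε, abs_of_pos hμ]
  exact max_lt hε' hμ'

section Continuity

variable (δ₁ δ₂ δ₃ : ℝ)

theorem contDiff_phase (v : Fin 8) : ContDiff ℝ ⊤ fun z : Param => z.2.2 v := by fun_prop

theorem contDiff_relΨ₁ : ContDiff ℝ ⊤ (relΨ₁ δ₁) := by unfold relΨ₁; fun_prop
theorem contDiff_relΓ₂ : ContDiff ℝ ⊤ (relΓ₂ δ₁) := by unfold relΓ₂ relΨ₁; fun_prop
theorem contDiff_relΔ : ContDiff ℝ ⊤ (relΔ δ₃) := by unfold relΔ; fun_prop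
theorem contDiff_relΓ₃ : ContDiff ℝ ⊤ (relΓ₃ δ₂ δ₃) := by unfold relΓ₃ relΔ; fun_prop

theorem sqrt_one_sub_sq_lt_one {w : ℝ} (hw : 0 < w) : √(1 - w ^ 2) < 1 :=
  (Real.sqrt_lt' one_pos).2 (by nlinarith)

theorem eventually_isSmall {δ₁ δ₂ δ₃ : ℝ} (m : Fin 4 → ℝ) (L₁ : ℝ) (hδ₁ : 0 < δ₁ ∧ δ₁ < 1)
    (hδ₂ : 0 < δ₂ ∧ δ₂ < 1) (hδ₃ : |δ₃| < δ₁) (x : Phase) :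
    ∀ᶠ z in 𝓝 ((0, 0, x) : Param), IsSmall m L₁ δ₁ δ₂ δ₃ z := by
  have cΨ : Continuous (relΨ₁ δ₁) := (contDiff_relΨ₁ δ₁).continuous
  have cΓ₂ : Continuous (relΓ₂ δ₁) := (contDiff_relΓ₂ δ₁).continuous
  have cΔ : Continuous (relΔ δ₃) := (contDiff_relΔ δ₃).continuous
  have cΓ₃ : Continuous (relΓ₃ δ₂ δ₃) := (contDiff_relΓ₃ δ₂ δ₃).continuous
  have ev : ∀ {f g : Param → ℝ}, Continuous f → Continuous g → f (0, 0, x) < g (0, 0, x) →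
      ∀ᶠ z in 𝓝 ((0, 0, x) : Param), f z < g z := fun hf hg h =>
    hf.continuousAt.eventually_lt hg.continuousAt h
  have vΨ : relΨ₁ δ₁ (0, 0, x) = δ₁ := by simp [relΨ₁]
  have vΓ₂' : relΓ₂ δ₁ (0, 0, x) = δ₁ := by simp [relΓ₂, vΨ]
  have vΔ : relΔ δ₃ (0, 0, x) = δ₃ := by simp [relΔ]
  have vΓ₃' : relΓ₃ δ₂ δ₃ (0, 0, x) = δ₂ := by simp [relΓ₃]
  filter_upwards [ev (continuous_const (y := (0 : ℝ))) cΓ₂ (by rw [vΓ₂']; exact hδ₁.1),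
    ev cΓ₂ (continuous_const (y := (1 : ℝ))) (by rw [vΓ₂']; exact hδ₁.2),
    ev (continuous_const (y := (0 : ℝ))) cΓ₃ (by rw [vΓ₃']; exact hδ₂.1),
    ev cΓ₃ (continuous_const (y := (1 : ℝ))) (by rw [vΓ₃']; exact hδ₂.2),
    ev cΔ.abs cΨ (by rw [vΔ, vΨ]; exact hδ₃),
    ev (f := fun z => z.1 * z.2.2 vΓ₁) (by fun_prop) (cΨ.add cΓ₂)
      (by simp only [Pi.add_apply, vΨ, vΓ₂', zero_mul]; linarith [hδ₁.1]),
    ev (f := fun z => z.2.1 * relΨ₁ δ₁ z) (g := fun z => relΓ₃ δ₂ δ₃ z + δ₂) (by fun_prop)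
      (by fun_prop) (by simp only [vΓ₃', zero_mul]; linarith [hδ₂.1]),
    ev (f := fun z => 5 * (L₁ ^ 2 / kepler m 1 * kepler m 2 * z.1 ^ 2))
      (g := fun z => 1 - √(1 - relΓ₂ δ₁ z ^ 2)) (by fun_prop) (by fun_prop)
      (by simpa [vΓ₂'] using sqrt_one_sub_sq_lt_one hδ₁.1),
    ev (f := fun z => 5 * (kepler m 3 / kepler m 2 * z.2.1 ^ 2))
      (g := fun z => 1 - √(1 - relΓ₃ δ₂ δ₃ z ^ 2)) (by fun_prop) (by fun_prop)
      (by simpa [vΓ₃'] using sqrt_one_sub_sq_lt_one hδ₂.1)]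
    with z h1 h2 h3 h4 h5 h6 h7 h8 h9
  exact ⟨h1, h2, h3, h4, h5, h6, h7, h8, h9⟩

end Continuity

/-! ### The averages of the realizing ellipses -/

section Values

variable {m : Fin 4 → ℝ} {L₁ δ₁ δ₂ δ₃ : ℝ} {z : Param} {T : EllipseTriple}

theorem relΓ₁_mem (hL : 0 < L₁) (hx : z.2.2 ∈ domain L₁) :
    0 < z.2.2 vΓ₁ / L₁ ∧ z.2.2 vΓ₁ / L₁ < 1 :=
  ⟨div_pos (hx.1.trans hx.2.1) hL, (div_lt_one hL).2 hx.2.2⟩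

theorem Fquad12_eq (hm : ∀ i, 0 < m i) (hL : 0 < L₁) (hx : z.2.2 ∈ domain L₁) (hε : 0 < z.1)
    (hs : IsSmall m L₁ δ₁ δ₂ δ₃ z) (hT : EllipseData m L₁ δ₁ δ₂ δ₃ z T) :
    Fquad12 T = -((L₁ ^ 2 / kepler m 1) ^ 2 * kepler m 2 ^ 3 / (8 * δ₁ ^ 3) * z.1 ^ 6) +
      z.1 ^ 6 * z.2.1 ^ 0 * quadFun₁₂ m L₁ δ₁ z := by
  have k1 := kepler_pos hm 1
  have k2 := kepler_pos hm 2
  rw [Fquad12, mean2_quadKernel, hT.dots₁₂, hT.ecc₁, hT.ecc₂,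
    quadAvg_eq_quadNorm (relΓ₁_mem hL hx).1 (relΓ₁_mem hL hx).2 hs.Γ₂_pos hs.Γ₂_lt, hT.semi₁,
    hT.semi₂, quadFun₁₂]
  generalize quadNorm _ _ _ = q
  have e : (L₁ ^ 2 / kepler m 1) ^ 2 / (1 / (kepler m 2 * z.1 ^ 2)) ^ 3 =
      (L₁ ^ 2 / kepler m 1) ^ 2 * kepler m 2 ^ 3 * z.1 ^ 6 := by
    field_simp
  rw [e]
  ring

theorem Foct12_eq (hm : ∀ i, 0 < m i) (hL : 0 < L₁) (hx : z.2.2 ∈ domain L₁) (hε : 0 < z.1)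
    (hs : IsSmall m L₁ δ₁ δ₂ δ₃ z) (hT : EllipseData m L₁ δ₁ δ₂ δ₃ z T) :
    Foct12 T = z.1 ^ 8 * z.2.1 ^ 0 * octFun₁₂ m L₁ δ₁ z := by
  have k1 := kepler_pos hm 1
  have k2 := kepler_pos hm 2
  rw [Foct12, mean2_octKernel, hT.dots₁₂, hT.ecc₁, hT.ecc₂,
    octAvg_eq_octNorm (relΓ₁_mem hL hx).1 (relΓ₁_mem hL hx).2 hs.Γ₂_pos hs.Γ₂_lt, hT.semi₁,
    hT.semi₂, octFun₁₂]
  generalize octNorm _ _ _ = q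
  have e : (L₁ ^ 2 / kepler m 1) ^ 3 / (1 / (kepler m 2 * z.1 ^ 2)) ^ 4 =
      (L₁ ^ 2 / kepler m 1) ^ 3 * kepler m 2 ^ 4 * z.1 ^ 8 := by
    field_simp
  rw [e]
  ring

theorem Fquad23_eq (hm : ∀ i, 0 < m i) (hε : 0 < z.1) (hμ : 0 < z.2.1)
    (hs : IsSmall m L₁ δ₁ δ₂ δ₃ z) (hT : EllipseData m L₁ δ₁ δ₂ δ₃ z T) :
    Fquad23 T = kquad23 m * quadConst₂₃ δ₁ δ₂ δ₃ * (z.1 ^ 2 * z.2.1 ^ 6) +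
      z.1 ^ 2 * z.2.1 ^ 6 * quadFun₂₃ m δ₁ δ₂ δ₃ z := by
  have k2 := kepler_pos hm 2
  have k3 := kepler_pos hm 3
  rw [Fquad23, mean2_quadKernel, hT.dots₂₃, hT.ecc₂, hT.ecc₃,
    quadAvg_eq_quadNorm hs.Γ₂_pos hs.Γ₂_lt hs.Γ₃_pos hs.Γ₃_lt, hT.semi₂, hT.semi₃, quadFun₂₃]
  generalize quadNorm _ _ _ = q
  have e : (1 / (kepler m 2 * z.1 ^ 2)) ^ 2 / (1 / (kepler m 3 * z.1 ^ 2 * z.2.1 ^ 2)) ^ 3 =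
      kquad23 m * (z.1 ^ 2 * z.2.1 ^ 6) := by
    have : kquad23 m = kepler m 3 ^ 3 / kepler m 2 ^ 2 := by
      simp only [kquad23, kepler]; ring
    rw [this]
    field_simp
  rw [e]
  ring

theorem Foct23_eq (hm : ∀ i, 0 < m i) (hε : 0 < z.1) (hμ : 0 < z.2.1)
    (hs : IsSmall m L₁ δ₁ δ₂ δ₃ z) (hT : EllipseData m L₁ δ₁ δ₂ δ₃ z T) :
    Foct23 T = z.1 ^ 2 * z.2.1 ^ 8 * octFun₂₃ m δ₁ δ₂ δ₃ z := by
  have k2 := kepler_pos hm 2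
  have k3 := kepler_pos hm 3
  rw [Foct23, mean2_octKernel, hT.dots₂₃, hT.ecc₂, hT.ecc₃,
    octAvg_eq_octNorm hs.Γ₂_pos hs.Γ₂_lt hs.Γ₃_pos hs.Γ₃_lt, hT.semi₂, hT.semi₃, octFun₂₃]
  generalize octNorm _ _ _ = q
  have e : (1 / (kepler m 2 * z.1 ^ 2)) ^ 3 / (1 / (kepler m 3 * z.1 ^ 2 * z.2.1 ^ 2)) ^ 4 =
      koct23 m * (z.1 ^ 2 * z.2.1 ^ 8) := by
    have : koct23 m = kepler m 3 ^ 4 / kepler m 2 ^ 3 := by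
      simp only [koct23, kepler]; ring
    rw [this]
    field_simp
  rw [e]
  ring

/-- The monopole cancels against the Keplerian term, and the dipole by the choice of the
barycenter. -/
theorem mean2_Fper12_eq (hm : ∀ i, 0 < m i) (hε : 0 < z.1)
    (hs : IsSmall m L₁ δ₁ δ₂ δ₃ z) (hT : EllipseData m L₁ δ₁ δ₂ δ₃ z T) :
    mean2 T.E₁ T.E₂ (Fper12 m) =
      -(redMass m 1 * m 2) * (Fquad12 T + sigmaOct12 m * Foct12 T)
        - z.1 ^ 10 * z.2.1 ^ 0 * tailFun₁₂ m L₁ δ₁ z := by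
  have k1 := kepler_pos hm 1
  have k2 := kepler_pos hm 2
  obtain ⟨c1, c2, c3⟩ := mass_coeff₁₂ hm
  obtain ⟨a1, a2, -⟩ := abs_massRatio_le hm
  have e : T.E₁.semiaxis / T.E₂.semiaxis =
      L₁ ^ 2 / kepler m 1 * kepler m 2 * z.1 ^ 2 := by
    rw [hT.semi₁, hT.semi₂]; field_simp
  rw [Fper12_eq hm, mean2_pairKernel _ _ c1 a1 a2 (by rw [e, hT.ecc₂]; exact hs.ratio₁₂), c2, c3,
    e, hT.ecc₁, hT.ecc₂, hT.dots₁₂, hT.semi₂, tailFun₁₂, Fquad12, Foct12]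
  have e2 : (1 / (kepler m 2 * z.1 ^ 2))⁻¹ = kepler m 2 * z.1 ^ 2 := by field_simp
  rw [e2]
  ring

theorem mean2_Fper23_eq (hm : ∀ i, 0 < m i) (hε : 0 < z.1) (hμ : 0 < z.2.1)
    (hs : IsSmall m L₁ δ₁ δ₂ δ₃ z) (hT : EllipseData m L₁ δ₁ δ₂ δ₃ z T) :
    mean2 T.E₂ T.E₃ (Fper23 m) =
      -(redMass m 2 * m 3) * (Fquad23 T + sigmaOct23 m * Foct23 T)
        - z.1 ^ 2 * z.2.1 ^ 10 * tailFun₂₃ m δ₁ δ₂ δ₃ z := by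
  have k2 := kepler_pos hm 2
  have k3 := kepler_pos hm 3
  obtain ⟨c1, c2, c3⟩ := mass_coeff₂₃ hm
  obtain ⟨-, -, a1, a2⟩ := abs_massRatio_le hm
  have e : T.E₂.semiaxis / T.E₃.semiaxis = kepler m 3 / kepler m 2 * z.2.1 ^ 2 := by
    rw [hT.semi₂, hT.semi₃]; field_simp
  rw [Fper23_eq hm, mean2_pairKernel _ _ c1 a1 a2 (by rw [e, hT.ecc₃]; exact hs.ratio₂₃), c2, c3,
    e, hT.ecc₂, hT.ecc₃, hT.dots₂₃, hT.semi₃, tailFun₂₃, Fquad23, Foct23]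
  have e2 : (1 / (kepler m 3 * z.1 ^ 2 * z.2.1 ^ 2))⁻¹ = kepler m 3 * z.1 ^ 2 * z.2.1 ^ 2 := by
    field_simp
  rw [e2]
  ring

end Values

/-! ### Analyticity at `ε = μ = 0` -/

section Analytic

variable {m : Fin 4 → ℝ} {L₁ δ₁ δ₂ δ₃ : ℝ} {x : Phase}

@[simp] theorem relΨ₁_zero (μ : ℝ) : relΨ₁ δ₁ (0, μ, x) = δ₁ := by simp [relΨ₁]

@[simp] theorem relΓ₂_zero (μ : ℝ) : relΓ₂ δ₁ (0, μ, x) = δ₁ := by simp [relΓ₂]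

@[simp] theorem relΔ_zero (μ : ℝ) : relΔ δ₃ (0, μ, x) = δ₃ := by simp [relΔ]

theorem relΓ₃_zero (μ : ℝ) : relΓ₃ δ₂ δ₃ (0, μ, x) = δ₂ - μ * δ₃ := by simp [relΓ₃]

theorem cosIncl₁₂_zero (hδ₁ : 0 < δ₁) (μ : ℝ) :
    cosIncl₁₂ δ₁ (0, μ, x) = x vΓ₂ / x vΓ₁ := by
  simp only [cosIncl₁₂, relΨ₁_zero, relΓ₂_zero, zero_mul, sub_zero]
  rw [show 2 * δ₁ * x vΓ₂ = (2 * δ₁) * x vΓ₂ by ring,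
    show 2 * x vΓ₁ * δ₁ = (2 * δ₁) * x vΓ₁ by ring,
    mul_div_mul_left _ _ (by positivity : (2 * δ₁) ≠ 0)]

theorem cosIncl₂_zero (hδ₁ : 0 < δ₁) (μ : ℝ) : cosIncl₂ δ₁ (0, μ, x) = 1 := by
  simp only [cosIncl₂, relΨ₁_zero, relΓ₂_zero]
  field_simp
  ring

theorem sinIncl₂_zero (μ : ℝ) : sinIncl₂ δ₁ (0, μ, x) = 0 := by simp [sinIncl₂]

theorem cosIncl₃_zero_zero (hδ₂ : 0 < δ₂) :
    cosIncl₃ δ₁ δ₂ δ₃ (0, 0, x) = δ₃ / δ₁ := by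
  simp only [cosIncl₃, relΔ_zero, relΓ₃_zero, relΨ₁_zero, zero_mul, sub_zero]
  field_simp

theorem ratio_sq_lt_one {a b : ℝ} (hb : 0 < b) (h : |a| < b) : (a / b) ^ 2 < 1 := by
  rw [sq_lt_one_iff_abs_lt_one, abs_div, abs_of_pos hb]
  exact (div_lt_one hb).2 h

theorem contDiffAt_cosIncl₁₂ (hδ₁ : 0 < δ₁) (hx : x ∈ domain L₁) :
    ContDiffAt ℝ ⊤ (cosIncl₁₂ δ₁) (0, 0, x) := by
  have h1 := (contDiff_relΨ₁ δ₁).contDiffAt (x := (0, 0, x))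
  have h2 := (contDiff_relΓ₂ δ₁).contDiffAt (x := (0, 0, x))
  have h3 : 0 < x vΓ₁ := hx.1.trans hx.2.1
  refine ContDiffAt.div (by fun_prop) (by fun_prop) ?_
  simp only [relΓ₂_zero]
  positivity

theorem contDiffAt_cosIncl₂ (hδ₁ : 0 < δ₁) : ContDiffAt ℝ ⊤ (cosIncl₂ δ₁) (0, 0, x) := by
  have h1 := (contDiff_relΨ₁ δ₁).contDiffAt (x := (0, 0, x))
  have h2 := (contDiff_relΓ₂ δ₁).contDiffAt (x := (0, 0, x))
  refine ContDiffAt.div (by fun_prop) (by fun_prop) ?_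
  simp only [relΓ₂_zero, relΨ₁_zero]
  positivity

theorem contDiffAt_sinIncl₂ (hδ₁ : 0 < δ₁) (hx : x ∈ domain L₁) :
    ContDiffAt ℝ ⊤ (sinIncl₂ δ₁) (0, 0, x) := by
  have h1 := (contDiff_relΨ₁ δ₁).contDiffAt (x := (0, 0, x))
  have h2 := contDiffAt_cosIncl₁₂ hδ₁ hx
  have h3 : (x vΓ₂ / x vΓ₁) ^ 2 < 1 :=
    ratio_sq_lt_one (hx.1.trans hx.2.1) (by rw [abs_of_pos hx.1]; exact hx.2.1)
  have h4 : ContDiffAt ℝ ⊤ (fun z => √(1 - cosIncl₁₂ δ₁ z ^ 2)) (0, 0, x) := by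
    refine (contDiffAt_const.sub (h2.pow 2)).sqrt ?_
    simp only [cosIncl₁₂_zero hδ₁]
    linarith
  refine ContDiffAt.mul (by fun_prop) (ContDiffAt.div (by fun_prop) h1 ?_)
  rw [relΨ₁_zero]
  exact hδ₁.ne'

theorem contDiffAt_cosIncl₃ (hδ₁ : 0 < δ₁) (hδ₂ : 0 < δ₂) :
    ContDiffAt ℝ ⊤ (cosIncl₃ δ₁ δ₂ δ₃) (0, 0, x) := by
  have h1 := (contDiff_relΨ₁ δ₁).contDiffAt (x := (0, 0, x))
  have h2 := (contDiff_relΓ₃ δ₂ δ₃).contDiffAt (x := (0, 0, x))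
  have h3 := (contDiff_relΔ δ₃).contDiffAt (x := (0, 0, x))
  refine ContDiffAt.div (by fun_prop) (by fun_prop) ?_
  simp only [relΓ₃_zero, relΨ₁_zero, zero_mul, sub_zero]
  positivity

theorem contDiffAt_sinIncl₃ (hδ₁ : 0 < δ₁) (hδ₂ : 0 < δ₂) (hδ₃ : |δ₃| < δ₁) :
    ContDiffAt ℝ ⊤ (sinIncl₃ δ₁ δ₂ δ₃) (0, 0, x) := by
  refine (contDiffAt_const.sub ((contDiffAt_cosIncl₃ hδ₁ hδ₂).pow 2)).sqrt ?_
  simp only [cosIncl₃_zero_zero hδ₂]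
  linarith [ratio_sq_lt_one hδ₁ hδ₃]

/-- The four inner products are analytic functions of the parameters. -/
structure ContDiffDots (d : Param → AxisDots) (z₀ : Param) : Prop where
  pp : ContDiffAt ℝ ⊤ (fun z => (d z).pp) z₀
  pq : ContDiffAt ℝ ⊤ (fun z => (d z).pq) z₀
  qp : ContDiffAt ℝ ⊤ (fun z => (d z).qp) z₀
  qq : ContDiffAt ℝ ⊤ (fun z => (d z).qq) z₀

theorem ContDiffDots.rot {d : Param → AxisDots} {z₀ : Param} (h : ContDiffDots d z₀)
    {θ θ' : Param → ℝ} (hθ : ContDiffAt ℝ ⊤ θ z₀) (hθ' : ContDiffAt ℝ ⊤ θ' z₀) :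
    ContDiffDots (fun z => (d z).rot (θ z) (θ' z)) z₀ := by
  obtain ⟨h1, h2, h3, h4⟩ := h
  have c := Real.contDiff_cos.contDiffAt.comp z₀ hθ
  have s := Real.contDiff_sin.contDiffAt.comp z₀ hθ
  have c' := Real.contDiff_cos.contDiffAt.comp z₀ hθ'
  have s' := Real.contDiff_sin.contDiffAt.comp z₀ hθ'
  exact ⟨(((c.mul h1).add (s.mul h3)).mul c').add (((c.mul h2).add (s.mul h4)).mul s'),
    (((c.mul h1).add (s.mul h3)).mul s').neg.add (((c.mul h2).add (s.mul h4)).mul c'),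
    (((s.neg.mul h1).add (c.mul h3)).mul c').add (((s.neg.mul h2).add (c.mul h4)).mul s'),
    (((s.neg.mul h1).add (c.mul h3)).mul s').neg.add (((s.neg.mul h2).add (c.mul h4)).mul c')⟩

theorem ContDiffDots.turn {d : Param → AxisDots} {z₀ : Param} (h : ContDiffDots d z₀)
    (v : Fin 8) : ContDiffDots (fun z => (d z).rot 0 (-z.2.2 v)) z₀ :=
  h.rot (θ := fun _ => 0) contDiffAt_const (contDiff_phase v).neg.contDiffAt

theorem contDiffDots₁₂ (hδ₁ : 0 < δ₁) (hx : x ∈ domain L₁) :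
    ContDiffDots (dots₁₂ δ₁) (0, 0, x) :=
  ContDiffDots.rot (d := fun z => commonNodeDots (cosIncl₁₂ δ₁ z))
    (θ := fun z => z.2.2 vγ₁) (θ' := fun _ => 0)
    ⟨contDiffAt_const, contDiffAt_const, contDiffAt_const, contDiffAt_cosIncl₁₂ hδ₁ hx⟩
    (contDiff_phase _).contDiffAt contDiffAt_const

theorem contDiffDots₂₃ (hδ₁ : 0 < δ₁) (hδ₂ : 0 < δ₂) (hδ₃ : |δ₃| < δ₁) (hx : x ∈ domain L₁) :
    ContDiffDots (dots₂₃ δ₁ δ₂ δ₃) (0, 0, x) := by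
  have a := (contDiff_phase vψ₁).contDiffAt (x := (0, 0, x))
  have b := (contDiff_phase vγ₂).contDiffAt (x := (0, 0, x))
  have c := Real.contDiff_cos.contDiffAt.comp _ (a.add b)
  have s := Real.contDiff_sin.contDiffAt.comp _ (a.add b)
  have c₂ := contDiffAt_cosIncl₂ (x := x) hδ₁
  have c₃ := contDiffAt_cosIncl₃ (x := x) (δ₃ := δ₃) hδ₁ hδ₂
  have s₂ := contDiffAt_sinIncl₂ hδ₁ hx
  have s₃ := contDiffAt_sinIncl₃ (x := x) hδ₁ hδ₂ hδ₃
  exact ContDiffDots.rot (d := fun z => twoNodesDots (z.2.2 vψ₁ + z.2.2 vγ₂) (cosIncl₂ δ₁ z)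
      (cosIncl₃ δ₁ δ₂ δ₃ z) (sinIncl₂ δ₁ z) (sinIncl₃ δ₁ δ₂ δ₃ z))
    (θ := fun z => -z.2.2 vγ₂) (θ' := fun _ => 0) ⟨c, c₃.mul s, c₂.neg.mul s, ((c₂.mul c₃).mul c).add (s₂.mul s₃)⟩
    b.neg contDiffAt_const

theorem contDiffAt_quadNorm {d : Param → AxisDots} {w w' : Param → ℝ} {z₀ : Param}
    (hd : ContDiffDots d z₀) (hw : ContDiffAt ℝ ⊤ w z₀) (hw' : ContDiffAt ℝ ⊤ w' z₀)
    (h : w' z₀ ≠ 0) : ContDiffAt ℝ ⊤ (fun z => quadNorm (d z) (w z) (w' z)) z₀ := by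
  obtain ⟨h1, h2, h3, h4⟩ := hd
  unfold quadNorm
  refine ContDiffAt.mul (ContDiffAt.div (by fun_prop) (by fun_prop) (by simp [h])) ?_
  fun_prop

theorem contDiffAt_ecc {w : Param → ℝ} {z₀ : Param} (hw : ContDiffAt ℝ ⊤ w z₀)
    (h0 : 0 < w z₀) (h1 : w z₀ < 1) : ContDiffAt ℝ ⊤ (fun z => √(1 - w z ^ 2)) z₀ := by
  refine (contDiffAt_const.sub (hw.pow 2)).sqrt ?_
  have : w z₀ ^ 2 < 1 := by nlinarith
  linarith

theorem contDiffAt_octNorm {d : Param → AxisDots} {w w' : Param → ℝ} {z₀ : Param}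
    (hd : ContDiffDots d z₀) (hw : ContDiffAt ℝ ⊤ w z₀) (hw' : ContDiffAt ℝ ⊤ w' z₀)
    (h0 : 0 < w z₀) (h1 : w z₀ < 1) (h0' : 0 < w' z₀) (h1' : w' z₀ < 1) :
    ContDiffAt ℝ ⊤ (fun z => octNorm (d z) (w z) (w' z)) z₀ := by
  obtain ⟨a1, a2, a3, a4⟩ := hd
  have e := contDiffAt_ecc hw h0 h1
  have e' := contDiffAt_ecc hw' h0' h1'
  unfold octNorm
  refine ContDiffAt.mul (ContDiffAt.div (by fun_prop) (by fun_prop) (by simp [h0'.ne'])) ?_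
  fun_prop

theorem contDiffAt_relΓ₁ : ContDiffAt ℝ ⊤ (fun z : Param => z.2.2 vΓ₁ / L₁) (0, 0, x) :=
  (contDiff_phase _).contDiffAt.div_const _

theorem analyticAt_quadFun₁₂ (hδ₁ : 0 < δ₁) (hx : x ∈ domain L₁) :
    AnalyticAt ℝ (quadFun₁₂ m L₁ δ₁) (0, 0, x) := by
  have h := contDiffAt_quadNorm (contDiffDots₁₂ hδ₁ hx) (contDiffAt_relΓ₁ (L₁ := L₁))
    (contDiff_relΓ₂ δ₁).contDiffAt (by rw [relΓ₂_zero]; exact hδ₁.ne')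
  exact (contDiffAt_const.mul (h.add contDiffAt_const)).analyticAt

theorem analyticAt_octFun₁₂ (hL : 0 < L₁) (hδ₁ : 0 < δ₁ ∧ δ₁ < 1) (hx : x ∈ domain L₁) :
    AnalyticAt ℝ (octFun₁₂ m L₁ δ₁) (0, 0, x) := by
  have h := contDiffAt_octNorm ((contDiffDots₁₂ hδ₁.1 hx).turn vγ₂) (contDiffAt_relΓ₁ (L₁ := L₁))
    (contDiff_relΓ₂ δ₁).contDiffAt (relΓ₁_mem (z := (0, 0, x)) hL hx).1
    (relΓ₁_mem (z := (0, 0, x)) hL hx).2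
    (by rw [relΓ₂_zero]; exact hδ₁.1) (by rw [relΓ₂_zero]; exact hδ₁.2)
  exact (contDiffAt_const.mul h).analyticAt

theorem analyticAt_quadFun₂₃ (hδ₁ : 0 < δ₁) (hδ₂ : 0 < δ₂) (hδ₃ : |δ₃| < δ₁)
    (hx : x ∈ domain L₁) : AnalyticAt ℝ (quadFun₂₃ m δ₁ δ₂ δ₃) (0, 0, x) := by
  have h := contDiffAt_quadNorm (contDiffDots₂₃ hδ₁ hδ₂ hδ₃ hx) (contDiff_relΓ₂ δ₁).contDiffAt
    (contDiff_relΓ₃ δ₂ δ₃).contDiffAt (by rw [relΓ₃_zero]; simpa using hδ₂.ne')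
  exact (contDiffAt_const.mul (h.sub contDiffAt_const)).analyticAt

theorem analyticAt_octFun₂₃ (hδ₁ : 0 < δ₁ ∧ δ₁ < 1) (hδ₂ : 0 < δ₂ ∧ δ₂ < 1) (hδ₃ : |δ₃| < δ₁)
    (hx : x ∈ domain L₁) : AnalyticAt ℝ (octFun₂₃ m δ₁ δ₂ δ₃) (0, 0, x) := by
  have h := contDiffAt_octNorm ((contDiffDots₂₃ hδ₁.1 hδ₂.1 hδ₃ hx).turn vγ₃) (contDiff_relΓ₂ δ₁).contDiffAt
    (contDiff_relΓ₃ δ₂ δ₃).contDiffAt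
    (by rw [relΓ₂_zero]; exact hδ₁.1) (by rw [relΓ₂_zero]; exact hδ₁.2)
    (by rw [relΓ₃_zero]; simpa using hδ₂.1) (by rw [relΓ₃_zero]; simpa using hδ₂.2)
  exact (contDiffAt_const.mul h).analyticAt

theorem abs_ecc_lt_one_of {w : ℝ} (h0 : 0 < w) : |√(1 - w ^ 2)| < 1 := by
  rw [abs_of_nonneg (Real.sqrt_nonneg _)]
  exact sqrt_one_sub_sq_lt_one h0

theorem analyticAt_tailFun₁₂ (hL : 0 < L₁) (hδ₁ : 0 < δ₁ ∧ δ₁ < 1) (hx : x ∈ domain L₁) :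
    AnalyticAt ℝ (tailFun₁₂ m L₁ δ₁) (0, 0, x) := by
  have hd := (contDiffDots₁₂ hδ₁.1 hx).turn vγ₂
  have m₁ := relΓ₁_mem (z := (0, 0, x)) hL hx
  have v₂ : relΓ₂ δ₁ (0, 0, x) = δ₁ := relΓ₂_zero 0
  have e₁ := contDiffAt_ecc (contDiffAt_relΓ₁ (L₁ := L₁) (x := x)) m₁.1 m₁.2
  have e₂ := contDiffAt_ecc (z₀ := (0, 0, x)) (contDiff_relΓ₂ δ₁).contDiffAt (by rw [v₂]; exact hδ₁.1)
    (by rw [v₂]; exact hδ₁.2)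
  have key : ∀ s : ℝ, AnalyticAt ℝ (fun z : Param =>
      multipoleTail √(1 - (z.2.2 vΓ₁ / L₁) ^ 2) √(1 - relΓ₂ δ₁ z ^ 2)
        ((dots₁₂ δ₁ z).rot 0 (-z.2.2 vγ₂))
        (s * (L₁ ^ 2 / kepler m 1 * kepler m 2 * z.1 ^ 2))) (0, 0, x) := fun s =>
    analyticAt_multipoleTail e₁ e₂ (by fun_prop) hd.pp hd.pq hd.qp hd.qq
      (abs_ecc_lt_one_of m₁.1) (abs_ecc_lt_one_of (by rw [v₂]; exact hδ₁.1)) (by simp)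
  exact analyticAt_const.mul ((analyticAt_const.mul (key _)).add (analyticAt_const.mul (key _)))

theorem analyticAt_tailFun₂₃ (hδ₁ : 0 < δ₁ ∧ δ₁ < 1) (hδ₂ : 0 < δ₂ ∧ δ₂ < 1) (hδ₃ : |δ₃| < δ₁)
    (hx : x ∈ domain L₁) : AnalyticAt ℝ (tailFun₂₃ m δ₁ δ₂ δ₃) (0, 0, x) := by
  have hd := (contDiffDots₂₃ hδ₁.1 hδ₂.1 hδ₃ hx).turn vγ₃
  have v₂ : relΓ₂ δ₁ (0, 0, x) = δ₁ := relΓ₂_zero 0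
  have v₃ : relΓ₃ δ₂ δ₃ (0, 0, x) = δ₂ := by simp [relΓ₃_zero]
  have e₂ := contDiffAt_ecc (z₀ := (0, 0, x)) (contDiff_relΓ₂ δ₁).contDiffAt (by rw [v₂]; exact hδ₁.1)
    (by rw [v₂]; exact hδ₁.2)
  have e₃ := contDiffAt_ecc (z₀ := (0, 0, x)) (contDiff_relΓ₃ δ₂ δ₃).contDiffAt (by rw [v₃]; exact hδ₂.1)
    (by rw [v₃]; exact hδ₂.2)
  have key : ∀ s : ℝ, AnalyticAt ℝ (fun z : Param =>
      multipoleTail √(1 - relΓ₂ δ₁ z ^ 2) √(1 - relΓ₃ δ₂ δ₃ z ^ 2)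
        ((dots₂₃ δ₁ δ₂ δ₃ z).rot 0 (-z.2.2 vγ₃))
        (s * (kepler m 3 / kepler m 2 * z.2.1 ^ 2))) (0, 0, x) := fun s =>
    analyticAt_multipoleTail e₂ e₃ (by fun_prop) hd.pp hd.pq hd.qp hd.qq
      (abs_ecc_lt_one_of (by rw [v₂]; exact hδ₁.1)) (abs_ecc_lt_one_of (by rw [v₃]; exact hδ₂.1)) (by simp)
  exact analyticAt_const.mul ((analyticAt_const.mul (key _)).add (analyticAt_const.mul (key _)))

end Analytic

/-! ### Derivatives of the averages and their values at `ε = 0` -/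

/-- The four inner products are differentiable in a real parameter, with derivatives `d'`. -/
structure HasDerivDots (d : ℝ → AxisDots) (d' : AxisDots) (t : ℝ) : Prop where
  pp : HasDerivAt (fun s => (d s).pp) d'.pp t
  pq : HasDerivAt (fun s => (d s).pq) d'.pq t
  qp : HasDerivAt (fun s => (d s).qp) d'.qp t
  qq : HasDerivAt (fun s => (d s).qq) d'.qq t

theorem HasDerivDots.turn {d : ℝ → AxisDots} {d' : AxisDots} {t : ℝ} (h : HasDerivDots d d' t)
    (θ : ℝ) : HasDerivDots (fun s => (d s).rot 0 θ) (d'.rot 0 θ) t := by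
  obtain ⟨h1, h2, h3, h4⟩ := h
  refine ⟨?_, ?_, ?_, ?_⟩ <;>
    simp only [AxisDots.rot, Real.cos_zero, Real.sin_zero, one_mul, zero_mul, add_zero, neg_zero,
      zero_add]
  · exact (h1.mul_const _).add (h2.mul_const _)
  · exact (h1.mul_const _).neg.add (h2.mul_const _)
  · exact (h3.mul_const _).add (h4.mul_const _)
  · exact (h3.mul_const _).neg.add (h4.mul_const _)

theorem hasDerivAt_quadNorm {d : ℝ → AxisDots} {w w' : ℝ → ℝ} {d' : AxisDots} {v v' t : ℝ}
    (hd : HasDerivDots d d' t) (hw : HasDerivAt w v t) (hw' : HasDerivAt w' v' t)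
    (h0 : w' t ≠ 0) : HasDerivAt (fun s => quadNorm (d s) (w s) (w' s))
      (-(3 * v') / (4 * w' t ^ 4) * ((5 / 2 - 2 * w t ^ 2) *
          (3 * ((d t).pp ^ 2 + (d t).pq ^ 2) - 2) +
          w t ^ 2 / 2 * (3 * ((d t).qp ^ 2 + (d t).qq ^ 2) - 2)) +
        1 / (4 * w' t ^ 3) * (-4 * w t * v * (3 * ((d t).pp ^ 2 + (d t).pq ^ 2) - 2) +
          (5 / 2 - 2 * w t ^ 2) * (6 * ((d t).pp * d'.pp + (d t).pq * d'.pq)) +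
          w t * v * (3 * ((d t).qp ^ 2 + (d t).qq ^ 2) - 2) +
          w t ^ 2 / 2 * (6 * ((d t).qp * d'.qp + (d t).qq * d'.qq)))) t := by
  obtain ⟨h1, h2, h3, h4⟩ := hd
  have e := (((((hw.pow 2).const_mul 2).const_sub (5 / 2)).mul
    ((((h1.pow 2).add (h2.pow 2)).const_mul 3).sub_const 2)).add
    (((hw.pow 2).div_const 2).mul ((((h3.pow 2).add (h4.pow 2)).const_mul 3).sub_const 2)))
  have e' := (((hw'.pow 3).const_mul 4).inv (by simpa using h0)).mul e
  have key := e'.congr_of_eventuallyEq (f₁ := fun s => quadNorm (d s) (w s) (w' s))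
    (Eventually.of_forall fun s => by simp [quadNorm])
  refine key.congr_deriv ?_
  simp only [Pi.pow_apply, Pi.mul_apply, Pi.add_apply, Pi.inv_apply]
  field_simp
  ring

/-- The polynomial in the octupole. -/
def octPoly (w : ℝ) (g : AxisDots) : ℝ :=
  g.pp * ((5 * (g.pp ^ 2 + g.pq ^ 2) - 4) * (7 - 4 * w ^ 2) +
      (5 * (g.qp ^ 2 + g.qq ^ 2) - 4) * w ^ 2) +
    10 * g.qp * (g.pp * g.qp + g.pq * g.qq) * w ^ 2

/-- The differential of `octPoly`, in the direction `v` of the variable `w`. -/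
def octPolyDerivW (w v : ℝ) (g : AxisDots) : ℝ :=
  g.pp * (-(5 * (g.pp ^ 2 + g.pq ^ 2) - 4) * (8 * w * v) +
      (5 * (g.qp ^ 2 + g.qq ^ 2) - 4) * (2 * w * v)) +
    10 * g.qp * (g.pp * g.qp + g.pq * g.qq) * (2 * w * v)

/-- The differential of `octPoly`, in the direction `h` of the inner products. -/
def octPolyDeriv (w : ℝ) (g h : AxisDots) : ℝ :=
  h.pp * ((5 * (g.pp ^ 2 + g.pq ^ 2) - 4) * (7 - 4 * w ^ 2) +
      (5 * (g.qp ^ 2 + g.qq ^ 2) - 4) * w ^ 2) +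
    g.pp * (10 * (g.pp * h.pp + g.pq * h.pq) * (7 - 4 * w ^ 2) +
      10 * (g.qp * h.qp + g.qq * h.qq) * w ^ 2) +
    10 * h.qp * (g.pp * g.qp + g.pq * g.qq) * w ^ 2 +
    10 * g.qp * (h.pp * g.qp + g.pp * h.qp + h.pq * g.qq + g.pq * h.qq) * w ^ 2

theorem octNorm_eq (g : AxisDots) (w w' : ℝ) : octNorm g w w' =
    -(15 * √(1 - w' ^ 2)) / (64 * w' ^ 5) * (√(1 - w ^ 2) * octPoly w g) := by
  rw [octNorm, octPoly]
  ring

theorem hasDerivAt_octPoly {d : ℝ → AxisDots} {w : ℝ → ℝ} {d' : AxisDots} {v t : ℝ}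
    (hd : HasDerivDots d d' t) (hw : HasDerivAt w v t) :
    HasDerivAt (fun s => octPoly (w s) (d s))
      (octPolyDerivW (w t) v (d t) + octPolyDeriv (w t) (d t) d') t := by
  obtain ⟨h1, h2, h3, h4⟩ := hd
  have P := (((h1.pow 2).add (h2.pow 2)).const_mul 5).sub_const 4
  have Q := (((h3.pow 2).add (h4.pow 2)).const_mul 5).sub_const 4
  have W := hw.pow 2
  have e := (h1.mul ((P.mul ((W.const_mul 4).const_sub 7)).add (Q.mul W))).add
    (((h3.const_mul 10).mul ((h1.mul h3).add (h2.mul h4))).mul W)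
  have key := e.congr_of_eventuallyEq (f₁ := fun s => octPoly (w s) (d s))
    (Eventually.of_forall fun s => rfl)
  refine key.congr_deriv ?_
  simp only [Pi.pow_apply, Pi.mul_apply, Pi.add_apply, octPolyDeriv, octPolyDerivW]
  ring

section Values

variable {m : Fin 4 → ℝ} {L₁ δ₁ δ₂ δ₃ : ℝ} {x : Phase}

theorem dots₁₂_eq (z : Param) : dots₁₂ δ₁ z =
    ⟨Real.cos (z.2.2 vγ₁), Real.sin (z.2.2 vγ₁) * cosIncl₁₂ δ₁ z, -Real.sin (z.2.2 vγ₁),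
      Real.cos (z.2.2 vγ₁) * cosIncl₁₂ δ₁ z⟩ := by
  simp [dots₁₂, AxisDots.rot, commonNodeDots]

theorem dots₂₃_eq (z : Param) : dots₂₃ δ₁ δ₂ δ₃ z =
    ⟨Real.cos (z.2.2 vγ₂) * Real.cos (z.2.2 vψ₁ + z.2.2 vγ₂)
        + cosIncl₂ δ₁ z * (Real.sin (z.2.2 vγ₂) * Real.sin (z.2.2 vψ₁ + z.2.2 vγ₂)),
      cosIncl₃ δ₁ δ₂ δ₃ z * (Real.cos (z.2.2 vγ₂) * Real.sin (z.2.2 vψ₁ + z.2.2 vγ₂)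
        - cosIncl₂ δ₁ z * (Real.sin (z.2.2 vγ₂) * Real.cos (z.2.2 vψ₁ + z.2.2 vγ₂)))
        - Real.sin (z.2.2 vγ₂) * (sinIncl₂ δ₁ z * sinIncl₃ δ₁ δ₂ δ₃ z),
      Real.sin (z.2.2 vγ₂) * Real.cos (z.2.2 vψ₁ + z.2.2 vγ₂)
        - cosIncl₂ δ₁ z * (Real.cos (z.2.2 vγ₂) * Real.sin (z.2.2 vψ₁ + z.2.2 vγ₂)),
      cosIncl₃ δ₁ δ₂ δ₃ z * (Real.sin (z.2.2 vγ₂) * Real.sin (z.2.2 vψ₁ + z.2.2 vγ₂)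
        + cosIncl₂ δ₁ z * (Real.cos (z.2.2 vγ₂) * Real.cos (z.2.2 vψ₁ + z.2.2 vγ₂)))
        + Real.cos (z.2.2 vγ₂) * (sinIncl₂ δ₁ z * sinIncl₃ δ₁ δ₂ δ₃ z)⟩ := by
  simp only [dots₂₃, AxisDots.rot, twoNodesDots, Real.cos_neg, Real.sin_neg, Real.cos_zero,
    Real.sin_zero, AxisDots.mk.injEq]
  refine ⟨?_, ?_, ?_, ?_⟩ <;> ring

theorem trig_turn (ψ γ : ℝ) :
    Real.cos γ * Real.cos (ψ + γ) + Real.sin γ * Real.sin (ψ + γ) = Real.cos ψ ∧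
    Real.cos γ * Real.sin (ψ + γ) - Real.sin γ * Real.cos (ψ + γ) = Real.sin ψ := by
  have h := Real.sin_sq_add_cos_sq γ
  rw [Real.cos_add, Real.sin_add]
  constructor
  · linear_combination Real.cos ψ * h
  · linear_combination Real.sin ψ * h

/-- The inner products of the axes of an ellipse with the frame of a second one, for nodes at the
angle `ψ` and a plane inclined with cosine `c`. -/
def nodeDots (c ψ : ℝ) : AxisDots :=
  ⟨Real.cos ψ, c * Real.sin ψ, -Real.sin ψ, c * Real.cos ψ⟩

/-- At `ε = 0` the first two planets are replaced by one in the plane orthogonal to their total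
angular momentum. -/
theorem dots₂₃_zero (hδ₁ : 0 < δ₁) (μ : ℝ) : dots₂₃ δ₁ δ₂ δ₃ (0, μ, x) =
    nodeDots (cosIncl₃ δ₁ δ₂ δ₃ (0, μ, x)) (x vψ₁) := by
  obtain ⟨h1, h2⟩ := trig_turn (x vψ₁) (x vγ₂)
  simp only [dots₂₃_eq, cosIncl₂_zero hδ₁, sinIncl₂_zero, nodeDots, AxisDots.mk.injEq]
  refine ⟨?_, ?_, ?_, ?_⟩
  · linear_combination h1
  · linear_combination cosIncl₃ δ₁ δ₂ δ₃ (0, μ, x) * h2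
  · linear_combination -h2
  · linear_combination cosIncl₃ δ₁ δ₂ δ₃ (0, μ, x) * h1

theorem cosIncl₃_zero (μ : ℝ) : cosIncl₃ δ₁ δ₂ δ₃ (0, μ, x) =
    (2 * δ₂ * δ₃ - μ * (δ₃ ^ 2 + δ₁ ^ 2)) / (2 * δ₁ * (δ₂ - μ * δ₃)) := by
  simp only [cosIncl₃, relΔ_zero, relΨ₁_zero, relΓ₃_zero]

/-- The value at `ε = 0` gives `H_0^{12}`. -/
theorem quadFun₁₂_zero (hm : ∀ i, 0 < m i) (hL : 0 < L₁) (hδ₁ : 0 < δ₁) (hx : x ∈ domain L₁) :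
    quadFun₁₂ m L₁ δ₁ (0, 0, x) = alpha012 m L₁ δ₁ * H012 L₁ x := by
  have h1 : 0 < x vΓ₁ := hx.1.trans hx.2.1
  have a := redMass_pos hm 1
  have b := totalMass_pos hm 1
  simp only [quadFun₁₂, dots₁₂_eq, cosIncl₁₂_zero hδ₁, relΓ₂_zero, quadNorm, alpha012, H012,
    kepler, neg_sq, mul_pow, div_pow, Real.cos_sq' (x vγ₁)]
  generalize Real.sin (x vγ₁) = s
  field_simp
  ring

/-- The value at `ε = 0` gives `H_2^{12}`. -/
theorem octFun₁₂_zero (hm : ∀ i, 0 < m i) (hL : 0 < L₁) (hδ₁ : 0 < δ₁) (hx : x ∈ domain L₁) :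
    octFun₁₂ m L₁ δ₁ (0, 0, x) = alpha212 m L₁ δ₁ * H212 L₁ x := by
  have h1 : 0 < x vΓ₁ := hx.1.trans hx.2.1
  have a := redMass_pos hm 1
  have b := totalMass_pos hm 1
  have hs := Real.sin_sq_add_cos_sq (x vγ₁)
  have hk : octPoly (x vΓ₁ / L₁) ((dots₁₂ δ₁ (0, 0, x)).rot 0 (-x vγ₂)) =
      Real.cos (x vγ₁) * Real.cos (x vγ₂) *
        (x vΓ₁ ^ 2 / L₁ ^ 2 *
            (5 * (1 - x vΓ₂ ^ 2 / x vΓ₁ ^ 2) * (6 - 7 * Real.cos (x vγ₁) ^ 2) - 3)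
          - 35 * Real.sin (x vγ₁) ^ 2 * (1 - x vΓ₂ ^ 2 / x vΓ₁ ^ 2) + 7)
      - x vΓ₂ / x vΓ₁ * Real.sin (x vγ₁) * Real.sin (x vγ₂) *
        (x vΓ₁ ^ 2 / L₁ ^ 2 *
            (5 * (1 - x vΓ₂ ^ 2 / x vΓ₁ ^ 2) * (4 - 7 * Real.cos (x vγ₁) ^ 2) - 3)
          - 35 * Real.sin (x vγ₁) ^ 2 * (1 - x vΓ₂ ^ 2 / x vΓ₁ ^ 2) + 7) := by
    have hs2 := Real.sin_sq_add_cos_sq (x vγ₂)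
    rw [← div_pow, ← div_pow]
    simp only [octPoly, AxisDots.rot, dots₁₂_eq, cosIncl₁₂_zero hδ₁, Real.cos_zero, Real.sin_zero,
      Real.cos_neg, Real.sin_neg]
    generalize Real.cos (x vγ₁) = c at *
    generalize Real.sin (x vγ₁) = s at *
    generalize Real.cos (x vγ₂) = c' at *
    generalize Real.sin (x vγ₂) = s' at *
    generalize x vΓ₂ / x vΓ₁ = r
    generalize x vΓ₁ / L₁ = k
    grind
  rw [octFun₁₂, octNorm_eq, H212, ← hk, alpha212, relΓ₂_zero, kepler, kepler]
  simp only [div_pow]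
  generalize octPoly _ _ = q
  field_simp

/-- The value at `ε = μ = 0` gives `cos² ψ̃₁`. -/
theorem quadFun₂₃_zero (hδ₁ : 0 < δ₁) (hδ₂ : 0 < δ₂) :
    quadFun₂₃ m δ₁ δ₂ δ₃ (0, 0, x) = alpha023 m δ₁ δ₂ δ₃ * H023 x := by
  simp only [quadFun₂₃, dots₂₃_zero hδ₁, nodeDots, cosIncl₃_zero_zero hδ₂, relΓ₂_zero, relΓ₃_zero,
      quadNorm,
    alpha023, H023, quadConst₂₃, neg_sq, mul_pow, Real.sin_sq, zero_mul, sub_zero]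
  field_simp
  ring

/-- The value at `ε = μ = 0` gives `H_3^{23}`. -/
theorem octFun₂₃_zero (hδ₁ : 0 < δ₁) (hδ₂ : 0 < δ₂) :
    octFun₂₃ m δ₁ δ₂ δ₃ (0, 0, x) = alpha323 m δ₁ δ₂ * H323 δ₁ δ₃ x := by
  have hk : octPoly δ₁ ((dots₂₃ δ₁ δ₂ δ₃ (0, 0, x)).rot 0 (-x vγ₃)) = H323 δ₁ δ₃ x := by
    have hs := Real.sin_sq_add_cos_sq (x vψ₁)
    have hs3 := Real.sin_sq_add_cos_sq (x vγ₃)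
    simp only [H323, octPoly, AxisDots.rot, dots₂₃_zero hδ₁, nodeDots, cosIncl₃_zero_zero hδ₂,
      Real.cos_zero,
      Real.sin_zero, Real.cos_neg, Real.sin_neg, Real.cos_add, Real.cos_sub, Real.cos_three_mul,
      Real.sin_three_mul, nu0, nu1, nu2, nu3]
    obtain ⟨r, hr⟩ : ∃ r, δ₃ = δ₁ * r := ⟨δ₃ / δ₁, by field_simp⟩
    rw [hr, mul_div_cancel_left₀ _ hδ₁.ne']
    generalize Real.cos (x vψ₁) = c at *
    generalize Real.sin (x vψ₁) = s at *
    generalize Real.cos (x vγ₃) = c' at *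
    generalize Real.sin (x vγ₃) = s' at *
    field_simp
    grind
  rw [octFun₂₃, octNorm_eq, relΓ₂_zero, hk, relΓ₃_zero, alpha323]
  simp only [zero_mul, sub_zero]
  ring

end Values

section Derivatives

variable {m : Fin 4 → ℝ} {L₁ δ₁ δ₂ δ₃ : ℝ} {x : Phase}

theorem hasDerivAt_relΨ₁ : HasDerivAt (fun ε => relΨ₁ δ₁ (ε, 0, x)) (x vΨ₁) 0 := by
  simpa [relΨ₁] using ((hasDerivAt_id (0 : ℝ)).mul_const (x vΨ₁)).const_add δ₁

theorem hasDerivAt_relΓ₂ : HasDerivAt (fun ε => relΓ₂ δ₁ (ε, 0, x)) (x vΨ₁ - x vΓ₂) 0 := by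
  have key := (hasDerivAt_relΨ₁.sub ((hasDerivAt_id (0 : ℝ)).mul_const (x vΓ₂))).congr_of_eventuallyEq
    (f₁ := fun ε => relΓ₂ δ₁ (ε, 0, x)) (Eventually.of_forall fun ε => rfl)
  exact key.congr_deriv (by rw [one_mul])

theorem hasDerivAt_relΔ : HasDerivAt (fun ε => relΔ δ₃ (ε, 0, x)) (x vΓ₃) 0 := by
  simpa [relΔ] using ((hasDerivAt_id (0 : ℝ)).mul_const (x vΓ₃)).const_add δ₃

theorem relΓ₃_of_zero (ε : ℝ) : relΓ₃ δ₂ δ₃ (ε, 0, x) = δ₂ := by simp [relΓ₃]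

theorem hasDerivAt_cosIncl₁₂ (hδ₁ : 0 < δ₁) (hx : x ∈ domain L₁) :
    HasDerivAt (fun ε => cosIncl₁₂ δ₁ (ε, 0, x))
      ((x vΓ₂ ^ 2 - x vΓ₁ ^ 2) / (2 * x vΓ₁ * δ₁)) 0 := by
  have h3 : 0 < x vΓ₁ := hx.1.trans hx.2.1
  have hN := ((hasDerivAt_relΨ₁ (δ₁ := δ₁) (x := x)).const_mul 2).mul_const (x vΓ₂) |>.sub
    ((hasDerivAt_id (0 : ℝ)).mul_const (x vΓ₂ ^ 2 + x vΓ₁ ^ 2))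
  have hD := (hasDerivAt_relΓ₂ (δ₁ := δ₁) (x := x)).const_mul (2 * x vΓ₁)
  have key := (hN.div hD (by simp only [relΓ₂_zero]; positivity)).congr_of_eventuallyEq
    (f₁ := fun ε => cosIncl₁₂ δ₁ (ε, 0, x)) (Eventually.of_forall fun ε => rfl)
  refine key.congr_deriv ?_
  simp only [Pi.sub_apply, relΓ₂_zero, relΨ₁_zero, id]
  field_simp
  ring

theorem hasDerivAt_cosIncl₂ (hδ₁ : 0 < δ₁) :
    HasDerivAt (fun ε => cosIncl₂ δ₁ (ε, 0, x)) 0 0 := by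
  have h1 := hasDerivAt_relΨ₁ (δ₁ := δ₁) (x := x)
  have h2 := hasDerivAt_relΓ₂ (δ₁ := δ₁) (x := x)
  have hN := ((h1.pow 2).add (h2.pow 2)).sub
    (((hasDerivAt_id (0 : ℝ)).pow 2).mul_const (x vΓ₁ ^ 2))
  have hD := (h1.const_mul 2).mul h2
  have key := (hN.div hD (by
    simp only [Pi.mul_apply, relΓ₂_zero, relΨ₁_zero]; positivity)).congr_of_eventuallyEq
    (f₁ := fun ε => cosIncl₂ δ₁ (ε, 0, x)) (Eventually.of_forall fun ε => rfl)
  refine key.congr_deriv ?_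
  simp only [Pi.sub_apply, Pi.add_apply, Pi.mul_apply, Pi.pow_apply, relΓ₂_zero, relΨ₁_zero, id]
  field_simp
  ring

theorem hasDerivAt_cosIncl₃ (hδ₁ : 0 < δ₁) (hδ₂ : 0 < δ₂) :
    HasDerivAt (fun ε => cosIncl₃ δ₁ δ₂ δ₃ (ε, 0, x))
      ((x vΓ₃ * δ₁ - δ₃ * x vΨ₁) / δ₁ ^ 2) 0 := by
  have h1 := hasDerivAt_relΨ₁ (δ₁ := δ₁) (x := x)
  have h2 := hasDerivAt_relΔ (δ₃ := δ₃) (x := x)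
  have key := (h2.div h1 (by rw [relΨ₁_zero]; exact hδ₁.ne')).congr_of_eventuallyEq
    (f₁ := fun ε => cosIncl₃ δ₁ δ₂ δ₃ (ε, 0, x)) (Eventually.of_forall fun ε => by
      simp only [cosIncl₃, relΓ₃_of_zero, zero_mul, sub_zero, Pi.div_apply]
      rw [show 2 * δ₂ * relΔ δ₃ (ε, 0, x) = (2 * δ₂) * relΔ δ₃ (ε, 0, x) by ring,
        show 2 * relΨ₁ δ₁ (ε, 0, x) * δ₂ = (2 * δ₂) * relΨ₁ δ₁ (ε, 0, x) by ring,
        mul_div_mul_left _ _ (by positivity : (2 * δ₂) ≠ 0)])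
  refine key.congr_deriv ?_
  simp only [relΔ_zero, relΨ₁_zero]

theorem exists_hasDerivAt_line {f : Param → ℝ} (hf : ContDiffAt ℝ ⊤ f (0, 0, x)) :
    ∃ d, HasDerivAt (fun ε => f (ε, 0, x)) d 0 := by
  have h1 : HasDerivAt (fun ε : ℝ => ((ε, 0, x) : Param)) unitε 0 :=
    (hasDerivAt_id (0 : ℝ)).prodMk (hasDerivAt_const (0 : ℝ) ((0, x) : ℝ × Phase))
  exact ⟨_, (hf.differentiableAt (by simp)).hasFDerivAt.comp_hasDerivAt 0 h1⟩

theorem hasDerivAt_sinIncl₂ (hδ₁ : 0 < δ₁) (hx : x ∈ domain L₁) :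
    HasDerivAt (fun ε => sinIncl₂ δ₁ (ε, 0, x)) (√(x vΓ₁ ^ 2 - x vΓ₂ ^ 2) / δ₁) 0 := by
  have h0 : 0 < x vΓ₁ := hx.1.trans hx.2.1
  have h1 := hasDerivAt_relΨ₁ (δ₁ := δ₁) (x := x)
  have h2 := hasDerivAt_cosIncl₁₂ hδ₁ hx
  have h3 : (x vΓ₂ / x vΓ₁) ^ 2 < 1 :=
    ratio_sq_lt_one h0 (by rw [abs_of_pos hx.1]; exact hx.2.1)
  have h4 := ((h2.pow 2).const_sub 1).sqrt (by
    simp only [Pi.pow_apply, cosIncl₁₂_zero hδ₁]; linarith)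
  have h5 := (h4.const_mul (x vΓ₁)).div h1 (by rw [relΨ₁_zero]; exact hδ₁.ne')
  have key := ((hasDerivAt_id (0 : ℝ)).mul h5).congr_of_eventuallyEq
    (f₁ := fun ε => sinIncl₂ δ₁ (ε, 0, x)) (Eventually.of_forall fun ε => rfl)
  refine key.congr_deriv ?_
  rw [id, zero_mul, add_zero, one_mul]
  simp only [Pi.div_apply, Pi.pow_apply, cosIncl₁₂_zero hδ₁, relΨ₁_zero]
  congr 1
  rw [show x vΓ₁ ^ 2 - x vΓ₂ ^ 2 = x vΓ₁ ^ 2 * (1 - (x vΓ₂ / x vΓ₁) ^ 2) by field_simp,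
    Real.sqrt_mul (sq_nonneg _), Real.sqrt_sq h0.le]

theorem sinIncl₃_zero_zero (hδ₁ : 0 < δ₁) (hδ₂ : 0 < δ₂) :
    sinIncl₃ δ₁ δ₂ δ₃ (0, 0, x) = √(δ₁ ^ 2 - δ₃ ^ 2) / δ₁ := by
  rw [sinIncl₃, cosIncl₃_zero_zero hδ₂,
    show 1 - (δ₃ / δ₁) ^ 2 = (δ₁ ^ 2 - δ₃ ^ 2) / δ₁ ^ 2 by field_simp,
    Real.sqrt_div' _ (sq_nonneg _), Real.sqrt_sq hδ₁.le]

theorem hasDerivDots₁₂ (hδ₁ : 0 < δ₁) (hx : x ∈ domain L₁) :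
    HasDerivDots (fun ε => dots₁₂ δ₁ (ε, 0, x))
      ⟨0, Real.sin (x vγ₁) * ((x vΓ₂ ^ 2 - x vΓ₁ ^ 2) / (2 * x vΓ₁ * δ₁)), 0,
        Real.cos (x vγ₁) * ((x vΓ₂ ^ 2 - x vΓ₁ ^ 2) / (2 * x vΓ₁ * δ₁))⟩ 0 := by
  have h := hasDerivAt_cosIncl₁₂ hδ₁ hx
  simp only [dots₁₂_eq]
  exact ⟨hasDerivAt_const _ _, h.const_mul _, hasDerivAt_const _ _, h.const_mul _⟩

/-- The derivative of the inner products of the axes of the second ellipse with the frame of the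
third one, when the cosine of the inclination of the third plane changes with velocity `a` and the
second plane is tilted with velocity `b`; `γ` determines the pericenter of the second ellipse. -/
def tiltDots (a b ψ γ : ℝ) : AxisDots :=
  ⟨0, a * Real.sin ψ - b * Real.sin γ, 0, a * Real.cos ψ + b * Real.cos γ⟩

theorem hasDerivDots₂₃ (hδ₁ : 0 < δ₁) (hδ₂ : 0 < δ₂) (hδ₃ : |δ₃| < δ₁) (hx : x ∈ domain L₁) :
    HasDerivDots (fun ε => dots₂₃ δ₁ δ₂ δ₃ (ε, 0, x))
      (tiltDots ((x vΓ₃ * δ₁ - δ₃ * x vΨ₁) / δ₁ ^ 2)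
        (√(x vΓ₁ ^ 2 - x vΓ₂ ^ 2) / δ₁ * (√(δ₁ ^ 2 - δ₃ ^ 2) / δ₁)) (x vψ₁) (x vγ₂)) 0 := by
  obtain ⟨t1, t2⟩ := trig_turn (x vψ₁) (x vγ₂)
  have c₂ := hasDerivAt_cosIncl₂ (x := x) hδ₁
  have c₃ := hasDerivAt_cosIncl₃ (x := x) (δ₃ := δ₃) hδ₁ hδ₂
  have s₂ := hasDerivAt_sinIncl₂ hδ₁ hx
  obtain ⟨ds₃, s₃⟩ := exists_hasDerivAt_line (contDiffAt_sinIncl₃ (x := x) hδ₁ hδ₂ hδ₃)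
  have ss := s₂.mul s₃
  simp only [dots₂₃_eq, tiltDots]
  refine ⟨?_, ?_, ?_, ?_⟩
  · exact ((c₂.mul_const _).const_add _).congr_deriv (by ring)
  · refine ((c₃.mul ((c₂.mul_const _).const_sub _)).sub (ss.const_mul _)).congr_deriv ?_
    simp only [cosIncl₂_zero hδ₁, sinIncl₂_zero, sinIncl₃_zero_zero hδ₁ hδ₂]
    rw [one_mul, t2]
    ring
  · exact ((c₂.mul_const _).const_sub _).congr_deriv (by ring)
  · refine ((c₃.mul ((c₂.mul_const _).const_add _)).add (ss.const_mul _)).congr_deriv ?_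
    simp only [cosIncl₂_zero hδ₁, sinIncl₂_zero, sinIncl₃_zero_zero hδ₁ hδ₂]
    rw [one_mul, add_comm (Real.sin (x vγ₂) * _), t1]
    ring

/-- The derivative at `ε = 0` gives `H_1^{12}`. -/
theorem hasDerivAt_quadFun₁₂ (hm : ∀ i, 0 < m i) (hL : 0 < L₁) (hδ₁ : 0 < δ₁)
    (hx : x ∈ domain L₁) :
    HasDerivAt (fun ε => quadFun₁₂ m L₁ δ₁ (ε, 0, x)) (alpha112 m L₁ δ₁ * H112 L₁ x) 0 := by
  have h1 : 0 < x vΓ₁ := hx.1.trans hx.2.1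
  have a := redMass_pos hm 1
  have b := totalMass_pos hm 1
  have key := ((hasDerivAt_quadNorm (hasDerivDots₁₂ hδ₁ hx)
    (hasDerivAt_const (0 : ℝ) (x vΓ₁ / L₁)) (hasDerivAt_relΓ₂ (δ₁ := δ₁) (x := x))
    (by rw [relΓ₂_zero]; exact hδ₁.ne')).add_const (1 / (8 * δ₁ ^ 3))).const_mul
    ((L₁ ^ 2 / kepler m 1) ^ 2 * kepler m 2 ^ 3)
  refine key.congr_deriv ?_
  simp only [dots₁₂_eq, cosIncl₁₂_zero hδ₁, relΓ₂_zero, alpha112, H112, H012,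
    kepler]
  have hs := Real.sin_sq_add_cos_sq (x vγ₁)
  generalize Real.sin (x vγ₁) = s at *
  generalize Real.cos (x vγ₁) = c at *
  obtain ⟨r, hr⟩ : ∃ r, x vΓ₂ = x vΓ₁ * r := ⟨x vΓ₂ / x vΓ₁, by field_simp⟩
  obtain ⟨k, hk⟩ : ∃ k, x vΓ₁ = L₁ * k := ⟨x vΓ₁ / L₁, by field_simp⟩
  have hk0 : 0 < k := by
    rw [hk] at h1
    exact pos_of_mul_pos_right h1 hL.le
  rw [hr, hk]
  field_simp
  grind

/-- The derivative at `ε = 0` gives `H_2^{23}` and `H̃_3`. -/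
theorem hasDerivAt_quadFun₂₃ (hδ₁ : 0 < δ₁) (hδ₂ : 0 < δ₂) (hδ₃ : |δ₃| < δ₁)
    (hx : x ∈ domain L₁) : HasDerivAt (fun ε => quadFun₂₃ m δ₁ δ₂ δ₃ (ε, 0, x))
      (alpha223 m δ₁ δ₂ δ₃ * H223 δ₁ x + alphaTilde3 m δ₁ δ₂ * Htilde3 δ₁ δ₃ x) 0 := by
  have key := ((hasDerivAt_quadNorm (hasDerivDots₂₃ hδ₁ hδ₂ hδ₃ hx)
    (hasDerivAt_relΓ₂ (δ₁ := δ₁) (x := x)) (hasDerivAt_const (0 : ℝ) δ₂)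
    hδ₂.ne').sub_const (quadConst₂₃ δ₁ δ₂ δ₃)).const_mul (kquad23 m)
  have key' := key.congr_of_eventuallyEq (f₁ := fun ε => quadFun₂₃ m δ₁ δ₂ δ₃ (ε, 0, x))
    (Eventually.of_forall fun ε => by simp only [quadFun₂₃, relΓ₃_of_zero])
  refine key'.congr_deriv ?_
  simp only [dots₂₃_zero hδ₁, nodeDots, cosIncl₃_zero_zero hδ₂, relΓ₂_zero, alpha223, alphaTilde3,
      H223,
    Htilde3, tiltDots]
  have hs := Real.sin_sq_add_cos_sq (x vψ₁)
  generalize Real.sin (x vψ₁) = s at *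
  generalize Real.cos (x vψ₁) = c at *
  generalize √(x vΓ₁ ^ 2 - x vΓ₂ ^ 2) = A
  generalize √(δ₁ ^ 2 - δ₃ ^ 2) = B
  field_simp
  grind

/-- The part of the `ε`-derivative of the octupole of the planets 2 and 3 which does not
contain `γ₁`, `Γ₁`, `γ̃₂`. -/
def octRest₂₃ (m : Fin 4 → ℝ) (δ₁ δ₂ δ₃ : ℝ) (x : Phase) : ℝ :=
  koct23 m * (-(15 * √(1 - δ₂ ^ 2)) / (64 * δ₂ ^ 5)) *
    (-(δ₁ * (x vΨ₁ - x vΓ₂)) / √(1 - δ₁ ^ 2) *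
        octPoly δ₁ ((nodeDots (δ₃ / δ₁) (x vψ₁)).rot 0 (-x vγ₃)) +
      √(1 - δ₁ ^ 2) *
        (octPolyDerivW δ₁ (x vΨ₁ - x vΓ₂) ((nodeDots (δ₃ / δ₁) (x vψ₁)).rot 0 (-x vγ₃)) +
          octPolyDeriv δ₁ ((nodeDots (δ₃ / δ₁) (x vψ₁)).rot 0 (-x vγ₃))
            ((tiltDots ((x vΓ₃ * δ₁ - δ₃ * x vΨ₁) / δ₁ ^ 2) 0 (x vψ₁) 0).rot 0 (-x vγ₃))))

/-- The tilt of the plane of the second planet, of order `ε`, produces `H_5^{23}`. -/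
theorem octPolyDeriv_tilt (hδ₁ : 0 < δ₁) (a b ψ γ γ' : ℝ) :
    octPolyDeriv δ₁ ((nodeDots (δ₃ / δ₁) ψ).rot 0 (-γ')) ((tiltDots a b ψ γ).rot 0 (-γ')) =
    octPolyDeriv δ₁ ((nodeDots (δ₃ / δ₁) ψ).rot 0 (-γ')) ((tiltDots a 0 ψ 0).rot 0 (-γ')) -
      b * (J₁ δ₁ δ₃ ψ γ' * Real.cos γ + J₂ δ₁ δ₃ ψ γ' * Real.sin γ) := by
  have hs := Real.sin_sq_add_cos_sq ψ
  have hs' := Real.sin_sq_add_cos_sq γ'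
  obtain ⟨r, hr⟩ : ∃ r, δ₃ = δ₁ * r := ⟨δ₃ / δ₁, by field_simp⟩
  simp only [octPolyDeriv, AxisDots.rot, J₁, J₂, Real.cos_zero, Real.sin_zero, Real.cos_neg,
    Real.sin_neg, nodeDots, tiltDots]
  rw [hr, mul_div_cancel_left₀ _ hδ₁.ne']
  generalize Real.cos ψ = c at *
  generalize Real.sin ψ = s at *
  generalize Real.cos γ = c₂ at *
  generalize Real.sin γ = s₂ at *
  generalize Real.cos γ' = c₃ at *
  generalize Real.sin γ' = s₃ at *
  field_simp
  grind

/-- The derivative at `ε = 0` gives `H_5^{23}`, up to terms without `γ₁`, `Γ₁`, `γ̃₂`. -/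
theorem hasDerivAt_octFun₂₃ (hδ₁ : 0 < δ₁ ∧ δ₁ < 1) (hδ₂ : 0 < δ₂) (hδ₃ : |δ₃| < δ₁)
    (hx : x ∈ domain L₁) : HasDerivAt (fun ε => octFun₂₃ m δ₁ δ₂ δ₃ (ε, 0, x))
      (alpha523 m δ₁ δ₂ δ₃ * H523 δ₁ δ₃ x + octRest₂₃ m δ₁ δ₂ δ₃ x) 0 := by
  have h1 : 0 < 1 - δ₁ ^ 2 := by nlinarith [hδ₁.1, hδ₁.2]
  have hw := hasDerivAt_relΓ₂ (δ₁ := δ₁) (x := x)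
  have hd := (hasDerivDots₂₃ hδ₁.1 hδ₂ hδ₃ hx).turn (-x vγ₃)
  have he := ((hw.pow 2).const_sub 1).sqrt (by
    simp only [Pi.pow_apply, relΓ₂_zero]; exact h1.ne')
  have key := ((he.mul (hasDerivAt_octPoly hd hw)).const_mul
    (-(15 * √(1 - δ₂ ^ 2)) / (64 * δ₂ ^ 5))).const_mul (koct23 m)
  have key' := key.congr_of_eventuallyEq (f₁ := fun ε => octFun₂₃ m δ₁ δ₂ δ₃ (ε, 0, x))
    (Eventually.of_forall fun ε => by
      simp only [octFun₂₃, relΓ₃_of_zero, octNorm_eq, Pi.mul_apply, Pi.pow_apply])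
  refine key'.congr_deriv ?_
  simp only [Pi.pow_apply, relΓ₂_zero, dots₂₃_zero hδ₁.1, cosIncl₃_zero_zero hδ₂]
  rw [octPolyDeriv_tilt hδ₁.1, octRest₂₃, alpha523, H523]
  generalize octPolyDeriv _ _ _ = D
  generalize octPolyDerivW _ _ _ = D'
  generalize octPoly _ _ = P
  have hq := Real.sqrt_pos.2 h1
  field_simp
  ring

end Derivatives

/-! ### Appearance and coupling of variables -/

section Coupling

variable {D : Set Phase} {v : Fin 8} {f g : Phase → ℝ}

theorem Appears.of_const_mul_add {c : ℝ} (hf : Appears D v f) (hc : c ≠ 0)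
    (h : Indep D v fun x => g x - c * f x) : Appears D v g := fun hg => hf <| by
  have h1 := (hg.add (h.const_mul (-1))).const_mul c⁻¹
  exact h1.congr fun x _ => by field_simp; ring

theorem not_couples_of_indep (h : Indep D v f) : ¬ Couples D v f := fun hc =>
  hc ⟨f, fun _ => 0, h, ⟨indep_const 0, indep_const 0, indep_const 0⟩, fun x _ => by simp⟩

/-- The function does not depend on the variables `γ₁`, `Γ₁`, `γ̃₂`. -/
def IndepInner (D : Set Phase) (f : Phase → ℝ) : Prop :=
  Indep D vγ₁ f ∧ Indep D vΓ₁ f ∧ Indep D vγ₂ f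

theorem not_couples_of_indepInner (h : IndepInner D f) : ¬ Couples D v f := fun hc =>
  hc ⟨fun _ => 0, f, indep_const 0, h, fun x _ => by simp⟩

theorem not_couples_add (hf : ¬ Couples D v f) (hg : ¬ Couples D v g) :
    ¬ Couples D v fun x => f x + g x := by
  obtain ⟨a, b, ha, ⟨h1, h2, h3⟩, hab⟩ := not_not.1 hf
  obtain ⟨a', b', ha', ⟨h1', h2', h3'⟩, hab'⟩ := not_not.1 hg
  exact fun hc => hc ⟨_, _, ha.add ha', ⟨h1.add h1', h2.add h2', h3.add h3'⟩, fun x hx => by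
    show f x + g x = _
    rw [hab x hx, hab' x hx]; ring⟩

theorem not_couples_const_mul (hf : ¬ Couples D v f) (c : ℝ) :
    ¬ Couples D v fun x => c * f x := by
  obtain ⟨a, b, ha, ⟨h1, h2, h3⟩, hab⟩ := not_not.1 hf
  exact fun hc => hc ⟨_, _, ha.const_mul c, ⟨h1.const_mul c, h2.const_mul c, h3.const_mul c⟩,
    fun x hx => by
      show c * f x = _
      rw [hab x hx]; ring⟩

theorem not_couples_congr (hf : ¬ Couples D v f) (h : ∀ x ∈ D, g x = f x) :
    ¬ Couples D v g := by
  obtain ⟨a, b, ha, hb, hab⟩ := not_not.1 hf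
  exact fun hc => hc ⟨a, b, ha, hb, fun x hx => by rw [h x hx, hab x hx]⟩

theorem Couples.of_const_mul_add {c : ℝ} (hf : Couples D v f) (hc : c ≠ 0)
    (h : ¬ Couples D v fun x => g x - c * f x) : Couples D v g := by
  by_contra hg
  refine not_couples_congr (not_couples_const_mul
    (not_couples_add hg (not_couples_const_mul h (-1))) c⁻¹) (fun x _ => ?_) hf
  field_simp
  ring

/-- A nonzero mixed difference in `v` and `γ̃₂` shows that `v` is coupled with `γ̃₂`. -/
theorem couples_of_mixed_difference {x y x' y' : Phase} (hx : x ∈ D) (hy : y ∈ D) (hx' : x' ∈ D)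
    (hy' : y' ∈ D) (h1 : ∀ w, w ≠ v → x w = x' w) (h2 : ∀ w, w ≠ v → y w = y' w)
    (h3 : ∀ w, w ≠ vγ₂ → x w = y w) (h4 : ∀ w, w ≠ vγ₂ → x' w = y' w)
    (h : f x - f y ≠ f x' - f y') : Couples D v f := by
  rintro ⟨a, b, ha, ⟨-, -, hb⟩, hab⟩
  apply h
  rw [hab x hx, hab y hy, hab x' hx', hab y' hy', ha x hx x' hx' h1, ha y hy y' hy' h2,
    hb x hx y hy h3, hb x' hx' y' hy' h4]
  ring

end Coupling

section Explicit

variable {L₁ δ₁ δ₂ δ₃ : ℝ}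

/-- The point with the given coordinates. -/
def point (γ₁ Γ₁ γ₂ Γ₂ ψ Ψ γ₃ Γ₃ : ℝ) : Phase := ![γ₁, Γ₁, γ₂, Γ₂, ψ, Ψ, γ₃, Γ₃]

section Point

variable (γ₁ Γ₁ γ₂ Γ₂ ψ Ψ γ₃ Γ₃ : ℝ)

@[simp] theorem point_γ₁ : point γ₁ Γ₁ γ₂ Γ₂ ψ Ψ γ₃ Γ₃ vγ₁ = γ₁ := rfl
@[simp] theorem point_Γ₁ : point γ₁ Γ₁ γ₂ Γ₂ ψ Ψ γ₃ Γ₃ vΓ₁ = Γ₁ := rfl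
@[simp] theorem point_γ₂ : point γ₁ Γ₁ γ₂ Γ₂ ψ Ψ γ₃ Γ₃ vγ₂ = γ₂ := rfl
@[simp] theorem point_Γ₂ : point γ₁ Γ₁ γ₂ Γ₂ ψ Ψ γ₃ Γ₃ vΓ₂ = Γ₂ := rfl
@[simp] theorem point_ψ₁ : point γ₁ Γ₁ γ₂ Γ₂ ψ Ψ γ₃ Γ₃ vψ₁ = ψ := rfl
@[simp] theorem point_Ψ₁ : point γ₁ Γ₁ γ₂ Γ₂ ψ Ψ γ₃ Γ₃ vΨ₁ = Ψ := rfl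
@[simp] theorem point_γ₃ : point γ₁ Γ₁ γ₂ Γ₂ ψ Ψ γ₃ Γ₃ vγ₃ = γ₃ := rfl
@[simp] theorem point_Γ₃ : point γ₁ Γ₁ γ₂ Γ₂ ψ Ψ γ₃ Γ₃ vΓ₃ = Γ₃ := rfl

end Point

theorem mem_domain (hL : 0 < L₁) {a b : ℝ} (h0 : 0 < b) (h1 : b < a) (h2 : a < 1)
    (γ₁ γ₂ ψ Ψ γ₃ Γ₃ : ℝ) :
    point γ₁ (a * L₁) γ₂ (b * L₁) ψ Ψ γ₃ Γ₃ ∈ domain L₁ := by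
  refine ⟨mul_pos h0 hL, mul_lt_mul_of_pos_right h1 hL, ?_⟩
  have := mul_lt_mul_of_pos_right h2 hL
  rwa [one_mul] at this

theorem appears_γ₁_H012 (hL : 0 < L₁) : Appears (domain L₁) vγ₁ (H012 L₁) := by
  intro h
  have := h _ (mem_domain hL (a := 2 / 3) (b := 1 / 3) (by norm_num) (by norm_num) (by norm_num)
      0 0 0 0 0 0)
    _ (mem_domain hL (a := 2 / 3) (b := 1 / 3) (by norm_num) (by norm_num) (by norm_num)
      (Real.pi / 2) 0 0 0 0 0)
      (by intro w hw; fin_cases w <;> first | exact absurd rfl hw | simp [point])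
  simp only [H012, point_γ₁, point_Γ₁, point_Γ₂, Real.sin_zero, Real.sin_pi_div_two] at this
  field_simp at this
  norm_num at this

theorem appears_Γ₁_H012 (hL : 0 < L₁) : Appears (domain L₁) vΓ₁ (H012 L₁) := by
  intro h
  have := h _ (mem_domain hL (a := 2 / 3) (b := 1 / 3) (by norm_num) (by norm_num) (by norm_num)
      0 0 0 0 0 0)
    _ (mem_domain hL (a := 1 / 2) (b := 1 / 3) (by norm_num) (by norm_num) (by norm_num)
      0 0 0 0 0 0)
      (by intro w hw; fin_cases w <;> first | exact absurd rfl hw | simp [point])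
  simp only [H012, point_γ₁, point_Γ₁, point_Γ₂, Real.sin_zero] at this
  field_simp at this
  norm_num at this

theorem appears_Γ₂_H012 (hL : 0 < L₁) : Appears (domain L₁) vΓ₂ (H012 L₁) := by
  intro h
  have := h _ (mem_domain hL (a := 2 / 3) (b := 1 / 3) (by norm_num) (by norm_num) (by norm_num)
      0 0 0 0 0 0)
    _ (mem_domain hL (a := 2 / 3) (b := 1 / 2) (by norm_num) (by norm_num) (by norm_num)
      0 0 0 0 0 0)
      (by intro w hw; fin_cases w <;> first | exact absurd rfl hw | simp [point])
  simp only [H012, point_γ₁, point_Γ₁, point_Γ₂, Real.sin_zero] at this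
  field_simp at this
  norm_num at this

theorem appears_Ψ₁_H112 (hL : 0 < L₁) : Appears (domain L₁) vΨ₁ (H112 L₁) := by
  intro h
  have := h _ (mem_domain hL (a := 2 / 3) (b := 1 / 3) (by norm_num) (by norm_num) (by norm_num)
      0 0 0 0 0 0)
    _ (mem_domain hL (a := 2 / 3) (b := 1 / 3) (by norm_num) (by norm_num) (by norm_num)
      0 0 0 1 0 0)
      (by intro w hw; fin_cases w <;> first | exact absurd rfl hw | simp [point])
  simp only [H112, H012, point_γ₁, point_Γ₁, point_Γ₂, point_Ψ₁, Real.sin_zero] at this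
  field_simp at this
  linarith

theorem appears_γ₂_H212 (hL : 0 < L₁) : Appears (domain L₁) vγ₂ (H212 L₁) := by
  intro h
  have := h _ (mem_domain hL (a := 2 / 3) (b := 1 / 3) (by norm_num) (by norm_num) (by norm_num)
      0 0 0 0 0 0)
    _ (mem_domain hL (a := 2 / 3) (b := 1 / 3) (by norm_num) (by norm_num) (by norm_num)
      0 Real.pi 0 0 0 0)
      (by intro w hw; fin_cases w <;> first | exact absurd rfl hw | simp [point])
  have e1 : (2 / 3 * L₁) ^ 2 / L₁ ^ 2 = 4 / 9 := by field_simp; norm_num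
  have e2 : (1 / 3 * L₁) ^ 2 / (2 / 3 * L₁) ^ 2 = 1 / 4 := by field_simp; norm_num
  have e3 : 0 < √(5 : ℝ) := Real.sqrt_pos.2 (by norm_num)
  simp only [H212, point_γ₁, point_Γ₁, point_γ₂, point_Γ₂, Real.cos_zero, Real.sin_zero, Real.cos_pi, Real.sin_pi,
    e1, e2] at this
  norm_num at this
  linarith

theorem appears_ψ₁_H023 (hL : 0 < L₁) : Appears (domain L₁) vψ₁ H023 := by
  intro h
  have := h _ (mem_domain hL (a := 2 / 3) (b := 1 / 3) (by norm_num) (by norm_num) (by norm_num)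
      0 0 0 0 0 0)
    _ (mem_domain hL (a := 2 / 3) (b := 1 / 3) (by norm_num) (by norm_num) (by norm_num)
      0 0 (Real.pi / 2) 0 0 0)
      (by intro w hw; fin_cases w <;> first | exact absurd rfl hw | simp [point])
  simp [H023] at this

theorem couples_H223 (hL : 0 < L₁) (hδ₁ : 0 < δ₁) : Couples (domain L₁) vψ₁ (H223 δ₁) := by
  have hmem := fun γ₂ ψ : ℝ => mem_domain hL (a := 2 / 3) (b := 1 / 3) (by norm_num) (by norm_num)
    (by norm_num) 0 γ₂ ψ 0 0 0
  refine couples_of_mixed_difference (hmem 0 0) (hmem Real.pi 0) (hmem 0 (Real.pi / 2))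
    (hmem Real.pi (Real.pi / 2)) ?_ ?_ ?_ ?_ ?_
  · intro w hw; fin_cases w <;> first | exact absurd rfl hw | simp [point]
  · intro w hw; fin_cases w <;> first | exact absurd rfl hw | simp [point]
  · intro w hw; fin_cases w <;> first | exact absurd rfl hw | simp [point]
  · intro w hw; fin_cases w <;> first | exact absurd rfl hw | simp [point]
  · have e : 0 < √((2 / 3 * L₁) ^ 2 - (1 / 3 * L₁) ^ 2) := Real.sqrt_pos.2 (by nlinarith)
    have e' : 0 < √((2 / 3 * L₁) ^ 2 - (1 / 3 * L₁) ^ 2) * δ₁ ^ 2 := by positivity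
    simp only [H223, point_Γ₁, point_Γ₂, point_γ₂, point_ψ₁, Real.cos_zero, Real.sin_zero,
      Real.cos_pi, Real.sin_pi, Real.cos_pi_div_two, Real.sin_pi_div_two]
    intro h
    linarith

theorem appears_Γ₃_Htilde3 (hL : 0 < L₁) (hδ₁ : 0 < δ₁ ∧ δ₁ < 1) (hδ₃ : δ₃ ≠ 0) :
    Appears (domain L₁) vΓ₃ (Htilde3 δ₁ δ₃) := by
  intro h
  have := h _ (mem_domain hL (a := 2 / 3) (b := 1 / 3) (by norm_num) (by norm_num) (by norm_num)
      0 0 (Real.pi / 2) 0 0 0)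
    _ (mem_domain hL (a := 2 / 3) (b := 1 / 3) (by norm_num) (by norm_num) (by norm_num)
      0 0 (Real.pi / 2) 0 0 1)
      (by intro w hw; fin_cases w <;> first | exact absurd rfl hw | simp [point])
  simp only [Htilde3, point_Γ₂, point_ψ₁, point_Ψ₁, point_Γ₃, Real.cos_pi_div_two] at this
  have h1 : δ₁ * δ₃ * (5 - 4 * δ₁ ^ 2) = 0 := by linarith
  have h2 : 0 < 5 - 4 * δ₁ ^ 2 := by nlinarith [hδ₁.1, hδ₁.2]
  simp [hδ₁.1.ne', hδ₃, h2.ne'] at h1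

theorem appears_γ₃_H323 (hL : 0 < L₁) (hδ₁ : 0 < δ₁ ∧ δ₁ < 1) (hδ₃ : |δ₃| < δ₁) :
    Appears (domain L₁) vγ₃ (H323 δ₁ δ₃) := by
  intro h
  have key : ∀ ψ : ℝ, (nu0 δ₁ δ₃ + nu3 δ₁ δ₃) * Real.cos (3 * ψ) +
      (nu1 δ₁ δ₃ + nu2 δ₁ δ₃) * Real.cos ψ = 0 := by
    intro ψ
    have := h _ (mem_domain hL (a := 2 / 3) (b := 1 / 3) (by norm_num) (by norm_num)
        (by norm_num) 0 0 ψ 0 0 0)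
      _ (mem_domain hL (a := 2 / 3) (b := 1 / 3) (by norm_num) (by norm_num) (by norm_num)
        0 0 ψ 0 Real.pi 0)
      (by intro w hw; fin_cases w <;> first | exact absurd rfl hw | simp [point])
    simp only [H323, point_ψ₁, point_γ₃, zero_add, zero_sub, Real.cos_neg, Real.cos_add,
      Real.cos_sub, Real.cos_pi, Real.sin_pi] at this
    linarith
  -- `ψ̃₁ = 0` and `ψ̃₁ = π/4` separate the two harmonics of `key`.
  have k0 := key 0
  have k1 := key (Real.pi / 4)
  have e : Real.cos (3 * (Real.pi / 4)) = -Real.cos (Real.pi / 4) := by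
    rw [← Real.cos_pi_sub]; congr 1; ring
  have e0 : 0 < Real.cos (Real.pi / 4) := by rw [Real.cos_pi_div_four]; positivity
  rw [e] at k1
  simp only [mul_zero, Real.cos_zero, mul_one] at k0
  have k2 : (nu1 δ₁ δ₃ + nu2 δ₁ δ₃) - (nu0 δ₁ δ₃ + nu3 δ₁ δ₃) = 0 := by
    have : ((nu1 δ₁ δ₃ + nu2 δ₁ δ₃) - (nu0 δ₁ δ₃ + nu3 δ₁ δ₃)) * Real.cos (Real.pi / 4) = 0 := by
      linarith
    exact (mul_eq_zero.1 this).resolve_right e0.ne'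
  have k3 : nu0 δ₁ δ₃ + nu3 δ₁ δ₃ = 0 := by linarith
  have k4 : nu0 δ₁ δ₃ + nu3 δ₁ δ₃ =
      35 / (4 * δ₁ ^ 2) * ((1 - δ₁ ^ 2) * (δ₁ ^ 2 - δ₃ ^ 2)) := by
    have := hδ₁.1
    simp only [nu0, nu3]; field_simp; ring
  have h1 : 0 < 1 - δ₁ ^ 2 := by nlinarith [hδ₁.1, hδ₁.2]
  have h2 : 0 < δ₁ ^ 2 - δ₃ ^ 2 := by
    rw [sub_pos, sq_lt_sq, abs_of_pos hδ₁.1]; exact hδ₃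
  have h3 := hδ₁.1
  have h4 : 0 < 35 / (4 * δ₁ ^ 2) * ((1 - δ₁ ^ 2) * (δ₁ ^ 2 - δ₃ ^ 2)) := by positivity
  linarith

theorem couples_H523 (hL : 0 < L₁) (hδ₁ : 0 < δ₁) : Couples (domain L₁) vγ₃ (H523 δ₁ δ₃) := by
  have hmem := fun γ₂ ψ γ₃ : ℝ => mem_domain hL (a := 2 / 3) (b := 1 / 3) (by norm_num)
    (by norm_num) (by norm_num) 0 γ₂ ψ 0 γ₃ 0
  have e : 0 < √((2 / 3 * L₁) ^ 2 - (1 / 3 * L₁) ^ 2) := Real.sqrt_pos.2 (by nlinarith)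
  have key : ∀ ψ γ γ' : ℝ, J₁ δ₁ δ₃ ψ γ ≠ J₁ δ₁ δ₃ ψ γ' →
      Couples (domain L₁) vγ₃ (H523 δ₁ δ₃) := by
    intro ψ γ γ' hJ
    refine couples_of_mixed_difference (hmem 0 ψ γ) (hmem Real.pi ψ γ) (hmem 0 ψ γ')
      (hmem Real.pi ψ γ') ?_ ?_ ?_ ?_ ?_
    · intro w hw; fin_cases w <;> first | exact absurd rfl hw | simp [point]
    · intro w hw; fin_cases w <;> first | exact absurd rfl hw | simp [point]
    · intro w hw; fin_cases w <;> first | exact absurd rfl hw | simp [point]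
    · intro w hw; fin_cases w <;> first | exact absurd rfl hw | simp [point]
    · simp only [H523, point_Γ₁, point_Γ₂, point_ψ₁, point_γ₃, point_γ₂, Real.cos_zero,
        Real.sin_zero, Real.cos_pi, Real.sin_pi]
      intro h
      apply hJ
      have : √((2 / 3 * L₁) ^ 2 - (1 / 3 * L₁) ^ 2) * (J₁ δ₁ δ₃ ψ γ - J₁ δ₁ δ₃ ψ γ') = 0 := by
        linarith
      linarith [(mul_eq_zero.1 this).resolve_left e.ne']
  -- The terms of `J₁` with the factor `δ₃` vanish when `δ₃ = 0`, and then the other one is used.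
  by_cases h3 : δ₃ = 0
  · refine key (Real.pi / 4) (Real.pi / 2) (-(Real.pi / 2)) ?_
    have h0 : 0 < Real.cos (Real.pi / 4) := by rw [Real.cos_pi_div_four]; positivity
    have h1 : 0 < Real.sin (Real.pi / 4) := by rw [Real.sin_pi_div_four]; positivity
    have h2 : 0 < δ₁ ^ 2 * Real.cos (Real.pi / 4) * Real.sin (Real.pi / 4) := by positivity
    simp only [J₁, h3, Real.sin_neg, Real.cos_neg, Real.cos_pi_div_two, Real.sin_pi_div_two]
    intro h
    linarith
  · refine key 0 0 Real.pi ?_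
    simp only [J₁, Real.cos_zero, Real.sin_zero, Real.cos_pi, Real.sin_pi]
    intro h
    have : δ₁ * δ₃ = 0 := by linarith
    simp [hδ₁.ne', h3] at this

theorem indep_H012 {D : Set Phase} {v : Fin 8} (h1 : v ≠ vγ₁) (h2 : v ≠ vΓ₁) (h3 : v ≠ vΓ₂) :
    Indep D v (H012 L₁) := fun x _ y _ h => by
  simp only [H012, h vγ₁ h1.symm, h vΓ₁ h2.symm, h vΓ₂ h3.symm]

theorem indep_H112 {D : Set Phase} {v : Fin 8} (h1 : v ≠ vγ₁) (h2 : v ≠ vΓ₁) (h3 : v ≠ vΓ₂)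
    (h4 : v ≠ vΨ₁) : Indep D v (H112 L₁) := fun x _ y _ h => by
  simp only [H112, H012, h vγ₁ h1.symm, h vΓ₁ h2.symm, h vΓ₂ h3.symm, h vΨ₁ h4.symm]

theorem indep_Γ₃_H223 {D : Set Phase} : Indep D vΓ₃ (H223 δ₁) := fun x _ y _ h => by
  simp only [H223, h vγ₂ (by decide), h vΓ₁ (by decide), h vΓ₂ (by decide), h vψ₁ (by decide)]

theorem indepInner_Htilde3 {D : Set Phase} : IndepInner D (Htilde3 δ₁ δ₃) := by
  refine ⟨?_, ?_, ?_⟩ <;> intro x _ y _ h <;>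
    simp only [Htilde3, h vΨ₁ (by decide), h vψ₁ (by decide), h vΓ₂ (by decide),
      h vΓ₃ (by decide)]

theorem indepInner_octRest₂₃ {D : Set Phase} (m : Fin 4 → ℝ) :
    IndepInner D (octRest₂₃ m δ₁ δ₂ δ₃) := by
  refine ⟨?_, ?_, ?_⟩ <;> intro x _ y _ h <;>
    simp only [octRest₂₃, h vψ₁ (by decide), h vγ₃ (by decide), h vΨ₁ (by decide),
      h vΓ₂ (by decide), h vΓ₃ (by decide)]

end Explicit

/-! ### Integrability -/

section Integrable

variable {H : Phase → ℝ} {L₁ : ℝ}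

theorem fderiv_eq_zero_of_forall {x e : Phase} (h : ∀ t : ℝ, H (x + t • e) = H x) :
    fderiv ℝ H x e = 0 := by
  by_cases hd : DifferentiableAt ℝ H x
  · rw [← hd.lineDeriv_eq_fderiv, lineDeriv]
    simp only [h]
    exact deriv_const _ _
  · rw [fderiv_zero_of_not_differentiableAt hd]; rfl

theorem fderiv_coord (x : Phase) (v w : Fin 8) :
    fderiv ℝ (fun y : Phase => y v) x (Pi.single w 1) = if v = w then 1 else 0 := by
  have : fderiv ℝ (fun y : Phase => y v) x = ContinuousLinearMap.proj v :=
    (ContinuousLinearMap.proj (R := ℝ) (φ := fun _ : Fin 8 => ℝ) v).hasFDerivAt.fderiv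
  rw [this, ContinuousLinearMap.proj_apply, Pi.single_apply]

/-- A function of `γ₁`, `Γ₁`, `Γ̃₂`, `Ψ̃₁` is integrable, with the integrals `Γ̃₂`, `Ψ̃₁`, `Γ̃₃`,
as soon as it really depends on `γ₁`. -/
theorem isIntegrable_of (hH : AnalyticOnNhd ℝ H (domain L₁))
    (hi : ∀ x y : Phase, x vγ₁ = y vγ₁ → x vΓ₁ = y vΓ₁ → x vΓ₂ = y vΓ₂ → x vΨ₁ = y vΨ₁ →
      H x = H y)
    (hd : ∀ x ∈ domain L₁, x ∈ closure {y | y ∈ domain L₁ ∧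
      fderiv ℝ H y (Pi.single vγ₁ 1) ≠ 0}) : IsIntegrable (domain L₁) H := by
  have z : ∀ (x : Phase) (v : Fin 8), v ≠ vγ₁ → v ≠ vΓ₁ → v ≠ vΓ₂ → v ≠ vΨ₁ →
      fderiv ℝ H x (Pi.single v 1) = 0 := by
    intro x v h1 h2 h3 h4
    refine fderiv_eq_zero_of_forall fun t => hi _ _ ?_ ?_ ?_ ?_ <;>
      simp [h1.symm, h2.symm, h3.symm, h4.symm]
  refine ⟨![H, fun x => x vΓ₂, fun x => x vΨ₁, fun x => x vΓ₃], rfl, ?_, ?_, ?_⟩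
  · intro a
    have hc : ∀ v : Fin 8, AnalyticOnNhd ℝ (fun x : Phase => x v) (domain L₁) := fun v x _ =>
      (ContinuousLinearMap.proj (R := ℝ) (φ := fun _ : Fin 8 => ℝ) v).analyticAt x
    fin_cases a
    · exact hH
    · exact hc _
    · exact hc _
    · exact hc _
  · intro a b x _
    have z1 := z x vγ₂ (by decide) (by decide) (by decide) (by decide)
    have z2 := z x vψ₁ (by decide) (by decide) (by decide) (by decide)
    have z3 := z x vγ₃ (by decide) (by decide) (by decide) (by decide)
    fin_cases a <;> fin_cases b <;>
      simp only [Fin.zero_eta, Fin.mk_one, Fin.reduceFinMk, Matrix.cons_val, poisson, fderiv_coord,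
        z1, z2, z3] <;> simp [vγ₁, vΓ₁, vγ₂, vΓ₂, vψ₁, vΨ₁, vγ₃, vΓ₃]
    ring
  · intro x hx
    refine closure_mono ?_ (hd x hx)
    rintro y ⟨hy, hne⟩
    refine ⟨hy, ?_⟩
    rw [Fintype.linearIndependent_iff]
    intro g hg
    have ap : ∀ v : Fin 8, g 0 * fderiv ℝ H y (Pi.single v 1) + g 1 * (if vΓ₂ = v then 1 else 0) +
        g 2 * (if vΨ₁ = v then 1 else 0) + g 3 * (if vΓ₃ = v then 1 else 0) = 0 := by
      intro v
      have := congrArg (fun l : Phase →L[ℝ] ℝ => l (Pi.single v 1)) hg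
      simpa only [Fin.sum_univ_four, Matrix.cons_val, _root_.add_apply,
        _root_.smul_apply, smul_eq_mul, fderiv_coord,
        _root_.zero_apply] using this
    have g0 : g 0 = 0 := by
      have := ap vγ₁
      simp only [vγ₁, vΓ₂, vΨ₁, vΓ₃, Fin.reduceEq, if_false, mul_zero, add_zero] at this
      exact (mul_eq_zero.1 this).resolve_right hne
    have g1 : g 1 = 0 := by simpa [g0, vΓ₂, vΨ₁, vΓ₃] using ap vΓ₂
    have g2 : g 2 = 0 := by simpa [g0, vΓ₂, vΨ₁, vΓ₃] using ap vΨ₁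
    have g3 : g 3 = 0 := by simpa [g0, vΓ₂, vΨ₁, vΓ₃] using ap vΓ₃
    intro i
    fin_cases i
    · exact g0
    · exact g1
    · exact g2
    · exact g3

theorem contDiffAt_H012 {x : Phase} (hx : x ∈ domain L₁) : ContDiffAt ℝ ⊤ (H012 L₁) x := by
  have h0 : x vΓ₁ ≠ 0 := (hx.1.trans hx.2.1).ne'
  have hs : ContDiffAt ℝ ⊤ (fun y : Phase => Real.sin (y vγ₁)) x :=
    (Real.contDiff_sin.comp (by fun_prop)).contDiffAt
  have hq : ContDiffAt ℝ ⊤ (fun y : Phase => y vΓ₂ ^ 2 / y vΓ₁ ^ 2) x :=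
    ContDiffAt.div (by fun_prop) (by fun_prop) (by simpa using h0)
  have h1 : ContDiffAt ℝ ⊤ (fun y : Phase => 1 - y vΓ₁ ^ 2 / L₁ ^ 2) x := by fun_prop
  have h2 : ContDiffAt ℝ ⊤ (fun y : Phase => y vΓ₂ ^ 2 / L₁ ^ 2) x := by fun_prop
  exact (h1.mul (contDiffAt_const.sub
    ((contDiffAt_const.mul (contDiffAt_const.sub hq)).mul (hs.pow 2)))).add h2

theorem contDiffAt_H112 {x : Phase} (hx : x ∈ domain L₁) : ContDiffAt ℝ ⊤ (H112 L₁) x := by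
  have h := contDiffAt_H012 hx
  have h1 : ContDiffAt ℝ ⊤ (fun y : Phase => y vΓ₁ ^ 2 * y vΓ₂ / L₁ ^ 2) x := by fun_prop
  have h2 : ContDiffAt ℝ ⊤ (fun y : Phase => y vΓ₂) x := by fun_prop
  have h3 : ContDiffAt ℝ ⊤ (fun y : Phase => y vΨ₁) x := by fun_prop
  exact (((((contDiffAt_const.mul h).sub contDiffAt_const).mul h3).sub
    ((contDiffAt_const.mul h2).mul h)).add (contDiffAt_const.mul h2)).sub h1

theorem hasDerivAt_γ₁_H012 (x : Phase) :
    HasDerivAt (fun t : ℝ => H012 L₁ (x + t • Pi.single vγ₁ 1))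
      (-(1 - x vΓ₁ ^ 2 / L₁ ^ 2) * (5 * (1 - x vΓ₂ ^ 2 / x vΓ₁ ^ 2)) * Real.sin (2 * x vγ₁)) 0 := by
  have h1 : HasDerivAt (fun t : ℝ => Real.sin (x vγ₁ + t)) (Real.cos (x vγ₁ + 0)) 0 := by
    have := (Real.hasDerivAt_sin (x vγ₁ + 0)).comp (0 : ℝ) ((hasDerivAt_id (0 : ℝ)).const_add _)
    rwa [mul_one] at this
  have key := ((((h1.pow 2).const_mul (5 * (1 - x vΓ₂ ^ 2 / x vΓ₁ ^ 2))).const_sub 2).const_mul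
    (1 - x vΓ₁ ^ 2 / L₁ ^ 2)).add_const (x vΓ₂ ^ 2 / L₁ ^ 2)
  have key' := key.congr_of_eventuallyEq (f₁ := fun t : ℝ => H012 L₁ (x + t • Pi.single vγ₁ 1))
    (Eventually.of_forall fun t => by simp [H012, vγ₁, vΓ₁, vΓ₂])
  refine key'.congr_deriv ?_
  rw [Real.sin_two_mul, add_zero]
  ring

theorem fderiv_γ₁_H012 {x : Phase} (hx : x ∈ domain L₁) :
    fderiv ℝ (H012 L₁) x (Pi.single vγ₁ 1) =
      -(1 - x vΓ₁ ^ 2 / L₁ ^ 2) * (5 * (1 - x vΓ₂ ^ 2 / x vΓ₁ ^ 2)) * Real.sin (2 * x vγ₁) := by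
  have hd : DifferentiableAt ℝ (H012 L₁) x := (contDiffAt_H012 hx).differentiableAt (by simp)
  rw [← hd.lineDeriv_eq_fderiv, lineDeriv]
  exact (hasDerivAt_γ₁_H012 x).deriv

theorem fderiv_γ₁_H112 {x : Phase} (hx : x ∈ domain L₁) :
    fderiv ℝ (H112 L₁) x (Pi.single vγ₁ 1) = (3 * x vΨ₁ - 4 * x vΓ₂) *
      (-(1 - x vΓ₁ ^ 2 / L₁ ^ 2) * (5 * (1 - x vΓ₂ ^ 2 / x vΓ₁ ^ 2)) *
        Real.sin (2 * x vγ₁)) := by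
  have hd : DifferentiableAt ℝ (H112 L₁) x := (contDiffAt_H112 hx).differentiableAt (by simp)
  rw [← hd.lineDeriv_eq_fderiv, lineDeriv]
  have h := hasDerivAt_γ₁_H012 (L₁ := L₁) x
  have key := ((((((h.const_mul 3).sub_const 1).mul_const (x vΨ₁)).sub
    (h.const_mul (4 * x vΓ₂))).add_const (3 * x vΓ₂)).sub_const
      (x vΓ₁ ^ 2 * x vΓ₂ / L₁ ^ 2))
  have key' := key.congr_of_eventuallyEq (f₁ := fun t : ℝ => H112 L₁ (x + t • Pi.single vγ₁ 1))
    (Eventually.of_forall fun t => by simp [H112, vγ₁, vΓ₁, vΓ₂, vΨ₁])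
  rw [key'.deriv]
  ring

/-- Generic points: moving along `γ₁` and `Ψ̃₁` one leaves the zero sets of `sin 2γ₁` and of
`3Ψ̃₁ - 4Γ̃₂`. -/
theorem mem_closure_generic {x : Phase} (hx : x ∈ domain L₁) :
    x ∈ closure {y | y ∈ domain L₁ ∧ 3 * y vΨ₁ - 4 * y vΓ₂ ≠ 0 ∧
      -(1 - y vΓ₁ ^ 2 / L₁ ^ 2) * (5 * (1 - y vΓ₂ ^ 2 / y vΓ₁ ^ 2)) *
        Real.sin (2 * y vγ₁) ≠ 0} := by
  have hL : 0 < L₁ := (hx.1.trans hx.2.1).trans hx.2.2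
  have hk : 0 < 1 - x vΓ₁ ^ 2 / L₁ ^ 2 := by
    rw [sub_pos, ← div_pow]
    exact ratio_sq_lt_one hL (by rw [abs_of_pos (hx.1.trans hx.2.1)]; exact hx.2.2)
  have hs : 0 < 1 - x vΓ₂ ^ 2 / x vΓ₁ ^ 2 := by
    rw [sub_pos, ← div_pow]
    exact ratio_sq_lt_one (hx.1.trans hx.2.1) (by rw [abs_of_pos hx.1]; exact hx.2.1)
  set u : Phase := Pi.single vγ₁ 1 + Pi.single vΨ₁ 1 with hu
  have e1 : ∀ t : ℝ, (x + t • u) vγ₁ = x vγ₁ + t := fun t => by simp [hu, vγ₁, vΨ₁]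
  have e2 : ∀ t : ℝ, (x + t • u) vΨ₁ = x vΨ₁ + t := fun t => by simp [hu, vγ₁, vΨ₁]
  have e3 : ∀ t : ℝ, (x + t • u) vΓ₁ = x vΓ₁ := fun t => by simp [hu, vγ₁, vΓ₁, vΨ₁]
  have e4 : ∀ t : ℝ, (x + t • u) vΓ₂ = x vΓ₂ := fun t => by simp [hu, vγ₁, vΓ₂, vΨ₁]
  have hc : Tendsto (fun t : ℝ => x + t • u) (𝓝[≠] 0) (𝓝 x) := by
    have : Continuous fun t : ℝ => x + t • u := by fun_prop
    simpa using (this.tendsto 0).mono_left nhdsWithin_le_nhds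
  have d1 : ∀ᶠ t in 𝓝[≠] (0 : ℝ), 3 * (x vΨ₁ + t) - 4 * x vΓ₂ ≠ 0 := by
    have : HasDerivAt (fun t : ℝ => 3 * (x vΨ₁ + t) - 4 * x vΓ₂) (3 * 1) 0 :=
      (((hasDerivAt_id (0 : ℝ)).const_add _).const_mul 3).sub_const _
    exact this.eventually_ne (by norm_num)
  have d2 : ∀ᶠ t in 𝓝[≠] (0 : ℝ), Real.sin (2 * (x vγ₁ + t)) ≠ 0 := by
    by_cases h0 : Real.sin (2 * x vγ₁) = 0
    · have : HasDerivAt (fun t : ℝ => Real.sin (2 * (x vγ₁ + t)))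
          (Real.cos (2 * (x vγ₁ + 0)) * (2 * 1)) 0 :=
        (Real.hasDerivAt_sin _).comp (0 : ℝ) (((hasDerivAt_id (0 : ℝ)).const_add _).const_mul 2)
      refine this.eventually_ne ?_
      rw [add_zero]
      have hcs := Real.sin_sq_add_cos_sq (2 * x vγ₁)
      intro hz
      have : Real.cos (2 * x vγ₁) = 0 := by linarith
      rw [h0, this] at hcs
      norm_num at hcs
    · have hcont : Continuous fun t : ℝ => Real.sin (2 * (x vγ₁ + t)) := by fun_prop
      refine (hcont.continuousAt.eventually_ne (y := 0) ?_).filter_mono nhdsWithin_le_nhds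
      simpa using h0
  refine mem_closure_of_tendsto hc ?_
  filter_upwards [d1, d2] with t h1 h2
  refine ⟨⟨?_, ?_, ?_⟩, ?_, ?_⟩
  · rw [e4]; exact hx.1
  · rw [e3, e4]; exact hx.2.1
  · rw [e3]; exact hx.2.2
  · rwa [e2, e4]
  · rw [e1, e3, e4]
    exact mul_ne_zero (mul_ne_zero (neg_ne_zero.2 hk.ne') (by positivity)) h2

theorem isIntegrable_H012 : IsIntegrable (domain L₁) (H012 L₁) := by
  refine isIntegrable_of (fun x hx => (contDiffAt_H012 hx).analyticAt) (fun x y h1 h2 h3 _ => ?_)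
    fun x hx => closure_mono ?_ (mem_closure_generic hx)
  · simp only [H012, h1, h2, h3]
  · rintro y ⟨hy, -, h⟩
    exact ⟨hy, by rwa [fderiv_γ₁_H012 hy]⟩

theorem isIntegrable_H112 : IsIntegrable (domain L₁) (H112 L₁) := by
  refine isIntegrable_of (fun x hx => (contDiffAt_H112 hx).analyticAt) (fun x y h1 h2 h3 h4 => ?_)
    fun x hx => closure_mono ?_ (mem_closure_generic hx)
  · simp only [H112, H012, h1, h2, h3, h4]
  · rintro y ⟨hy, h, h'⟩
    exact ⟨hy, by rw [fderiv_γ₁_H112 hy]; exact mul_ne_zero h h'⟩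

end Integrable

/-! ### The variables on which the coefficients depend -/

section Dependence

variable {m : Fin 4 → ℝ} {L₁ δ₁ δ₂ δ₃ : ℝ}

theorem quadFun₁₂_congr (ε μ μ' : ℝ) {x y : Phase} (h1 : x vγ₁ = y vγ₁) (h2 : x vΓ₁ = y vΓ₁)
    (h3 : x vΓ₂ = y vΓ₂) (h4 : x vΨ₁ = y vΨ₁) :
    quadFun₁₂ m L₁ δ₁ (ε, μ, x) = quadFun₁₂ m L₁ δ₁ (ε, μ', y) := by
  simp only [quadFun₁₂, dots₁₂, cosIncl₁₂, relΓ₂, relΨ₁, h1, h2, h3, h4]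

theorem octFun₁₂_congr (ε μ μ' : ℝ) {x y : Phase} (h1 : x vγ₁ = y vγ₁) (h2 : x vΓ₁ = y vΓ₁)
    (h3 : x vΓ₂ = y vΓ₂) (h4 : x vΨ₁ = y vΨ₁) (h5 : x vγ₂ = y vγ₂) :
    octFun₁₂ m L₁ δ₁ (ε, μ, x) = octFun₁₂ m L₁ δ₁ (ε, μ', y) := by
  simp only [octFun₁₂, dots₁₂, cosIncl₁₂, relΓ₂, relΨ₁, h1, h2, h3, h4, h5]

theorem tailFun₁₂_congr (ε μ μ' : ℝ) {x y : Phase} (h1 : x vγ₁ = y vγ₁) (h2 : x vΓ₁ = y vΓ₁)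
    (h3 : x vΓ₂ = y vΓ₂) (h4 : x vΨ₁ = y vΨ₁) (h5 : x vγ₂ = y vγ₂) :
    tailFun₁₂ m L₁ δ₁ (ε, μ, x) = tailFun₁₂ m L₁ δ₁ (ε, μ', y) := by
  simp only [tailFun₁₂, dots₁₂, cosIncl₁₂, relΓ₂, relΨ₁, h1, h2, h3, h4, h5]

theorem paramIndep_γ₃_quadFun₂₃ : ParamIndep vγ₃ (quadFun₂₃ m δ₁ δ₂ δ₃) := fun ε μ x y h => by
  simp only [quadFun₂₃, dots₂₃, cosIncl₂, cosIncl₃, sinIncl₂, sinIncl₃, cosIncl₁₂, relΓ₂, relΓ₃,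
    relΔ, relΨ₁, h vΓ₁ (by decide), h vγ₂ (by decide), h vΓ₂ (by decide), h vψ₁ (by decide),
    h vΨ₁ (by decide), h vΓ₃ (by decide)]

/-- At `ε = 0` the orbital plane of planet 2 and its eccentricity are given by `δ₁`, `δ₂`, `δ₃`
and `μ`, so that only the angles remain. -/
theorem quadFun₂₃_zero_congr (hδ₁ : 0 < δ₁) (μ : ℝ) {x y : Phase} (h : x vψ₁ = y vψ₁) :
    quadFun₂₃ m δ₁ δ₂ δ₃ (0, μ, x) = quadFun₂₃ m δ₁ δ₂ δ₃ (0, μ, y) := by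
  rw [quadFun₂₃, quadFun₂₃, dots₂₃_zero hδ₁, dots₂₃_zero hδ₁, cosIncl₃_zero, cosIncl₃_zero, h,
    relΓ₂_zero, relΓ₂_zero, relΓ₃_zero, relΓ₃_zero]

theorem octFun₂₃_zero_congr (hδ₁ : 0 < δ₁) (μ : ℝ) {x y : Phase} (h : x vψ₁ = y vψ₁)
    (h' : x vγ₃ = y vγ₃) :
    octFun₂₃ m δ₁ δ₂ δ₃ (0, μ, x) = octFun₂₃ m δ₁ δ₂ δ₃ (0, μ, y) := by
  rw [octFun₂₃, octFun₂₃, dots₂₃_zero hδ₁, dots₂₃_zero hδ₁, cosIncl₃_zero, cosIncl₃_zero, h,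
    relΓ₂_zero, relΓ₂_zero, relΓ₃_zero, relΓ₃_zero]
  simp only [h']

end Dependence

/-! ### The coefficients of the secular Hamiltonian -/

section Coefficients

variable (m : Fin 4 → ℝ) (L₁ δ₁ δ₂ δ₃ : ℝ) (r₁₂ r₂₃ r₃ : ℕ → ℕ → Phase → ℝ)

/-- The coefficients of the quadrupole of the planets 1 and 2. -/
def quadCoeff₁₂ : ℕ → ℕ → Phase → ℝ := shiftCoeff 6 0 (taylorCoeff (quadFun₁₂ m L₁ δ₁))

/-- The coefficients of the octupole of the planets 1 and 2. -/
def octCoeff₁₂ : ℕ → ℕ → Phase → ℝ := shiftCoeff 8 0 (taylorCoeff (octFun₁₂ m L₁ δ₁))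

/-- The coefficients of the higher multipoles of the planets 1 and 2. -/
def tailCoeff₁₂ : ℕ → ℕ → Phase → ℝ := shiftCoeff 10 0 (taylorCoeff (tailFun₁₂ m L₁ δ₁))

/-- The coefficients of the quadrupole of the planets 2 and 3. -/
def quadCoeff₂₃ : ℕ → ℕ → Phase → ℝ := shiftCoeff 2 6 (taylorCoeff (quadFun₂₃ m δ₁ δ₂ δ₃))

/-- The coefficients of the octupole of the planets 2 and 3. -/
def octCoeff₂₃ : ℕ → ℕ → Phase → ℝ := shiftCoeff 2 8 (taylorCoeff (octFun₂₃ m δ₁ δ₂ δ₃))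

/-- The coefficients of the higher multipoles of the planets 2 and 3. -/
def tailCoeff₂₃ : ℕ → ℕ → Phase → ℝ := shiftCoeff 2 10 (taylorCoeff (tailFun₂₃ m δ₁ δ₂ δ₃))

/-- The coefficients of the secular Hamiltonian with remainders `r₁₂`, `r₂₃`, `r₃`. -/
def secCoeff (i j : ℕ) (x : Phase) : ℝ :=
  -(redMass m 1 * m 2) * (quadCoeff₁₂ m L₁ δ₁ i j x + sigmaOct12 m * octCoeff₁₂ m L₁ δ₁ i j x)
    - redMass m 2 * m 3 *
      (quadCoeff₂₃ m δ₁ δ₂ δ₃ i j x + sigmaOct23 m * octCoeff₂₃ m δ₁ δ₂ δ₃ i j x)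
    + r₁₂ i j x + r₂₃ i j x + r₃ i j x
    - tailCoeff₁₂ m L₁ δ₁ i j x - tailCoeff₂₃ m δ₁ δ₂ δ₃ i j x

end Coefficients

section Supports

variable {m : Fin 4 → ℝ} {L₁ δ₁ δ₂ δ₃ : ℝ} {i j : ℕ} {x : Phase}

theorem quadCoeff₁₂_eq_zero (hδ₁ : 0 < δ₁ ∧ δ₁ < 1) (hx : x ∈ domain L₁)
    (h : ¬ (6 ≤ i ∧ j = 0)) : quadCoeff₁₂ m L₁ δ₁ i j x = 0 := by
  by_cases hi : 6 ≤ i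
  · rw [quadCoeff₁₂, shiftCoeff, if_pos ⟨hi, Nat.zero_le j⟩]
    exact taylorCoeff_eq_zero_of_dropμ (analyticAt_quadFun₁₂ hδ₁.1 hx)
      (fun _ _ _ => quadFun₁₂_congr _ _ _ rfl rfl rfl rfl) (by omega)
  · exact shiftCoeff_of_not (fun hc => hi hc.1) _ _

theorem octCoeff₁₂_eq_zero (hL : 0 < L₁) (hδ₁ : 0 < δ₁ ∧ δ₁ < 1) (hx : x ∈ domain L₁)
    (h : ¬ (8 ≤ i ∧ j = 0)) : octCoeff₁₂ m L₁ δ₁ i j x = 0 := by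
  by_cases hi : 8 ≤ i
  · rw [octCoeff₁₂, shiftCoeff, if_pos ⟨hi, Nat.zero_le j⟩]
    exact taylorCoeff_eq_zero_of_dropμ (analyticAt_octFun₁₂ hL hδ₁ hx)
      (fun _ _ _ => octFun₁₂_congr _ _ _ rfl rfl rfl rfl rfl) (by omega)
  · exact shiftCoeff_of_not (fun hc => hi hc.1) _ _

theorem tailCoeff₁₂_eq_zero (hL : 0 < L₁) (hδ₁ : 0 < δ₁ ∧ δ₁ < 1) (hx : x ∈ domain L₁)
    (h : ¬ (10 ≤ i ∧ j = 0)) : tailCoeff₁₂ m L₁ δ₁ i j x = 0 := by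
  by_cases hi : 10 ≤ i
  · rw [tailCoeff₁₂, shiftCoeff, if_pos ⟨hi, Nat.zero_le j⟩]
    exact taylorCoeff_eq_zero_of_dropμ (analyticAt_tailFun₁₂ hL hδ₁ hx)
      (fun _ _ _ => tailFun₁₂_congr _ _ _ rfl rfl rfl rfl rfl) (by omega)
  · exact shiftCoeff_of_not (fun hc => hi hc.1) _ _

theorem quadCoeff₂₃_eq_zero (h : ¬ (2 ≤ i ∧ 6 ≤ j)) : quadCoeff₂₃ m δ₁ δ₂ δ₃ i j x = 0 :=
  shiftCoeff_of_not h _ _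

theorem octCoeff₂₃_eq_zero (h : ¬ (2 ≤ i ∧ 8 ≤ j)) : octCoeff₂₃ m δ₁ δ₂ δ₃ i j x = 0 :=
  shiftCoeff_of_not h _ _

theorem tailCoeff₂₃_eq_zero (h : ¬ (2 ≤ i ∧ 10 ≤ j)) : tailCoeff₂₃ m δ₁ δ₂ δ₃ i j x = 0 :=
  shiftCoeff_of_not h _ _

end Supports

section Values

variable {m : Fin 4 → ℝ} {L₁ δ₁ δ₂ δ₃ : ℝ} {x : Phase}

theorem quadCoeff₁₂_six (hm : ∀ i, 0 < m i) (hL : 0 < L₁) (hδ₁ : 0 < δ₁ ∧ δ₁ < 1)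
    (hx : x ∈ domain L₁) : quadCoeff₁₂ m L₁ δ₁ 6 0 x = alpha012 m L₁ δ₁ * H012 L₁ x := by
  rw [quadCoeff₁₂, shiftCoeff, if_pos (by decide), taylorCoeff_zero_zero,
    quadFun₁₂_zero hm hL hδ₁.1 hx]

theorem quadCoeff₁₂_seven (hm : ∀ i, 0 < m i) (hL : 0 < L₁) (hδ₁ : 0 < δ₁ ∧ δ₁ < 1)
    (hx : x ∈ domain L₁) : quadCoeff₁₂ m L₁ δ₁ 7 0 x = alpha112 m L₁ δ₁ * H112 L₁ x := by
  rw [quadCoeff₁₂, shiftCoeff, if_pos (by decide)]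
  exact taylorCoeff_one_zero (analyticAt_quadFun₁₂ hδ₁.1 hx) (hasDerivAt_quadFun₁₂ hm hL hδ₁.1 hx)

theorem octCoeff₁₂_eight (hm : ∀ i, 0 < m i) (hL : 0 < L₁) (hδ₁ : 0 < δ₁ ∧ δ₁ < 1)
    (hx : x ∈ domain L₁) : octCoeff₁₂ m L₁ δ₁ 8 0 x = alpha212 m L₁ δ₁ * H212 L₁ x := by
  rw [octCoeff₁₂, shiftCoeff, if_pos (by decide), taylorCoeff_zero_zero,
    octFun₁₂_zero hm hL hδ₁.1 hx]

theorem quadCoeff₂₃_two_six (hδ₁ : 0 < δ₁ ∧ δ₁ < 1) (hδ₂ : 0 < δ₂ ∧ δ₂ < 1) :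
    quadCoeff₂₃ m δ₁ δ₂ δ₃ 2 6 x = alpha023 m δ₁ δ₂ δ₃ * H023 x := by
  rw [quadCoeff₂₃, shiftCoeff, if_pos (by decide), taylorCoeff_zero_zero,
    quadFun₂₃_zero hδ₁.1 hδ₂.1]

theorem quadCoeff₂₃_three_six (hδ₁ : 0 < δ₁ ∧ δ₁ < 1) (hδ₂ : 0 < δ₂ ∧ δ₂ < 1)
    (hδ₃ : |δ₃| < δ₁) (hx : x ∈ domain L₁) : quadCoeff₂₃ m δ₁ δ₂ δ₃ 3 6 x =
      alpha223 m δ₁ δ₂ δ₃ * H223 δ₁ x + alphaTilde3 m δ₁ δ₂ * Htilde3 δ₁ δ₃ x := by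
  rw [quadCoeff₂₃, shiftCoeff, if_pos (by decide)]
  exact taylorCoeff_one_zero (analyticAt_quadFun₂₃ hδ₁.1 hδ₂.1 hδ₃ hx)
    (hasDerivAt_quadFun₂₃ hδ₁.1 hδ₂.1 hδ₃ hx)

theorem octCoeff₂₃_two_eight (hδ₁ : 0 < δ₁ ∧ δ₁ < 1) (hδ₂ : 0 < δ₂ ∧ δ₂ < 1) :
    octCoeff₂₃ m δ₁ δ₂ δ₃ 2 8 x = alpha323 m δ₁ δ₂ * H323 δ₁ δ₃ x := by
  rw [octCoeff₂₃, shiftCoeff, if_pos (by decide), taylorCoeff_zero_zero,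
    octFun₂₃_zero hδ₁.1 hδ₂.1]

theorem octCoeff₂₃_three_eight (hδ₁ : 0 < δ₁ ∧ δ₁ < 1) (hδ₂ : 0 < δ₂ ∧ δ₂ < 1)
    (hδ₃ : |δ₃| < δ₁) (hx : x ∈ domain L₁) : octCoeff₂₃ m δ₁ δ₂ δ₃ 3 8 x =
      alpha523 m δ₁ δ₂ δ₃ * H523 δ₁ δ₃ x + octRest₂₃ m δ₁ δ₂ δ₃ x := by
  rw [octCoeff₂₃, shiftCoeff, if_pos (by decide)]
  exact taylorCoeff_one_zero (analyticAt_octFun₂₃ hδ₁ hδ₂ hδ₃ hx)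
    (hasDerivAt_octFun₂₃ hδ₁ hδ₂.1 hδ₃ hx)

end Values

/-! ### Dependence and explicit values of the coefficients -/

section CoefficientDependence

variable {m : Fin 4 → ℝ} {L₁ δ₁ δ₂ δ₃ : ℝ} {v : Fin 8}

theorem indep_quadCoeff₁₂ (h1 : v ≠ vγ₁) (h2 : v ≠ vΓ₁) (h3 : v ≠ vΓ₂) (h4 : v ≠ vΨ₁) (i j : ℕ) :
    Indep (domain L₁) v (quadCoeff₁₂ m L₁ δ₁ i j) :=
  indep_shiftCoeff (fun i j => ParamIndep.indep_taylorCoeff (fun _ _ _ _ h => quadFun₁₂_congr _ _ _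
    (h _ h1.symm) (h _ h2.symm) (h _ h3.symm) (h _ h4.symm)) i j) _ _ i j

theorem indep_octCoeff₁₂ (h1 : v ≠ vγ₁) (h2 : v ≠ vΓ₁) (h3 : v ≠ vΓ₂) (h4 : v ≠ vΨ₁)
    (h5 : v ≠ vγ₂) (i j : ℕ) : Indep (domain L₁) v (octCoeff₁₂ m L₁ δ₁ i j) :=
  indep_shiftCoeff (fun i j => ParamIndep.indep_taylorCoeff (fun _ _ _ _ h => octFun₁₂_congr _ _ _
    (h _ h1.symm) (h _ h2.symm) (h _ h3.symm) (h _ h4.symm) (h _ h5.symm)) i j) _ _ i j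

theorem indep_tailCoeff₁₂ (h1 : v ≠ vγ₁) (h2 : v ≠ vΓ₁) (h3 : v ≠ vΓ₂) (h4 : v ≠ vΨ₁)
    (h5 : v ≠ vγ₂) (i j : ℕ) : Indep (domain L₁) v (tailCoeff₁₂ m L₁ δ₁ i j) :=
  indep_shiftCoeff (fun i j => ParamIndep.indep_taylorCoeff (fun _ _ _ _ h => tailFun₁₂_congr _ _ _
    (h _ h1.symm) (h _ h2.symm) (h _ h3.symm) (h _ h4.symm) (h _ h5.symm)) i j) _ _ i j

theorem indep_γ₃_quadCoeff₂₃ (i j : ℕ) :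
    Indep (domain L₁) vγ₃ (quadCoeff₂₃ m δ₁ δ₂ δ₃ i j) :=
  indep_shiftCoeff (fun i j => paramIndep_γ₃_quadFun₂₃.indep_taylorCoeff i j) _ _ i j

theorem indep_quadCoeff₂₃_two (hδ₁ : 0 < δ₁ ∧ δ₁ < 1) (hδ₂ : 0 < δ₂ ∧ δ₂ < 1)
    (hδ₃ : |δ₃| < δ₁) (hv : v ≠ vψ₁) (j : ℕ) :
    Indep (domain L₁) v (quadCoeff₂₃ m δ₁ δ₂ δ₃ 2 j) := by
  by_cases hj : 6 ≤ j
  · rw [quadCoeff₂₃, shiftCoeff, if_pos ⟨le_rfl, hj⟩]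
    exact indep_taylorCoeff_zero (fun x hx => analyticAt_quadFun₂₃ hδ₁.1 hδ₂.1 hδ₃ hx)
      (fun μ x y h => quadFun₂₃_zero_congr hδ₁.1 μ (h _ hv.symm)) _
  · exact Indep.of_forall_eq_zero fun x _ => quadCoeff₂₃_eq_zero fun h => hj h.2

theorem indep_octCoeff₂₃_two (hδ₁ : 0 < δ₁ ∧ δ₁ < 1) (hδ₂ : 0 < δ₂ ∧ δ₂ < 1)
    (hδ₃ : |δ₃| < δ₁) (hv : v ≠ vψ₁) (hv' : v ≠ vγ₃) (j : ℕ) :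
    Indep (domain L₁) v (octCoeff₂₃ m δ₁ δ₂ δ₃ 2 j) := by
  by_cases hj : 8 ≤ j
  · rw [octCoeff₂₃, shiftCoeff, if_pos ⟨le_rfl, hj⟩]
    exact indep_taylorCoeff_zero (fun x hx => analyticAt_octFun₂₃ hδ₁ hδ₂ hδ₃ hx)
      (fun μ x y h => octFun₂₃_zero_congr hδ₁.1 μ (h _ hv.symm) (h _ hv'.symm)) _
  · exact Indep.of_forall_eq_zero fun x _ => octCoeff₂₃_eq_zero fun h => hj h.2

end CoefficientDependence

section Secular

variable {m : Fin 4 → ℝ} {L₁ δ₁ δ₂ δ₃ : ℝ} {R₁₂ R₂₃ R₃ : ℝ → ℝ → Phase → ℝ}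
  {r₁₂ r₂₃ r₃ : ℕ → ℕ → Phase → ℝ} {i j : ℕ} {x : Phase}

theorem secCoeff_eq (hL : 0 < L₁) (hδ₁ : 0 < δ₁ ∧ δ₁ < 1) (h1 : ¬ (10 ≤ i ∧ j = 0))
    (h2 : ¬ (2 ≤ i ∧ 10 ≤ j)) (hx : x ∈ domain L₁) :
    secCoeff m L₁ δ₁ δ₂ δ₃ r₁₂ r₂₃ r₃ i j x =
      -(redMass m 1 * m 2) * (quadCoeff₁₂ m L₁ δ₁ i j x + sigmaOct12 m * octCoeff₁₂ m L₁ δ₁ i j x)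
      - redMass m 2 * m 3 *
        (quadCoeff₂₃ m δ₁ δ₂ δ₃ i j x + sigmaOct23 m * octCoeff₂₃ m δ₁ δ₂ δ₃ i j x)
      + r₁₂ i j x + r₂₃ i j x + r₃ i j x := by
  rw [secCoeff, tailCoeff₁₂_eq_zero hL hδ₁ hx h1, tailCoeff₂₃_eq_zero h2, sub_zero, sub_zero]

theorem secCoeff_eq_zero (hL : 0 < L₁) (hδ₁ : 0 < δ₁ ∧ δ₁ < 1)
    (hR₁₂ : IsRemainder12 (domain L₁) R₁₂ r₁₂) (hR₂₃ : IsRemainder23 (domain L₁) R₂₃ r₂₃)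
    (hR₃ : IsRemainder3 (domain L₁) R₃ r₃) (h1 : ¬ (6 ≤ i ∧ j = 0)) (h2 : ¬ (2 ≤ i ∧ 6 ≤ j))
    (h3 : ¬ (1 ≤ i ∧ 9 ≤ j)) (hx : x ∈ domain L₁) :
    secCoeff m L₁ δ₁ δ₂ δ₃ r₁₂ r₂₃ r₃ i j x = 0 := by
  rw [secCoeff_eq hL hδ₁ (by omega) (by omega) hx, quadCoeff₁₂_eq_zero hδ₁ hx h1,
    octCoeff₁₂_eq_zero hL hδ₁ hx (by omega), quadCoeff₂₃_eq_zero h2,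
    octCoeff₂₃_eq_zero (by omega), hR₁₂.2.1 i j (by omega) x hx, hR₂₃.2 i j h3 x hx,
    hR₃.2 i j (by omega) x hx]
  ring

/-- The terms without `μ` come from the planets 1 and 2. -/
theorem secCoeff_row_zero (hR₂₃ : IsRemainder23 (domain L₁) R₂₃ r₂₃)
    (hR₃ : IsRemainder3 (domain L₁) R₃ r₃) (i : ℕ) (hx : x ∈ domain L₁) :
    secCoeff m L₁ δ₁ δ₂ δ₃ r₁₂ r₂₃ r₃ i 0 x =
      -(redMass m 1 * m 2) * (quadCoeff₁₂ m L₁ δ₁ i 0 x + sigmaOct12 m * octCoeff₁₂ m L₁ δ₁ i 0 x)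
      + r₁₂ i 0 x - tailCoeff₁₂ m L₁ δ₁ i 0 x := by
  rw [secCoeff, quadCoeff₂₃_eq_zero (by omega), octCoeff₂₃_eq_zero (by omega),
    tailCoeff₂₃_eq_zero (by omega), hR₂₃.2 i 0 (by omega) x hx, hR₃.2 i 0 (by omega) x hx]
  ring

/-- The terms with few powers of `ε` come from the planets 2 and 3. -/
theorem secCoeff_of_lt (hL : 0 < L₁) (hδ₁ : 0 < δ₁ ∧ δ₁ < 1)
    (hR₁₂ : IsRemainder12 (domain L₁) R₁₂ r₁₂) (hR₃ : IsRemainder3 (domain L₁) R₃ r₃)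
    (hi : i < 6) (hij : i < 2 ∨ j < 10) (hx : x ∈ domain L₁) :
    secCoeff m L₁ δ₁ δ₂ δ₃ r₁₂ r₂₃ r₃ i j x =
      -(redMass m 2 * m 3) *
        (quadCoeff₂₃ m δ₁ δ₂ δ₃ i j x + sigmaOct23 m * octCoeff₂₃ m δ₁ δ₂ δ₃ i j x)
      + r₂₃ i j x := by
  rw [secCoeff_eq hL hδ₁ (by omega) (by omega) hx, quadCoeff₁₂_eq_zero hδ₁ hx (by omega),
    octCoeff₁₂_eq_zero hL hδ₁ hx (by omega), hR₁₂.2.1 i j (by omega) x hx,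
    hR₃.2 i j (by omega) x hx]
  ring

/-- The terms with few powers of `ε` and `μ` come from the quadrupole of the planets 2 and 3. -/
theorem secCoeff_quad (hL : 0 < L₁) (hδ₁ : 0 < δ₁ ∧ δ₁ < 1)
    (hR₁₂ : IsRemainder12 (domain L₁) R₁₂ r₁₂) (hR₂₃ : IsRemainder23 (domain L₁) R₂₃ r₂₃)
    (hR₃ : IsRemainder3 (domain L₁) R₃ r₃) (hj : j < 8) (hi : i < 6)
    (hx : x ∈ domain L₁) : secCoeff m L₁ δ₁ δ₂ δ₃ r₁₂ r₂₃ r₃ i j x =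
      -(redMass m 2 * m 3) * quadCoeff₂₃ m δ₁ δ₂ δ₃ i j x := by
  rw [secCoeff_of_lt hL hδ₁ hR₁₂ hR₃ hi (by omega) hx, octCoeff₂₃_eq_zero (by omega),
    hR₂₃.2 i j (by omega) x hx]
  ring

theorem secCoeff_six (hm : ∀ i, 0 < m i) (hL : 0 < L₁) (hδ₁ : 0 < δ₁ ∧ δ₁ < 1)
    (hR₁₂ : IsRemainder12 (domain L₁) R₁₂ r₁₂) (hR₂₃ : IsRemainder23 (domain L₁) R₂₃ r₂₃)
    (hR₃ : IsRemainder3 (domain L₁) R₃ r₃) (hx : x ∈ domain L₁) :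
    secCoeff m L₁ δ₁ δ₂ δ₃ r₁₂ r₂₃ r₃ 6 0 x =
      -(redMass m 1 * m 2) * alpha012 m L₁ δ₁ * H012 L₁ x := by
  rw [secCoeff_row_zero hR₂₃ hR₃ 6 hx, quadCoeff₁₂_six hm hL hδ₁ hx,
    octCoeff₁₂_eq_zero hL hδ₁ hx (by omega), hR₁₂.2.1 6 0 (by omega) x hx,
    tailCoeff₁₂_eq_zero hL hδ₁ hx (by omega)]
  ring

theorem secCoeff_seven (hm : ∀ i, 0 < m i) (hL : 0 < L₁) (hδ₁ : 0 < δ₁ ∧ δ₁ < 1)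
    (hR₁₂ : IsRemainder12 (domain L₁) R₁₂ r₁₂) (hR₂₃ : IsRemainder23 (domain L₁) R₂₃ r₂₃)
    (hR₃ : IsRemainder3 (domain L₁) R₃ r₃) (hx : x ∈ domain L₁) :
    secCoeff m L₁ δ₁ δ₂ δ₃ r₁₂ r₂₃ r₃ 7 0 x =
      -(redMass m 1 * m 2) * alpha112 m L₁ δ₁ * H112 L₁ x := by
  rw [secCoeff_row_zero hR₂₃ hR₃ 7 hx, quadCoeff₁₂_seven hm hL hδ₁ hx,
    octCoeff₁₂_eq_zero hL hδ₁ hx (by omega), hR₁₂.2.1 7 0 (by omega) x hx,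
    tailCoeff₁₂_eq_zero hL hδ₁ hx (by omega)]
  ring

theorem secCoeff_eight (hm : ∀ i, 0 < m i) (hL : 0 < L₁) (hδ₁ : 0 < δ₁ ∧ δ₁ < 1)
    (hR₁₂ : IsRemainder12 (domain L₁) R₁₂ r₁₂) (hR₂₃ : IsRemainder23 (domain L₁) R₂₃ r₂₃)
    (hR₃ : IsRemainder3 (domain L₁) R₃ r₃) (hx : x ∈ domain L₁) :
    secCoeff m L₁ δ₁ δ₂ δ₃ r₁₂ r₂₃ r₃ 8 0 x =
      -(redMass m 1 * m 2) * (quadCoeff₁₂ m L₁ δ₁ 8 0 x +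
        sigmaOct12 m * (alpha212 m L₁ δ₁ * H212 L₁ x)) := by
  rw [secCoeff_row_zero hR₂₃ hR₃ 8 hx, octCoeff₁₂_eight hm hL hδ₁ hx,
    hR₁₂.2.1 8 0 (by omega) x hx, tailCoeff₁₂_eq_zero hL hδ₁ hx (by omega)]
  ring

theorem secCoeff_two_six (hL : 0 < L₁) (hδ₁ : 0 < δ₁ ∧ δ₁ < 1) (hδ₂ : 0 < δ₂ ∧ δ₂ < 1)
    (hR₁₂ : IsRemainder12 (domain L₁) R₁₂ r₁₂) (hR₂₃ : IsRemainder23 (domain L₁) R₂₃ r₂₃)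
    (hR₃ : IsRemainder3 (domain L₁) R₃ r₃) (hx : x ∈ domain L₁) :
    secCoeff m L₁ δ₁ δ₂ δ₃ r₁₂ r₂₃ r₃ 2 6 x =
      -(redMass m 2 * m 3) * alpha023 m δ₁ δ₂ δ₃ * H023 x := by
  rw [secCoeff_quad hL hδ₁ hR₁₂ hR₂₃ hR₃ (by omega) (by omega) hx,
    quadCoeff₂₃_two_six hδ₁ hδ₂]
  ring

theorem secCoeff_three_six (hL : 0 < L₁) (hδ₁ : 0 < δ₁ ∧ δ₁ < 1) (hδ₂ : 0 < δ₂ ∧ δ₂ < 1)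
    (hδ₃ : |δ₃| < δ₁) (hR₁₂ : IsRemainder12 (domain L₁) R₁₂ r₁₂)
    (hR₂₃ : IsRemainder23 (domain L₁) R₂₃ r₂₃) (hR₃ : IsRemainder3 (domain L₁) R₃ r₃)
    (hx : x ∈ domain L₁) :
    secCoeff m L₁ δ₁ δ₂ δ₃ r₁₂ r₂₃ r₃ 3 6 x = -(redMass m 2 * m 3) *
      (alpha223 m δ₁ δ₂ δ₃ * H223 δ₁ x + alphaTilde3 m δ₁ δ₂ * Htilde3 δ₁ δ₃ x) := by
  rw [secCoeff_quad hL hδ₁ hR₁₂ hR₂₃ hR₃ (by omega) (by omega) hx,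
    quadCoeff₂₃_three_six hδ₁ hδ₂ hδ₃ hx]

/-! ### The order in which the variables appear -/

/-- The terms without `μ` do not contain the variables of the planets 2 and 3. -/
theorem indep_secCoeff_row_zero (hR₁₂ : IsRemainder12 (domain L₁) R₁₂ r₁₂)
    (hR₂₃ : IsRemainder23 (domain L₁) R₂₃ r₂₃) (hR₃ : IsRemainder3 (domain L₁) R₃ r₃) (i : ℕ) :
    Indep (domain L₁) vψ₁ (secCoeff m L₁ δ₁ δ₂ δ₃ r₁₂ r₂₃ r₃ i 0) ∧
    Indep (domain L₁) vγ₃ (secCoeff m L₁ δ₁ δ₂ δ₃ r₁₂ r₂₃ r₃ i 0) ∧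
    Indep (domain L₁) vΓ₃ (secCoeff m L₁ δ₁ δ₂ δ₃ r₁₂ r₂₃ r₃ i 0) := by
  have key : ∀ v : Fin 8, v ≠ vγ₁ → v ≠ vΓ₁ → v ≠ vΓ₂ → v ≠ vΨ₁ → v ≠ vγ₂ →
      Indep (domain L₁) v (r₁₂ i 0) →
      Indep (domain L₁) v (secCoeff m L₁ δ₁ δ₂ δ₃ r₁₂ r₂₃ r₃ i 0) := by
    intro v h1 h2 h3 h4 h5 h6
    refine Indep.congr (((((indep_quadCoeff₁₂ (m := m) (δ₁ := δ₁) h1 h2 h3 h4 i 0).add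
      ((indep_octCoeff₁₂ (m := m) (δ₁ := δ₁) h1 h2 h3 h4 h5 i 0).const_mul
        (sigmaOct12 m))).const_mul (-(redMass m 1 * m 2))).add h6).add
      ((indep_tailCoeff₁₂ (m := m) (δ₁ := δ₁) h1 h2 h3 h4 h5 i 0).const_mul (-1))) fun x hx => ?_
    rw [secCoeff_row_zero hR₂₃ hR₃ i hx]
    ring
  obtain ⟨h1, h2, h3⟩ := hR₁₂.2.2 i 0
  exact ⟨key _ (by decide) (by decide) (by decide) (by decide) (by decide) h1,
    key _ (by decide) (by decide) (by decide) (by decide) (by decide) h2,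
    key _ (by decide) (by decide) (by decide) (by decide) (by decide) h3⟩

theorem indep_secCoeff_of_quad {v : Fin 8} (hL : 0 < L₁) (hδ₁ : 0 < δ₁ ∧ δ₁ < 1)
    (hR₁₂ : IsRemainder12 (domain L₁) R₁₂ r₁₂) (hR₂₃ : IsRemainder23 (domain L₁) R₂₃ r₂₃)
    (hR₃ : IsRemainder3 (domain L₁) R₃ r₃) (hj : j < 8) (hi : i < 6)
    (h : Indep (domain L₁) v (quadCoeff₂₃ m δ₁ δ₂ δ₃ i j)) :
    Indep (domain L₁) v (secCoeff m L₁ δ₁ δ₂ δ₃ r₁₂ r₂₃ r₃ i j) :=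
  (h.const_mul (-(redMass m 2 * m 3))).congr fun _ hx =>
    secCoeff_quad hL hδ₁ hR₁₂ hR₂₃ hR₃ hj hi hx

/-- The exponents that can occur in the secular Hamiltonian; the last alternative comes from
`R₂₃`. -/
theorem secCoeff_support (hL : 0 < L₁) (hδ₁ : 0 < δ₁ ∧ δ₁ < 1)
    (hR₁₂ : IsRemainder12 (domain L₁) R₁₂ r₁₂) (hR₂₃ : IsRemainder23 (domain L₁) R₂₃ r₂₃)
    (hR₃ : IsRemainder3 (domain L₁) R₃ r₃)
    (h : ∃ x ∈ domain L₁, secCoeff m L₁ δ₁ δ₂ δ₃ r₁₂ r₂₃ r₃ i j x ≠ 0) :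
    (6 ≤ i ∧ j = 0) ∨ (2 ≤ i ∧ 6 ≤ j) ∨ (1 ≤ i ∧ 9 ≤ j) := by
  obtain ⟨x, hx, hne⟩ := h
  by_contra! hc
  exact hne (secCoeff_eq_zero hL hδ₁ hR₁₂ hR₂₃ hR₃ (by omega) (by omega) (by omega) hx)

theorem Appears.exists_ne_zero {D : Set Phase} {v : Fin 8} {f : Phase → ℝ} (h : Appears D v f) :
    ∃ x ∈ D, f x ≠ 0 := by
  by_contra! hc
  exact h (Indep.of_forall_eq_zero hc)

theorem Couples.appears {D : Set Phase} {v : Fin 8} {f : Phase → ℝ} (h : Couples D v f) :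
    Appears D v f := fun hi => not_couples_of_indep hi h

end Secular

/-! ### Nonvanishing of the constants -/

section Constants

variable {m : Fin 4 → ℝ} {L₁ δ₁ δ₂ δ₃ : ℝ}

theorem kquad23_pos (hm : ∀ i, 0 < m i) : 0 < kquad23 m := by
  have := totalMass_pos hm 2
  have := totalMass_pos hm 3
  have := redMass_pos hm 2
  have := redMass_pos hm 3
  unfold kquad23
  positivity

theorem koct23_pos (hm : ∀ i, 0 < m i) : 0 < koct23 m := by
  have := totalMass_pos hm 2
  have := totalMass_pos hm 3
  have := redMass_pos hm 2
  have := redMass_pos hm 3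
  unfold koct23
  positivity

theorem alpha012_ne_zero (hm : ∀ i, 0 < m i) (hL : 0 < L₁) (hδ₁ : 0 < δ₁) :
    alpha012 m L₁ δ₁ ≠ 0 := by
  have := totalMass_pos hm 1
  have := totalMass_pos hm 2
  have := redMass_pos hm 1
  have := redMass_pos hm 2
  unfold alpha012
  positivity

theorem alpha112_ne_zero (hm : ∀ i, 0 < m i) (hL : 0 < L₁) (hδ₁ : 0 < δ₁) :
    alpha112 m L₁ δ₁ ≠ 0 := by
  have := totalMass_pos hm 1
  have := totalMass_pos hm 2
  have := redMass_pos hm 1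
  have := redMass_pos hm 2
  unfold alpha112
  exact neg_ne_zero.2 (by positivity)

theorem sqrt_one_sub_sq_pos {δ : ℝ} (h : 0 < δ ∧ δ < 1) : 0 < √(1 - δ ^ 2) :=
  Real.sqrt_pos.2 (by nlinarith [h.1, h.2])

theorem sq_sub_sq_pos_of_abs_lt (hδ₃ : |δ₃| < δ₁) : 0 < δ₁ ^ 2 - δ₃ ^ 2 := by
  rw [sub_pos, sq_lt_sq, abs_of_pos ((abs_nonneg _).trans_lt hδ₃)]
  exact hδ₃

theorem alpha212_ne_zero (hm : ∀ i, 0 < m i) (hL : 0 < L₁) (hδ₁ : 0 < δ₁ ∧ δ₁ < 1) :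
    alpha212 m L₁ δ₁ ≠ 0 := by
  have := totalMass_pos hm 1
  have := totalMass_pos hm 2
  have := redMass_pos hm 1
  have := redMass_pos hm 2
  have := sqrt_one_sub_sq_pos hδ₁
  have := hδ₁.1
  unfold alpha212
  rw [neg_mul, neg_mul]
  exact neg_ne_zero.2 (by positivity)

theorem alpha023_ne_zero (hm : ∀ i, 0 < m i) (hδ₁ : 0 < δ₁ ∧ δ₁ < 1) (hδ₂ : 0 < δ₂)
    (hδ₃ : |δ₃| < δ₁) : alpha023 m δ₁ δ₂ δ₃ ≠ 0 := by
  have := kquad23_pos hm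
  have := sq_sub_sq_pos_of_abs_lt hδ₃
  have := hδ₁.1
  have : 0 < 1 - δ₁ ^ 2 := by nlinarith [hδ₁.1, hδ₁.2]
  unfold alpha023
  positivity

theorem alphaTilde3_ne_zero (hm : ∀ i, 0 < m i) (hδ₁ : 0 < δ₁) (hδ₂ : 0 < δ₂) :
    alphaTilde3 m δ₁ δ₂ ≠ 0 := by
  have := kquad23_pos hm
  unfold alphaTilde3
  positivity

theorem alpha223_ne_zero (hm : ∀ i, 0 < m i) (hδ₁ : 0 < δ₁) (hδ₂ : 0 < δ₂)
    (hδ₃ : |δ₃| < δ₁) (h : δ₃ ≠ 0) : alpha223 m δ₁ δ₂ δ₃ ≠ 0 := by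
  have := kquad23_pos hm
  have := Real.sqrt_pos.2 (sq_sub_sq_pos_of_abs_lt hδ₃)
  unfold alpha223
  positivity

theorem alpha323_ne_zero (hm : ∀ i, 0 < m i) (hδ₁ : 0 < δ₁ ∧ δ₁ < 1) (hδ₂ : 0 < δ₂ ∧ δ₂ < 1) :
    alpha323 m δ₁ δ₂ ≠ 0 := by
  have := koct23_pos hm
  have := sqrt_one_sub_sq_pos hδ₁
  have := sqrt_one_sub_sq_pos hδ₂
  have := hδ₂.1
  unfold alpha323
  rw [neg_mul, neg_mul, neg_mul, neg_div]
  exact neg_ne_zero.2 (by positivity)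

theorem alpha523_ne_zero (hm : ∀ i, 0 < m i) (hδ₁ : 0 < δ₁ ∧ δ₁ < 1) (hδ₂ : 0 < δ₂ ∧ δ₂ < 1)
    (hδ₃ : |δ₃| < δ₁) : alpha523 m δ₁ δ₂ δ₃ ≠ 0 := by
  have := koct23_pos hm
  have := sqrt_one_sub_sq_pos hδ₁
  have := sqrt_one_sub_sq_pos hδ₂
  have := Real.sqrt_pos.2 (sq_sub_sq_pos_of_abs_lt hδ₃)
  have := hδ₁.1
  have := hδ₂.1
  unfold alpha523
  positivity

theorem sigmaOct12_ne_zero (hm : ∀ i, 0 < m i) (h : m 0 ≠ m 1) : sigmaOct12 m ≠ 0 := by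
  have hM := totalMass_pos hm 1
  have e : sigmaOct12 m = (m 0 - m 1) / totalMass m 1 := by
    have h1 := massRatio_one hm
    rw [sigmaOct12, sq_sub_sq, h1, one_mul, massRatio, massRatio, sub_div]
  rw [e]
  exact div_ne_zero (sub_ne_zero.2 h) hM.ne'

theorem sigmaOct23_ne_zero (hm : ∀ i, 0 < m i) (h : m 0 + m 1 ≠ m 2) : sigmaOct23 m ≠ 0 := by
  have hM := totalMass_pos hm 2
  have e : sigmaOct23 m = (m 0 + m 1 - m 2) / totalMass m 2 := by
    have h1 := massRatio_two hm
    rw [sigmaOct23, sq_sub_sq, h1, one_mul, massRatio, massRatio, massRatio, sub_div, add_div]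
  rw [e]
  exact div_ne_zero (sub_ne_zero.2 h) hM.ne'

end Constants

/-! ### First appearances -/

/-- The parameters, and remainders of the secular Hamiltonian with their coefficients. -/
structure IsSetting (m : Fin 4 → ℝ) (L₁ δ₁ δ₂ δ₃ : ℝ) (R₁₂ R₂₃ R₃ : ℝ → ℝ → Phase → ℝ)
    (r₁₂ r₂₃ r₃ : ℕ → ℕ → Phase → ℝ) : Prop where
  hm : ∀ i, 0 < m i
  hL : 0 < L₁
  hδ₁ : 0 < δ₁ ∧ δ₁ < 1
  hδ₂ : 0 < δ₂ ∧ δ₂ < 1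
  hδ₃ : |δ₃| < δ₁
  hR₁₂ : IsRemainder12 (domain L₁) R₁₂ r₁₂
  hR₂₃ : IsRemainder23 (domain L₁) R₂₃ r₂₃
  hR₃ : IsRemainder3 (domain L₁) R₃ r₃

namespace IsSetting

variable {m : Fin 4 → ℝ} {L₁ δ₁ δ₂ δ₃ : ℝ} {R₁₂ R₂₃ R₃ : ℝ → ℝ → Phase → ℝ}
  {r₁₂ r₂₃ r₃ : ℕ → ℕ → Phase → ℝ} {v : Fin 8} {i j : ℕ}

local notation "F" => secCoeff m L₁ δ₁ δ₂ δ₃ r₁₂ r₂₃ r₃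
local notation "D" => domain L₁
local notation "Setting" => IsSetting m L₁ δ₁ δ₂ δ₃ R₁₂ R₂₃ R₃ r₁₂ r₂₃ r₃

theorem mass₁₂_ne (S : Setting) : -(redMass m 1 * m 2) ≠ 0 := by
  have := redMass_pos S.hm 1
  have := S.hm 2
  exact neg_ne_zero.2 (by positivity)

theorem mass₂₃_ne (S : Setting) : -(redMass m 2 * m 3) ≠ 0 := by
  have := redMass_pos S.hm 2
  have := S.hm 3
  exact neg_ne_zero.2 (by positivity)

theorem support (S : Setting) (h : ∃ x ∈ D, F i j x ≠ 0) :
    (6 ≤ i ∧ j = 0) ∨ (2 ≤ i ∧ 6 ≤ j) ∨ (1 ≤ i ∧ 9 ≤ j) :=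
  secCoeff_support S.hL S.hδ₁ S.hR₁₂ S.hR₂₃ S.hR₃ h

/-- Apart from the first two, all nontrivial terms are smaller than `ε⁷`. -/
theorem muchSmaller_seven (S : Setting) (h : ∃ x ∈ D, F i j x ≠ 0) (h6 : (i, j) ≠ (6, 0))
    (h7 : (i, j) ≠ (7, 0)) : MuchSmaller i j 7 0 := by
  simp only [ne_eq, Prod.mk.injEq] at h6
  rcases S.support h with h | h | h <;> refine muchSmaller_of_le ?_ ?_ h7 <;>
    simp only [Prod.mk.injEq, ne_eq] at h7 <;> omega

theorem indep_six (S : Setting) (h1 : v ≠ vγ₁) (h2 : v ≠ vΓ₁) (h3 : v ≠ vΓ₂) : Indep D v (F 6 0) :=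
  ((indep_H012 h1 h2 h3).const_mul (-(redMass m 1 * m 2) * alpha012 m L₁ δ₁)).congr fun _ hx =>
    secCoeff_six S.hm S.hL S.hδ₁ S.hR₁₂ S.hR₂₃ S.hR₃ hx

theorem indep_seven (S : Setting) (h1 : v ≠ vγ₁) (h2 : v ≠ vΓ₁) (h3 : v ≠ vΓ₂) (h4 : v ≠ vΨ₁) :
    Indep D v (F 7 0) :=
  ((indep_H112 h1 h2 h3 h4).const_mul (-(redMass m 1 * m 2) * alpha112 m L₁ δ₁)).congr
    fun _ hx => secCoeff_seven S.hm S.hL S.hδ₁ S.hR₁₂ S.hR₂₃ S.hR₃ hx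

/-- At order `ε²`, the terms with `μ⁶` and `μ⁷` depend only on `ψ̃₁`. -/
theorem indep_two (S : Setting) (hv : v ≠ vψ₁) (hj : j < 8) : Indep D v (F 2 j) :=
  indep_secCoeff_of_quad S.hL S.hδ₁ S.hR₁₂ S.hR₂₃ S.hR₃ hj (by omega)
    (indep_quadCoeff₂₃_two S.hδ₁ S.hδ₂ S.hδ₃ hv j)

theorem indep_γ₃_of_lt (S : Setting) (hi : i < 6) (hj : j < 8) : Indep D vγ₃ (F i j) :=
  indep_secCoeff_of_quad S.hL S.hδ₁ S.hR₁₂ S.hR₂₃ S.hR₃ hj hi (indep_γ₃_quadCoeff₂₃ i j)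

/-- At order `ε` only the remainder `R₂₃` contributes. -/
theorem secCoeff_one (S : Setting) (x : Phase) (hx : x ∈ D) : F 1 j x = r₂₃ 1 j x := by
  rw [secCoeff_of_lt S.hL S.hδ₁ S.hR₁₂ S.hR₃ (by omega) (by omega) hx,
    quadCoeff₂₃_eq_zero (by omega), octCoeff₂₃_eq_zero (by omega)]
  ring

theorem firstAt_six (S : Setting) (h : Appears D v (H012 L₁)) : FirstAt (Appears D v) F 6 0 := by
  refine ⟨h.of_const_mul_add (mul_ne_zero S.mass₁₂_ne (alpha012_ne_zero S.hm S.hL S.hδ₁.1))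
    (Indep.of_forall_eq_zero fun x hx => ?_), fun i j hA hne => ?_⟩
  · rw [secCoeff_six S.hm S.hL S.hδ₁ S.hR₁₂ S.hR₂₃ S.hR₃ hx, sub_self]
  · rcases S.support hA.exists_ne_zero with h | h | h <;>
      exact muchSmaller_of_le (by omega) (by omega) hne

theorem firstAt_Ψ₁ (S : Setting) : FirstAt (Appears D vΨ₁) F 7 0 := by
  refine ⟨(appears_Ψ₁_H112 S.hL).of_const_mul_add
    (mul_ne_zero S.mass₁₂_ne (alpha112_ne_zero S.hm S.hL S.hδ₁.1))
    (Indep.of_forall_eq_zero fun x hx => ?_), fun i j hA hne => ?_⟩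
  · rw [secCoeff_seven S.hm S.hL S.hδ₁ S.hR₁₂ S.hR₂₃ S.hR₃ hx, sub_self]
  · refine S.muchSmaller_seven hA.exists_ne_zero (fun h => ?_) hne
    obtain ⟨rfl, rfl⟩ := Prod.mk.inj h
    exact hA (S.indep_six (by decide) (by decide) (by decide))

theorem indep_γ₂_eight (S : Setting) : Indep D vγ₂ fun x => F 8 0 x +
    redMass m 1 * m 2 * sigmaOct12 m * (alpha212 m L₁ δ₁ * H212 L₁ x) :=
  ((indep_quadCoeff₁₂ (m := m) (δ₁ := δ₁) (by decide) (by decide) (by decide) (by decide) 8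
    0).const_mul (-(redMass m 1 * m 2))).congr fun x hx => by
      rw [secCoeff_eight S.hm S.hL S.hδ₁ S.hR₁₂ S.hR₂₃ S.hR₃ hx]
      ring

theorem firstAt_γ₂ (S : Setting) (h01 : m 0 ≠ m 1) : FirstAt (Appears D vγ₂) F 8 0 := by
  refine ⟨(appears_γ₂_H212 S.hL).of_const_mul_add (mul_ne_zero (mul_ne_zero S.mass₁₂_ne
    (sigmaOct12_ne_zero S.hm h01)) (alpha212_ne_zero S.hm S.hL S.hδ₁))
    (S.indep_γ₂_eight.congr fun x _ => by ring), fun i j hA hne => ?_⟩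
  rcases S.support hA.exists_ne_zero with ⟨hi, rfl⟩ | ⟨hi, hj⟩ | ⟨hi, hj⟩
  · by_cases h6 : i = 6
    · subst h6
      exact absurd (S.indep_six (by decide) (by decide) (by decide)) hA
    by_cases h7 : i = 7
    · subst h7
      exact absurd (S.indep_seven (by decide) (by decide) (by decide) (by decide)) hA
    exact muchSmaller_of_le (by omega) (by omega) hne
  · by_cases h2 : i = 2 ∧ j < 8
    · obtain ⟨rfl, hj'⟩ := h2
      exact absurd (S.indep_two (by decide) hj') hA
    exact muchSmaller_of_le (by omega) (by omega) hne
  · exact muchSmaller_of_le (by omega) (by omega) hne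

theorem firstAt_ψ₁ (S : Setting) : FirstAt (Appears D vψ₁) F 2 6 := by
  refine ⟨(appears_ψ₁_H023 S.hL).of_const_mul_add
    (mul_ne_zero S.mass₂₃_ne (alpha023_ne_zero S.hm S.hδ₁ S.hδ₂.1 S.hδ₃))
    (Indep.of_forall_eq_zero fun x hx => ?_), fun i j hA hne => ?_⟩
  · rw [secCoeff_two_six S.hL S.hδ₁ S.hδ₂ S.hR₁₂ S.hR₂₃ S.hR₃ hx, sub_self]
  rcases S.support hA.exists_ne_zero with ⟨hi, rfl⟩ | ⟨hi, hj⟩ | ⟨hi, hj⟩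
  · exact absurd (indep_secCoeff_row_zero S.hR₁₂ S.hR₂₃ S.hR₃ i).1 hA
  · exact muchSmaller_of_le (by omega) (by omega) hne
  · exact muchSmaller_of_le (by omega) (by omega) hne

theorem firstAt_couples_ψ₁ (S : Setting) (h0 : δ₃ ≠ 0) : FirstAt (Couples D vψ₁) F 3 6 := by
  refine ⟨(couples_H223 S.hL S.hδ₁.1).of_const_mul_add
    (mul_ne_zero S.mass₂₃_ne (alpha223_ne_zero S.hm S.hδ₁.1 S.hδ₂.1 S.hδ₃ h0))
    (not_couples_congr (not_couples_const_mul (not_couples_of_indepInner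
      (indepInner_Htilde3 (δ₁ := δ₁) (δ₃ := δ₃)))
      (-(redMass m 2 * m 3) * alphaTilde3 m δ₁ δ₂)) fun x hx => ?_), fun i j hA hne => ?_⟩
  · rw [secCoeff_three_six S.hL S.hδ₁ S.hδ₂ S.hδ₃ S.hR₁₂ S.hR₂₃ S.hR₃ hx]
    ring
  rcases S.support hA.appears.exists_ne_zero with ⟨hi, rfl⟩ | ⟨hi, hj⟩ | ⟨hi, hj⟩
  · exact absurd (indep_secCoeff_row_zero S.hR₁₂ S.hR₂₃ S.hR₃ i).1 hA.appears
  · by_cases h2 : i = 2 ∧ j < 8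
    · obtain ⟨rfl, hj'⟩ := h2
      exact absurd hA (not_couples_of_indepInner ⟨S.indep_two (by decide) hj',
        S.indep_two (by decide) hj', S.indep_two (by decide) hj'⟩)
    exact muchSmaller_of_le (by omega) (by omega) hne
  · exact muchSmaller_of_le (by omega) (by omega) hne

theorem firstAt_Γ₃ (S : Setting) (h0 : δ₃ ≠ 0) : FirstAt (Appears D vΓ₃) F 3 6 := by
  refine ⟨(appears_Γ₃_Htilde3 S.hL S.hδ₁ h0).of_const_mul_add
    (mul_ne_zero S.mass₂₃_ne (alphaTilde3_ne_zero S.hm S.hδ₁.1 S.hδ₂.1))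
    (Indep.congr ((indep_Γ₃_H223 (δ₁ := δ₁)).const_mul
      (-(redMass m 2 * m 3) * alpha223 m δ₁ δ₂ δ₃)) fun x hx => ?_), fun i j hA hne => ?_⟩
  · rw [secCoeff_three_six S.hL S.hδ₁ S.hδ₂ S.hδ₃ S.hR₁₂ S.hR₂₃ S.hR₃ hx]
    ring
  rcases S.support hA.exists_ne_zero with ⟨hi, rfl⟩ | ⟨hi, hj⟩ | ⟨hi, hj⟩
  · exact absurd (indep_secCoeff_row_zero S.hR₁₂ S.hR₂₃ S.hR₃ i).2.2 hA
  · by_cases h2 : i = 2 ∧ j < 8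
    · obtain ⟨rfl, hj'⟩ := h2
      exact absurd (S.indep_two (by decide) hj') hA
    exact muchSmaller_of_le (by omega) (by omega) hne
  · exact muchSmaller_of_le (by omega) (by omega) hne

theorem indep_γ₃_two_eight (S : Setting) : Indep D vγ₃ fun x => F 2 8 x +
    redMass m 2 * m 3 * sigmaOct23 m * (alpha323 m δ₁ δ₂ * H323 δ₁ δ₃ x) :=
  ((indep_γ₃_quadCoeff₂₃ (m := m) (δ₁ := δ₁) (δ₂ := δ₂) (δ₃ := δ₃) 2 8).const_mul
    (-(redMass m 2 * m 3))).congr fun x hx => by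
      rw [secCoeff_of_lt S.hL S.hδ₁ S.hR₁₂ S.hR₃ (by omega) (by omega) hx,
        octCoeff₂₃_two_eight S.hδ₁ S.hδ₂, S.hR₂₃.2 2 8 (by omega) x hx]
      ring

theorem firstAt_γ₃ (S : Setting) (h012 : m 0 + m 1 ≠ m 2)
    (hr : ∀ i j, Appears D vγ₃ (r₂₃ i j) → MuchSmaller i j 2 8) :
    FirstAt (Appears D vγ₃) F 2 8 := by
  refine ⟨(appears_γ₃_H323 S.hL S.hδ₁ S.hδ₃).of_const_mul_add (mul_ne_zero (mul_ne_zero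
    S.mass₂₃_ne (sigmaOct23_ne_zero S.hm h012)) (alpha323_ne_zero S.hm S.hδ₁ S.hδ₂))
    (S.indep_γ₃_two_eight.congr fun x _ => by ring), fun i j hA hne => ?_⟩
  rcases S.support hA.exists_ne_zero with ⟨hi, rfl⟩ | ⟨hi, hj⟩ | ⟨hi, hj⟩
  · exact absurd (indep_secCoeff_row_zero S.hR₁₂ S.hR₂₃ S.hR₃ i).2.1 hA
  · by_cases h2 : i < 6 ∧ j < 8
    · exact absurd (S.indep_γ₃_of_lt h2.1 h2.2) hA
    exact muchSmaller_of_le (by omega) (by omega) hne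
  · by_cases h1 : i = 1
    · subst h1
      exact hr 1 j fun h => hA (h.congr fun x hx => S.secCoeff_one x hx)
    exact muchSmaller_of_le (by omega) (by omega) hne

theorem not_couples_three_eight (S : Setting) : ¬ Couples D vγ₃ fun x => F 3 8 x +
    redMass m 2 * m 3 * sigmaOct23 m * (alpha523 m δ₁ δ₂ δ₃ * H523 δ₁ δ₃ x) :=
  not_couples_congr (not_couples_add
    (not_couples_const_mul (not_couples_of_indep
      (indep_γ₃_quadCoeff₂₃ (m := m) (δ₁ := δ₁) (δ₂ := δ₂) (δ₃ := δ₃) 3 8))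
      (-(redMass m 2 * m 3)))
    (not_couples_const_mul (not_couples_of_indepInner
      (indepInner_octRest₂₃ (δ₁ := δ₁) (δ₂ := δ₂) (δ₃ := δ₃) m))
      (-(redMass m 2 * m 3) * sigmaOct23 m))) fun x hx => by
    rw [secCoeff_of_lt S.hL S.hδ₁ S.hR₁₂ S.hR₃ (by omega) (by omega) hx,
      octCoeff₂₃_three_eight S.hδ₁ S.hδ₂ S.hδ₃ hx, S.hR₂₃.2 3 8 (by omega) x hx]
    ring

/-- At order `ε²`, the octupole of the planets 2 and 3 does not contain the variables of the
first planet, so that only the remainder can couple `γ̃₃` with them. -/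
theorem couples_two (S : Setting) (hj : j < 10) (h : Couples D vγ₃ (F 2 j)) :
    Couples D vγ₃ (r₂₃ 2 j) := by
  have hO : IndepInner D (octCoeff₂₃ m δ₁ δ₂ δ₃ 2 j) :=
    ⟨indep_octCoeff₂₃_two S.hδ₁ S.hδ₂ S.hδ₃ (by decide) (by decide) j,
      indep_octCoeff₂₃_two S.hδ₁ S.hδ₂ S.hδ₃ (by decide) (by decide) j,
      indep_octCoeff₂₃_two S.hδ₁ S.hδ₂ S.hδ₃ (by decide) (by decide) j⟩
  by_contra hr
  refine not_couples_congr (not_couples_add (not_couples_add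
    (not_couples_const_mul (not_couples_of_indep
      (indep_γ₃_quadCoeff₂₃ (m := m) (δ₁ := δ₁) (δ₂ := δ₂) (δ₃ := δ₃) 2 j))
      (-(redMass m 2 * m 3)))
    (not_couples_const_mul (not_couples_of_indepInner hO)
      (-(redMass m 2 * m 3) * sigmaOct23 m))) hr) (fun x hx => ?_) h
  rw [secCoeff_of_lt S.hL S.hδ₁ S.hR₁₂ S.hR₃ (by omega) (by omega) hx]
  ring

theorem firstAt_couples_γ₃ (S : Setting) (h012 : m 0 + m 1 ≠ m 2)
    (hr : ∀ i j, Couples D vγ₃ (r₂₃ i j) → MuchSmaller i j 3 8) :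
    FirstAt (Couples D vγ₃) F 3 8 := by
  refine ⟨(couples_H523 S.hL S.hδ₁.1).of_const_mul_add (mul_ne_zero (mul_ne_zero
    S.mass₂₃_ne (sigmaOct23_ne_zero S.hm h012)) (alpha523_ne_zero S.hm S.hδ₁ S.hδ₂ S.hδ₃))
    (not_couples_congr S.not_couples_three_eight fun x _ => by ring), fun i j hA hne => ?_⟩
  rcases S.support hA.appears.exists_ne_zero with ⟨hi, rfl⟩ | ⟨hi, hj⟩ | ⟨hi, hj⟩
  · exact absurd (indep_secCoeff_row_zero S.hR₁₂ S.hR₂₃ S.hR₃ i).2.1 hA.appears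
  · by_cases h2 : i < 6 ∧ j < 8
    · exact absurd (S.indep_γ₃_of_lt h2.1 h2.2) hA.appears
    by_cases h3 : i = 2 ∧ j < 10
    · obtain ⟨rfl, hj'⟩ := h3
      exact hr 2 j (S.couples_two hj' hA)
    simp only [ne_eq, Prod.mk.injEq] at hne
    exact muchSmaller_of_le (by omega) (by omega) (by simpa using hne)
  · by_cases h1 : i = 1
    · subst h1
      refine hr 1 j ?_
      by_contra h
      exact not_couples_congr h (fun x hx => S.secCoeff_one x hx) hA
    by_cases h3 : i = 2 ∧ j < 10
    · obtain ⟨rfl, hj'⟩ := h3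
      exact hr 2 j (S.couples_two hj' hA)
    exact muchSmaller_of_le (by omega) (by omega) hne

end IsSetting

/-! ### The expansions -/

section Expansions

variable {m : Fin 4 → ℝ} {L₁ δ₁ δ₂ δ₃ : ℝ} {R₁₂ R₂₃ R₃ : ℝ → ℝ → Phase → ℝ}
  {r₁₂ r₂₃ r₃ : ℕ → ℕ → Phase → ℝ}

theorem exists_isSmall (m : Fin 4 → ℝ) (L₁ : ℝ) (hδ₁ : 0 < δ₁ ∧ δ₁ < 1)
    (hδ₂ : 0 < δ₂ ∧ δ₂ < 1) (hδ₃ : |δ₃| < δ₁) {K : Set Phase} (hK : IsCompact K) :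
    ∃ ρ : ℝ, 0 < ρ ∧ ∀ ε μ : ℝ, 0 < ε → ε < ρ → 0 < μ → μ < ρ → ∀ x ∈ K,
      IsSmall m L₁ δ₁ δ₂ δ₃ (ε, μ, x) :=
  exists_forall_small hK fun x _ => eventually_isSmall m L₁ hδ₁ hδ₂ hδ₃ x

/-- A function of the ellipses that is given by `G` up to a constant is expanded like `G`. -/
theorem isExpansion_of_realizes (hm : ∀ i, 0 < m i) (hδ₁ : 0 < δ₁ ∧ δ₁ < 1)
    (hδ₂ : 0 < δ₂ ∧ δ₂ < 1) (hδ₃ : |δ₃| < δ₁) {f : ℝ → ℝ → Phase → EllipseTriple → ℝ}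
    {c : ℝ → ℝ → ℝ} {G : ℝ → ℝ → Phase → ℝ} {A : ℕ → ℕ → Phase → ℝ}
    (hG : IsExpansionOf (domain L₁) G A)
    (hf : ∀ ε μ x T, 0 < ε → 0 < μ → x ∈ domain L₁ → IsSmall m L₁ δ₁ δ₂ δ₃ (ε, μ, x) →
      EllipseData m L₁ δ₁ δ₂ δ₃ (ε, μ, x) T → f ε μ x T = c ε μ + G ε μ x) :
    IsExpansion (domain L₁) (fun ε μ x y => ∃ T, Realizes m L₁ δ₁ δ₂ δ₃ ε μ x T ∧
      f ε μ x T = c ε μ + y) A := by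
  refine hG.isExpansion fun K hKD hK => ?_
  obtain ⟨ρ, hρ, hs⟩ := exists_isSmall m L₁ hδ₁ hδ₂ hδ₃ hK
  refine ⟨ρ, hρ, fun ε μ hε hε' hμ hμ' x hx y ⟨T, hT, hy⟩ => ?_⟩
  rw [hf ε μ x T hε hμ (hKD hx) (hs ε μ hε hε' hμ hμ' x hx) (hT.ellipseData hm hε hμ)] at hy
  exact (add_left_cancel hy).symm

theorem isExpansionOf_quad₁₂ (m : Fin 4 → ℝ) (L₁ : ℝ) (hδ₁ : 0 < δ₁ ∧ δ₁ < 1) :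
    IsExpansionOf (domain L₁) (fun ε μ x => ε ^ 6 * μ ^ 0 * quadFun₁₂ m L₁ δ₁ (ε, μ, x))
      (quadCoeff₁₂ m L₁ δ₁) :=
  IsExpansionOf.shift (isExpansion_taylorCoeff fun _ hx => analyticAt_quadFun₁₂ hδ₁.1 hx) 6 0

theorem isExpansionOf_oct₁₂ (m : Fin 4 → ℝ) (hL : 0 < L₁) (hδ₁ : 0 < δ₁ ∧ δ₁ < 1) :
    IsExpansionOf (domain L₁) (fun ε μ x => ε ^ 8 * μ ^ 0 * octFun₁₂ m L₁ δ₁ (ε, μ, x))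
      (octCoeff₁₂ m L₁ δ₁) :=
  IsExpansionOf.shift (isExpansion_taylorCoeff fun _ hx => analyticAt_octFun₁₂ hL hδ₁ hx) 8 0

theorem isExpansionOf_tail₁₂ (m : Fin 4 → ℝ) (hL : 0 < L₁) (hδ₁ : 0 < δ₁ ∧ δ₁ < 1) :
    IsExpansionOf (domain L₁) (fun ε μ x => ε ^ 10 * μ ^ 0 * tailFun₁₂ m L₁ δ₁ (ε, μ, x))
      (tailCoeff₁₂ m L₁ δ₁) :=
  IsExpansionOf.shift (isExpansion_taylorCoeff fun _ hx => analyticAt_tailFun₁₂ hL hδ₁ hx) 10 0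

theorem isExpansionOf_quad₂₃ (m : Fin 4 → ℝ) (L₁ : ℝ) (hδ₁ : 0 < δ₁ ∧ δ₁ < 1)
    (hδ₂ : 0 < δ₂ ∧ δ₂ < 1) (hδ₃ : |δ₃| < δ₁) :
    IsExpansionOf (domain L₁) (fun ε μ x => ε ^ 2 * μ ^ 6 * quadFun₂₃ m δ₁ δ₂ δ₃ (ε, μ, x))
      (quadCoeff₂₃ m δ₁ δ₂ δ₃) :=
  IsExpansionOf.shift
    (isExpansion_taylorCoeff fun _ hx => analyticAt_quadFun₂₃ hδ₁.1 hδ₂.1 hδ₃ hx) 2 6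

theorem isExpansionOf_oct₂₃ (m : Fin 4 → ℝ) (L₁ : ℝ) (hδ₁ : 0 < δ₁ ∧ δ₁ < 1)
    (hδ₂ : 0 < δ₂ ∧ δ₂ < 1) (hδ₃ : |δ₃| < δ₁) :
    IsExpansionOf (domain L₁) (fun ε μ x => ε ^ 2 * μ ^ 8 * octFun₂₃ m δ₁ δ₂ δ₃ (ε, μ, x))
      (octCoeff₂₃ m δ₁ δ₂ δ₃) :=
  IsExpansionOf.shift (isExpansion_taylorCoeff fun _ hx => analyticAt_octFun₂₃ hδ₁ hδ₂ hδ₃ hx) 2 8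

theorem isExpansionOf_tail₂₃ (m : Fin 4 → ℝ) (L₁ : ℝ) (hδ₁ : 0 < δ₁ ∧ δ₁ < 1)
    (hδ₂ : 0 < δ₂ ∧ δ₂ < 1) (hδ₃ : |δ₃| < δ₁) :
    IsExpansionOf (domain L₁) (fun ε μ x => ε ^ 2 * μ ^ 10 * tailFun₂₃ m δ₁ δ₂ δ₃ (ε, μ, x))
      (tailCoeff₂₃ m δ₁ δ₂ δ₃) :=
  IsExpansionOf.shift
    (isExpansion_taylorCoeff fun _ hx => analyticAt_tailFun₂₃ hδ₁ hδ₂ hδ₃ hx) 2 10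

/-- The part of the quadrupole of the planets 1 and 2 that depends only on `ε`. -/
def quadConst₁₂ (m : Fin 4 → ℝ) (L₁ δ₁ ε : ℝ) : ℝ :=
  -((L₁ ^ 2 / kepler m 1) ^ 2 * kepler m 2 ^ 3 / (8 * δ₁ ^ 3) * ε ^ 6)

theorem isExpansion_Fquad12 (hm : ∀ i, 0 < m i) (hL : 0 < L₁) (hδ₁ : 0 < δ₁ ∧ δ₁ < 1)
    (hδ₂ : 0 < δ₂ ∧ δ₂ < 1) (hδ₃ : |δ₃| < δ₁) :
    IsExpansion (domain L₁) (fun ε μ x y => ∃ T, Realizes m L₁ δ₁ δ₂ δ₃ ε μ x T ∧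
      Fquad12 T = quadConst₁₂ m L₁ δ₁ ε + y) (quadCoeff₁₂ m L₁ δ₁) :=
  isExpansion_of_realizes (f := fun _ _ _ T => Fquad12 T)
    (c := fun ε _ => quadConst₁₂ m L₁ δ₁ ε) hm hδ₁ hδ₂ hδ₃ (isExpansionOf_quad₁₂ m L₁ hδ₁)
    fun ε μ x T hε _ hx hs hT => by rw [Fquad12_eq hm hL hx hε hs hT, quadConst₁₂]

theorem isExpansion_Foct12 (hm : ∀ i, 0 < m i) (hL : 0 < L₁) (hδ₁ : 0 < δ₁ ∧ δ₁ < 1)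
    (hδ₂ : 0 < δ₂ ∧ δ₂ < 1) (hδ₃ : |δ₃| < δ₁) :
    IsExpansion (domain L₁) (fun ε μ x y => ∃ T, Realizes m L₁ δ₁ δ₂ δ₃ ε μ x T ∧
      Foct12 T = 0 + y) (octCoeff₁₂ m L₁ δ₁) :=
  isExpansion_of_realizes (f := fun _ _ _ T => Foct12 T) (c := fun _ _ => 0) hm hδ₁ hδ₂ hδ₃
    (isExpansionOf_oct₁₂ m hL hδ₁)
    fun ε μ x T hε _ hx hs hT => by rw [Foct12_eq hm hL hx hε hs hT, zero_add]

theorem isExpansion_Fquad23 (L₁ : ℝ) (hm : ∀ i, 0 < m i) (hδ₁ : 0 < δ₁ ∧ δ₁ < 1)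
    (hδ₂ : 0 < δ₂ ∧ δ₂ < 1) (hδ₃ : |δ₃| < δ₁) :
    IsExpansion (domain L₁) (fun ε μ x y => ∃ T, Realizes m L₁ δ₁ δ₂ δ₃ ε μ x T ∧
      Fquad23 T = kquad23 m * quadConst₂₃ δ₁ δ₂ δ₃ * (ε ^ 2 * μ ^ 6) + y)
      (quadCoeff₂₃ m δ₁ δ₂ δ₃) :=
  isExpansion_of_realizes (f := fun _ _ _ T => Fquad23 T)
    (c := fun ε μ => kquad23 m * quadConst₂₃ δ₁ δ₂ δ₃ * (ε ^ 2 * μ ^ 6)) hm hδ₁ hδ₂ hδ₃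
    (isExpansionOf_quad₂₃ m L₁ hδ₁ hδ₂ hδ₃)
    fun ε μ x T hε hμ _ hs hT => by rw [Fquad23_eq hm hε hμ hs hT]

theorem isExpansion_Foct23 (L₁ : ℝ) (hm : ∀ i, 0 < m i) (hδ₁ : 0 < δ₁ ∧ δ₁ < 1)
    (hδ₂ : 0 < δ₂ ∧ δ₂ < 1) (hδ₃ : |δ₃| < δ₁) :
    IsExpansion (domain L₁) (fun ε μ x y => ∃ T, Realizes m L₁ δ₁ δ₂ δ₃ ε μ x T ∧
      Foct23 T = 0 + y) (octCoeff₂₃ m δ₁ δ₂ δ₃) :=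
  isExpansion_of_realizes (f := fun _ _ _ T => Foct23 T) (c := fun _ _ => 0) hm hδ₁ hδ₂ hδ₃
    (isExpansionOf_oct₂₃ m L₁ hδ₁ hδ₂ hδ₃)
    fun ε μ x T hε hμ _ hs hT => by rw [Foct23_eq hm hε hμ hs hT, zero_add]

theorem isExpansion_secCoeff (S : IsSetting m L₁ δ₁ δ₂ δ₃ R₁₂ R₂₃ R₃ r₁₂ r₂₃ r₃) :
    IsExpansion (domain L₁) (fun ε μ x y => ∃ T, Realizes m L₁ δ₁ δ₂ δ₃ ε μ x T ∧
      averagedPer m T + R₁₂ ε μ x + R₂₃ ε μ x + R₃ ε μ x =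
        (-(redMass m 1 * m 2) * quadConst₁₂ m L₁ δ₁ ε - redMass m 2 * m 3 *
          (kquad23 m * quadConst₂₃ δ₁ δ₂ δ₃ * (ε ^ 2 * μ ^ 6))) + y)
      (secCoeff m L₁ δ₁ δ₂ δ₃ r₁₂ r₂₃ r₃) := by
  have q₁ := isExpansionOf_quad₁₂ m L₁ S.hδ₁
  have o₁ := isExpansionOf_oct₁₂ m S.hL S.hδ₁
  have t₁ := isExpansionOf_tail₁₂ m S.hL S.hδ₁
  have q₂ := isExpansionOf_quad₂₃ m L₁ S.hδ₁ S.hδ₂ S.hδ₃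
  have o₂ := isExpansionOf_oct₂₃ m L₁ S.hδ₁ S.hδ₂ S.hδ₃
  have t₂ := isExpansionOf_tail₂₃ m L₁ S.hδ₁ S.hδ₂ S.hδ₃
  have h := ((((((((q₁.add (o₁.const_mul (sigmaOct12 m))).const_mul (-(redMass m 1 * m 2))).add
    ((q₂.add (o₂.const_mul (sigmaOct23 m))).const_mul (-(redMass m 2 * m 3)))).add
    S.hR₁₂.1).add S.hR₂₃.1).add S.hR₃.1).add (t₁.const_mul (-1))).add (t₂.const_mul (-1)))
  have e : secCoeff m L₁ δ₁ δ₂ δ₃ r₁₂ r₂₃ r₃ = fun i j x =>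
      -(redMass m 1 * m 2) *
        (quadCoeff₁₂ m L₁ δ₁ i j x + sigmaOct12 m * octCoeff₁₂ m L₁ δ₁ i j x)
      + -(redMass m 2 * m 3) *
        (quadCoeff₂₃ m δ₁ δ₂ δ₃ i j x + sigmaOct23 m * octCoeff₂₃ m δ₁ δ₂ δ₃ i j x)
      + r₁₂ i j x + r₂₃ i j x + r₃ i j x
      + -1 * tailCoeff₁₂ m L₁ δ₁ i j x + -1 * tailCoeff₂₃ m δ₁ δ₂ δ₃ i j x := by
    funext i j x
    rw [secCoeff]
    ring
  rw [e]
  refine isExpansion_of_realizes (f := fun ε μ x T =>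
    averagedPer m T + R₁₂ ε μ x + R₂₃ ε μ x + R₃ ε μ x) S.hm S.hδ₁ S.hδ₂ S.hδ₃ h
    fun ε μ x T hε hμ hx hs hT => ?_
  simp only [averagedPer, mean2_Fper12_eq S.hm hε hs hT, mean2_Fper23_eq S.hm hε hμ hs hT,
    Fquad12_eq S.hm S.hL hx hε hs hT, Foct12_eq S.hm S.hL hx hε hs hT,
    Fquad23_eq S.hm hε hμ hs hT, Foct23_eq S.hm hε hμ hs hT, quadConst₁₂]
  ring

end Expansions

end FourBody

end

theorem proposition3p2
    (m : Fin 4 → ℝ) (hm : ∀ i, 0 < m i) (hm01 : m 0 ≠ m 1) (hm012 : m 0 + m 1 ≠ m 2)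
    (L₁ δ₁ δ₂ δ₃ : ℝ) (hL₁ : 0 < L₁) (hδ₁ : 0 < δ₁ ∧ δ₁ < 1) (hδ₂ : 0 < δ₂ ∧ δ₂ < 1)
    (hδ₃ : |δ₃| < δ₁)
    -- the remainders of the secular Hamiltonian
    (R₁₂ R₂₃ R₃ : ℝ → ℝ → FourBody.Phase → ℝ) (r₁₂ r₂₃ r₃ : ℕ → ℕ → FourBody.Phase → ℝ)
    (hR₁₂ : FourBody.IsRemainder12 (FourBody.domain L₁) R₁₂ r₁₂)
    (hR₂₃ : FourBody.IsRemainder23 (FourBody.domain L₁) R₂₃ r₂₃)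
    (hR₃ : FourBody.IsRemainder3 (FourBody.domain L₁) R₃ r₃) :
    -- the coordinates are realized by triples of ellipses
    (∀ K : Set FourBody.Phase, K ⊆ FourBody.domain L₁ → IsCompact K → ∃ ρ : ℝ, 0 < ρ ∧
      ∀ ε μ : ℝ, 0 < ε → ε < ρ → 0 < μ → μ < ρ → ∀ x ∈ K,
        ∃ T, FourBody.Realizes m L₁ δ₁ δ₂ δ₃ ε μ x T) ∧
    ∃ (c cq12 co12 cq23 co23 : ℝ → ℝ → ℝ) (F Q12 O12 Q23 O23 : ℕ → ℕ → FourBody.Phase → ℝ),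
      -- the expansions of the secular Hamiltonian and of its quadrupoles and octupoles
      FourBody.IsExpansion (FourBody.domain L₁)
        (fun ε μ x y => ∃ T, FourBody.Realizes m L₁ δ₁ δ₂ δ₃ ε μ x T ∧
          FourBody.averagedPer m T + R₁₂ ε μ x + R₂₃ ε μ x + R₃ ε μ x = c ε μ + y) F ∧
      FourBody.IsExpansion (FourBody.domain L₁)
        (fun ε μ x y => ∃ T, FourBody.Realizes m L₁ δ₁ δ₂ δ₃ ε μ x T ∧
          FourBody.Fquad12 T = cq12 ε μ + y) Q12 ∧
      FourBody.IsExpansion (FourBody.domain L₁)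
        (fun ε μ x y => ∃ T, FourBody.Realizes m L₁ δ₁ δ₂ δ₃ ε μ x T ∧
          FourBody.Foct12 T = co12 ε μ + y) O12 ∧
      FourBody.IsExpansion (FourBody.domain L₁)
        (fun ε μ x y => ∃ T, FourBody.Realizes m L₁ δ₁ δ₂ δ₃ ε μ x T ∧
          FourBody.Fquad23 T = cq23 ε μ + y) Q23 ∧
      FourBody.IsExpansion (FourBody.domain L₁)
        (fun ε μ x y => ∃ T, FourBody.Realizes m L₁ δ₁ δ₂ δ₃ ε μ x T ∧
          FourBody.Foct23 T = co23 ε μ + y) O23 ∧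
      -- up to multipoles of higher order and remainders, the terms come from these four functions
      (∀ i j, ¬ (10 ≤ i ∧ j = 0) → ¬ (2 ≤ i ∧ 10 ≤ j) → ∀ x ∈ FourBody.domain L₁,
        F i j x =
          -(FourBody.redMass m 1 * m 2) * (Q12 i j x + FourBody.sigmaOct12 m * O12 i j x)
          - FourBody.redMass m 2 * m 3 * (Q23 i j x + FourBody.sigmaOct23 m * O23 i j x)
          + r₁₂ i j x + r₂₃ i j x + r₃ i j x) ∧
      -- the orders from which on they contribute
      (∀ i j, ∀ x ∈ FourBody.domain L₁,
        (¬ (6 ≤ i ∧ j = 0) → Q12 i j x = 0) ∧ (¬ (8 ≤ i ∧ j = 0) → O12 i j x = 0) ∧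
        (¬ (2 ≤ i ∧ 6 ≤ j) → Q23 i j x = 0) ∧ (¬ (2 ≤ i ∧ 8 ≤ j) → O23 i j x = 0)) ∧
      -- the constants are nontrivial
      (FourBody.alpha012 m L₁ δ₁ ≠ 0 ∧ FourBody.alpha112 m L₁ δ₁ ≠ 0 ∧
        FourBody.alpha212 m L₁ δ₁ ≠ 0 ∧ FourBody.alpha023 m δ₁ δ₂ δ₃ ≠ 0 ∧
        FourBody.alphaTilde3 m δ₁ δ₂ ≠ 0 ∧ (δ₃ ≠ 0 → FourBody.alpha223 m δ₁ δ₂ δ₃ ≠ 0) ∧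
        FourBody.alpha323 m δ₁ δ₂ ≠ 0 ∧ FourBody.alpha523 m δ₁ δ₂ δ₃ ≠ 0) ∧
      -- 1. the quadrupole of the planets 1 and 2
      ((∀ x ∈ FourBody.domain L₁,
          Q12 6 0 x = FourBody.alpha012 m L₁ δ₁ * FourBody.H012 L₁ x ∧
          Q12 7 0 x = FourBody.alpha112 m L₁ δ₁ * FourBody.H112 L₁ x ∧
          F 6 0 x =
            -(FourBody.redMass m 1 * m 2) * FourBody.alpha012 m L₁ δ₁ * FourBody.H012 L₁ x ∧
          F 7 0 x =
            -(FourBody.redMass m 1 * m 2) * FourBody.alpha112 m L₁ δ₁ * FourBody.H112 L₁ x) ∧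
        FourBody.MuchSmaller 7 0 6 0 ∧
        (∀ i j, (∃ x ∈ FourBody.domain L₁, F i j x ≠ 0) →
          (i, j) ≠ (6, 0) → (i, j) ≠ (7, 0) → FourBody.MuchSmaller i j 7 0) ∧
        FourBody.IsIntegrable (FourBody.domain L₁) (FourBody.H012 L₁) ∧
        FourBody.IsIntegrable (FourBody.domain L₁) (FourBody.H112 L₁) ∧
        FourBody.FirstAt (FourBody.Appears (FourBody.domain L₁) FourBody.vγ₁) F 6 0 ∧
        FourBody.FirstAt (FourBody.Appears (FourBody.domain L₁) FourBody.vΓ₁) F 6 0 ∧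
        FourBody.FirstAt (FourBody.Appears (FourBody.domain L₁) FourBody.vΓ₂) F 6 0 ∧
        FourBody.FirstAt (FourBody.Appears (FourBody.domain L₁) FourBody.vΨ₁) F 7 0) ∧
      -- 2. the octupole of the planets 1 and 2
      ((∀ x ∈ FourBody.domain L₁,
          O12 8 0 x = FourBody.alpha212 m L₁ δ₁ * FourBody.H212 L₁ x) ∧
        FourBody.Indep (FourBody.domain L₁) FourBody.vγ₂ (fun x => F 8 0 x
          + FourBody.redMass m 1 * m 2 * FourBody.sigmaOct12 m
            * (FourBody.alpha212 m L₁ δ₁ * FourBody.H212 L₁ x)) ∧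
        FourBody.FirstAt (FourBody.Appears (FourBody.domain L₁) FourBody.vγ₂) F 8 0) ∧
      -- 3. the first term of the quadrupole of the planets 2 and 3
      ((∀ x ∈ FourBody.domain L₁,
          Q23 2 6 x = FourBody.alpha023 m δ₁ δ₂ δ₃ * FourBody.H023 x ∧
          F 2 6 x =
            -(FourBody.redMass m 2 * m 3) * FourBody.alpha023 m δ₁ δ₂ δ₃ * FourBody.H023 x) ∧
        FourBody.FirstAt (FourBody.Appears (FourBody.domain L₁) FourBody.vψ₁) F 2 6) ∧
      -- 4. and 5. the next term of this quadrupole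
      ((∀ x ∈ FourBody.domain L₁,
          Q23 3 6 x = FourBody.alpha223 m δ₁ δ₂ δ₃ * FourBody.H223 δ₁ x
            + FourBody.alphaTilde3 m δ₁ δ₂ * FourBody.Htilde3 δ₁ δ₃ x ∧
          F 3 6 x = -(FourBody.redMass m 2 * m 3) *
            (FourBody.alpha223 m δ₁ δ₂ δ₃ * FourBody.H223 δ₁ x
              + FourBody.alphaTilde3 m δ₁ δ₂ * FourBody.Htilde3 δ₁ δ₃ x)) ∧
        (δ₃ ≠ 0 →
          FourBody.FirstAt (FourBody.Couples (FourBody.domain L₁) FourBody.vψ₁) F 3 6) ∧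
        (δ₃ ≠ 0 →
          FourBody.FirstAt (FourBody.Appears (FourBody.domain L₁) FourBody.vΓ₃) F 3 6)) ∧
      -- 6. the first term of the octupole of the planets 2 and 3
      ((∀ x ∈ FourBody.domain L₁,
          O23 2 8 x = FourBody.alpha323 m δ₁ δ₂ * FourBody.H323 δ₁ δ₃ x) ∧
        FourBody.Indep (FourBody.domain L₁) FourBody.vγ₃ (fun x => F 2 8 x
          + FourBody.redMass m 2 * m 3 * FourBody.sigmaOct23 m
            * (FourBody.alpha323 m δ₁ δ₂ * FourBody.H323 δ₁ δ₃ x)) ∧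
        ((∀ i j, FourBody.Appears (FourBody.domain L₁) FourBody.vγ₃ (r₂₃ i j) →
            FourBody.MuchSmaller i j 2 8) →
          FourBody.FirstAt (FourBody.Appears (FourBody.domain L₁) FourBody.vγ₃) F 2 8)) ∧
      -- 7. the next term of this octupole
      ((∃ E : FourBody.Phase → ℝ,
          FourBody.Indep (FourBody.domain L₁) FourBody.vγ₁ E ∧
          FourBody.Indep (FourBody.domain L₁) FourBody.vΓ₁ E ∧
          FourBody.Indep (FourBody.domain L₁) FourBody.vγ₂ E ∧
          ∀ x ∈ FourBody.domain L₁,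
            O23 3 8 x = FourBody.alpha523 m δ₁ δ₂ δ₃ * FourBody.H523 δ₁ δ₃ x + E x) ∧
        ¬ FourBody.Couples (FourBody.domain L₁) FourBody.vγ₃ (fun x => F 3 8 x
          + FourBody.redMass m 2 * m 3 * FourBody.sigmaOct23 m
            * (FourBody.alpha523 m δ₁ δ₂ δ₃ * FourBody.H523 δ₁ δ₃ x)) ∧
        ((∀ i j, FourBody.Couples (FourBody.domain L₁) FourBody.vγ₃ (r₂₃ i j) →
            FourBody.MuchSmaller i j 3 8) →
          FourBody.FirstAt (FourBody.Couples (FourBody.domain L₁) FourBody.vγ₃) F 3 8)) := by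
  have S : FourBody.IsSetting m L₁ δ₁ δ₂ δ₃ R₁₂ R₂₃ R₃ r₁₂ r₂₃ r₃ :=
    ⟨hm, hL₁, hδ₁, hδ₂, hδ₃, hR₁₂, hR₂₃, hR₃⟩
  refine ⟨fun K hKD hK => ?_,
    fun ε μ => -(FourBody.redMass m 1 * m 2) * FourBody.quadConst₁₂ m L₁ δ₁ ε -
      FourBody.redMass m 2 * m 3 *
        (FourBody.kquad23 m * FourBody.quadConst₂₃ δ₁ δ₂ δ₃ * (ε ^ 2 * μ ^ 6)),
    fun ε _ => FourBody.quadConst₁₂ m L₁ δ₁ ε, fun _ _ => 0,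
    fun ε μ => FourBody.kquad23 m * FourBody.quadConst₂₃ δ₁ δ₂ δ₃ * (ε ^ 2 * μ ^ 6),
    fun _ _ => 0, FourBody.secCoeff m L₁ δ₁ δ₂ δ₃ r₁₂ r₂₃ r₃, FourBody.quadCoeff₁₂ m L₁ δ₁,
    FourBody.octCoeff₁₂ m L₁ δ₁, FourBody.quadCoeff₂₃ m δ₁ δ₂ δ₃, FourBody.octCoeff₂₃ m δ₁ δ₂ δ₃,
    FourBody.isExpansion_secCoeff S,
    FourBody.isExpansion_Fquad12 hm hL₁ hδ₁ hδ₂ hδ₃,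
    FourBody.isExpansion_Foct12 hm hL₁ hδ₁ hδ₂ hδ₃,
    FourBody.isExpansion_Fquad23 L₁ hm hδ₁ hδ₂ hδ₃,
    FourBody.isExpansion_Foct23 L₁ hm hδ₁ hδ₂ hδ₃,
    fun i j h1 h2 x hx => FourBody.secCoeff_eq hL₁ hδ₁ h1 h2 hx,
    fun i j x hx => ⟨FourBody.quadCoeff₁₂_eq_zero hδ₁ hx, FourBody.octCoeff₁₂_eq_zero hL₁ hδ₁ hx,
      FourBody.quadCoeff₂₃_eq_zero, FourBody.octCoeff₂₃_eq_zero⟩,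
    ⟨FourBody.alpha012_ne_zero hm hL₁ hδ₁.1, FourBody.alpha112_ne_zero hm hL₁ hδ₁.1,
      FourBody.alpha212_ne_zero hm hL₁ hδ₁, FourBody.alpha023_ne_zero hm hδ₁ hδ₂.1 hδ₃,
      FourBody.alphaTilde3_ne_zero hm hδ₁.1 hδ₂.1,
      FourBody.alpha223_ne_zero hm hδ₁.1 hδ₂.1 hδ₃,
      FourBody.alpha323_ne_zero hm hδ₁ hδ₂, FourBody.alpha523_ne_zero hm hδ₁ hδ₂ hδ₃⟩,
    ⟨fun x hx => ⟨FourBody.quadCoeff₁₂_six hm hL₁ hδ₁ hx, FourBody.quadCoeff₁₂_seven hm hL₁ hδ₁ hx,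
      FourBody.secCoeff_six hm hL₁ hδ₁ hR₁₂ hR₂₃ hR₃ hx,
      FourBody.secCoeff_seven hm hL₁ hδ₁ hR₁₂ hR₂₃ hR₃ hx⟩,
      FourBody.muchSmaller_of_le (by decide) (by decide) (by decide),
      fun i j => S.muchSmaller_seven, FourBody.isIntegrable_H012, FourBody.isIntegrable_H112,
      S.firstAt_six (FourBody.appears_γ₁_H012 hL₁), S.firstAt_six (FourBody.appears_Γ₁_H012 hL₁),
      S.firstAt_six (FourBody.appears_Γ₂_H012 hL₁), S.firstAt_Ψ₁⟩,
    ⟨fun x hx => FourBody.octCoeff₁₂_eight hm hL₁ hδ₁ hx, S.indep_γ₂_eight, S.firstAt_γ₂ hm01⟩,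
    ⟨fun x hx => ⟨FourBody.quadCoeff₂₃_two_six hδ₁ hδ₂,
      FourBody.secCoeff_two_six hL₁ hδ₁ hδ₂ hR₁₂ hR₂₃ hR₃ hx⟩, S.firstAt_ψ₁⟩,
    ⟨fun x hx => ⟨FourBody.quadCoeff₂₃_three_six hδ₁ hδ₂ hδ₃ hx,
      FourBody.secCoeff_three_six hL₁ hδ₁ hδ₂ hδ₃ hR₁₂ hR₂₃ hR₃ hx⟩,
      S.firstAt_couples_ψ₁, S.firstAt_Γ₃⟩,
    ⟨fun x hx => FourBody.octCoeff₂₃_two_eight hδ₁ hδ₂, S.indep_γ₃_two_eight,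
      S.firstAt_γ₃ hm012⟩,
    ⟨FourBody.octRest₂₃ m δ₁ δ₂ δ₃, FourBody.indepInner_octRest₂₃ m |>.1,
      FourBody.indepInner_octRest₂₃ m |>.2.1, FourBody.indepInner_octRest₂₃ m |>.2.2,
      fun x hx => FourBody.octCoeff₂₃_three_eight hδ₁ hδ₂ hδ₃ hx⟩,
    S.not_couples_three_eight, S.firstAt_couples_γ₃ hm012⟩
  obtain ⟨ρ, hρ, hs⟩ := FourBody.exists_isSmall m L₁ hδ₁ hδ₂ hδ₃ hK
  refine ⟨ρ, hρ, fun ε μ hε hε' hμ hμ' x hx => ?_⟩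
  have h := hs ε μ hε hε' hμ hμ' x hx
  exact FourBody.exists_realizes hm (hKD hx) hδ₂.1 hε hμ h.Γ₂_pos h.Γ₂_lt h.Γ₃_pos h.Γ₃_lt
    h.abs_Δ_lt h.Γ₁_lt h.Ψ₁_lt
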